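/- Let $\Gamma$ be an abelian group and $\omega:\Gamma\times\Gamma\to\mathbb C^\times$ a commutative factor, i.e. a bi-additive map (with values in the multiplicative group) such that $\omega(\alpha,\beta)\omega(\beta,\alpha)=1$. The tensor product $A\otimes B$ of two $\Gamma$-graded algebras carries the multiplication $(a\otimes b)(a'\otimes b')=\omega(d(b),d(a'))\,aa'\otimes bb'$ for homogeneous elements, $d$ denoting the degree; a Hopf $(\Gamma,\omega)$-algebra is a $\Gamma$-graded algebra with a co-multiplication and a co-unit which are homomorphisms of graded algebras (for this multiplication on $A\otimes A$), and an antipode of degree $0$ with $S(ab)=\omega(d(a),d(b))S(b)S(a)$, satisfying the usual axioms. Let $V$ be a finite dimensional $\Gamma$-graded vector space over $\mathbb C$ with a homogeneous basis $(e_i)$, $d(e_i)=d_i$, and let $(\bar e_i)$ be the dual basis of $V^*$, with $d(\bar e_i)=-d_i$. Let $U=U(\mathfrak{gl}(V))$ be the universal enveloping algebra of the general linear Lie $(\Gamma,\omega)$-algebra, with bracket $[X,Y]=XY-\omega(d(X),d(Y))YX$. It is a Hopf $(\Gamma,\omega)$-algebra with $\Delta(X)=X\otimes1+1\otimes X$,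 $\varepsilon(X)=0$, $S(X)=-X$ for $X\in\mathfrak{gl}(V)$. It acts on $V$, and on $V^*$ by $(x\bar w)(v)=\omega(d(x),d(\bar w))\,\bar w(S(x)v)$. The dual space $U^*$, graded so that a functional of degree $\gamma$ vanishes on $U_\beta$ for $\beta\ne-\gamma$, is an algebra with $\langle fg,x\rangle=\langle f\otimes g,\Delta(x)\rangle$ and identity $\varepsilon$, where $\langle f\otimes g,x\otimes y\rangle=\omega(d(g),d(x))\langle f,x\rangle\langle g,y\rangle$. Let $t_{ji},\bar t_{ji}\in U^*$ be the matrix coefficients of $V$ and $V^*$: $$x e_i=\omega(d(x),d_i)\sum_j e_j\langle t_{ji},x\rangle,\qquad x\bar e_i=\omega(d(x),-d_i)\sum_j\bar e_j\langle\bar t_{ji},x\rangle .$$ The coordinate algebra $\mathcal T(V)$ is the subalgebra of $U^*$ generated by all $t_{ji},\bar t_{ji}$, and $T\subset\mathcal T(V)$ is the subalgebra generated by all $t_{ji}$. The co-action $\delta$ of $T$ on $V^{\otimes n}$ is given by $\delta(e_i)=\sum_je_j\otimes t_{ji}$ for $n=1$ and by $\delta(v\otimes w)=\sum\omega(d(v_{(1)}),d(w_{(0)}))\,v_{(0)}\otimes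 w_{(0)}\otimes v_{(1)}w_{(1)}$ in general. Let $V_\pm=\bigoplus_{\omega(\alpha,\alpha)=\pm1}V_\alpha$, $M_\pm=\dim V_\pm$, and let $p_\pm:V\to V_\pm$ be the projections. The symmetric group acts on $V^{\otimes n}$ by the braidings $v\otimes w\mapsto\omega(d(v),d(w))\,w\otimes v$ of neighbouring factors; let $\wedge^n_\omega V_+$ be the image of the antisymmetriser on $V_+^{\otimes n}$ and $S^n_\omega V_-$ the image of the symmetriser on $V_-^{\otimes n}$. Let $F(V)=S_\omega(V^*\otimes V)$ and $\overline F(V)=S_\omega(V\otimes V^*)$, where $S_\omega(M)$ is the quotient of the tensor algebra of $M$ by the relations $mm'=\omega(d(m),d(m'))m'm$. Let $X_{ji}\in F(V)$ be the image of $\bar e_j\otimes e_i$, and $\overline X_{ji}\in\overline F(V)$ the image of $\omega(d_j,d_j)\,e_j\otimes\bar e_i$. Let $\mathcal F(V)=(F(V)\otimes\overline F(V))/J_V$, where $J_V$ is the two-sided ideal generated by $$\sum_i\omega(d_k,d_i-d_j)X_{ji}\overline X_{ki}-\delta_{jk},\qquad \sum_i\omega(d_i-d_j,d_i)\overline X_{ij}X_{ik}-\delta_{jk}\qquad\text{for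 all }j,k.$$ **Theorem.** 1. $\mathcal T(V)$ is contained in the finite dual $U^0$ of $U$ (the functionals vanishing on a two-sided ideal of finite codimension). 2. There are unique elements $D_+,D_-\in T$ such that $p_+^{\otimes M_+}\delta(\Lambda)=\Lambda\otimes D_+$ for all $\Lambda\in\wedge_\omega^{M_+}V_+$ and $p_-^{\otimes M_-}\delta(\Lambda)=\Lambda\otimes D_-$ for all $\Lambda\in S_\omega^{M_-}V_-$. The elements of the multiplicative set $\mathbb D=\{D_+^iD_-^j\mid i,j\ge0\}$ are central in $T$ and of degree $0$. Let $\mathbb D^{-1}T$ be the ring of fractions, graded so that $s^{-1}a$ has the degree of $a$. With $e_{ji}$ denoting the matrix units of $\mathrm{End}(V)$, the element $t=\sum_{i,j}\omega(d_j,d_i-d_j)\,t_{ji}\otimes e_{ji}$ is invertible in $\mathbb D^{-1}T\otimes\mathrm{End}(V)$. There is an isomorphism $\mathcal T(V)\simeq\mathbb D^{-1}T$ of $\Gamma$-graded algebras which sends each $f\in T$ to $f/1$. 3. $\mathcal T(V)$ is a Hopf $(\Gamma,\omega)$-algebra with $\langle\Delta(f),x\otimes y\rangle=\langle f,xy\rangle$,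 $\varepsilon(f)=\langle f,1\rangle$ and $\langle S(f),x\rangle=\langle f,S(x)\rangle$. $\mathcal F(V)$ is a Hopf $(\Gamma,\omega)$-algebra with $$\Delta(X_{ji})=\sum_kX_{jk}\otimes X_{ki},\quad \Delta(\overline X_{ji})=\sum_k\overline X_{jk}\otimes\overline X_{ki},\quad \varepsilon(X_{ji})=\varepsilon(\overline X_{ji})=\delta_{ij},$$ $$S(X_{ji})=\omega(d_i-d_j,d_i)\overline X_{ij},\qquad S(\overline X_{ij})=\omega(d_i,d_i-d_j)X_{ji}.$$ There is a unique isomorphism $\mathcal F(V)\to\mathcal T(V)$ of Hopf $(\Gamma,\omega)$-algebras such that $X_{ji}\mapsto t_{ji}$ and $\overline X_{ji}\mapsto\bar t_{ji}$ for all $i,j$. -/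

import Mathlib

open scoped TensorProduct DirectSum

noncomputable section

set_option linter.unusedSectionVars false

namespace Colour

/-- A commutative factor `ω : Γ × Γ → ℂˣ` on an abelian group `Γ`. -/
structure CommFactor (Γ : Type*) [AddCommGroup Γ] where
  /-- the underlying function -/
  toFun : Γ → Γ → ℂ
  skew : ∀ α β, toFun α β * toFun β α = 1
  add_right : ∀ α β γ, toFun α (β + γ) = toFun α β * toFun α γ
  add_left : ∀ α β γ, toFun (α + β) γ = toFun α γ * toFun β γ

instance {Γ : Type*} [AddCommGroup Γ] : CoeFun (CommFactor Γ) (fun _ => Γ → Γ → ℂ) :=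
  ⟨CommFactor.toFun⟩

variable {Γ : Type*} [AddCommGroup Γ]

theorem CommFactor.ne_zero (ω : CommFactor Γ) (α β : Γ) : ω α β ≠ 0 :=
  left_ne_zero_of_mul_eq_one (ω.skew α β)

@[simp] theorem CommFactor.zero_right (ω : CommFactor Γ) (α : Γ) : ω α 0 = 1 := by
  have h := ω.add_right α 0 0
  rw [add_zero] at h
  exact (mul_eq_left₀ (ω.ne_zero α 0)).1 h.symm

@[simp] theorem CommFactor.zero_left (ω : CommFactor Γ) (α : Γ) : ω 0 α = 1 := by
  have h := ω.add_left 0 0 α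
  rw [add_zero] at h
  exact (mul_eq_left₀ (ω.ne_zero 0 α)).1 h.symm

section Graded

variable [DecidableEq Γ]
variable {M N : Type*} [AddCommGroup M] [Module ℂ M] [AddCommGroup N] [Module ℂ N]

/-- The linear operator which multiplies the homogeneous component `M_γ` by the scalar `c γ`. -/
def gradScale (𝓜 : Γ → Submodule ℂ M) [DirectSum.Decomposition 𝓜] (c : Γ → ℂ) : M →ₗ[ℂ] M :=
  (DirectSum.toModule ℂ Γ M fun γ => c γ • (𝓜 γ).subtype) ∘ₗ
    (DirectSum.decomposeLinearEquiv 𝓜).toLinearMap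

theorem gradScale_of_mem (𝓜 : Γ → Submodule ℂ M) [DirectSum.Decomposition 𝓜] (c : Γ → ℂ)
    {γ : Γ} {m : M} (hm : m ∈ 𝓜 γ) : gradScale 𝓜 c m = c γ • m := by
  simp only [gradScale, LinearMap.comp_apply, LinearEquiv.coe_coe,
    DirectSum.decomposeLinearEquiv_apply, DirectSum.decompose_of_mem _ hm]
  erw [DirectSum.toModule_lof]
  simp

/-- The linear operator on `M ⊗ N` which multiplies `M_α ⊗ N_β` by `ω(α, β)`. -/
def twist (ω : CommFactor Γ) (𝓜 : Γ → Submodule ℂ M) (𝓝 : Γ → Submodule ℂ N)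
    [DirectSum.Decomposition 𝓜] [DirectSum.Decomposition 𝓝] : M ⊗[ℂ] N →ₗ[ℂ] M ⊗[ℂ] N :=
  TensorProduct.lift
    ((DirectSum.toModule ℂ Γ (N →ₗ[ℂ] M ⊗[ℂ] N) fun α =>
        ((TensorProduct.mk ℂ M N).comp (𝓜 α).subtype).compl₂ (gradScale 𝓝 (ω α))) ∘ₗ
      (DirectSum.decomposeLinearEquiv 𝓜).toLinearMap)

theorem twist_left (ω : CommFactor Γ) (𝓜 : Γ → Submodule ℂ M) (𝓝 : Γ → Submodule ℂ N)
    [DirectSum.Decomposition 𝓜] [DirectSum.Decomposition 𝓝] {α : Γ} {m : M} (hm : m ∈ 𝓜 α)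
    (n : N) : twist ω 𝓜 𝓝 (m ⊗ₜ n) = m ⊗ₜ gradScale 𝓝 (ω α) n := by
  simp only [twist, LinearMap.comp_apply, LinearEquiv.coe_coe, TensorProduct.lift.tmul,
    DirectSum.decomposeLinearEquiv_apply, DirectSum.decompose_of_mem _ hm]
  erw [DirectSum.toModule_lof]
  simp

theorem twist_tmul (ω : CommFactor Γ) (𝓜 : Γ → Submodule ℂ M) (𝓝 : Γ → Submodule ℂ N)
    [DirectSum.Decomposition 𝓜] [DirectSum.Decomposition 𝓝] {α β : Γ} {m : M} {n : N}
    (hm : m ∈ 𝓜 α) (hn : n ∈ 𝓝 β) :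
    twist ω 𝓜 𝓝 (m ⊗ₜ n) = ω α β • (m ⊗ₜ n) := by
  rw [twist_left ω 𝓜 𝓝 hm, gradScale_of_mem _ _ hn, TensorProduct.tmul_smul]

/-- The braiding `τ : M ⊗ N → N ⊗ M`, `m ⊗ n ↦ ω(d(m), d(n)) n ⊗ m`. -/
def braiding (ω : CommFactor Γ) (𝓜 : Γ → Submodule ℂ M) (𝓝 : Γ → Submodule ℂ N)
    [DirectSum.Decomposition 𝓜] [DirectSum.Decomposition 𝓝] : M ⊗[ℂ] N →ₗ[ℂ] N ⊗[ℂ] M :=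
  (TensorProduct.comm ℂ M N).toLinearMap ∘ₗ twist ω 𝓜 𝓝

theorem braiding_tmul (ω : CommFactor Γ) (𝓜 : Γ → Submodule ℂ M) (𝓝 : Γ → Submodule ℂ N)
    [DirectSum.Decomposition 𝓜] [DirectSum.Decomposition 𝓝] {α β : Γ} {m : M} {n : N}
    (hm : m ∈ 𝓜 α) (hn : n ∈ 𝓝 β) :
    braiding ω 𝓜 𝓝 (m ⊗ₜ n) = ω α β • (n ⊗ₜ m) := by
  simp [braiding, twist_tmul ω 𝓜 𝓝 hm hn]

/-- The grading of a tensor product: `(M ⊗ N)_γ = ∑_{α + β = γ} M_α ⊗ N_β`. -/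
def tensorGr (𝓜 : Γ → Submodule ℂ M) (𝓝 : Γ → Submodule ℂ N) (γ : Γ) :
    Submodule ℂ (M ⊗[ℂ] N) :=
  Submodule.span ℂ {x | ∃ α β m n, m ∈ 𝓜 α ∧ n ∈ 𝓝 β ∧ α + β = γ ∧ x = m ⊗ₜ n}

theorem tmul_mem_tensorGr {𝓜 : Γ → Submodule ℂ M} {𝓝 : Γ → Submodule ℂ N} {α β : Γ} {m : M}
    {n : N} (hm : m ∈ 𝓜 α) (hn : n ∈ 𝓝 β) : m ⊗ₜ n ∈ tensorGr 𝓜 𝓝 (α + β) :=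
  Submodule.subset_span ⟨α, β, m, n, hm, hn, rfl, rfl⟩

/-- Every element of a family of submodules is determined in the direct sum by its degree and its
underlying value. -/
theorem lof_congr {𝓜 : Γ → Submodule ℂ M} {α β : Γ} {x : 𝓜 α} {y : 𝓜 β} (h : α = β)
    (hxy : (x : M) = y) :
    DirectSum.of (fun γ => 𝓜 γ) α x = DirectSum.of (fun γ => 𝓜 γ) β y := by
  subst h
  rw [Subtype.ext hxy]

/-- A linear map to the direct sum which is a section of the summation map and sends homogeneous
elements to homogeneous elements gives a decomposition. -/
@[reducible] def decompositionOfMap (𝓜 : Γ → Submodule ℂ M) (f : M →ₗ[ℂ] ⨁ γ, 𝓜 γ)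
    (h1 : ∀ m, DirectSum.coeAddMonoidHom 𝓜 (f m) = m)
    (h2 : ∀ γ (m : M) (hm : m ∈ 𝓜 γ), f m = DirectSum.of (fun γ => 𝓜 γ) γ ⟨m, hm⟩) :
    DirectSum.Decomposition 𝓜 where
  decompose' := f
  left_inv := h1
  right_inv x := by
    induction x using DirectSum.induction_on with
    | zero => simp
    | of γ x => rw [DirectSum.coeAddMonoidHom_of]; exact h2 γ _ x.2
    | add x y hx hy => rw [map_add, map_add, hx, hy]

theorem hom_induction (𝓜 : Γ → Submodule ℂ M) [DirectSum.Decomposition 𝓜] {P : M → Prop}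
    (h0 : P 0) (h : ∀ γ m, m ∈ 𝓜 γ → P m) (hadd : ∀ m m', P m → P m' → P (m + m')) (m : M) :
    P m :=
  DirectSum.Decomposition.inductionOn 𝓜 h0 (fun {γ} m => h γ m m.2) hadd m

/-- The decomposition map of a tensor product. -/
def tensorDecompose (𝓜 : Γ → Submodule ℂ M) (𝓝 : Γ → Submodule ℂ N)
    [DirectSum.Decomposition 𝓜] [DirectSum.Decomposition 𝓝] :
    M ⊗[ℂ] N →ₗ[ℂ] ⨁ γ, tensorGr 𝓜 𝓝 γ :=
  TensorProduct.lift
    ((DirectSum.toModule ℂ Γ (N →ₗ[ℂ] ⨁ γ, tensorGr 𝓜 𝓝 γ) fun α =>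
      LinearMap.flip
        ((DirectSum.toModule ℂ Γ (𝓜 α →ₗ[ℂ] ⨁ γ, tensorGr 𝓜 𝓝 γ) fun β =>
            LinearMap.mk₂ ℂ (fun (n : 𝓝 β) (m : 𝓜 α) =>
              DirectSum.lof ℂ Γ (fun γ => tensorGr 𝓜 𝓝 γ) (α + β)
                ⟨(m : M) ⊗ₜ (n : N), tmul_mem_tensorGr m.2 n.2⟩)
              (fun n n' m => by
                rw [← map_add]; congr 1; ext; simp [TensorProduct.tmul_add])
              (fun c n m => by
                rw [← map_smul]; congr 1; ext; simp [TensorProduct.tmul_smul])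
              (fun n m m' => by
                rw [← map_add]; congr 1; ext; simp [TensorProduct.add_tmul])
              (fun c n m => by
                rw [← map_smul]; congr 1)) ∘ₗ
          (DirectSum.decomposeLinearEquiv 𝓝).toLinearMap)) ∘ₗ
      (DirectSum.decomposeLinearEquiv 𝓜).toLinearMap)

theorem tensorDecompose_tmul (𝓜 : Γ → Submodule ℂ M) (𝓝 : Γ → Submodule ℂ N)
    [DirectSum.Decomposition 𝓜] [DirectSum.Decomposition 𝓝] {α β : Γ} {m : M} {n : N}
    (hm : m ∈ 𝓜 α) (hn : n ∈ 𝓝 β) :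
    tensorDecompose 𝓜 𝓝 (m ⊗ₜ n) =
      DirectSum.of (fun γ => tensorGr 𝓜 𝓝 γ) (α + β) ⟨m ⊗ₜ n, tmul_mem_tensorGr hm hn⟩ := by
  simp only [tensorDecompose, LinearMap.comp_apply, LinearEquiv.coe_coe, TensorProduct.lift.tmul,
    DirectSum.decomposeLinearEquiv_apply, DirectSum.decompose_of_mem _ hm]
  erw [DirectSum.toModule_lof]
  simp only [LinearMap.flip_apply, LinearMap.comp_apply, LinearEquiv.coe_coe,
    DirectSum.decomposeLinearEquiv_apply, DirectSum.decompose_of_mem _ hn]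
  erw [DirectSum.toModule_lof]
  rfl

instance tensorDecomposition (𝓜 : Γ → Submodule ℂ M) (𝓝 : Γ → Submodule ℂ N)
    [DirectSum.Decomposition 𝓜] [DirectSum.Decomposition 𝓝] :
    DirectSum.Decomposition (tensorGr 𝓜 𝓝) :=
  decompositionOfMap _ (tensorDecompose 𝓜 𝓝)
    (fun x => by
      induction x using TensorProduct.induction_on with
      | zero => simp
      | add x y hx hy => rw [map_add, map_add, hx, hy]
      | tmul m n =>
        induction m using hom_induction 𝓜 with
        | h0 => simp
        | hadd m m' h h' => rw [TensorProduct.add_tmul, map_add, map_add, h, h']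
        | h α m hm =>
          induction n using hom_induction 𝓝 with
          | h0 => simp
          | hadd m m' h h' => rw [TensorProduct.tmul_add, map_add, map_add, h, h']
          | h β n hn => rw [tensorDecompose_tmul _ _ hm hn, DirectSum.coeAddMonoidHom_of])
    (fun γ x hx => by
      induction hx using Submodule.span_induction with
      | mem x h =>
        obtain ⟨α, β, m, n, hm, hn, rfl, rfl⟩ := h
        rw [tensorDecompose_tmul _ _ hm hn]
      | zero => rw [map_zero]; symm; exact map_zero _
      | add x y hx hy h h' =>
        rw [map_add, h, h', ← map_add]; rfl
      | smul c x hx h =>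
        rw [map_smul, h]
        exact (map_smul (DirectSum.lof ℂ Γ (fun γ => tensorGr 𝓜 𝓝 γ) γ) c _).symm)

end Graded

section Algebras

variable [DecidableEq Γ]
variable {A B : Type*} [Ring A] [Algebra ℂ A] [Ring B] [Algebra ℂ B]

/-- The tensor product `A ⊗ B` of two graded algebras, as a graded algebra with the multiplication
`(a ⊗ b)(a' ⊗ b') = ω(d(b), d(a')) aa' ⊗ bb'`. -/
def CTensor (_ω : CommFactor Γ) (𝒜 : Γ → Submodule ℂ A) (ℬ : Γ → Submodule ℂ B)
    [GradedAlgebra 𝒜] [GradedAlgebra ℬ] : Type _ :=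
  A ⊗[ℂ] B

namespace CTensor

variable (ω : CommFactor Γ) (𝒜 : Γ → Submodule ℂ A) (ℬ : Γ → Submodule ℂ B)
  [GradedAlgebra 𝒜] [GradedAlgebra ℬ]

instance : AddCommGroup (CTensor ω 𝒜 ℬ) := inferInstanceAs (AddCommGroup (A ⊗[ℂ] B))

instance : Module ℂ (CTensor ω 𝒜 ℬ) := inferInstanceAs (Module ℂ (A ⊗[ℂ] B))

/-- The identity map from `A ⊗ B` to `CTensor ω 𝒜 ℬ`. -/
def of : A ⊗[ℂ] B ≃ₗ[ℂ] CTensor ω 𝒜 ℬ := LinearEquiv.refl ℂ _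

/-- The elementary tensor `a ⊗ b`. -/
def tmul (a : A) (b : B) : CTensor ω 𝒜 ℬ := of ω 𝒜 ℬ (a ⊗ₜ b)

/-- `(μ_A ⊗ μ_B) ∘ (id_A ⊗ τ_{B, A} ⊗ id_B)`. -/
def mulAux : (A ⊗[ℂ] B) ⊗[ℂ] (A ⊗[ℂ] B) →ₗ[ℂ] A ⊗[ℂ] B :=
  TensorProduct.map (LinearMap.mul' ℂ A) (LinearMap.mul' ℂ B) ∘ₗ
    (TensorProduct.assoc ℂ A A (B ⊗[ℂ] B)).symm.toLinearMap ∘ₗ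
    TensorProduct.map LinearMap.id
      ((TensorProduct.assoc ℂ A B B).toLinearMap ∘ₗ
        TensorProduct.map (braiding ω ℬ 𝒜) LinearMap.id ∘ₗ
        (TensorProduct.assoc ℂ B A B).symm.toLinearMap) ∘ₗ
    (TensorProduct.assoc ℂ A B (A ⊗[ℂ] B)).toLinearMap

instance : Mul (CTensor ω 𝒜 ℬ) :=
  ⟨fun x y => of ω 𝒜 ℬ (mulAux ω 𝒜 ℬ ((of ω 𝒜 ℬ).symm x ⊗ₜ (of ω 𝒜 ℬ).symm y))⟩

instance : One (CTensor ω 𝒜 ℬ) := ⟨tmul ω 𝒜 ℬ 1 1⟩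

theorem one_def : (1 : CTensor ω 𝒜 ℬ) = tmul ω 𝒜 ℬ 1 1 := rfl

theorem mul_def (x y : CTensor ω 𝒜 ℬ) :
    x * y = of ω 𝒜 ℬ (mulAux ω 𝒜 ℬ ((of ω 𝒜 ℬ).symm x ⊗ₜ (of ω 𝒜 ℬ).symm y)) := rfl

theorem tmul_mul_tmul (a : A) {β α' : Γ} {b : B} {a' : A} (hb : b ∈ ℬ β) (ha' : a' ∈ 𝒜 α')
    (b' : B) :
    tmul ω 𝒜 ℬ a b * tmul ω 𝒜 ℬ a' b' = ω β α' • tmul ω 𝒜 ℬ (a * a') (b * b') := by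
  have h : mulAux ω 𝒜 ℬ ((a ⊗ₜ b) ⊗ₜ (a' ⊗ₜ b')) = ω β α' • ((a * a') ⊗ₜ (b * b')) := by
    simp only [mulAux, LinearMap.comp_apply, LinearEquiv.coe_coe, TensorProduct.assoc_tmul,
      TensorProduct.map_tmul, TensorProduct.assoc_symm_tmul, braiding_tmul ω ℬ 𝒜 hb ha',
      LinearMap.id_apply, ← TensorProduct.smul_tmul', map_smul, TensorProduct.tmul_smul,
      LinearMap.mul'_apply]
  exact h

protected theorem mul_add' (x y z : CTensor ω 𝒜 ℬ) : x * (y + z) = x * y + x * z := by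
  simp only [mul_def, map_add, TensorProduct.tmul_add]

protected theorem add_mul' (x y z : CTensor ω 𝒜 ℬ) : (x + y) * z = x * z + y * z := by
  simp only [mul_def, map_add, TensorProduct.add_tmul]

protected theorem smul_mul' (c : ℂ) (x y : CTensor ω 𝒜 ℬ) : (c • x) * y = c • (x * y) := by
  simp only [mul_def, map_smul, ← TensorProduct.smul_tmul']

protected theorem mul_smul' (c : ℂ) (x y : CTensor ω 𝒜 ℬ) : x * (c • y) = c • (x * y) := by
  simp only [mul_def, map_smul, TensorProduct.tmul_smul]

/-- To prove an additive property of all elements of `A ⊗ B`, it is enough to prove it for tensors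
of homogeneous elements. -/
theorem induction {P : CTensor ω 𝒜 ℬ → Prop} (h0 : P 0)
    (h : ∀ α β a b, a ∈ 𝒜 α → b ∈ ℬ β → P (tmul ω 𝒜 ℬ a b))
    (hadd : ∀ x y, P x → P y → P (x + y)) (x : CTensor ω 𝒜 ℬ) : P x := by
  refine TensorProduct.induction_on (motive := fun y => P (of ω 𝒜 ℬ y)) x h0 (fun a b => ?_)
    (fun x y hx hy => hadd _ _ hx hy)
  induction a using hom_induction 𝒜 with
  | h0 => rw [TensorProduct.zero_tmul, map_zero]; exact h0
  | hadd m m' h h' => rw [TensorProduct.add_tmul, map_add]; exact hadd _ _ h h'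
  | h α a ha =>
    induction b using hom_induction ℬ with
    | h0 => rw [TensorProduct.tmul_zero, map_zero]; exact h0
    | hadd m m' h h' => rw [TensorProduct.tmul_add, map_add]; exact hadd _ _ h h'
    | h β b hb => exact h α β a b ha hb

protected theorem zero_mul' (x : CTensor ω 𝒜 ℬ) : 0 * x = 0 := by
  simp only [mul_def, map_zero, TensorProduct.zero_tmul]

protected theorem mul_zero' (x : CTensor ω 𝒜 ℬ) : x * 0 = 0 := by
  simp only [mul_def, map_zero, TensorProduct.tmul_zero]

protected theorem one_mul' (x : CTensor ω 𝒜 ℬ) : 1 * x = x := by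
  induction x using induction with
  | h0 => exact CTensor.mul_zero' ω 𝒜 ℬ 1
  | hadd x y hx hy => rw [CTensor.mul_add', hx, hy]
  | h α β a b ha hb =>
    rw [one_def, tmul_mul_tmul ω 𝒜 ℬ 1 SetLike.GradedOne.one_mem ha b]; simp

protected theorem mul_one' (x : CTensor ω 𝒜 ℬ) : x * 1 = x := by
  induction x using induction with
  | h0 => exact CTensor.zero_mul' ω 𝒜 ℬ 1
  | hadd x y hx hy => rw [CTensor.add_mul', hx, hy]
  | h α β a b ha hb =>
    rw [one_def, tmul_mul_tmul ω 𝒜 ℬ a hb SetLike.GradedOne.one_mem]; simp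

protected theorem mul_assoc' (x y z : CTensor ω 𝒜 ℬ) : x * y * z = x * (y * z) := by
  induction x using induction with
  | h0 => simp only [CTensor.zero_mul']
  | hadd x x' hx hy => simp only [CTensor.add_mul', hx, hy]
  | h α β a b ha hb =>
    induction y using induction with
    | h0 => simp only [CTensor.zero_mul', CTensor.mul_zero']
    | hadd x x' hx hy => simp only [CTensor.add_mul', CTensor.mul_add', hx, hy]
    | h α' β' a' b' ha' hb' =>
      induction z using induction with
      | h0 => simp only [CTensor.mul_zero']
      | hadd x x' hx hy => simp only [CTensor.mul_add', hx, hy]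
      | h α'' β'' a'' b'' ha'' hb'' =>
        rw [tmul_mul_tmul ω 𝒜 ℬ a hb ha', tmul_mul_tmul ω 𝒜 ℬ a' hb' ha'',
          CTensor.smul_mul', CTensor.mul_smul',
          tmul_mul_tmul ω 𝒜 ℬ _ (SetLike.mul_mem_graded hb hb') ha'',
          tmul_mul_tmul ω 𝒜 ℬ _ hb (SetLike.mul_mem_graded ha' ha''), smul_smul, smul_smul,
          mul_assoc, mul_assoc, ω.add_left, ω.add_right]
        congr 1
        ring

instance : Ring (CTensor ω 𝒜 ℬ) :=
  { (inferInstance : AddCommGroup (CTensor ω 𝒜 ℬ)), (inferInstance : Mul (CTensor ω 𝒜 ℬ)),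
    (inferInstance : One (CTensor ω 𝒜 ℬ)) with
    left_distrib := CTensor.mul_add' ω 𝒜 ℬ
    right_distrib := CTensor.add_mul' ω 𝒜 ℬ
    zero_mul := CTensor.zero_mul' ω 𝒜 ℬ
    mul_zero := CTensor.mul_zero' ω 𝒜 ℬ
    mul_assoc := CTensor.mul_assoc' ω 𝒜 ℬ
    one_mul := CTensor.one_mul' ω 𝒜 ℬ
    mul_one := CTensor.mul_one' ω 𝒜 ℬ }

instance : Algebra ℂ (CTensor ω 𝒜 ℬ) :=
  Algebra.ofModule (CTensor.smul_mul' ω 𝒜 ℬ) (fun c x y => CTensor.mul_smul' ω 𝒜 ℬ c x y)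

/-- The grading of `A ⊗ B`. -/
def gr (γ : Γ) : Submodule ℂ (CTensor ω 𝒜 ℬ) :=
  Submodule.span ℂ {x | ∃ α β a b, a ∈ 𝒜 α ∧ b ∈ ℬ β ∧ α + β = γ ∧ x = tmul ω 𝒜 ℬ a b}

theorem tmul_mem_gr {α β : Γ} {a : A} {b : B} (ha : a ∈ 𝒜 α) (hb : b ∈ ℬ β) :
    tmul ω 𝒜 ℬ a b ∈ gr ω 𝒜 ℬ (α + β) :=
  Submodule.subset_span ⟨α, β, a, b, ha, hb, rfl, rfl⟩

instance : SetLike.GradedMonoid (gr ω 𝒜 ℬ) where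
  one_mem := by
    have h := tmul_mem_gr ω 𝒜 ℬ (a := 1) (b := 1) SetLike.GradedOne.one_mem
      SetLike.GradedOne.one_mem
    rw [add_zero] at h
    exact h
  mul_mem := by
    intro γ δ x y hx hy
    induction hx using Submodule.span_induction with
    | zero => rw [zero_mul]; exact zero_mem _
    | add x x' _ _ h h' => rw [add_mul]; exact add_mem h h'
    | smul c x _ h => rw [smul_mul_assoc]; exact Submodule.smul_mem _ c h
    | mem x hx =>
      obtain ⟨α, β, a, b, ha, hb, rfl, rfl⟩ := hx
      induction hy using Submodule.span_induction with
      | zero => rw [mul_zero]; exact zero_mem _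
      | add x x' _ _ h h' => rw [mul_add]; exact add_mem h h'
      | smul c x _ h => rw [mul_smul_comm]; exact Submodule.smul_mem _ c h
      | mem x hx =>
        obtain ⟨α', β', a', b', ha', hb', rfl, rfl⟩ := hx
        have h := tmul_mul_tmul ω 𝒜 ℬ a hb ha' b'
        have h' := tmul_mem_gr ω 𝒜 ℬ (SetLike.mul_mem_graded ha ha')
          (SetLike.mul_mem_graded hb hb')
        rw [add_add_add_comm] at h'
        exact h ▸ Submodule.smul_mem _ _ h'

instance : GradedAlgebra (gr ω 𝒜 ℬ) :=
  { (inferInstance : SetLike.GradedMonoid (gr ω 𝒜 ℬ)), tensorDecomposition 𝒜 ℬ with }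

end CTensor

end Algebras


section Presented

variable [DecidableEq Γ]

section TensorAlg

variable {M : Type*} [AddCommGroup M] [Module ℂ M] (𝓜 : Γ → Submodule ℂ M)

/-- The `Γ`-grading of the tensor algebra of a graded vector space `M`: the component of degree `γ`
is spanned by the products `m₁ ⋯ m_r` of homogeneous elements whose degrees add up to `γ`. -/
def taGr (γ : Γ) : Submodule ℂ (TensorAlgebra ℂ M) :=
  Submodule.span ℂ {x | ∃ l : List (Γ × M), (∀ p ∈ l, p.2 ∈ 𝓜 p.1) ∧
    (l.map Prod.fst).sum = γ ∧ x = (l.map fun p => TensorAlgebra.ι ℂ p.2).prod}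

theorem ι_mem_taGr {γ : Γ} {m : M} (hm : m ∈ 𝓜 γ) : TensorAlgebra.ι ℂ m ∈ taGr 𝓜 γ :=
  Submodule.subset_span ⟨[(γ, m)], by simpa using hm, by simp, by simp⟩

instance : SetLike.GradedMonoid (taGr 𝓜) where
  one_mem := Submodule.subset_span ⟨[], by simp, by simp, by simp⟩
  mul_mem := by
    intro γ δ x y hx hy
    induction hx using Submodule.span_induction with
    | zero => rw [zero_mul]; exact zero_mem _
    | add x x' _ _ h h' => rw [add_mul]; exact add_mem h h'
    | smul c x _ h => rw [smul_mul_assoc]; exact Submodule.smul_mem _ c h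
    | mem x hx =>
      obtain ⟨l, hl, rfl, rfl⟩ := hx
      induction hy using Submodule.span_induction with
      | zero => rw [mul_zero]; exact zero_mem _
      | add x x' _ _ h h' => rw [mul_add]; exact add_mem h h'
      | smul c x _ h => rw [mul_smul_comm]; exact Submodule.smul_mem _ c h
      | mem x hx =>
        obtain ⟨l', hl', rfl, rfl⟩ := hx
        refine Submodule.subset_span ⟨l ++ l', fun p hp => ?_, by simp, by simp⟩
        rcases List.mem_append.1 hp with h | h
        exacts [hl p h, hl' p h]

variable [DirectSum.Decomposition 𝓜]

/-- The decomposition map of the tensor algebra. -/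
def taDecompose : TensorAlgebra ℂ M →ₐ[ℂ] ⨁ γ, taGr 𝓜 γ :=
  TensorAlgebra.lift ℂ
    ((DirectSum.toModule ℂ Γ _ fun γ => DirectSum.lof ℂ Γ (fun γ => taGr 𝓜 γ) γ ∘ₗ
        ((TensorAlgebra.ι ℂ).comp (𝓜 γ).subtype).codRestrict (taGr 𝓜 γ)
          (fun m => ι_mem_taGr 𝓜 m.2)) ∘ₗ
      (DirectSum.decomposeLinearEquiv 𝓜).toLinearMap)

theorem taDecompose_ι {γ : Γ} {m : M} (hm : m ∈ 𝓜 γ) :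
    taDecompose 𝓜 (TensorAlgebra.ι ℂ m) =
      DirectSum.of (fun γ => taGr 𝓜 γ) γ ⟨TensorAlgebra.ι ℂ m, ι_mem_taGr 𝓜 hm⟩ := by
  rw [taDecompose, TensorAlgebra.lift_ι_apply]
  simp only [LinearMap.comp_apply, LinearEquiv.coe_coe,
    DirectSum.decomposeLinearEquiv_apply, DirectSum.decompose_of_mem _ hm]
  erw [DirectSum.toModule_lof]
  rfl

theorem taDecompose_prod (l : List (Γ × M)) (hl : ∀ p ∈ l, p.2 ∈ 𝓜 p.1) :
    taDecompose 𝓜 (l.map fun p => TensorAlgebra.ι ℂ p.2).prod =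
      DirectSum.of (fun γ => taGr 𝓜 γ) (l.map Prod.fst).sum
        ⟨(l.map fun p => TensorAlgebra.ι ℂ p.2).prod, Submodule.subset_span ⟨l, hl, rfl, rfl⟩⟩ := by
  induction l with
  | nil => simp only [List.map_nil, List.prod_nil, map_one]; rfl
  | cons p l ih =>
    simp only [List.map_cons, List.prod_cons, map_mul]
    rw [ih (fun q hq => hl q (List.mem_cons_of_mem _ hq)),
      taDecompose_ι 𝓜 (hl p List.mem_cons_self), DirectSum.of_mul_of]
    exact lof_congr (by simp) rfl

instance : GradedAlgebra (taGr 𝓜) :=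
  { (inferInstance : SetLike.GradedMonoid (taGr 𝓜)),
    decompositionOfMap (taGr 𝓜) (taDecompose 𝓜).toLinearMap
      (fun x => by
        have h : (DirectSum.coeAlgHom (taGr 𝓜)).comp (taDecompose 𝓜) = AlgHom.id ℂ _ := by
          apply TensorAlgebra.hom_ext
          ext m
          induction m using hom_induction 𝓜 with
          | h0 => simp
          | hadd m m' h h' =>
            simp only [map_add, h, h']
          | h γ m hm =>
            simp only [LinearMap.comp_apply, AlgHom.toLinearMap_apply, AlgHom.comp_apply,
              taDecompose_ι 𝓜 hm, AlgHom.id_apply]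
            exact DirectSum.coeAlgHom_of _ _ _
        exact DFunLike.congr_fun h x)
      (fun γ x hx => by
        induction hx using Submodule.span_induction with
        | mem x h =>
          obtain ⟨l, hl, rfl, rfl⟩ := h
          exact taDecompose_prod 𝓜 l hl
        | zero => rw [map_zero]; symm; exact map_zero _
        | add x y hx hy h h' => rw [map_add, h, h', ← map_add]; rfl
        | smul c x hx h =>
          rw [map_smul, h]
          exact (map_smul (DirectSum.lof ℂ Γ (fun γ => taGr 𝓜 γ) γ) c _).symm) with }

end TensorAlg

section Quotient

variable {A : Type*} [Ring A] [Algebra ℂ A] (𝒜 : Γ → Submodule ℂ A) (r : A → A → Prop)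

/-- The grading of the quotient of a graded algebra by the two-sided ideal generated by the
differences `x - y` for `r x y`: the images of the homogeneous components. -/
def quotGr (γ : Γ) : Submodule ℂ (RingQuot r) :=
  (𝒜 γ).map (RingQuot.mkAlgHom ℂ r).toLinearMap

variable {𝒜} in
theorem mk_mem_quotGr {γ : Γ} {a : A} (ha : a ∈ 𝒜 γ) :
    RingQuot.mkAlgHom ℂ r a ∈ quotGr 𝒜 r γ := ⟨a, ha, rfl⟩

variable [GradedAlgebra 𝒜]

instance : SetLike.GradedMonoid (quotGr 𝒜 r) where
  one_mem := ⟨1, SetLike.GradedOne.one_mem, map_one (RingQuot.mkAlgHom ℂ r)⟩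
  mul_mem := by
    rintro γ δ _ _ ⟨x, hx, rfl⟩ ⟨y, hy, rfl⟩
    exact ⟨x * y, SetLike.mul_mem_graded hx hy, map_mul (RingQuot.mkAlgHom ℂ r) x y⟩

/-- The map from `A` to the sum of the homogeneous components of its quotient. -/
def quotDecomposeAux : A →ₐ[ℂ] ⨁ γ, quotGr 𝒜 r γ :=
  (DirectSum.toAlgebra ℂ (fun γ => 𝒜 γ)
      (fun γ => DirectSum.lof ℂ Γ (fun γ => quotGr 𝒜 r γ) γ ∘ₗ
        ((RingQuot.mkAlgHom ℂ r).toLinearMap.comp (𝒜 γ).subtype).codRestrict (quotGr 𝒜 r γ)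
          (fun a => mk_mem_quotGr r a.2))
      (lof_congr rfl (map_one (RingQuot.mkAlgHom ℂ r)))
      (fun {i j} a b => by
        refine Eq.trans ?_ (DirectSum.of_mul_of _ _).symm
        exact lof_congr rfl (map_mul (RingQuot.mkAlgHom ℂ r) (a : A) b))).comp
    (DirectSum.decomposeAlgEquiv 𝒜).toAlgHom

theorem quotDecomposeAux_of_mem {γ : Γ} {a : A} (ha : a ∈ 𝒜 γ) :
    quotDecomposeAux 𝒜 r a =
      DirectSum.of (fun γ => quotGr 𝒜 r γ) γ ⟨RingQuot.mkAlgHom ℂ r a, mk_mem_quotGr r ha⟩ := by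
  have h : (DirectSum.decomposeAlgEquiv 𝒜) a = DirectSum.of (fun γ => 𝒜 γ) γ ⟨a, ha⟩ :=
    DirectSum.decompose_of_mem 𝒜 ha
  rw [quotDecomposeAux, AlgHom.comp_apply]
  refine (congrArg _ h).trans ?_
  exact DirectSum.toAddMonoid_of (β := fun γ => 𝒜 γ)
    (fun γ => (DirectSum.lof ℂ Γ (fun γ => quotGr 𝒜 r γ) γ ∘ₗ
        ((RingQuot.mkAlgHom ℂ r).toLinearMap.comp (𝒜 γ).subtype).codRestrict (quotGr 𝒜 r γ)
          (fun a => mk_mem_quotGr r a.2)).toAddMonoidHom) γ ⟨a, ha⟩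

/-- The quotient of a graded algebra by homogeneous relations is a graded algebra. -/
@[reducible] def quotGraded (hr : ∀ x y, r x y → ∃ γ, x ∈ 𝒜 γ ∧ y ∈ 𝒜 γ) :
    GradedAlgebra (quotGr 𝒜 r) :=
  let f : RingQuot r →ₐ[ℂ] ⨁ γ, quotGr 𝒜 r γ :=
    RingQuot.liftAlgHom ℂ ⟨quotDecomposeAux 𝒜 r, fun x y h => by
      obtain ⟨γ, hx, hy⟩ := hr x y h
      rw [quotDecomposeAux_of_mem 𝒜 r hx, quotDecomposeAux_of_mem 𝒜 r hy]
      exact lof_congr rfl (RingQuot.mkAlgHom_rel ℂ h)⟩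
  have hf : ∀ a, f (RingQuot.mkAlgHom ℂ r a) = quotDecomposeAux 𝒜 r a := fun a =>
    RingQuot.liftAlgHom_mkAlgHom_apply ℂ _ _ _
  { (inferInstance : SetLike.GradedMonoid (quotGr 𝒜 r)),
    decompositionOfMap (quotGr 𝒜 r) f.toLinearMap
      (fun x => by
        obtain ⟨a, rfl⟩ := RingQuot.mkAlgHom_surjective ℂ r x
        rw [AlgHom.toLinearMap_apply, hf]
        induction a using hom_induction 𝒜 with
        | h0 => simp
        | hadd m m' h h' => simp only [map_add, h, h']
        | h γ a ha => rw [quotDecomposeAux_of_mem 𝒜 r ha, DirectSum.coeAddMonoidHom_of])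
      (fun γ x hx => by
        obtain ⟨a, ha, rfl⟩ := hx
        exact (hf a).trans (quotDecomposeAux_of_mem 𝒜 r ha)) with }

end Quotient

section Sym

variable {M : Type*} [AddCommGroup M] [Module ℂ M] (ω : CommFactor Γ) (𝓜 : Γ → Submodule ℂ M)

/-- The relations `m m' = ω(d(m), d(m')) m' m` in the tensor algebra. -/
inductive symRel : TensorAlgebra ℂ M → TensorAlgebra ℂ M → Prop
  | comm (α β : Γ) (m m' : M) (hm : m ∈ 𝓜 α) (hm' : m' ∈ 𝓜 β) :
    symRel (TensorAlgebra.ι ℂ m * TensorAlgebra.ι ℂ m')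
      (ω α β • (TensorAlgebra.ι ℂ m' * TensorAlgebra.ι ℂ m))

/-- The symmetric `(Γ, ω)`-algebra `S_ω(M)`: the quotient of the tensor algebra by the ideal
generated by the elements `m ⊗ m' - ω(d(m), d(m')) m' ⊗ m`. -/
abbrev SymAlg : Type _ := RingQuot (symRel ω 𝓜)

/-- The canonical map `M → S_ω(M)`. -/
def SymAlg.ι : M →ₗ[ℂ] SymAlg ω 𝓜 :=
  (RingQuot.mkAlgHom ℂ (symRel ω 𝓜)).toLinearMap ∘ₗ TensorAlgebra.ι ℂ

/-- The `Γ`-grading of `S_ω(M)`. -/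
abbrev symGr : Γ → Submodule ℂ (SymAlg ω 𝓜) := quotGr (taGr 𝓜) (symRel ω 𝓜)

instance [DirectSum.Decomposition 𝓜] : GradedAlgebra (symGr ω 𝓜) :=
  quotGraded (taGr 𝓜) (symRel ω 𝓜) (by
    rintro _ _ ⟨α, β, m, m', hm, hm'⟩
    refine ⟨α + β, SetLike.mul_mem_graded (ι_mem_taGr 𝓜 hm) (ι_mem_taGr 𝓜 hm'),
      Submodule.smul_mem _ _ ?_⟩
    rw [add_comm]
    exact SetLike.mul_mem_graded (ι_mem_taGr 𝓜 hm') (ι_mem_taGr 𝓜 hm))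

theorem SymAlg.ι_mem {γ : Γ} {m : M} (hm : m ∈ 𝓜 γ) : SymAlg.ι ω 𝓜 m ∈ symGr ω 𝓜 γ :=
  mk_mem_quotGr _ (ι_mem_taGr 𝓜 hm)

end Sym

end Presented

section HomGrading

variable [DecidableEq Γ]
variable {V W : Type*} [AddCommGroup V] [Module ℂ V] [AddCommGroup W] [Module ℂ W]
variable (𝒱 : Γ → Submodule ℂ V) (𝒲 : Γ → Submodule ℂ W)

/-- The grading of `Hom(V, W)`: the maps of degree `γ` send `V_β` to `W_{γ + β}`. -/
def homGr (γ : Γ) : Submodule ℂ (V →ₗ[ℂ] W) where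
  carrier := {f | ∀ β, ∀ v ∈ 𝒱 β, f v ∈ 𝒲 (γ + β)}
  add_mem' hf hg β v hv := add_mem (hf β v hv) (hg β v hv)
  zero_mem' _ _ _ := zero_mem _
  smul_mem' c _ hf β v hv := Submodule.smul_mem _ c (hf β v hv)

/-- The field `ℂ`, concentrated in degree `0`. -/
def trivGr (γ : Γ) : Submodule ℂ ℂ := if γ = 0 then ⊤ else ⊥

/-- The grading of the dual space: `(V^*)_γ` consists of the functionals which vanish on `V_β` for
all `β ≠ -γ`. -/
abbrev dualGr : Γ → Submodule ℂ (Module.Dual ℂ V) := homGr 𝒱 trivGr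

theorem mem_dualGr {γ : Γ} {φ : Module.Dual ℂ V} :
    φ ∈ dualGr 𝒱 γ ↔ ∀ β, ∀ v ∈ 𝒱 β, γ + β ≠ 0 → φ v = 0 := by
  have h : ∀ β v, φ v ∈ trivGr (γ + β) ↔ (γ + β ≠ 0 → φ v = 0) := by
    intro β v
    by_cases h : γ + β = 0 <;> simp [trivGr, h]
  exact ⟨fun hφ β v hv => (h β v).1 (hφ β v hv), fun hφ β v hv => (h β v).2 (hφ β v hv)⟩

variable [DirectSum.Decomposition 𝒱] [DirectSum.Decomposition 𝒲]

/-- The projection of a graded vector space to its component of degree `γ`. -/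
def projGr (γ : Γ) : V →ₗ[ℂ] V := gradScale 𝒱 (fun δ => if δ = γ then 1 else 0)

theorem projGr_same {γ : Γ} {v : V} (hv : v ∈ 𝒱 γ) : projGr 𝒱 γ v = v := by
  simp [projGr, gradScale_of_mem 𝒱 _ hv]

theorem projGr_ne {γ δ : Γ} {v : V} (hv : v ∈ 𝒱 γ) (h : γ ≠ δ) : projGr 𝒱 δ v = 0 := by
  simp [projGr, gradScale_of_mem 𝒱 _ hv, h]

theorem projGr_mem (γ : Γ) (v : V) : projGr 𝒱 γ v ∈ 𝒱 γ := by
  induction v using hom_induction 𝒱 with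
  | h0 => rw [map_zero]; exact zero_mem _
  | hadd v w h h' => rw [map_add]; exact add_mem h h'
  | h δ v hv =>
    by_cases h : δ = γ
    · subst h; rwa [projGr_same 𝒱 hv]
    · rw [projGr_ne 𝒱 hv h]; exact zero_mem _

theorem finite_support [FiniteDimensional ℂ V] : {γ | 𝒱 γ ≠ ⊥}.Finite :=
  WellFoundedGT.finite_ne_bot_of_iSupIndep
    (DirectSum.Decomposition.isInternal 𝒱).submodule_iSupIndep

variable [FiniteDimensional ℂ V]

theorem sum_projGr (S : Finset Γ) (hS : ∀ γ, 𝒱 γ ≠ ⊥ → γ ∈ S) (v : V) :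
    ∑ γ ∈ S, projGr 𝒱 γ v = v := by
  induction v using hom_induction 𝒱 with
  | h0 => simp
  | hadd v w h h' => simp only [map_add, Finset.sum_add_distrib, h, h']
  | h δ v hv =>
    by_cases h : 𝒱 δ = ⊥
    · rw [h, Submodule.mem_bot] at hv
      simp [hv]
    · rw [Finset.sum_eq_single δ (fun γ _ h' => projGr_ne 𝒱 hv (Ne.symm h'))
        (fun h' => absurd (hS δ h) h'), projGr_same 𝒱 hv]

end HomGrading

section HomGrading2

variable [DecidableEq Γ]
variable {V W : Type*} [AddCommGroup V] [Module ℂ V] [AddCommGroup W] [Module ℂ W]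
variable (𝒱 : Γ → Submodule ℂ V) (𝒲 : Γ → Submodule ℂ W)
variable [DirectSum.Decomposition 𝒱] [DirectSum.Decomposition 𝒲] [FiniteDimensional ℂ V]
  [FiniteDimensional ℂ W]

theorem projGr_comp_mem (f : V →ₗ[ℂ] W) (α β : Γ) :
    projGr 𝒲 α ∘ₗ f ∘ₗ projGr 𝒱 β ∈ homGr 𝒱 𝒲 (α - β) := by
  intro γ v hv
  by_cases h : γ = β
  · subst h
    rw [sub_add_cancel]
    exact projGr_mem 𝒲 α _
  · simp [projGr_ne 𝒱 hv h]

/-- The decomposition map of `Hom(V, W)`, for finite dimensional `V` and `W`. -/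
def homDecompose : (V →ₗ[ℂ] W) →ₗ[ℂ] ⨁ γ, homGr 𝒱 𝒲 γ :=
  ∑ α ∈ (finite_support 𝒲).toFinset, ∑ β ∈ (finite_support 𝒱).toFinset,
    DirectSum.lof ℂ Γ (fun γ => homGr 𝒱 𝒲 γ) (α - β) ∘ₗ
      LinearMap.codRestrict (homGr 𝒱 𝒲 (α - β))
        ((LinearMap.llcomp ℂ V W W (projGr 𝒲 α)) ∘ₗ
          (LinearMap.lcomp ℂ W (projGr 𝒱 β)))
        (fun f => projGr_comp_mem 𝒱 𝒲 f α β)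

theorem homDecompose_apply (f : V →ₗ[ℂ] W) :
    homDecompose 𝒱 𝒲 f =
      ∑ α ∈ (finite_support 𝒲).toFinset, ∑ β ∈ (finite_support 𝒱).toFinset,
        DirectSum.of (fun γ => homGr 𝒱 𝒲 γ) (α - β)
          ⟨projGr 𝒲 α ∘ₗ f ∘ₗ projGr 𝒱 β, projGr_comp_mem 𝒱 𝒲 f α β⟩ := by
  simp only [homDecompose, LinearMap.sum_apply]
  rfl

theorem homDecompose_left (f : V →ₗ[ℂ] W) :
    DirectSum.coeAddMonoidHom (homGr 𝒱 𝒲) (homDecompose 𝒱 𝒲 f) = f := by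
  rw [homDecompose_apply]
  simp only [map_sum, DirectSum.coeAddMonoidHom_of]
  ext v
  simp only [LinearMap.sum_apply, LinearMap.comp_apply]
  rw [Finset.sum_comm]
  rw [Finset.sum_congr rfl (fun β _ => sum_projGr 𝒲 _ (fun γ h => by simpa using h) _),
    ← map_sum, sum_projGr 𝒱 _ (fun γ h => by simpa using h)]

instance homDecomposition : DirectSum.Decomposition (homGr 𝒱 𝒲) :=
  decompositionOfMap _ (homDecompose 𝒱 𝒲) (homDecompose_left 𝒱 𝒲)
    (fun γ f hf => by
      have key : ∀ α ∈ (finite_support 𝒲).toFinset, ∀ β ∈ (finite_support 𝒱).toFinset,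
          DirectSum.of (fun γ => homGr 𝒱 𝒲 γ) (α - β)
            ⟨projGr 𝒲 α ∘ₗ f ∘ₗ projGr 𝒱 β, projGr_comp_mem 𝒱 𝒲 f α β⟩ =
          DirectSum.of (fun γ => homGr 𝒱 𝒲 γ) γ
            (if h : α - β = γ then ⟨projGr 𝒲 α ∘ₗ f ∘ₗ projGr 𝒱 β,
              h ▸ projGr_comp_mem 𝒱 𝒲 f α β⟩ else 0) := by
        intro α _ β _
        by_cases h : α - β = γ
        · rw [dif_pos h]
          exact lof_congr h rfl
        · rw [dif_neg h, map_zero]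
          have h0 : projGr 𝒲 α ∘ₗ f ∘ₗ projGr 𝒱 β = 0 := by
            ext v
            refine projGr_ne 𝒲 (hf β _ (projGr_mem 𝒱 β v)) (fun h' => h ?_)
            rw [← h', add_sub_cancel_right]
          rw [← map_zero (DirectSum.of (fun γ => homGr 𝒱 𝒲 γ) (α - β))]
          congr 1
          exact Subtype.ext h0
      have h1 := homDecompose_apply 𝒱 𝒲 f
      rw [Finset.sum_congr rfl (fun α hα => Finset.sum_congr rfl (key α hα))] at h1
      simp only [← map_sum] at h1
      rw [h1]
      congr 1
      have h2 := congrArg (DirectSum.coeAddMonoidHom (homGr 𝒱 𝒲)) h1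
      rw [homDecompose_left, DirectSum.coeAddMonoidHom_of] at h2
      exact Subtype.ext h2.symm)

/-- The grading of `End(V)`. -/
abbrev endGr : Γ → Submodule ℂ (Module.End ℂ V) := homGr 𝒱 𝒱

instance : GradedAlgebra (endGr 𝒱) :=
  { homDecomposition 𝒱 𝒱 with
    one_mem := fun β v hv => by rw [zero_add]; exact hv
    mul_mem := fun α β f g hf hg γ v hv => by
      rw [add_assoc]
      exact hf _ _ (hg _ _ hv) }

instance : DirectSum.Decomposition (trivGr (Γ := Γ)) :=
  decompositionOfMap _
    (DirectSum.lof ℂ Γ (fun γ : Γ => trivGr γ) 0 ∘ₗ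
      LinearMap.codRestrict (trivGr (0 : Γ)) LinearMap.id (fun c => by simp [trivGr]))
    (fun c => DirectSum.coeAddMonoidHom_of _ _ _)
    (fun γ c hc => by
      by_cases h : γ = 0
      · exact lof_congr h.symm rfl
      · have h0 : c = 0 := by simpa [trivGr, h] using hc
        subst h0
        rw [map_zero]
        symm
        exact map_zero _)

end HomGrading2

section COp

variable [DecidableEq Γ]
variable {A : Type*} [Ring A] [Algebra ℂ A]

/-- The opposite of a graded algebra `A`: the graded vector space `A` with the multiplication
`μ ∘ τ`, i.e. `(a, b) ↦ ω(d(a), d(b)) b a`. An anti-homomorphism `A → B` of `(Γ, ω)`-algebras is a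
homomorphism from `A` to the opposite of `B`. -/
def COp (_ω : CommFactor Γ) (𝒜 : Γ → Submodule ℂ A) [GradedAlgebra 𝒜] : Type _ := A

namespace COp

variable (ω : CommFactor Γ) (𝒜 : Γ → Submodule ℂ A) [GradedAlgebra 𝒜]

instance : AddCommGroup (COp ω 𝒜) := inferInstanceAs (AddCommGroup A)

instance : Module ℂ (COp ω 𝒜) := inferInstanceAs (Module ℂ A)

/-- The identity map from `A` to its opposite. -/
def of : A ≃ₗ[ℂ] COp ω 𝒜 := LinearEquiv.refl ℂ _

instance : Mul (COp ω 𝒜) :=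
  ⟨fun x y => of ω 𝒜 (LinearMap.mul' ℂ A
    (braiding ω 𝒜 𝒜 ((of ω 𝒜).symm x ⊗ₜ (of ω 𝒜).symm y)))⟩

instance : One (COp ω 𝒜) := ⟨of ω 𝒜 1⟩

theorem mul_def (x y : COp ω 𝒜) :
    x * y = of ω 𝒜 (LinearMap.mul' ℂ A
      (braiding ω 𝒜 𝒜 ((of ω 𝒜).symm x ⊗ₜ (of ω 𝒜).symm y))) := rfl

theorem one_def : (1 : COp ω 𝒜) = of ω 𝒜 1 := rfl

theorem of_mul_of {α β : Γ} {a b : A} (ha : a ∈ 𝒜 α) (hb : b ∈ 𝒜 β) :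
    of ω 𝒜 a * of ω 𝒜 b = ω α β • of ω 𝒜 (b * a) := by
  rw [mul_def, LinearEquiv.symm_apply_apply, LinearEquiv.symm_apply_apply,
    braiding_tmul ω 𝒜 𝒜 ha hb, map_smul, map_smul, LinearMap.mul'_apply]

protected theorem mul_add' (x y z : COp ω 𝒜) : x * (y + z) = x * y + x * z := by
  simp only [mul_def, map_add, TensorProduct.tmul_add]

protected theorem add_mul' (x y z : COp ω 𝒜) : (x + y) * z = x * z + y * z := by
  simp only [mul_def, map_add, TensorProduct.add_tmul]

protected theorem smul_mul' (c : ℂ) (x y : COp ω 𝒜) : (c • x) * y = c • (x * y) := by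
  simp only [mul_def, map_smul, ← TensorProduct.smul_tmul']

protected theorem mul_smul' (c : ℂ) (x y : COp ω 𝒜) : x * (c • y) = c • (x * y) := by
  simp only [mul_def, map_smul, TensorProduct.tmul_smul]

protected theorem zero_mul' (x : COp ω 𝒜) : 0 * x = 0 := by
  simp only [mul_def, map_zero, TensorProduct.zero_tmul]

protected theorem mul_zero' (x : COp ω 𝒜) : x * 0 = 0 := by
  simp only [mul_def, map_zero, TensorProduct.tmul_zero]

theorem induction {P : COp ω 𝒜 → Prop} (h0 : P 0) (h : ∀ α a, a ∈ 𝒜 α → P (of ω 𝒜 a))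
    (hadd : ∀ x y, P x → P y → P (x + y)) (x : COp ω 𝒜) : P x :=
  hom_induction 𝒜 (P := P) h0 h hadd x

protected theorem one_mul' (x : COp ω 𝒜) : 1 * x = x := by
  induction x using induction with
  | h0 => exact COp.mul_zero' ω 𝒜 1
  | hadd x y hx hy => rw [COp.mul_add', hx, hy]
  | h α a ha => rw [one_def, of_mul_of ω 𝒜 SetLike.GradedOne.one_mem ha]; simp

protected theorem mul_one' (x : COp ω 𝒜) : x * 1 = x := by
  induction x using induction with
  | h0 => exact COp.zero_mul' ω 𝒜 1
  | hadd x y hx hy => rw [COp.add_mul', hx, hy]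
  | h α a ha => rw [one_def, of_mul_of ω 𝒜 ha SetLike.GradedOne.one_mem]; simp

protected theorem mul_assoc' (x y z : COp ω 𝒜) : x * y * z = x * (y * z) := by
  induction x using induction with
  | h0 => simp only [COp.zero_mul']
  | hadd x x' hx hy => simp only [COp.add_mul', hx, hy]
  | h α a ha =>
    induction y using induction with
    | h0 => simp only [COp.zero_mul', COp.mul_zero']
    | hadd x x' hx hy => simp only [COp.add_mul', COp.mul_add', hx, hy]
    | h β b hb =>
      induction z using induction with
      | h0 => simp only [COp.mul_zero']
      | hadd x x' hx hy => simp only [COp.mul_add', hx, hy]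
      | h γ c hc =>
        rw [of_mul_of ω 𝒜 ha hb, of_mul_of ω 𝒜 hb hc, COp.smul_mul', COp.mul_smul',
          of_mul_of ω 𝒜 (SetLike.mul_mem_graded hb ha) hc,
          of_mul_of ω 𝒜 ha (SetLike.mul_mem_graded hc hb), smul_smul, smul_smul,
          mul_assoc, ω.add_left, ω.add_right]
        congr 1
        ring

instance : Ring (COp ω 𝒜) :=
  { (inferInstance : AddCommGroup (COp ω 𝒜)), (inferInstance : Mul (COp ω 𝒜)),
    (inferInstance : One (COp ω 𝒜)) with
    left_distrib := COp.mul_add' ω 𝒜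
    right_distrib := COp.add_mul' ω 𝒜
    zero_mul := COp.zero_mul' ω 𝒜
    mul_zero := COp.mul_zero' ω 𝒜
    mul_assoc := COp.mul_assoc' ω 𝒜
    one_mul := COp.one_mul' ω 𝒜
    mul_one := COp.mul_one' ω 𝒜 }

instance : Algebra ℂ (COp ω 𝒜) :=
  Algebra.ofModule (COp.smul_mul' ω 𝒜) (fun c x y => COp.mul_smul' ω 𝒜 c x y)

end COp

end COp

section UEnv

variable [DecidableEq Γ] (ω : CommFactor Γ)
variable {V : Type*} [AddCommGroup V] [Module ℂ V]
variable (𝒱 : Γ → Submodule ℂ V)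

/-- The relations `X Y - ω(d(X), d(Y)) Y X = [X, Y]` in the tensor algebra of `gl(V) = End(V)`,
where `[X, Y] = X ∘ Y - ω(d(X), d(Y)) Y ∘ X`. -/
inductive uRel : TensorAlgebra ℂ (Module.End ℂ V) → TensorAlgebra ℂ (Module.End ℂ V) → Prop
  | bracket (α β : Γ) (X Y : Module.End ℂ V) (hX : X ∈ endGr 𝒱 α) (hY : Y ∈ endGr 𝒱 β) :
    uRel (TensorAlgebra.ι ℂ X * TensorAlgebra.ι ℂ Y -
        ω α β • (TensorAlgebra.ι ℂ Y * TensorAlgebra.ι ℂ X))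
      (TensorAlgebra.ι ℂ (X * Y - ω α β • (Y * X)))

/-- The universal enveloping algebra `U(gl(V))` of the general linear Lie `(Γ, ω)`-algebra. -/
abbrev UEnv : Type _ := RingQuot (uRel ω 𝒱)

/-- The canonical map `gl(V) → U(gl(V))`. -/
def UEnv.ι : Module.End ℂ V →ₗ[ℂ] UEnv ω 𝒱 :=
  (RingQuot.mkAlgHom ℂ (uRel ω 𝒱)).toLinearMap ∘ₗ TensorAlgebra.ι ℂ

/-- The `Γ`-grading of `U(gl(V))`. -/
abbrev uGr : Γ → Submodule ℂ (UEnv ω 𝒱) := quotGr (taGr (endGr 𝒱)) (uRel ω 𝒱)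

variable [DirectSum.Decomposition 𝒱] [FiniteDimensional ℂ V]

theorem endGr_mul {α β : Γ} {X Y : Module.End ℂ V} (hX : X ∈ endGr 𝒱 α) (hY : Y ∈ endGr 𝒱 β) :
    X * Y ∈ endGr 𝒱 (α + β) := SetLike.mul_mem_graded hX hY

theorem bracket_mem {α β : Γ} {X Y : Module.End ℂ V} (hX : X ∈ endGr 𝒱 α)
    (hY : Y ∈ endGr 𝒱 β) : X * Y - ω α β • (Y * X) ∈ endGr 𝒱 (α + β) :=
  sub_mem (endGr_mul 𝒱 hX hY)
    (Submodule.smul_mem _ _ (add_comm β α ▸ endGr_mul 𝒱 hY hX))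

instance : GradedAlgebra (uGr ω 𝒱) :=
  quotGraded (taGr (endGr 𝒱)) (uRel ω 𝒱) (by
    rintro _ _ ⟨α, β, X, Y, hX, hY⟩
    refine ⟨α + β, sub_mem (SetLike.mul_mem_graded (ι_mem_taGr _ hX) (ι_mem_taGr _ hY))
      (Submodule.smul_mem _ _ ?_), ι_mem_taGr _ (bracket_mem ω 𝒱 hX hY)⟩
    rw [add_comm]
    exact SetLike.mul_mem_graded (ι_mem_taGr _ hY) (ι_mem_taGr _ hX))

theorem UEnv.ι_mem {α : Γ} {X : Module.End ℂ V} (hX : X ∈ endGr 𝒱 α) :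
    UEnv.ι ω 𝒱 X ∈ uGr ω 𝒱 α := mk_mem_quotGr _ (ι_mem_taGr _ hX)

theorem UEnv.ι_bracket {α β : Γ} {X Y : Module.End ℂ V} (hX : X ∈ endGr 𝒱 α)
    (hY : Y ∈ endGr 𝒱 β) :
    UEnv.ι ω 𝒱 X * UEnv.ι ω 𝒱 Y - ω α β • (UEnv.ι ω 𝒱 Y * UEnv.ι ω 𝒱 X) =
      UEnv.ι ω 𝒱 (X * Y - ω α β • (Y * X)) := by
  have h := RingQuot.mkAlgHom_rel ℂ (uRel.bracket (ω := ω) (𝒱 := 𝒱) α β X Y hX hY)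
  rw [map_sub, map_smul, map_mul, map_mul] at h
  exact h

/-- The algebra homomorphism on `U(gl(V))` extending a linear map on `gl(V)` which respects the
brackets of homogeneous elements. -/
def UEnv.lift {B : Type*} [Ring B] [Algebra ℂ B] (f : Module.End ℂ V →ₗ[ℂ] B)
    (hf : ∀ α β X Y, X ∈ endGr 𝒱 α → Y ∈ endGr 𝒱 β →
      f X * f Y - ω α β • (f Y * f X) = f (X * Y - ω α β • (Y * X))) : UEnv ω 𝒱 →ₐ[ℂ] B :=
  RingQuot.liftAlgHom ℂ ⟨TensorAlgebra.lift ℂ f, by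
    rintro _ _ ⟨α, β, X, Y, hX, hY⟩
    rw [map_sub, map_smul, map_mul, map_mul]
    simp only [TensorAlgebra.lift_ι_apply]
    exact hf α β X Y hX hY⟩

theorem UEnv.lift_ι {B : Type*} [Ring B] [Algebra ℂ B] (f : Module.End ℂ V →ₗ[ℂ] B)
    (hf : ∀ α β X Y, X ∈ endGr 𝒱 α → Y ∈ endGr 𝒱 β →
      f X * f Y - ω α β • (f Y * f X) = f (X * Y - ω α β • (Y * X))) (X : Module.End ℂ V) :
    UEnv.lift ω 𝒱 f hf (UEnv.ι ω 𝒱 X) = f X := by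
  unfold UEnv.lift UEnv.ι
  rw [LinearMap.comp_apply, AlgHom.toLinearMap_apply, RingQuot.liftAlgHom_mkAlgHom_apply,
    TensorAlgebra.lift_ι_apply]

/-- The natural representation of `U(gl(V))` on `V`. -/
def natRep : UEnv ω 𝒱 →ₐ[ℂ] Module.End ℂ V :=
  UEnv.lift ω 𝒱 LinearMap.id (fun _ _ _ _ _ _ => rfl)

/-- The co-unit of `U(gl(V))`: `X ↦ 0` for `X` in `gl(V)`. -/
def uCounit : UEnv ω 𝒱 →ₐ[ℂ] ℂ := UEnv.lift ω 𝒱 0 (fun _ _ _ _ _ _ => by simp)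

/-- The linear map `X ↦ X ⊗ 1 + 1 ⊗ X`. -/
def uComulAux : Module.End ℂ V →ₗ[ℂ] CTensor ω (uGr ω 𝒱) (uGr ω 𝒱) :=
  (CTensor.of ω (uGr ω 𝒱) (uGr ω 𝒱)).toLinearMap ∘ₗ
    ((TensorProduct.mk ℂ (UEnv ω 𝒱) (UEnv ω 𝒱)).flip 1 + TensorProduct.mk ℂ _ _ 1) ∘ₗ
      UEnv.ι ω 𝒱

theorem uComulAux_apply (X : Module.End ℂ V) :
    uComulAux ω 𝒱 X = CTensor.tmul ω (uGr ω 𝒱) (uGr ω 𝒱) (UEnv.ι ω 𝒱 X) 1 +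
      CTensor.tmul ω (uGr ω 𝒱) (uGr ω 𝒱) 1 (UEnv.ι ω 𝒱 X) := rfl

theorem uComulAux_mul {α β : Γ} {X Y : Module.End ℂ V} (hX : X ∈ endGr 𝒱 α)
    (hY : Y ∈ endGr 𝒱 β) :
    uComulAux ω 𝒱 X * uComulAux ω 𝒱 Y =
      CTensor.tmul ω (uGr ω 𝒱) (uGr ω 𝒱) (UEnv.ι ω 𝒱 X * UEnv.ι ω 𝒱 Y) 1 +
      CTensor.tmul ω (uGr ω 𝒱) (uGr ω 𝒱) (UEnv.ι ω 𝒱 X) (UEnv.ι ω 𝒱 Y) +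
      (ω α β • CTensor.tmul ω (uGr ω 𝒱) (uGr ω 𝒱) (UEnv.ι ω 𝒱 Y) (UEnv.ι ω 𝒱 X) +
      CTensor.tmul ω (uGr ω 𝒱) (uGr ω 𝒱) 1 (UEnv.ι ω 𝒱 X * UEnv.ι ω 𝒱 Y)) := by
  have hX' := UEnv.ι_mem ω 𝒱 hX
  have hY' := UEnv.ι_mem ω 𝒱 hY
  have h1 : (1 : UEnv ω 𝒱) ∈ uGr ω 𝒱 0 := SetLike.GradedOne.one_mem
  rw [uComulAux_apply, uComulAux_apply, add_mul, mul_add, mul_add,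
    CTensor.tmul_mul_tmul ω _ _ _ h1 hY', CTensor.tmul_mul_tmul ω _ _ _ h1 h1,
    CTensor.tmul_mul_tmul ω _ _ _ hX' hY', CTensor.tmul_mul_tmul ω _ _ _ hX' h1]
  simp

/-- The co-multiplication of `U(gl(V))`, an algebra homomorphism with `X ↦ X ⊗ 1 + 1 ⊗ X` for `X`
in `gl(V)`. -/
def uComul : UEnv ω 𝒱 →ₐ[ℂ] CTensor ω (uGr ω 𝒱) (uGr ω 𝒱) :=
  UEnv.lift ω 𝒱 (uComulAux ω 𝒱) (fun α β X Y hX hY => by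
    rw [uComulAux_mul ω 𝒱 hX hY, uComulAux_mul ω 𝒱 hY hX, uComulAux_apply,
      ← UEnv.ι_bracket ω 𝒱 hX hY]
    simp only [CTensor.tmul, TensorProduct.sub_tmul, TensorProduct.tmul_sub, map_sub,
      ← TensorProduct.smul_tmul', TensorProduct.tmul_smul, map_smul, smul_add, smul_smul,
      ω.skew, one_smul]
    abel)

/-- The antipode of `U(gl(V))`, the anti-homomorphism with `X ↦ -X` for `X` in `gl(V)`. -/
def uAntipode : UEnv ω 𝒱 →ₐ[ℂ] COp ω (uGr ω 𝒱) :=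
  UEnv.lift ω 𝒱 (-((COp.of ω (uGr ω 𝒱)).toLinearMap ∘ₗ UEnv.ι ω 𝒱)) (fun α β X Y hX hY => by
    have hX' := UEnv.ι_mem ω 𝒱 hX
    have hY' := UEnv.ι_mem ω 𝒱 hY
    simp only [LinearMap.neg_apply, LinearMap.comp_apply, LinearEquiv.coe_coe, neg_mul_neg]
    rw [COp.of_mul_of ω _ hX' hY', COp.of_mul_of ω _ hY' hX', ← UEnv.ι_bracket ω 𝒱 hX hY,
      smul_smul, ω.skew, one_smul, map_sub, map_smul, neg_sub])

/-- The antipode of `U(gl(V))`, as a linear map. -/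
def uS : UEnv ω 𝒱 →ₗ[ℂ] UEnv ω 𝒱 :=
  (COp.of ω (uGr ω 𝒱)).symm.toLinearMap ∘ₗ (uAntipode ω 𝒱).toLinearMap

variable {ω 𝒱} in
theorem UEnv.induction {P : Γ → UEnv ω 𝒱 → Prop} (zero : ∀ γ, P γ 0)
    (add : ∀ γ x y, P γ x → P γ y → P γ (x + y)) (smul : ∀ γ (c : ℂ) x, P γ x → P γ (c • x))
    (one : P 0 1)
    (mul : ∀ α β X x, X ∈ endGr 𝒱 α → x ∈ uGr ω 𝒱 β → P β x → P (α + β) (UEnv.ι ω 𝒱 X * x))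
    {γ : Γ} {x : UEnv ω 𝒱} (hx : x ∈ uGr ω 𝒱 γ) : P γ x := by
  obtain ⟨y, hy, rfl⟩ := hx
  induction hy using Submodule.span_induction with
  | zero => rw [map_zero]; exact zero γ
  | add a b _ _ ha hb => rw [map_add]; exact add _ _ _ ha hb
  | smul c a _ ha => rw [map_smul]; exact smul _ _ _ ha
  | mem a ha =>
    obtain ⟨l, hl, rfl, rfl⟩ := ha
    induction l with
    | nil =>
      have h : (RingQuot.mkAlgHom ℂ (uRel ω 𝒱)).toLinearMap 1 = 1 :=
        map_one (RingQuot.mkAlgHom ℂ (uRel ω 𝒱))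
      simpa [h] using one
    | cons p l ih =>
      have hl' : ∀ q ∈ l, q.2 ∈ endGr 𝒱 q.1 := fun q hq => hl q (List.mem_cons_of_mem _ hq)
      simp only [List.map_cons, List.prod_cons, List.sum_cons, AlgHom.toLinearMap_apply, map_mul]
      exact mul _ _ _ _ (hl p List.mem_cons_self)
        (mk_mem_quotGr _ (Submodule.subset_span ⟨l, hl', rfl, rfl⟩)) (ih hl')

end UEnv


section Pairing

variable [DecidableEq Γ]
variable {A : Type*} [Ring A] [Algebra ℂ A]

/-- The pairing of `A^* ⊗ A^*` with `A ⊗ A`: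
`⟨f ⊗ g, x ⊗ y⟩ = ω(d(g), d(x)) ⟨f, x⟩ ⟨g, y⟩`. As `⟨g, y⟩ = 0` unless `d(g) = -d(y)`, the scalar is
`ω(-d(y), d(x)) = ω(d(x), d(y))`. -/
def colourPair (ω : CommFactor Γ) (𝒜 : Γ → Submodule ℂ A) [GradedAlgebra 𝒜] :
    Module.Dual ℂ A ⊗[ℂ] Module.Dual ℂ A →ₗ[ℂ] Module.Dual ℂ (A ⊗[ℂ] A) :=
  (twist ω 𝒜 𝒜).dualMap ∘ₗ TensorProduct.dualDistrib ℂ A A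

theorem colourPair_tmul (ω : CommFactor Γ) (𝒜 : Γ → Submodule ℂ A) [GradedAlgebra 𝒜]
    (f g : Module.Dual ℂ A) {α β : Γ} {x y : A} (hx : x ∈ 𝒜 α) (hy : y ∈ 𝒜 β) :
    colourPair ω 𝒜 (f ⊗ₜ g) (x ⊗ₜ y) = ω α β * (f x * g y) := by
  simp [colourPair, twist_tmul ω 𝒜 𝒜 hx hy]

end Pairing

section UDual

variable [DecidableEq Γ] (ω : CommFactor Γ)
variable {V : Type*} [AddCommGroup V] [Module ℂ V]
variable (𝒱 : Γ → Submodule ℂ V)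
variable [DirectSum.Decomposition 𝒱] [FiniteDimensional ℂ V]

/-- The dual space of `U = U(gl(V))`, as an algebra with the multiplication
`⟨f g, x⟩ = ⟨f ⊗ g, Δ(x)⟩` and the identity element `ε`. -/
def UDual (_ω : CommFactor Γ) (𝒱 : Γ → Submodule ℂ V) : Type _ := Module.Dual ℂ (UEnv _ω 𝒱)

namespace UDual

instance : AddCommGroup (UDual ω 𝒱) := inferInstanceAs (AddCommGroup (Module.Dual ℂ (UEnv ω 𝒱)))

instance : Module ℂ (UDual ω 𝒱) := inferInstanceAs (Module ℂ (Module.Dual ℂ (UEnv ω 𝒱)))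

/-- The identity map from the dual space of `U` to `UDual`. -/
def of : Module.Dual ℂ (UEnv ω 𝒱) ≃ₗ[ℂ] UDual ω 𝒱 := LinearEquiv.refl ℂ _

variable {ω 𝒱} in
/-- The pairing `⟨f, x⟩`. -/
def eval (f : UDual ω 𝒱) (x : UEnv ω 𝒱) : ℂ := (of ω 𝒱).symm f x

instance : Mul (UDual ω 𝒱) :=
  ⟨fun f g => of ω 𝒱 (colourPair ω (uGr ω 𝒱) ((of ω 𝒱).symm f ⊗ₜ (of ω 𝒱).symm g) ∘ₗ
    (CTensor.of ω (uGr ω 𝒱) (uGr ω 𝒱)).symm.toLinearMap ∘ₗ (uComul ω 𝒱).toLinearMap)⟩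

instance : One (UDual ω 𝒱) := ⟨of ω 𝒱 (uCounit ω 𝒱).toLinearMap⟩

theorem mul_def (f g : UDual ω 𝒱) :
    f * g = of ω 𝒱 (colourPair ω (uGr ω 𝒱) ((of ω 𝒱).symm f ⊗ₜ (of ω 𝒱).symm g) ∘ₗ
      (CTensor.of ω (uGr ω 𝒱) (uGr ω 𝒱)).symm.toLinearMap ∘ₗ (uComul ω 𝒱).toLinearMap) := rfl

theorem mul_eval (f g : UDual ω 𝒱) (x : UEnv ω 𝒱) :
    eval (f * g) x = colourPair ω (uGr ω 𝒱) ((of ω 𝒱).symm f ⊗ₜ (of ω 𝒱).symm g)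
      ((CTensor.of ω (uGr ω 𝒱) (uGr ω 𝒱)).symm (uComul ω 𝒱 x)) := rfl

theorem one_eval (x : UEnv ω 𝒱) : eval (1 : UDual ω 𝒱) x = uCounit ω 𝒱 x := rfl

variable {ω 𝒱} in
theorem ext' {f g : UDual ω 𝒱} (h : ∀ x, eval f x = eval g x) : f = g :=
  LinearMap.ext (f := (f : Module.Dual ℂ (UEnv ω 𝒱))) h

variable {ω 𝒱} in
@[simp] theorem eval_add (f : UDual ω 𝒱) (x y : UEnv ω 𝒱) :
    eval f (x + y) = eval f x + eval f y := map_add _ _ _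

variable {ω 𝒱} in
@[simp] theorem eval_smul (f : UDual ω 𝒱) (c : ℂ) (x : UEnv ω 𝒱) :
    eval f (c • x) = c * eval f x := by simp [eval]

variable {ω 𝒱} in
@[simp] theorem eval_zero (f : UDual ω 𝒱) : eval f 0 = 0 := map_zero _

variable {ω 𝒱} in
@[simp] theorem add_eval (f g : UDual ω 𝒱) (x : UEnv ω 𝒱) :
    eval (f + g) x = eval f x + eval g x := rfl

variable {ω 𝒱} in
/-- Two functionals which agree on homogeneous elements are equal. -/
theorem ext_hom {f g : UDual ω 𝒱} (h : ∀ γ, ∀ x ∈ uGr ω 𝒱 γ, eval f x = eval g x) : f = g :=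
  ext' fun x => hom_induction (uGr ω 𝒱) (by simp) h
    (fun x y hx hy => by simp [hx, hy]) x

protected theorem mul_add' (f g h : UDual ω 𝒱) : f * (g + h) = f * g + f * h :=
  ext' fun x => by simp only [mul_eval, add_eval, map_add, TensorProduct.tmul_add,
    LinearMap.add_apply]

protected theorem add_mul' (f g h : UDual ω 𝒱) : (f + g) * h = f * h + g * h :=
  ext' fun x => by simp only [mul_eval, add_eval, map_add, TensorProduct.add_tmul,
    LinearMap.add_apply]

protected theorem smul_mul' (c : ℂ) (f g : UDual ω 𝒱) : (c • f) * g = c • (f * g) := by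
  simp only [mul_def, map_smul, ← TensorProduct.smul_tmul', LinearMap.smul_comp]

protected theorem mul_smul' (c : ℂ) (f g : UDual ω 𝒱) : f * (c • g) = c • (f * g) := by
  simp only [mul_def, map_smul, TensorProduct.tmul_smul, LinearMap.smul_comp]

protected theorem mul_zero' (f : UDual ω 𝒱) : f * 0 = 0 := by
  simpa using UDual.mul_smul' ω 𝒱 0 f 0

protected theorem zero_mul' (f : UDual ω 𝒱) : 0 * f = 0 := by
  simpa using UDual.smul_mul' ω 𝒱 0 0 f

/-- The functional `x ↦ ⟨f, X x⟩`. -/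
def transL (X : Module.End ℂ V) (f : UDual ω 𝒱) : UDual ω 𝒱 :=
  of ω 𝒱 ((of ω 𝒱).symm f ∘ₗ LinearMap.mulLeft ℂ (UEnv.ι ω 𝒱 X))

/-- The functional `x ↦ ω(α, d(x)) ⟨f, x⟩`. -/
def scale (α : Γ) (f : UDual ω 𝒱) : UDual ω 𝒱 :=
  of ω 𝒱 ((of ω 𝒱).symm f ∘ₗ gradScale (uGr ω 𝒱) (ω α))

theorem transL_eval (X : Module.End ℂ V) (f : UDual ω 𝒱) (x : UEnv ω 𝒱) :
    eval (transL ω 𝒱 X f) x = eval f (UEnv.ι ω 𝒱 X * x) := rfl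

theorem scale_eval (α : Γ) (f : UDual ω 𝒱) {γ : Γ} {x : UEnv ω 𝒱} (hx : x ∈ uGr ω 𝒱 γ) :
    eval (scale ω 𝒱 α f) x = ω α γ * eval f x := by
  change (of ω 𝒱).symm f (gradScale (uGr ω 𝒱) (ω α) x) = _
  rw [gradScale_of_mem _ _ hx, map_smul]; rfl

theorem mul_eval_one (f g : UDual ω 𝒱) : eval (f * g) 1 = eval f 1 * eval g 1 := by
  rw [mul_eval, map_one, CTensor.one_def]
  have h1 : (1 : UEnv ω 𝒱) ∈ uGr ω 𝒱 0 := SetLike.GradedOne.one_mem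
  exact (colourPair_tmul ω _ _ _ h1 h1).trans (by simp; rfl)

theorem transL_mul {α : Γ} {X : Module.End ℂ V} (hX : X ∈ endGr 𝒱 α) (f g : UDual ω 𝒱) :
    transL ω 𝒱 X (f * g) = transL ω 𝒱 X f * scale ω 𝒱 α g + f * transL ω 𝒱 X g := by
  have hX' := UEnv.ι_mem ω 𝒱 hX
  have h1 : (1 : UEnv ω 𝒱) ∈ uGr ω 𝒱 0 := SetLike.GradedOne.one_mem
  have key : ∀ z : CTensor ω (uGr ω 𝒱) (uGr ω 𝒱),
      colourPair ω (uGr ω 𝒱) ((of ω 𝒱).symm f ⊗ₜ (of ω 𝒱).symm g)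
        ((CTensor.of ω (uGr ω 𝒱) (uGr ω 𝒱)).symm (uComulAux ω 𝒱 X * z)) =
      colourPair ω (uGr ω 𝒱) ((of ω 𝒱).symm (transL ω 𝒱 X f) ⊗ₜ (of ω 𝒱).symm (scale ω 𝒱 α g))
        ((CTensor.of ω (uGr ω 𝒱) (uGr ω 𝒱)).symm z) +
      colourPair ω (uGr ω 𝒱) ((of ω 𝒱).symm f ⊗ₜ (of ω 𝒱).symm (transL ω 𝒱 X g))
        ((CTensor.of ω (uGr ω 𝒱) (uGr ω 𝒱)).symm z) := by
    intro z
    induction z using CTensor.induction with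
    | h0 => simp
    | hadd x y hx hy => rw [mul_add, map_add, map_add, hx, hy]; simp only [map_add]; abel
    | h β γ a b ha hb =>
      rw [uComulAux_apply, add_mul, CTensor.tmul_mul_tmul ω _ _ _ h1 ha,
        CTensor.tmul_mul_tmul ω _ _ _ hX' ha]
      simp only [CTensor.tmul, map_add, map_smul, LinearEquiv.symm_apply_apply, one_mul]
      rw [colourPair_tmul ω _ _ _ (SetLike.mul_mem_graded hX' ha) hb,
        colourPair_tmul ω _ _ _ ha (SetLike.mul_mem_graded hX' hb),
        colourPair_tmul ω _ _ _ ha hb, colourPair_tmul ω _ _ _ ha hb]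
      change _ = ω β γ * (eval f (UEnv.ι ω 𝒱 X * a) * eval (scale ω 𝒱 α g) b) +
        ω β γ * (eval f a * eval g (UEnv.ι ω 𝒱 X * b))
      rw [scale_eval ω 𝒱 α g hb, ω.add_left, ω.add_right, ω.zero_left]
      simp only [smul_eq_mul, eval]
      linear_combination ω β γ * ((of ω 𝒱).symm f a * (of ω 𝒱).symm g (UEnv.ι ω 𝒱 X * b)) *
        ω.skew α β
  refine ext' fun x => ?_
  rw [transL_eval, mul_eval, map_mul, add_eval, mul_eval, mul_eval]
  have h : uComul ω 𝒱 (UEnv.ι ω 𝒱 X) = uComulAux ω 𝒱 X := UEnv.lift_ι ω 𝒱 _ _ X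
  rw [h]
  exact key _

theorem transL_scale (α : Γ) {β : Γ} {X : Module.End ℂ V} (hX : X ∈ endGr 𝒱 β)
    (f : UDual ω 𝒱) :
    transL ω 𝒱 X (scale ω 𝒱 α f) = ω α β • scale ω 𝒱 α (transL ω 𝒱 X f) := by
  refine ext_hom fun γ x hx => ?_
  change _ = ω α β • eval (scale ω 𝒱 α (transL ω 𝒱 X f)) x
  rw [transL_eval, scale_eval ω 𝒱 α _ hx,
    scale_eval ω 𝒱 α _ (SetLike.mul_mem_graded (UEnv.ι_mem ω 𝒱 hX) hx), transL_eval,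
    ω.add_right, smul_eq_mul, mul_assoc]

theorem scale_mul (α : Γ) (f g : UDual ω 𝒱) :
    scale ω 𝒱 α (f * g) = scale ω 𝒱 α f * scale ω 𝒱 α g := by
  refine ext_hom fun γ x hx => ?_
  revert f g
  refine UEnv.induction (P := fun _ x => ∀ f g : UDual ω 𝒱,
    eval (scale ω 𝒱 α (f * g)) x = eval (scale ω 𝒱 α f * scale ω 𝒱 α g) x)
    (by simp) ?_ ?_ ?_ ?_ hx
  · intro γ x y hx hy f g; simp [hx f g, hy f g]
  · intro γ c x hx f g; simp [hx f g]
  · intro f g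
    have h1 : (1 : UEnv ω 𝒱) ∈ uGr ω 𝒱 0 := SetLike.GradedOne.one_mem
    rw [scale_eval ω 𝒱 α _ h1, mul_eval_one, mul_eval_one, scale_eval ω 𝒱 α _ h1,
      scale_eval ω 𝒱 α _ h1]
    simp
  · intro β γ X x hX hx ih f g
    rw [← transL_eval, ← transL_eval, transL_scale ω 𝒱 α hX, transL_mul ω 𝒱 hX,
      transL_mul ω 𝒱 hX, transL_scale ω 𝒱 α hX, transL_scale ω 𝒱 α hX, UDual.smul_mul',
      UDual.mul_smul', add_eval]
    have e1 : scale ω 𝒱 α (transL ω 𝒱 X f * scale ω 𝒱 β g + f * transL ω 𝒱 X g) =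
        scale ω 𝒱 α (transL ω 𝒱 X f * scale ω 𝒱 β g) + scale ω 𝒱 α (f * transL ω 𝒱 X g) := rfl
    have e2 : scale ω 𝒱 β (scale ω 𝒱 α g) = scale ω 𝒱 α (scale ω 𝒱 β g) := by
      refine ext_hom fun δ y hy => ?_
      rw [scale_eval ω 𝒱 _ _ hy, scale_eval ω 𝒱 _ _ hy, scale_eval ω 𝒱 _ _ hy,
        scale_eval ω 𝒱 _ _ hy]
      ring
    rw [e1, e2]
    change ω α β • (eval (scale ω 𝒱 α (transL ω 𝒱 X f * scale ω 𝒱 β g)) x +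
        eval (scale ω 𝒱 α (f * transL ω 𝒱 X g)) x) =
      ω α β • eval (scale ω 𝒱 α (transL ω 𝒱 X f) * scale ω 𝒱 α (scale ω 𝒱 β g)) x +
        ω α β • eval (scale ω 𝒱 α f * scale ω 𝒱 α (transL ω 𝒱 X g)) x
    rw [ih, ih, smul_add]

protected theorem mul_assoc' (f g h : UDual ω 𝒱) : f * g * h = f * (g * h) := by
  refine ext_hom fun γ x hx => ?_
  revert f g h
  refine UEnv.induction (P := fun _ x => ∀ f g h : UDual ω 𝒱,
    eval (f * g * h) x = eval (f * (g * h)) x) (by simp) ?_ ?_ ?_ ?_ hx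
  · intro γ x y hx hy f g h; simp [hx f g h, hy f g h]
  · intro γ c x hx f g h; simp [hx f g h]
  · intro f g h
    rw [mul_eval_one, mul_eval_one, mul_eval_one, mul_eval_one, mul_assoc]
  · intro β γ X x hX hx ih f g h
    rw [← transL_eval, ← transL_eval, transL_mul ω 𝒱 hX, transL_mul ω 𝒱 hX,
      transL_mul ω 𝒱 hX, transL_mul ω 𝒱 hX, scale_mul, UDual.add_mul', UDual.mul_add']
    simp only [add_eval]
    rw [ih, ih, ih, add_assoc]

theorem transL_one (X : Module.End ℂ V) : transL ω 𝒱 X 1 = 0 := by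
  refine ext' fun x => ?_
  rw [transL_eval, one_eval, map_mul]
  have h : uCounit ω 𝒱 (UEnv.ι ω 𝒱 X) = 0 := UEnv.lift_ι ω 𝒱 _ _ X
  rw [h, zero_mul]; rfl

theorem scale_one (α : Γ) : scale ω 𝒱 α 1 = 1 := by
  refine ext_hom fun γ x hx => ?_
  refine UEnv.induction (P := fun _ x => eval (scale ω 𝒱 α 1) x = eval 1 x)
    (by simp) ?_ ?_ ?_ ?_ hx
  · intro γ x y hx hy; simp [hx, hy]
  · intro γ c x hx; simp [hx]
  · have h1 : (1 : UEnv ω 𝒱) ∈ uGr ω 𝒱 0 := SetLike.GradedOne.one_mem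
    rw [scale_eval ω 𝒱 α _ h1]; simp
  · intro β γ X x hX hx ih
    rw [← transL_eval, ← transL_eval, transL_scale ω 𝒱 α hX, transL_one]
    change ω α β • eval (0 : UDual ω 𝒱) _ = 0
    change ω α β • (0 : ℂ) = 0
    simp

protected theorem one_mul' (f : UDual ω 𝒱) : 1 * f = f := by
  refine ext_hom fun γ x hx => ?_
  revert f
  refine UEnv.induction (P := fun _ x => ∀ f : UDual ω 𝒱, eval (1 * f) x = eval f x)
    (by simp) ?_ ?_ ?_ ?_ hx
  · intro γ x y hx hy f; simp [hx f, hy f]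
  · intro γ c x hx f; simp [hx f]
  · intro f; rw [mul_eval_one, one_eval, map_one, one_mul]
  · intro β γ X x hX hx ih f
    rw [← transL_eval, ← transL_eval, transL_mul ω 𝒱 hX, transL_one, UDual.zero_mul', zero_add, ih]

protected theorem mul_one' (f : UDual ω 𝒱) : f * 1 = f := by
  refine ext_hom fun γ x hx => ?_
  revert f
  refine UEnv.induction (P := fun _ x => ∀ f : UDual ω 𝒱, eval (f * 1) x = eval f x)
    (by simp) ?_ ?_ ?_ ?_ hx
  · intro γ x y hx hy f; simp [hx f, hy f]
  · intro γ c x hx f; simp [hx f]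
  · intro f; rw [mul_eval_one, one_eval, map_one, mul_one]
  · intro β γ X x hX hx ih f
    rw [← transL_eval, ← transL_eval, transL_mul ω 𝒱 hX, transL_one, UDual.mul_zero', add_zero,
      scale_one, ih]

instance : Ring (UDual ω 𝒱) :=
  { (inferInstance : AddCommGroup (UDual ω 𝒱)), (inferInstance : Mul (UDual ω 𝒱)),
    (inferInstance : One (UDual ω 𝒱)) with
    left_distrib := UDual.mul_add' ω 𝒱
    right_distrib := UDual.add_mul' ω 𝒱
    zero_mul := UDual.zero_mul' ω 𝒱
    mul_zero := UDual.mul_zero' ω 𝒱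
    mul_assoc := UDual.mul_assoc' ω 𝒱
    one_mul := UDual.one_mul' ω 𝒱
    mul_one := UDual.mul_one' ω 𝒱 }

instance : Algebra ℂ (UDual ω 𝒱) :=
  Algebra.ofModule (UDual.smul_mul' ω 𝒱) (fun c x y => UDual.mul_smul' ω 𝒱 c x y)

/-- The functionals of degree `γ`: those which vanish on `U_β` for all `β ≠ -γ`. -/
def gr (γ : Γ) : Submodule ℂ (UDual ω 𝒱) :=
  (dualGr (uGr ω 𝒱) γ).map (of ω 𝒱).toLinearMap

variable {ω 𝒱} in
theorem mem_gr {γ : Γ} {f : UDual ω 𝒱} :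
    f ∈ gr ω 𝒱 γ ↔ ∀ β, ∀ x ∈ uGr ω 𝒱 β, γ + β ≠ 0 → eval f x = 0 := by
  refine Iff.trans ?_ (mem_dualGr (uGr ω 𝒱))
  exact ⟨fun ⟨g, hg, h⟩ => h ▸ hg, fun h => ⟨_, h, rfl⟩⟩

theorem transL_mem {α γ : Γ} {X : Module.End ℂ V} (hX : X ∈ endGr 𝒱 α) {f : UDual ω 𝒱}
    (hf : f ∈ gr ω 𝒱 γ) : transL ω 𝒱 X f ∈ gr ω 𝒱 (γ + α) := by
  rw [mem_gr] at hf ⊢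
  intro β x hx h
  rw [transL_eval]
  exact hf (α + β) _ (SetLike.mul_mem_graded (UEnv.ι_mem ω 𝒱 hX) hx) (by rwa [← add_assoc])

theorem scale_mem (α : Γ) {γ : Γ} {f : UDual ω 𝒱} (hf : f ∈ gr ω 𝒱 γ) :
    scale ω 𝒱 α f ∈ gr ω 𝒱 γ := by
  rw [mem_gr] at hf ⊢
  intro β x hx h
  rw [scale_eval ω 𝒱 α _ hx, hf β x hx h, mul_zero]

instance : SetLike.GradedMonoid (gr ω 𝒱) where
  one_mem := by
    rw [mem_gr]
    intro β x hx h
    rw [zero_add] at h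
    revert h
    refine UEnv.induction (P := fun β x => β ≠ 0 → eval (1 : UDual ω 𝒱) x = 0)
      (by simp) ?_ ?_ ?_ ?_ hx
    · intro γ x y hx hy h; simp [hx h, hy h]
    · intro γ c x hx h; simp [hx h]
    · intro h; exact absurd rfl h
    · intro β γ X x hX hx ih h
      rw [← transL_eval, transL_one]; rfl
  mul_mem := by
    intro α β f g hf hg
    rw [mem_gr]
    intro γ x hx h
    revert α β f g
    refine UEnv.induction (P := fun γ x => ∀ (α β : Γ) (f g : UDual ω 𝒱), f ∈ gr ω 𝒱 α →
      g ∈ gr ω 𝒱 β → α + β + γ ≠ 0 → eval (f * g) x = 0) (by simp) ?_ ?_ ?_ ?_ hx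
    · intro γ x y hx hy α β f g hf hg h
      simp [hx α β f g hf hg h, hy α β f g hf hg h]
    · intro γ c x hx α β f g hf hg h
      simp [hx α β f g hf hg h]
    · intro α β f g hf hg h
      have h1 : (1 : UEnv ω 𝒱) ∈ uGr ω 𝒱 0 := SetLike.GradedOne.one_mem
      rw [mul_eval_one]
      by_cases hα : α = 0
      · rw [mem_gr.1 hg 0 1 h1 (by rintro h'; apply h; rw [hα, zero_add, h']), mul_zero]
      · rw [mem_gr.1 hf 0 1 h1 (by rwa [add_zero]), zero_mul]
    · intro δ γ X x hX hx ih α β f g hf hg h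
      rw [← transL_eval, transL_mul ω 𝒱 hX, add_eval,
        ih _ _ _ _ (transL_mem ω 𝒱 hX hf) (scale_mem ω 𝒱 δ hg) (fun h' => h (by rw [← h']; abel)),
        ih _ _ _ _ hf (transL_mem ω 𝒱 hX hg) (fun h' => h (by rw [← h']; abel)), add_zero]

/-- The finite dual `U^0` of `U`: the functionals which vanish on a two-sided ideal of finite
codimension. -/
def finiteDual : Set (UDual ω 𝒱) :=
  {f | ∃ I : Submodule ℂ (UEnv ω 𝒱), (∀ a, ∀ x ∈ I, a * x ∈ I ∧ x * a ∈ I) ∧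
    FiniteDimensional ℂ (UEnv ω 𝒱 ⧸ I) ∧ ∀ x ∈ I, eval f x = 0}

/-- The subspaces of functionals of distinct degrees are independent. -/
theorem gr_indep : iSupIndep (gr ω 𝒱) := by
  rw [iSupIndep_iff_finsetSum_eq_zero_imp_eq_zero]
  intro s f hf h0 γ hγ
  refine ext_hom fun β x hx => ?_
  by_cases hβ : γ + β = 0
  · have h1 : ∑ δ ∈ s, eval (f δ) x = 0 := by
      have h2 := congrArg (fun g : UDual ω 𝒱 => (of ω 𝒱).symm g x) h0
      simpa [map_sum, LinearMap.sum_apply, eval] using h2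
    rw [Finset.sum_eq_single γ (fun δ hδ hne => mem_gr.1 (hf δ hδ) β x hx (fun h => hne
      (add_right_cancel (h.trans hβ.symm)))) (fun h => absurd hγ h)] at h1
    exact h1
  · exact mem_gr.1 (hf γ hγ) β x hx hβ

end UDual

end UDual


section Coord

variable [DecidableEq Γ]
variable {V : Type*} [AddCommGroup V] [Module ℂ V]

/-- A basis of a graded vector space which consists of homogeneous elements. -/
structure HomBasis (𝒱 : Γ → Submodule ℂ V) (ι : Type*) where
  /-- the basis -/
  basis : Module.Basis ι ℂ V
  /-- the degrees of the basis elements -/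
  deg : ι → Γ
  mem : ∀ i, basis i ∈ 𝒱 (deg i)

variable (ω : CommFactor Γ) (𝒱 : Γ → Submodule ℂ V)
variable [DirectSum.Decomposition 𝒱]
variable {ι : Type*}

variable {𝒱} in
theorem HomBasis.coord_eq_zero (e : HomBasis 𝒱 ι) {γ : Γ} {v : V} (hv : v ∈ 𝒱 γ) {j : ι}
    (h : γ ≠ e.deg j) : e.basis.coord j v = 0 := by
  have key : e.basis.coord j ∘ₗ projGr 𝒱 (e.deg j) = e.basis.coord j := by
    refine e.basis.ext fun i => ?_
    by_cases hi : e.deg i = e.deg j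
    · rw [LinearMap.comp_apply, projGr_same 𝒱 (hi ▸ e.mem i)]
    · rw [LinearMap.comp_apply, projGr_ne 𝒱 (e.mem i) hi, map_zero]
      have hne : i ≠ j := fun h => hi (by rw [h])
      simp [Finsupp.single_eq_of_ne' hne]
  rw [← key, LinearMap.comp_apply, projGr_ne 𝒱 hv h, map_zero]

variable [FiniteDimensional ℂ V]

theorem natRep_mem {γ : Γ} {x : UEnv ω 𝒱} (hx : x ∈ uGr ω 𝒱 γ) : natRep ω 𝒱 x ∈ endGr 𝒱 γ := by
  refine UEnv.induction (P := fun γ x => natRep ω 𝒱 x ∈ endGr 𝒱 γ) (fun γ => ?_) ?_ ?_ ?_ ?_ hx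
  · rw [map_zero]; exact zero_mem _
  · intro γ x y hx hy; rw [map_add]; exact add_mem hx hy
  · intro γ c x hx; rw [map_smul]; exact Submodule.smul_mem _ _ hx
  · rw [map_one]; exact SetLike.GradedOne.one_mem
  · intro α β X x hX hx ih
    have h : natRep ω 𝒱 (UEnv.ι ω 𝒱 X) = X := UEnv.lift_ι ω 𝒱 _ _ X
    rw [map_mul, h]
    exact SetLike.mul_mem_graded hX ih

theorem uS_mem {γ : Γ} {x : UEnv ω 𝒱} (hx : x ∈ uGr ω 𝒱 γ) : uS ω 𝒱 x ∈ uGr ω 𝒱 γ := by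
  refine UEnv.induction (P := fun γ x => uS ω 𝒱 x ∈ uGr ω 𝒱 γ) (fun γ => ?_) ?_ ?_ ?_ ?_ hx
  · rw [map_zero]; exact zero_mem _
  · intro γ x y hx hy; rw [map_add]; exact add_mem hx hy
  · intro γ c x hx; rw [map_smul]; exact Submodule.smul_mem _ _ hx
  · have h : uS ω 𝒱 1 = 1 := map_one (uAntipode ω 𝒱)
    rw [h]; exact SetLike.GradedOne.one_mem
  · intro α β X x hX hx ih
    have hX' := UEnv.ι_mem ω 𝒱 hX
    have h1 : uAntipode ω 𝒱 (UEnv.ι ω 𝒱 X) = -COp.of ω (uGr ω 𝒱) (UEnv.ι ω 𝒱 X) :=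
      UEnv.lift_ι ω 𝒱 _ _ X
    have h2 : uAntipode ω 𝒱 (UEnv.ι ω 𝒱 X * x) =
        -(ω α β • COp.of ω (uGr ω 𝒱) (uS ω 𝒱 x * UEnv.ι ω 𝒱 X)) := by
      rw [map_mul, h1, neg_mul, ← COp.of_mul_of ω _ hX' ih]; rfl
    have h3 : uS ω 𝒱 (UEnv.ι ω 𝒱 X * x) = -(ω α β • (uS ω 𝒱 x * UEnv.ι ω 𝒱 X)) :=
      congrArg (COp.of ω (uGr ω 𝒱)).symm h2
    rw [h3, add_comm]
    exact neg_mem (Submodule.smul_mem _ _ (SetLike.mul_mem_graded ih hX'))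

/-- The representation of `U` on the dual space `V^*`: `(x w)(v) = ω(d(x), d(w)) w(S(x) v)`. -/
def dualRep : UEnv ω 𝒱 →ₗ[ℂ] Module.End ℂ (Module.Dual ℂ V) :=
  TensorProduct.curry
    (TensorProduct.lift (Module.Dual.transpose ∘ₗ (natRep ω 𝒱).toLinearMap ∘ₗ uS ω 𝒱) ∘ₗ
      twist ω (uGr ω 𝒱) (dualGr 𝒱))

theorem dualRep_apply {α β : Γ} {x : UEnv ω 𝒱} {w : Module.Dual ℂ V} (hx : x ∈ uGr ω 𝒱 α)
    (hw : w ∈ dualGr 𝒱 β) (v : V) :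
    dualRep ω 𝒱 x w v = ω α β * w (natRep ω 𝒱 (uS ω 𝒱 x) v) := by
  have h : dualRep ω 𝒱 x w = TensorProduct.lift
    (Module.Dual.transpose ∘ₗ (natRep ω 𝒱).toLinearMap ∘ₗ uS ω 𝒱)
      (twist ω (uGr ω 𝒱) (dualGr 𝒱) (x ⊗ₜ w)) := rfl
  rw [h, twist_tmul ω _ _ hx hw, map_smul]
  rfl

/-- The matrix coefficients `t_{ji}` of a representation `π` of `U` on a space `W` with a
homogeneous basis `(b_i)` of degrees `d_i`. They are the elements of the dual space of `U` with
`x b_i = ω(d(x), d_i) ∑_j b_j ⟨t_{ji}, x⟩`, i.e. with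
`⟨t_{ji}, x⟩ = ω(d_i, d(x)) b_j^*(x b_i)`. -/
def matCoeff {W : Type*} [AddCommGroup W] [Module ℂ W] (π : UEnv ω 𝒱 →ₗ[ℂ] Module.End ℂ W)
    (b : Module.Basis ι ℂ W) (d : ι → Γ) (j i : ι) : UDual ω 𝒱 :=
  UDual.of ω 𝒱 (b.coord j ∘ₗ LinearMap.applyₗ (b i) ∘ₗ π ∘ₗ gradScale (uGr ω 𝒱) (ω (d i)))

theorem matCoeff_eval {W : Type*} [AddCommGroup W] [Module ℂ W]
    (π : UEnv ω 𝒱 →ₗ[ℂ] Module.End ℂ W) (b : Module.Basis ι ℂ W) (d : ι → Γ) (j i : ι)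
    {γ : Γ} {x : UEnv ω 𝒱} (hx : x ∈ uGr ω 𝒱 γ) :
    UDual.eval (matCoeff ω 𝒱 π b d j i) x = ω (d i) γ * b.coord j (π x (b i)) := by
  change b.coord j (π (gradScale (uGr ω 𝒱) (ω (d i)) x) (b i)) = _
  rw [gradScale_of_mem _ _ hx, map_smul, LinearMap.smul_apply, map_smul, smul_eq_mul]

variable [Fintype ι] [DecidableEq ι]
variable {𝒱}

/-- The matrix coefficients `t_{ji}` of `V`, of degree `d_i - d_j`. -/
def tGen (e : HomBasis 𝒱 ι) (j i : ι) : UDual ω 𝒱 :=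
  matCoeff ω 𝒱 (natRep ω 𝒱).toLinearMap e.basis e.deg j i

/-- The matrix coefficients of `V^*` with respect to the dual basis, whose `i`-th element has the
degree `-d_i`. They have the degrees `d_j - d_i`. -/
def tbarGen (e : HomBasis 𝒱 ι) (j i : ι) : UDual ω 𝒱 :=
  matCoeff ω 𝒱 (dualRep ω 𝒱) e.basis.dualBasis (fun i => -e.deg i) j i

theorem tGen_mem (e : HomBasis 𝒱 ι) (j i : ι) :
    tGen ω e j i ∈ UDual.gr ω 𝒱 (e.deg i - e.deg j) := by
  rw [UDual.mem_gr]
  intro β x hx h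
  rw [tGen, matCoeff_eval ω 𝒱 _ _ _ _ _ hx, AlgHom.toLinearMap_apply,
    e.coord_eq_zero (natRep_mem ω 𝒱 hx _ _ (e.mem i)) (fun h' => h (by rw [← h']; abel)),
    mul_zero]

theorem dualBasis_mem (e : HomBasis 𝒱 ι) (i : ι) : e.basis.dualBasis i ∈ dualGr 𝒱 (-e.deg i) := by
  rw [mem_dualGr]
  intro β v hv h
  rw [e.basis.coe_dualBasis]
  exact e.coord_eq_zero hv (fun h' => h (by rw [h']; abel))

theorem tbarGen_mem (e : HomBasis 𝒱 ι) (j i : ι) :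
    tbarGen ω e j i ∈ UDual.gr ω 𝒱 (e.deg j - e.deg i) := by
  rw [UDual.mem_gr]
  intro β x hx h
  have h1 : ∀ φ : Module.Dual ℂ V, e.basis.dualBasis.coord j φ = φ (e.basis j) := fun φ => by
    rw [Module.Basis.coord_apply, Module.Basis.dualBasis_repr]
  rw [tbarGen, matCoeff_eval ω 𝒱 _ _ _ _ _ hx, h1, dualRep_apply ω 𝒱 hx (dualBasis_mem e i),
    e.basis.coe_dualBasis, e.coord_eq_zero (natRep_mem ω 𝒱 (uS_mem ω 𝒱 hx) _ _ (e.mem j))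
      (fun h' => h (by rw [← h']; abel)), mul_zero, mul_zero]

/-- The grading of a subalgebra of the dual of `U`. -/
def subGr (A : Subalgebra ℂ (UDual ω 𝒱)) (γ : Γ) : Submodule ℂ A :=
  (UDual.gr ω 𝒱 γ).comap A.val.toLinearMap

instance (A : Subalgebra ℂ (UDual ω 𝒱)) : SetLike.GradedMonoid (subGr ω A) where
  one_mem := (SetLike.GradedOne.one_mem : (1 : UDual ω 𝒱) ∈ UDual.gr ω 𝒱 0)
  mul_mem _ _ _ _ hx hy := SetLike.GradedMul.mul_mem (A := UDual.gr ω 𝒱) hx hy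

theorem subGr_indep (A : Subalgebra ℂ (UDual ω 𝒱)) : iSupIndep (subGr ω A) := by
  have h := UDual.gr_indep ω 𝒱
  rw [iSupIndep_iff_finsetSum_eq_zero_imp_eq_zero] at h ⊢
  intro s f hf h0 γ hγ
  refine Subtype.ext (h s (fun γ => (f γ : UDual ω 𝒱)) hf ?_ γ hγ)
  simpa using congrArg A.val h0

theorem subGr_iSup (s : Set (UDual ω 𝒱)) (hs : ∀ f ∈ s, ∃ γ, f ∈ UDual.gr ω 𝒱 γ) :
    ⨆ γ, subGr ω (Algebra.adjoin ℂ s) γ = ⊤ := by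
  set A := Algebra.adjoin ℂ s
  have h1 : Subalgebra.toSubmodule A ≤ (⨆ γ, subGr ω A γ).map A.val.toLinearMap := by
    rw [Algebra.adjoin_eq_span, Submodule.span_le]
    intro f hf
    have h2 : f ∈ A ∧ ∃ γ, f ∈ UDual.gr ω 𝒱 γ := by
      induction hf using Submonoid.closure_induction with
      | mem x hx => exact ⟨Algebra.subset_adjoin hx, hs x hx⟩
      | one => exact ⟨one_mem _, 0, SetLike.GradedOne.one_mem⟩
      | mul x y _ _ hx hy =>
        obtain ⟨hx, α, hα⟩ := hx
        obtain ⟨hy, β, hβ⟩ := hy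
        exact ⟨mul_mem hx hy, α + β, SetLike.GradedMul.mul_mem hα hβ⟩
    obtain ⟨hA, γ, hγ⟩ := h2
    exact ⟨⟨f, hA⟩, Submodule.mem_iSup_of_mem (p := subGr ω A) γ hγ, rfl⟩
  rw [eq_top_iff]
  intro x _
  obtain ⟨y, hy, h⟩ := h1 x.2
  rwa [← Subtype.ext (a1 := y) (a2 := x) h]

/-- The grading of a subalgebra generated by homogeneous elements. -/
@[reducible] def adjoinGraded (s : Set (UDual ω 𝒱)) (hs : ∀ f ∈ s, ∃ γ, f ∈ UDual.gr ω 𝒱 γ) :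
    GradedAlgebra (subGr ω (Algebra.adjoin ℂ s)) :=
  { (inferInstance : SetLike.GradedMonoid (subGr ω (Algebra.adjoin ℂ s))),
    DirectSum.IsInternal.chooseDecomposition _
      (DirectSum.isInternal_submodule_of_iSupIndep_of_iSup_eq_top (subGr_indep ω _)
        (subGr_iSup ω s hs)) with }

/-- The subalgebra `T` generated by the matrix coefficients of `V`. -/
def algT (e : HomBasis 𝒱 ι) : Subalgebra ℂ (UDual ω 𝒱) :=
  Algebra.adjoin ℂ {f | ∃ j i, f = tGen ω e j i}

/-- The coordinate algebra, generated by the matrix coefficients of `V` and of `V^*`. -/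
def coordAlg (e : HomBasis 𝒱 ι) : Subalgebra ℂ (UDual ω 𝒱) :=
  Algebra.adjoin ℂ ({f | ∃ j i, f = tGen ω e j i} ∪ {f | ∃ j i, f = tbarGen ω e j i})

instance (e : HomBasis 𝒱 ι) : GradedAlgebra (subGr ω (algT ω e)) :=
  adjoinGraded ω _ (by rintro _ ⟨j, i, rfl⟩; exact ⟨_, tGen_mem ω e j i⟩)

instance (e : HomBasis 𝒱 ι) : GradedAlgebra (subGr ω (coordAlg ω e)) :=
  adjoinGraded ω _ (by
    rintro _ (⟨j, i, rfl⟩ | ⟨j, i, rfl⟩)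
    exacts [⟨_, tGen_mem ω e j i⟩, ⟨_, tbarGen_mem ω e j i⟩])

theorem algT_le (e : HomBasis 𝒱 ι) : algT ω e ≤ coordAlg ω e :=
  Algebra.adjoin_mono Set.subset_union_left

/-- `t_{ji}` as an element of `T`. -/
def tT (e : HomBasis 𝒱 ι) (j i : ι) : algT ω e :=
  ⟨tGen ω e j i, Algebra.subset_adjoin ⟨j, i, rfl⟩⟩

/-- `t_{ji}` as an element of the coordinate algebra. -/
def tC (e : HomBasis 𝒱 ι) (j i : ι) : coordAlg ω e :=
  ⟨tGen ω e j i, Algebra.subset_adjoin (Or.inl ⟨j, i, rfl⟩)⟩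

/-- The matrix coefficient of `V^*` with the indices `j, i` as an element of the coordinate
algebra. -/
def tbarC (e : HomBasis 𝒱 ι) (j i : ι) : coordAlg ω e :=
  ⟨tbarGen ω e j i, Algebra.subset_adjoin (Or.inr ⟨j, i, rfl⟩)⟩

end Coord

section Berezin

variable [DecidableEq Γ]
variable {V : Type*} [AddCommGroup V] [Module ℂ V]
variable (ω : CommFactor Γ) (𝒱 : Γ → Submodule ℂ V)

/-- The sum of the components `V_α` with `ω(α, α) = c`: it is `V_+` for `c = 1` and `V_-` for
`c = -1`. -/
def parityPart (c : ℂ) : Submodule ℂ V := ⨆ α, ⨆ _ : ω α α = c, 𝒱 α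

/-- The action of a permutation `σ` on `V^{⊗ n}`, generated by the braidings of neighbouring
factors: it sends `v_1 ⊗ ⋯ ⊗ v_n`, with `v_a` of degree `d_a`, to
`∏_{a < b, σ(a) > σ(b)} ω(d_a, d_b) v_{σ⁻¹(1)} ⊗ ⋯ ⊗ v_{σ⁻¹(n)}`. -/
def permTensor {n : ℕ} (σ : Equiv.Perm (Fin n)) (d : Fin n → Γ) (v : Fin n → V) :
    TensorAlgebra ℂ V :=
  (∏ p : Fin n × Fin n with p.1 < p.2 ∧ σ p.2 < σ p.1, ω (d p.1) (d p.2)) •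
    TensorAlgebra.tprod ℂ V n (v ∘ σ.symm)

/-- The exterior power `∧_ω^n(V_+)`, as a subspace of `V^{⊗ n}`: the image of the
antisymmetriser. -/
def extPlus (n : ℕ) : Submodule ℂ (TensorAlgebra ℂ V) :=
  Submodule.span ℂ {x | ∃ (d : Fin n → Γ) (v : Fin n → V),
    (∀ a, v a ∈ 𝒱 (d a) ∧ ω (d a) (d a) = 1) ∧
    x = ∑ σ : Equiv.Perm (Fin n), ((Equiv.Perm.sign σ : ℤ) : ℂ) • permTensor ω σ d v}

/-- The symmetric power `S_ω^n(V_-)`, as a subspace of `V^{⊗ n}`: the image of the symmetriser. -/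
def symMinus (n : ℕ) : Submodule ℂ (TensorAlgebra ℂ V) :=
  Submodule.span ℂ {x | ∃ (d : Fin n → Γ) (v : Fin n → V),
    (∀ a, v a ∈ 𝒱 (d a) ∧ ω (d a) (d a) = -1) ∧
    x = ∑ σ : Equiv.Perm (Fin n), permTensor ω σ d v}

variable [DirectSum.Decomposition 𝒱] [FiniteDimensional ℂ V]

open Classical in
/-- The map `p^{⊗ n}` on `V^{⊗ n}`, for all `n`, where `p` is the projection of `V` to `V_+` or
`V_-`. -/
def parityProj (c : ℂ) : TensorAlgebra ℂ V →ₐ[ℂ] TensorAlgebra ℂ V :=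
  TensorAlgebra.lift ℂ
    (TensorAlgebra.ι ℂ ∘ₗ gradScale 𝒱 (fun α => if ω α α = c then 1 else 0))

variable {ι : Type*} [Fintype ι] [DecidableEq ι]
variable {𝒱}

/-- The co-action `V^{⊗ n} → V^{⊗ n} ⊗ T`, for all `n`. It extends the co-action
`e_i ↦ ∑_j e_j ⊗ t_{ji}` of `V` by
`δ(v ⊗ w) = ∑ ω(d(v_(1)), d(w_(0))) v_(0) ⊗ w_(0) ⊗ v_(1) w_(1)`, i.e. it is multiplicative. -/
def coact (e : HomBasis 𝒱 ι) :
    TensorAlgebra ℂ V →ₐ[ℂ] CTensor ω (taGr 𝒱) (subGr ω (algT ω e)) :=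
  TensorAlgebra.lift ℂ (e.basis.constr ℂ fun i =>
    ∑ j, CTensor.tmul ω (taGr 𝒱) (subGr ω (algT ω e)) (TensorAlgebra.ι ℂ (e.basis j)) (tT ω e j i))

/-- The co-action followed by `p^{⊗ n}`. -/
def projCoact (e : HomBasis 𝒱 ι) (c : ℂ) : TensorAlgebra ℂ V →ₗ[ℂ] TensorAlgebra ℂ V ⊗[ℂ] algT ω e :=
  TensorProduct.map (parityProj ω 𝒱 c).toLinearMap LinearMap.id ∘ₗ
    (CTensor.of ω (taGr 𝒱) (subGr ω (algT ω e))).symm.toLinearMap ∘ₗ (coact ω e).toLinearMap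

/-- `D = D_+`: with `M_+ = dim V_+`, the elements `Λ` of the line `∧_ω^{M_+}(V_+)` satisfy
`p_+^{⊗ M_+}(δ(Λ)) = Λ ⊗ D`. -/
def IsDPlus (e : HomBasis 𝒱 ι) (D : algT ω e) : Prop :=
  ∀ Λ ∈ extPlus ω 𝒱 (Module.finrank ℂ (parityPart ω 𝒱 1)), projCoact ω e 1 Λ = Λ ⊗ₜ D

/-- `D = D_-`: with `M_- = dim V_-`, the elements `Λ` of the line `S_ω^{M_-}(V_-)` satisfy
`p_-^{⊗ M_-}(δ(Λ)) = Λ ⊗ D`. -/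
def IsDMinus (e : HomBasis 𝒱 ι) (D : algT ω e) : Prop :=
  ∀ Λ ∈ symMinus ω 𝒱 (Module.finrank ℂ (parityPart ω 𝒱 (-1))),
    projCoact ω e (-1) Λ = Λ ⊗ₜ D

end Berezin

section Fractions

variable [DecidableEq Γ]
variable {A : Type*} [Ring A] [Algebra ℂ A]

/-- The elements of the multiplicative set `S` are central. -/
class CentralSet (S : Submonoid A) : Prop where
  central : ∀ s ∈ S, ∀ a, s * a = a * s

/-- The elements of the multiplicative set `S` are of degree `0`. -/
class DegZeroSet (𝒜 : Γ → Submodule ℂ A) (S : Submonoid A) : Prop where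
  deg : ∀ s ∈ S, s ∈ 𝒜 0

/-- A central multiplicative set satisfies the Ore condition. -/
instance (S : Submonoid A) [CentralSet S] : OreLocalization.OreSet S where
  ore_right_cancel r r' s hs :=
    ⟨s, by rw [CentralSet.central s.1 s.2, CentralSet.central s.1 s.2, hs]⟩
  oreNum r _ := r
  oreDenom _ s := s
  ore_eq r s := CentralSet.central s.1 s.2 r

/-- The ring of fractions `S⁻¹A` of `A` with respect to a central multiplicative set `S`. The submonoid
generated by two central elements `D_+` and `D_-` is `{D_+^i D_-^j}`. -/
abbrev Frac (S : Submonoid A) [CentralSet S] : Type _ := OreLocalization S A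

namespace Frac

variable (𝒜 : Γ → Submodule ℂ A) (S : Submonoid A) [CentralSet S]

variable {S} in
/-- The fraction `s⁻¹a`. -/
def mk (a : A) (s : S) : Frac S := OreLocalization.oreDiv a s

variable {S}

theorem mk_mul_mk (a b : A) (s u : S) : mk a s * mk b u = mk (a * b) (s * u) := by
  have e := OreLocalization.oreDiv_mul_char (S := S) a b s u a u (CentralSet.central u.1 u.2 a)
  refine Eq.trans e ?_
  have hc : u * s = s * u := Subtype.ext (CentralSet.central u.1 u.2 s)
  rw [hc]; rfl

theorem mk_add_mk (a b : A) (s : S) : mk a s + mk b s = mk (a + b) s :=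
  OreLocalization.add_oreDiv

theorem smul_mk (c : ℂ) (a : A) (s : S) : c • mk a s = mk (c • a) s := by
  refine (OreLocalization.smul_oreDiv c a s).trans ?_
  have e : (c • (1 : A)) • a = c • a := by simp
  exact congrArg (fun b => mk b s) e

theorem mk_zero (s : S) : mk 0 s = 0 := OreLocalization.zero_oreDiv s

theorem mk_mul_cancel (a : A) (s : S) : mk (s * a) s = mk a 1 := by
  have e := OreLocalization.expand (S := S) a 1 (s : A) (by simp)
  refine Eq.trans ?_ e.symm
  have hs : (⟨(s : A) * ((1 : S) : A), by simp⟩ : S) = s := Subtype.ext (by simp)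
  rw [hs]; rfl

theorem one_eq : (1 : Frac S) = mk 1 1 := OreLocalization.one_def

theorem ind {P : Frac S → Prop} (hP : ∀ a s, P (mk a s)) (x : Frac S) : P x :=
  OreLocalization.ind (fun a s => hP a s) x

variable (S) in
/-- The grading of the ring of fractions: `s⁻¹a` has the degree of `a`. -/
def gr (γ : Γ) : Submodule ℂ (Frac S) :=
  Submodule.span ℂ {x | ∃ a ∈ 𝒜 γ, ∃ s : S, x = mk a s}

variable {𝒜} in
theorem mk_mem {γ : Γ} {a : A} (ha : a ∈ 𝒜 γ) (s : S) : mk a s ∈ gr 𝒜 S γ :=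
  Submodule.subset_span ⟨a, ha, s, rfl⟩

variable (S) [GradedAlgebra 𝒜] [DegZeroSet 𝒜 S]

instance : SetLike.GradedMonoid (gr 𝒜 S) where
  one_mem := by rw [one_eq]; exact mk_mem SetLike.GradedOne.one_mem 1
  mul_mem := by
    intro γ δ x y hx hy
    induction hx using Submodule.span_induction with
    | zero => rw [zero_mul]; exact zero_mem _
    | add x x' _ _ h h' => rw [add_mul]; exact add_mem h h'
    | smul c x _ h => rw [smul_mul_assoc]; exact Submodule.smul_mem _ c h
    | mem x hx =>
      obtain ⟨a, ha, s, rfl⟩ := hx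
      induction hy using Submodule.span_induction with
      | zero => rw [mul_zero]; exact zero_mem _
      | add x x' _ _ h h' => rw [mul_add]; exact add_mem h h'
      | smul c x _ h => rw [mul_smul_comm]; exact Submodule.smul_mem _ c h
      | mem y hy =>
        obtain ⟨b, hb, u, rfl⟩ := hy
        rw [mk_mul_mk]
        exact mk_mem (SetLike.mul_mem_graded ha hb) _

/-- The map `a ↦ a/1` on the component of degree `γ`. -/
def toGr (γ : Γ) : 𝒜 γ →ₗ[ℂ] gr 𝒜 S γ where
  toFun a := ⟨mk (a : A) 1, mk_mem a.2 1⟩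
  map_add' a b := Subtype.ext (mk_add_mk (a : A) b 1).symm
  map_smul' c a := Subtype.ext (smul_mk c (a : A) 1).symm

/-- The map `a ↦ ∑_γ a_γ/1`. -/
def decomposeAux : A →ₐ[ℂ] ⨁ γ, gr 𝒜 S γ :=
  (DirectSum.toAlgebra ℂ (fun γ => 𝒜 γ)
      (fun γ => DirectSum.lof ℂ Γ (fun γ => gr 𝒜 S γ) γ ∘ₗ
        toGr 𝒜 S γ)
      (lof_congr rfl (one_eq).symm)
      (fun {i j} a b => by
        refine Eq.trans ?_ (DirectSum.of_mul_of _ _).symm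
        refine lof_congr rfl ?_
        refine Eq.trans ?_ (mk_mul_mk (a : A) b 1 1).symm
        rw [one_mul]; rfl)).comp
    (DirectSum.decomposeAlgEquiv 𝒜).toAlgHom

theorem decomposeAux_of_mem {γ : Γ} {a : A} (ha : a ∈ 𝒜 γ) :
    decomposeAux 𝒜 S a = DirectSum.of (fun γ => gr 𝒜 S γ) γ ⟨mk a 1, mk_mem ha 1⟩ := by
  have h1 : (DirectSum.decomposeAlgEquiv 𝒜) a = DirectSum.of (fun γ => 𝒜 γ) γ ⟨a, ha⟩ :=
    DirectSum.decompose_of_mem 𝒜 ha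
  rw [decomposeAux, AlgHom.comp_apply]
  refine (congrArg _ h1).trans ?_
  exact DirectSum.toAddMonoid_of (β := fun γ => 𝒜 γ)
    (fun γ => (DirectSum.lof ℂ Γ (fun γ => gr 𝒜 S γ) γ ∘ₗ toGr 𝒜 S γ).toAddMonoidHom) γ ⟨a, ha⟩

/-- The homogeneous element `1/s`. -/
def invDeg (s : S) : ⨁ γ, gr 𝒜 S γ :=
  DirectSum.of (fun γ => gr 𝒜 S γ) 0 ⟨mk 1 s, mk_mem SetLike.GradedOne.one_mem s⟩

theorem mk_self (s : S) : mk (s : A) s = 1 := by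
  have := mk_mul_cancel 1 s
  rwa [mul_one, ← one_eq] at this

/-- The unit `s/1`. -/
def unitDeg : S →* (⨁ γ, gr 𝒜 S γ)ˣ where
  toFun s :=
    { val := decomposeAux 𝒜 S (s : A)
      inv := invDeg 𝒜 S s
      val_inv := by
        rw [decomposeAux_of_mem 𝒜 S (DegZeroSet.deg s.1 s.2), invDeg, DirectSum.of_mul_of]
        refine lof_congr (add_zero 0) ?_
        refine (mk_mul_mk (s : A) 1 1 s).trans ?_
        rw [mul_one, one_mul]; exact mk_self S s
      inv_val := by
        rw [decomposeAux_of_mem 𝒜 S (DegZeroSet.deg s.1 s.2), invDeg, DirectSum.of_mul_of]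
        refine lof_congr (add_zero 0) ?_
        refine (mk_mul_mk 1 (s : A) s 1).trans ?_
        rw [mul_one, one_mul]; exact mk_self S s }
  map_one' := Units.ext (map_one (decomposeAux 𝒜 S))
  map_mul' s u := Units.ext (map_mul (decomposeAux 𝒜 S) (s : A) u)

/-- The decomposition map of the ring of fractions. -/
def decompose : Frac S →ₗ[ℂ] ⨁ γ, gr 𝒜 S γ :=
  let f : Frac S →+* ⨁ γ, gr 𝒜 S γ :=
    OreLocalization.universalHom (S := S) (decomposeAux 𝒜 S).toRingHom (unitDeg 𝒜 S) (fun _ => rfl)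
  { toFun := f
    map_add' := map_add f
    map_smul' := fun c x => by
      have h1 : f (algebraMap ℂ (Frac S) c) = algebraMap ℂ _ c :=
        (OreLocalization.universalHom_commutes (S := S) (decomposeAux 𝒜 S).toRingHom (unitDeg 𝒜 S)
          (fun _ => rfl)).trans ((decomposeAux 𝒜 S).commutes c)
      rw [Algebra.smul_def, map_mul, h1, RingHom.id_apply, Algebra.smul_def] }

theorem decompose_mk {γ : Γ} {a : A} (ha : a ∈ 𝒜 γ) (s : S) :
    decompose 𝒜 S (mk a s) = DirectSum.of (fun γ => gr 𝒜 S γ) γ ⟨mk a s, mk_mem ha s⟩ := by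
  have h1 : decompose 𝒜 S (mk a s) = invDeg 𝒜 S s * decomposeAux 𝒜 S a := rfl
  rw [h1, decomposeAux_of_mem 𝒜 S ha, invDeg, DirectSum.of_mul_of]
  refine lof_congr (zero_add γ) ?_
  refine (mk_mul_mk 1 a s 1).trans ?_
  rw [one_mul, mul_one]

instance : GradedAlgebra (gr 𝒜 S) :=
  { (inferInstance : SetLike.GradedMonoid (gr 𝒜 S)),
    decompositionOfMap (gr 𝒜 S) (decompose 𝒜 S)
      (fun x => by
        induction x using ind with
        | hP a s =>
          induction a using hom_induction 𝒜 with
          | h0 => rw [mk_zero]; simp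
          | hadd a b ha hb => rw [← mk_add_mk, map_add, map_add, ha, hb]
          | h γ a ha => rw [decompose_mk 𝒜 S ha, DirectSum.coeAddMonoidHom_of])
      (fun γ x hx => by
        induction hx using Submodule.span_induction with
        | mem x hx => obtain ⟨a, ha, s, rfl⟩ := hx; exact decompose_mk 𝒜 S ha s
        | zero => rw [map_zero]; symm; exact map_zero _
        | add x y hx hy h h' => rw [map_add, h, h', ← map_add]; rfl
        | smul c x hx h1 =>
          rw [map_smul, h1]
          exact (map_smul (DirectSum.lof ℂ Γ (fun γ => gr 𝒜 S γ) γ) c _).symm) with }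

end Frac

end Fractions

section Hopf

variable [DecidableEq Γ]

/-- A Hopf `(Γ, ω)`-algebra structure on a graded algebra `A`: homomorphisms
`Δ : A → A ⊗ A` and `ε : A → ℂ` of graded algebras, where `A ⊗ A` has the multiplication
`(a ⊗ b)(a' ⊗ b') = ω(d(b), d(a')) aa' ⊗ bb'`, and an antipode, an anti-homomorphism
`S : A → A` of graded algebras. -/
structure ColourHopf (ω : CommFactor Γ) {A : Type*} [Ring A] [Algebra ℂ A]
    (𝒜 : Γ → Submodule ℂ A) [GradedAlgebra 𝒜] where
  /-- the co-multiplication -/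
  comul : A →ₐ[ℂ] CTensor ω 𝒜 𝒜
  /-- the co-unit -/
  counit : A →ₐ[ℂ] ℂ
  /-- the antipode -/
  antipode : A →ₗ[ℂ] A
  comul_mem : ∀ γ, ∀ a ∈ 𝒜 γ, comul a ∈ CTensor.gr ω 𝒜 𝒜 γ
  counit_eq_zero : ∀ γ, ∀ a ∈ 𝒜 γ, γ ≠ 0 → counit a = 0
  antipode_mem : ∀ γ, ∀ a ∈ 𝒜 γ, antipode a ∈ 𝒜 γ
  coassoc : ∀ a,
    TensorProduct.assoc ℂ A A A
      (TensorProduct.map ((CTensor.of ω 𝒜 𝒜).symm.toLinearMap ∘ₗ comul.toLinearMap) LinearMap.id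
        ((CTensor.of ω 𝒜 𝒜).symm (comul a))) =
    TensorProduct.map LinearMap.id ((CTensor.of ω 𝒜 𝒜).symm.toLinearMap ∘ₗ comul.toLinearMap)
      ((CTensor.of ω 𝒜 𝒜).symm (comul a))
  counit_left : ∀ a, TensorProduct.lid ℂ A
    (TensorProduct.map counit.toLinearMap LinearMap.id ((CTensor.of ω 𝒜 𝒜).symm (comul a))) = a
  counit_right : ∀ a, TensorProduct.rid ℂ A
    (TensorProduct.map LinearMap.id counit.toLinearMap ((CTensor.of ω 𝒜 𝒜).symm (comul a))) = a
  antipode_one : antipode 1 = 1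
  antipode_mul : ∀ α β, ∀ a ∈ 𝒜 α, ∀ b ∈ 𝒜 β,
    antipode (a * b) = ω α β • (antipode b * antipode a)
  antipode_left : ∀ a, LinearMap.mul' ℂ A
    (TensorProduct.map antipode LinearMap.id ((CTensor.of ω 𝒜 𝒜).symm (comul a))) =
      algebraMap ℂ A (counit a)
  antipode_right : ∀ a, LinearMap.mul' ℂ A
    (TensorProduct.map LinearMap.id antipode ((CTensor.of ω 𝒜 𝒜).symm (comul a))) =
      algebraMap ℂ A (counit a)

/-- An isomorphism of Hopf `(Γ, ω)`-algebras: an isomorphism of algebras which preserves the degrees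
and commutes with the structure maps. -/
structure IsHopfIso {ω : CommFactor Γ} {A B : Type*} [Ring A] [Algebra ℂ A] [Ring B] [Algebra ℂ B]
    {𝒜 : Γ → Submodule ℂ A} {ℬ : Γ → Submodule ℂ B} [GradedAlgebra 𝒜] [GradedAlgebra ℬ]
    (HA : ColourHopf ω 𝒜) (HB : ColourHopf ω ℬ) (φ : A ≃ₐ[ℂ] B) : Prop where
  map_mem : ∀ γ a, a ∈ 𝒜 γ ↔ φ a ∈ ℬ γ
  comul : ∀ a, (CTensor.of ω ℬ ℬ).symm (HB.comul (φ a)) =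
    TensorProduct.map φ.toLinearMap φ.toLinearMap ((CTensor.of ω 𝒜 𝒜).symm (HA.comul a))
  counit : ∀ a, HB.counit (φ a) = HA.counit a
  antipode : ∀ a, HB.antipode (φ a) = φ (HA.antipode a)

end Hopf

section Matrix

variable [DecidableEq Γ]
variable {V : Type*} [AddCommGroup V] [Module ℂ V] (ω : CommFactor Γ) {𝒱 : Γ → Submodule ℂ V}
variable [DirectSum.Decomposition 𝒱] [FiniteDimensional ℂ V]
variable {ι : Type*} [Fintype ι] [DecidableEq ι]

/-- The matrix unit `e_{ji}`, which sends `e_i` to `e_j` and the other basis elements to `0`. -/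
def matUnit (e : HomBasis 𝒱 ι) (j i : ι) : Module.End ℂ V :=
  (e.basis.coord i).smulRight (e.basis j)

/-- The element `∑_{j, i} ω(d_j, d_i - d_j) a_{ji} ⊗ e_{ji}` of `A ⊗ End(V)`, for elements `a_{ji}`
of an algebra `A`. -/
def genMatrix (e : HomBasis 𝒱 ι) {A : Type*} [Ring A] [Algebra ℂ A] (𝒜 : Γ → Submodule ℂ A)
    [GradedAlgebra 𝒜] (a : ι → ι → A) : CTensor ω 𝒜 (endGr 𝒱) :=
  ∑ j, ∑ i, ω (e.deg j) (e.deg i - e.deg j) • CTensor.tmul ω 𝒜 (endGr 𝒱) (a j i) (matUnit e j i)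

end Matrix

section Presentation

variable [DecidableEq Γ]
variable {V : Type*} [AddCommGroup V] [Module ℂ V] (ω : CommFactor Γ) (𝒱 : Γ → Submodule ℂ V)
variable [DirectSum.Decomposition 𝒱] [FiniteDimensional ℂ V]

/-- The symmetric `(Γ, ω)`-algebra `F(V) = S_ω(V^* ⊗ V)`. -/
abbrev FAlg : Type _ := SymAlg ω (tensorGr (dualGr 𝒱) 𝒱)

/-- The grading of `F(V)`. -/
abbrev fGr : Γ → Submodule ℂ (FAlg ω 𝒱) := symGr ω (tensorGr (dualGr 𝒱) 𝒱)

/-- The symmetric `(Γ, ω)`-algebra `S_ω(V ⊗ V^*)`. -/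
abbrev FbarAlg : Type _ := SymAlg ω (tensorGr 𝒱 (dualGr 𝒱))

/-- The grading of `S_ω(V ⊗ V^*)`. -/
abbrev fbarGr : Γ → Submodule ℂ (FbarAlg ω 𝒱) := symGr ω (tensorGr 𝒱 (dualGr 𝒱))

/-- The `(Γ, ω)`-algebra `S_ω(V^* ⊗ V) ⊗ S_ω(V ⊗ V^*)`. -/
abbrev FFAlg : Type _ := CTensor ω (fGr ω 𝒱) (fbarGr ω 𝒱)

/-- The grading of `S_ω(V^* ⊗ V) ⊗ S_ω(V ⊗ V^*)`. -/
abbrev ffGr : Γ → Submodule ℂ (FFAlg ω 𝒱) := CTensor.gr ω (fGr ω 𝒱) (fbarGr ω 𝒱)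

variable {ι : Type*} [Fintype ι] [DecidableEq ι] {𝒱}

/-- The image `X_{ji}` of `e_j^* ⊗ e_i`, as an element of `S_ω(V^* ⊗ V) ⊗ S_ω(V ⊗ V^*)`. It has the
degree `d_i - d_j`. -/
def XGen (e : HomBasis 𝒱 ι) (j i : ι) : FFAlg ω 𝒱 :=
  CTensor.tmul ω (fGr ω 𝒱) (fbarGr ω 𝒱)
    (SymAlg.ι ω (tensorGr (dualGr 𝒱) 𝒱) (e.basis.dualBasis j ⊗ₜ e.basis i)) 1

/-- The image of `ω(d_j, d_j) e_j ⊗ e_i^*`, as an element of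
`S_ω(V^* ⊗ V) ⊗ S_ω(V ⊗ V^*)`. It has the degree `d_j - d_i`. -/
def XbarGen (e : HomBasis 𝒱 ι) (j i : ι) : FFAlg ω 𝒱 :=
  CTensor.tmul ω (fGr ω 𝒱) (fbarGr ω 𝒱) 1
    (ω (e.deg j) (e.deg j) •
      SymAlg.ι ω (tensorGr 𝒱 (dualGr 𝒱)) (e.basis j ⊗ₜ e.basis.dualBasis i))

theorem XGen_mem (e : HomBasis 𝒱 ι) (j i : ι) : XGen ω e j i ∈ ffGr ω 𝒱 (e.deg i - e.deg j) := by
  have h1 := tmul_mem_tensorGr (dualBasis_mem e j) (e.mem i)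
  have h2 := CTensor.tmul_mem_gr ω (fGr ω 𝒱) (fbarGr ω 𝒱) (SymAlg.ι_mem ω _ h1)
    (b := 1) SetLike.GradedOne.one_mem
  rw [add_zero, neg_add_eq_sub] at h2
  exact h2

theorem XbarGen_mem (e : HomBasis 𝒱 ι) (j i : ι) :
    XbarGen ω e j i ∈ ffGr ω 𝒱 (e.deg j - e.deg i) := by
  have h1 := tmul_mem_tensorGr (e.mem j) (dualBasis_mem e i)
  have h2 := CTensor.tmul_mem_gr ω (fGr ω 𝒱) (fbarGr ω 𝒱) (a := 1) SetLike.GradedOne.one_mem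
    (Submodule.smul_mem _ (ω (e.deg j) (e.deg j)) (SymAlg.ι_mem ω _ h1))
  rw [zero_add, ← sub_eq_add_neg] at h2
  exact h2

/-- The relations which generate the ideal `J_V`. -/
inductive JRel (e : HomBasis 𝒱 ι) : FFAlg ω 𝒱 → FFAlg ω 𝒱 → Prop
  | right (j k : ι) : JRel e
      (∑ i, ω (e.deg k) (e.deg i - e.deg j) • (XGen ω e j i * XbarGen ω e k i))
      (if j = k then 1 else 0)
  | left (j k : ι) : JRel e
      (∑ i, ω (e.deg i - e.deg j) (e.deg i) • (XbarGen ω e i j * XGen ω e i k))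
      (if j = k then 1 else 0)

/-- The algebra `𝓕(V)`: the quotient of `S_ω(V^* ⊗ V) ⊗ S_ω(V ⊗ V^*)` by the ideal `J_V`. -/
abbrev presAlg (e : HomBasis 𝒱 ι) : Type _ := RingQuot (JRel ω e)

/-- The grading of `𝓕(V)`. -/
abbrev presGr (e : HomBasis 𝒱 ι) : Γ → Submodule ℂ (presAlg ω e) := quotGr (ffGr ω 𝒱) (JRel ω e)

theorem delta_mem (e : HomBasis 𝒱 ι) (j k : ι) :
    (if j = k then 1 else 0 : FFAlg ω 𝒱) ∈ ffGr ω 𝒱 (e.deg k - e.deg j) := by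
  split_ifs with h
  · subst h
    rw [sub_self]
    exact SetLike.GradedOne.one_mem
  · exact zero_mem _

instance (e : HomBasis 𝒱 ι) : GradedAlgebra (presGr ω e) :=
  quotGraded (ffGr ω 𝒱) (JRel ω e) (by
    rintro _ _ (⟨j, k⟩ | ⟨j, k⟩)
    · refine ⟨_, Submodule.sum_mem _ fun i _ => Submodule.smul_mem _ _ ?_, delta_mem ω e j k⟩
      have h := SetLike.mul_mem_graded (XGen_mem ω e j i) (XbarGen_mem ω e k i)
      rwa [add_comm, sub_add_sub_cancel] at h
    · refine ⟨_, Submodule.sum_mem _ fun i _ => Submodule.smul_mem _ _ ?_, delta_mem ω e j k⟩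
      have h := SetLike.mul_mem_graded (XbarGen_mem ω e i j) (XGen_mem ω e i k)
      rwa [add_comm, sub_add_sub_cancel] at h)

/-- `X_{ji}` as an element of `𝓕(V)`. -/
def presX (e : HomBasis 𝒱 ι) (j i : ι) : presAlg ω e :=
  RingQuot.mkAlgHom ℂ (JRel ω e) (XGen ω e j i)

/-- The generator of `𝓕(V)` which is the image of `ω(d_j, d_j) e_j ⊗ e_i^*`. -/
def presXbar (e : HomBasis 𝒱 ι) (j i : ι) : presAlg ω e :=
  RingQuot.mkAlgHom ℂ (JRel ω e) (XbarGen ω e j i)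

/-- The defining properties of the Hopf structure of `𝓕(V)`. -/
structure IsPresHopf (e : HomBasis 𝒱 ι) (H : ColourHopf ω (presGr ω e)) : Prop where
  comul_X : ∀ j i, H.comul (presX ω e j i) =
    ∑ k, CTensor.tmul ω (presGr ω e) (presGr ω e) (presX ω e j k) (presX ω e k i)
  comul_Xbar : ∀ j i, H.comul (presXbar ω e j i) =
    ∑ k, CTensor.tmul ω (presGr ω e) (presGr ω e) (presXbar ω e j k) (presXbar ω e k i)
  counit_X : ∀ j i, H.counit (presX ω e j i) = if j = i then 1 else 0
  counit_Xbar : ∀ j i, H.counit (presXbar ω e j i) = if j = i then 1 else 0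
  antipode_X : ∀ j i, H.antipode (presX ω e j i) =
    ω (e.deg i - e.deg j) (e.deg i) • presXbar ω e i j
  antipode_Xbar : ∀ i j, H.antipode (presXbar ω e i j) =
    ω (e.deg i) (e.deg i - e.deg j) • presX ω e j i

/-- The defining properties of the Hopf structure of the coordinate algebra, which is dual to the one
of `U`: `⟨Δ(f), x ⊗ y⟩ = ⟨f, x y⟩`, `ε(f) = ⟨f, 1⟩` and `⟨S(f), x⟩ = ⟨f, S(x)⟩`. -/
structure IsCoordHopf (e : HomBasis 𝒱 ι) (H : ColourHopf ω (subGr ω (coordAlg ω e))) : Prop where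
  comul : ∀ f x y,
    colourPair ω (uGr ω 𝒱)
      (TensorProduct.map ((UDual.of ω 𝒱).symm.toLinearMap ∘ₗ (coordAlg ω e).val.toLinearMap)
        ((UDual.of ω 𝒱).symm.toLinearMap ∘ₗ (coordAlg ω e).val.toLinearMap)
        ((CTensor.of ω (subGr ω (coordAlg ω e)) (subGr ω (coordAlg ω e))).symm (H.comul f)))
      (x ⊗ₜ y) = UDual.eval (f : UDual ω 𝒱) (x * y)
  counit : ∀ f : coordAlg ω e, H.counit f = UDual.eval (f : UDual ω 𝒱) 1
  antipode : ∀ (f : coordAlg ω e) x,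
    UDual.eval (H.antipode f : UDual ω 𝒱) x = UDual.eval (f : UDual ω 𝒱) (uS ω 𝒱 x)

end Presentation

end Colour

end

open Colour

set_option linter.unusedSectionVars false

namespace Colour

noncomputable section


/-! ### Commutative factors and `ω`-commutative graded algebras. -/

section Basics

variable {Γ : Type*} [AddCommGroup Γ] (ω : CommFactor Γ)

/-! Everything is a statement about one matrix. Call a square matrix over a graded algebra
homogeneous if its entry with indices j, i has the degree d_i - d_j (`homMat`). Since U is
co-commutative up to `ω`, its dual is `ω`-commutative (`UDual.omegaComm`), and t = (t_{ji}) is a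
homogeneous matrix over it. Composing with the antipode of U turns t into its inverse, whose entries
are, up to nonzero scalars, the coefficients of V^* (`antipode_tGen`, `antipode_mul_tGen`,
`tGen_mul_antipode`). So 𝒯(V) is an `ω`-commutative algebra generated by the entries of an
invertible homogeneous matrix and of its inverse, and a homomorphism on such an algebra is
determined by its values on the matrix (`hom_ext_of_matrix`). The relations of 𝓕(V) say exactly that
X has an inverse made of the other generators; hence 𝓕(V) is universal among `ω`-commutative
algebras with an invertible homogeneous matrix (`presLift`), which gives 𝓕(V) → 𝒯(V). The map back
needs two facts.

The first fact is that T is free: the map F(V) → T is injective (`fToT_injective`). Left translation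
by a matrix unit lifts to a twisted derivation of F(V), so the kernel is stable under these
derivations; by evaluation at the unit of U it lies in the augmentation ideal I generated by the
entries of X - 1. A suitable combination of the twisted derivations is a derivation E which acts on
I^k/I^{k+1} as multiplication by k (`eulerOp_sub_mem`). If the kernel lies in I^k with k ≥ 1, then E
maps it to I^{k+1}, so it lies in I^{k+1} itself. The intersection of all I^k is 0, because X - 1
can be rescaled by an indeterminate (`eq_zero_of_forall_mem_shiftPow`).

The second fact is that a homogeneous matrix over an `ω`-commutative algebra is invertible if and
only if the determinants of its blocks on V_+ and V_- are (`isUnit_iff_parDet`). The entries between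
V_+ and V_- have odd degrees, so they have square zero and generate a nilpotent ideal, and only the
diagonal blocks matter. On the block of parity c = ±1 the relevant tensors of top degree form a
line: exchanging neighbouring letters costs the factor -c ω(d_i, d_j), which is -1 for equal letters
in both cases. The block acts on this line by a multiplicative determinant which satisfies Cramer's
rule (`cdet_mul`, `exists_right_inverse`). For the matrix t the two determinants are D_+ and D_-
(`isDPlus_iff`, `isDMinus_iff`).

Hence D_+ and D_- are units in 𝒯(V), and the induced map from the ring of fractions to 𝒯(V) is
injective because T is a subalgebra of 𝒯(V), and surjective because t is already invertible over the
ring of fractions (`fracToCoord_bijective`). In the same way T ≃ F(V) → 𝓕(V) extends to the ring of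
fractions, since X is invertible over 𝓕(V); this is the map back.

The Hopf structure of 𝓕(V) comes from its universal property, and each axiom is checked on X only
(`hopfOfMatrix`). Carried over to 𝒯(V) it is the dual of the structure of U: this holds for the
matrix coefficients and passes to products (`IsDualComul.mul`). Finally, an element of 𝒯(V) lies in
a finite dimensional space of functionals stable under translations, because the coefficients of a
representation span such a space and sums and products of such spaces are again of this kind. -/

theorem CommFactor.neg_right (α β : Γ) : ω α (-β) = ω β α := by
  have h := ω.add_right α β (-β)
  rw [add_neg_cancel, ω.zero_right] at h
  have h2 := ω.skew β α
  linear_combination (-ω β α) * h + ω α (-β) * h2 * (-1)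

theorem CommFactor.neg_left (α β : Γ) : ω (-α) β = ω β α := by
  have h := ω.add_left α (-α) β
  rw [add_neg_cancel, ω.zero_left] at h
  have h2 := ω.skew α β
  linear_combination (-ω β α) * h - ω (-α) β * h2

theorem CommFactor.sub_right (α β γ : Γ) : ω α (β - γ) = ω α β * ω γ α := by
  rw [sub_eq_add_neg, ω.add_right, ω.neg_right]

theorem CommFactor.sub_left (α β γ : Γ) : ω (α - β) γ = ω α γ * ω γ β := by
  rw [sub_eq_add_neg, ω.add_left, ω.neg_left]

theorem CommFactor.self_eq (α : Γ) : ω α α = 1 ∨ ω α α = -1 :=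
  mul_self_eq_one_iff.1 (ω.skew α α)

variable [DecidableEq Γ] {A : Type*} [Ring A] [Algebra ℂ A] (𝒜 : Γ → Submodule ℂ A)

/-- `A` is `ω`-commutative: `a b = ω(d(a), d(b)) b a`. -/
def OmegaComm : Prop := ∀ ⦃α β : Γ⦄ ⦃a b : A⦄, a ∈ 𝒜 α → b ∈ 𝒜 β → a * b = ω α β • (b * a)

variable {ω 𝒜}

theorem OmegaComm.zero_left (h : OmegaComm ω 𝒜) {β : Γ} {a b : A} (ha : a ∈ 𝒜 0)
    (hb : b ∈ 𝒜 β) : a * b = b * a := by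
  rw [h ha hb, ω.zero_left, one_smul]

variable [GradedAlgebra 𝒜]

theorem OmegaComm.central (h : OmegaComm ω 𝒜) {a : A} (ha : a ∈ 𝒜 0) (b : A) :
    a * b = b * a := by
  induction b using hom_induction 𝒜 with
  | h0 => simp
  | hadd b b' hb hb' => rw [mul_add, add_mul, hb, hb']
  | h β b hb => exact h.zero_left ha hb

theorem OmegaComm.sq_eq_zero (h : OmegaComm ω 𝒜) {α : Γ} (hα : ω α α = -1) {a : A}
    (ha : a ∈ 𝒜 α) : a * a = 0 := by
  have h1 := h ha ha
  rw [hα, neg_one_smul] at h1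
  have h2 : (2 : ℂ) • (a * a) = 0 := by rw [two_smul]; exact add_eq_zero_iff_eq_neg.2 h1
  exact (smul_eq_zero.1 h2).resolve_left two_ne_zero

theorem gradScale_mul {c : Γ → ℂ} (hc : ∀ α β, c (α + β) = c α * c β) (a b : A) :
    gradScale 𝒜 c (a * b) = gradScale 𝒜 c a * gradScale 𝒜 c b := by
  induction a using hom_induction 𝒜 with
  | h0 => simp
  | hadd a a' ha ha' => simp only [add_mul, map_add, ha, ha']
  | h α a ha =>
    induction b using hom_induction 𝒜 with
    | h0 => simp
    | hadd a a' ha ha' => simp only [mul_add, map_add, ha, ha']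
    | h β b hb =>
      rw [gradScale_of_mem 𝒜 _ ha, gradScale_of_mem 𝒜 _ hb,
        gradScale_of_mem 𝒜 _ (SetLike.mul_mem_graded ha hb), hc, smul_mul_smul_comm]

variable (𝒜) in
/-- The scaling by a character of the group of degrees, as a homomorphism of algebras. -/
def charScale (c : Γ → ℂ) (h0 : c 0 = 1) (hc : ∀ α β, c (α + β) = c α * c β) : A →ₐ[ℂ] A :=
  AlgHom.ofLinearMap (gradScale 𝒜 c)
    (by rw [gradScale_of_mem 𝒜 c SetLike.GradedOne.one_mem, h0, one_smul]) (gradScale_mul hc)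

theorem charScale_of_mem {c : Γ → ℂ} {h0 : c 0 = 1} {hc : ∀ α β, c (α + β) = c α * c β}
    {α : Γ} {a : A} (ha : a ∈ 𝒜 α) : charScale 𝒜 c h0 hc a = c α • a :=
  gradScale_of_mem 𝒜 c ha

/-- A graded algebra which is generated by `ω`-commuting homogeneous elements is `ω`-commutative. -/
theorem OmegaComm.of_adjoin {κ : Type*} (x : κ → A) (d : κ → Γ) (hx : ∀ p, x p ∈ 𝒜 (d p))
    (htop : Algebra.adjoin ℂ (Set.range x) = ⊤)
    (hcomm : ∀ p q, x p * x q = ω (d p) (d q) • (x q * x p)) : OmegaComm ω 𝒜 := by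
  -- Moving a fixed generator past b multiplies each component of b by a character of its degree.
  -- Both sides are compatible with products in b, so generators suffice; `h2` repeats the argument
  -- in the other factor.
  have h1 : ∀ p (b : A), x p * b = charScale 𝒜 (ω (d p)) (ω.zero_right _) (ω.add_right _) b * x p := by
    intro p b
    have hb : b ∈ Algebra.adjoin ℂ (Set.range x) := htop ▸ Algebra.mem_top
    induction hb using Algebra.adjoin_induction with
    | mem b hb =>
      obtain ⟨q, rfl⟩ := hb
      rw [charScale_of_mem (hx q), smul_mul_assoc, hcomm]
    | algebraMap c => rw [AlgHom.commutes, Algebra.commutes]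
    | add b b' _ _ hb hb' => rw [mul_add, map_add, add_mul, hb, hb']
    | mul b b' _ _ hb hb' => rw [← mul_assoc, hb, mul_assoc, hb', map_mul, mul_assoc]
  intro α β a b ha hb
  have h2 : ∀ a : A, a * b = b * charScale 𝒜 (fun α => ω α β) (ω.zero_left _)
      (fun _ _ => ω.add_left _ _ _) a := by
    intro a
    have ha : a ∈ Algebra.adjoin ℂ (Set.range x) := htop ▸ Algebra.mem_top
    induction ha using Algebra.adjoin_induction with
    | mem a ha =>
      obtain ⟨q, rfl⟩ := ha
      rw [charScale_of_mem (hx q), h1, charScale_of_mem hb, smul_mul_assoc, mul_smul_comm]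
    | algebraMap c => rw [AlgHom.commutes, Algebra.commutes]
    | add b b' _ _ hb hb' => rw [add_mul, map_add, mul_add, hb, hb']
    | mul b b' _ _ hb hb' => rw [mul_assoc, hb', ← mul_assoc, hb, map_mul, mul_assoc]
  rw [h2, charScale_of_mem ha, mul_smul_comm]

variable {B : Type*} [Ring B] [Algebra ℂ B] {ℬ : Γ → Submodule ℂ B} [GradedAlgebra ℬ]

theorem OmegaComm.of_surjective_of_eq (h : OmegaComm ω 𝒜) (φ : A →ₐ[ℂ] B)
    (hφ : ∀ γ, ∀ b ∈ ℬ γ, ∃ a ∈ 𝒜 γ, φ a = b) : OmegaComm ω ℬ := by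
  intro α β a b ha hb
  obtain ⟨a', ha', rfl⟩ := hφ α a ha
  obtain ⟨b', hb', rfl⟩ := hφ β b hb
  rw [← map_mul, h ha' hb', map_smul, map_mul]

/-- A homomorphism of algebras which preserves the degrees of homogeneous generators preserves all
degrees. -/
theorem map_mem_of_adjoin {κ : Type*} (x : κ → A) (d : κ → Γ) (hx : ∀ p, x p ∈ 𝒜 (d p))
    (htop : Algebra.adjoin ℂ (Set.range x) = ⊤) (φ : A →ₐ[ℂ] B) (hφ : ∀ p, φ (x p) ∈ ℬ (d p))
    {γ : Γ} {a : A} (ha : a ∈ 𝒜 γ) : φ a ∈ ℬ γ := by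
  -- A is spanned by monomials in the generators. These are homogeneous and their images have the
  -- same degrees, so φ commutes with the projections to the components.
  have key : ∀ a : A, ∀ γ, φ (projGr 𝒜 γ a) = projGr ℬ γ (φ a) := by
    intro a
    have ha : a ∈ Submodule.span ℂ (Submonoid.closure (Set.range x) : Set A) := by
      rw [← Algebra.adjoin_eq_span ℂ (Set.range x), htop]
      exact (Algebra.mem_top : a ∈ (⊤ : Subalgebra ℂ A))
    induction ha using Submodule.span_induction with
    | zero => intro γ; simp
    | add a a' _ _ h h' => intro γ; simp only [map_add, h, h']
    | smul c a _ h => intro γ; simp only [map_smul, h]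
    | mem a ha =>
      have h1 : ∃ γ, a ∈ 𝒜 γ ∧ φ a ∈ ℬ γ := by
        induction ha using Submonoid.closure_induction with
        | mem a ha => obtain ⟨p, rfl⟩ := ha; exact ⟨d p, hx p, hφ p⟩
        | one => exact ⟨0, SetLike.GradedOne.one_mem, by
            rw [map_one]; exact SetLike.GradedOne.one_mem⟩
        | mul a a' _ _ h h' =>
          obtain ⟨α, h1, h2⟩ := h
          obtain ⟨α', h1', h2'⟩ := h'
          exact ⟨α + α', SetLike.mul_mem_graded h1 h1', by
            rw [map_mul]; exact SetLike.mul_mem_graded h2 h2'⟩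
      obtain ⟨α, h1, h2⟩ := h1
      intro γ
      by_cases h : α = γ
      · subst h; rw [projGr_same 𝒜 h1, projGr_same ℬ h2]
      · rw [projGr_ne 𝒜 h1 h, projGr_ne ℬ h2 h, map_zero]
  have h := key a γ
  rw [projGr_same 𝒜 ha] at h
  rw [h]
  exact projGr_mem ℬ γ _

/-- The inverse of an invertible element of degree `0` has the degree `0`. -/
theorem exists_inv_of_isUnit {a : A} (ha : a ∈ 𝒜 0) (h : IsUnit a) :
    ∃ b ∈ 𝒜 0, a * b = 1 ∧ b * a = 1 := by
  obtain ⟨b, hb⟩ := h.exists_right_inv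
  -- Multiplication by an element of degree 0 commutes with the projection to degree 0, so the
  -- component of degree 0 of a right inverse is again a right inverse.
  have h1 : ∀ b : A, a * projGr 𝒜 0 b = projGr 𝒜 0 (a * b) := by
    intro b
    induction b using hom_induction 𝒜 with
    | h0 => simp
    | hadd b b' hb hb' => simp only [map_add, mul_add, hb, hb']
    | h β b hb =>
      have h2 := SetLike.mul_mem_graded ha hb
      rw [zero_add] at h2
      by_cases h : β = 0
      · subst h; rw [projGr_same 𝒜 hb, projGr_same 𝒜 h2]
      · rw [projGr_ne 𝒜 hb h, projGr_ne 𝒜 h2 h, mul_zero]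
  have h2 := h1 b
  rw [hb, projGr_same 𝒜 SetLike.GradedOne.one_mem] at h2
  exact ⟨_, projGr_mem 𝒜 0 b, h2, (h.mul_right_inj).1 (by rw [← mul_assoc, h2, one_mul, mul_one])⟩

end Basics

end

end Colour

namespace Colour

noncomputable section


/-! ### Antisymmetric functions on words. -/

section AntiSym

/-- Two ways to split off a pair of neighbouring positions. -/
theorem exists_castSucc_of_succ {n : ℕ} {i j : Fin n} (h : (j : ℕ) = i + 1) :
    ∃ (m : ℕ) (e : n = m + 1) (k : Fin m), i = Fin.cast e.symm k.castSucc ∧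
      j = Fin.cast e.symm k.succ := by
  obtain _ | m := n
  · exact i.elim0
  · refine ⟨m, rfl, ⟨i, by have := j.2; omega⟩, Fin.ext rfl, Fin.ext h⟩

variable {κ : Type*} {M : Type*} [AddCommGroup M] [Module ℂ M]

/-- A function on words which is antisymmetric up to the factors `k`. -/
def AntiSym (k : κ → κ → ℂ) {n : ℕ} (f : (Fin n → κ) → M) : Prop :=
  ∀ i j : Fin n, (j : ℕ) = i + 1 → ∀ J, f (J ∘ Equiv.swap i j) = k (J i) (J j) • f J

theorem antiSym_succ {k : κ → κ → ℂ} {n : ℕ} {f : (Fin (n + 1) → κ) → M}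
    (h : ∀ (i : Fin n) J, f (J ∘ Equiv.swap i.castSucc i.succ) =
      k (J i.castSucc) (J i.succ) • f J) : AntiSym k f := by
  intro i j hij J
  obtain ⟨m, e, a, rfl, rfl⟩ := exists_castSucc_of_succ hij
  obtain rfl : n = m := by omega
  exact h a J

theorem antiSym_zero {k : κ → κ → ℂ} (f : (Fin 0 → κ) → M) : AntiSym k f :=
  fun i => i.elim0

/-- Neighbouring transpositions generate the symmetric group, and the factor picked up at each of
them depends on `k` and the word only. Two antisymmetric functions therefore change by the same
nonzero scalar, which is the source of their proportionality. -/
theorem AntiSym.perm {N : Type*} [AddCommGroup N] [Module ℂ N] {k : κ → κ → ℂ}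
    (hk : ∀ i j, k i j ≠ 0) {n : ℕ} {f : (Fin n → κ) → M} {g : (Fin n → κ) → N}
    (hf : AntiSym k f) (hg : AntiSym k g) (τ : Equiv.Perm (Fin n)) (J : Fin n → κ) :
    ∃ c : ℂ, c ≠ 0 ∧ f (J ∘ τ) = c • f J ∧ g (J ∘ τ) = c • g J := by
  obtain _ | n := n
  · refine ⟨1, one_ne_zero, ?_, ?_⟩ <;> rw [one_smul, Subsingleton.elim (J ∘ τ) J]
  have hτ : τ ∈ Submonoid.closure
      (Set.range fun i : Fin n => Equiv.swap i.castSucc i.succ) := by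
    rw [Equiv.Perm.mclosure_swap_castSucc_succ]; trivial
  induction hτ using Submonoid.closure_induction generalizing J with
  | mem τ hτ =>
    obtain ⟨i, rfl⟩ := hτ
    exact ⟨_, hk _ _, hf i.castSucc i.succ (by simp) J, hg i.castSucc i.succ (by simp) J⟩
  | one => exact ⟨1, one_ne_zero, by rw [one_smul]; rfl, by rw [one_smul]; rfl⟩
  | mul σ τ _ _ hσ hτ =>
    obtain ⟨c, hc, h1, h2⟩ := hσ J
    obtain ⟨c', hc', h1', h2'⟩ := hτ (J ∘ σ)
    refine ⟨c' * c, mul_ne_zero hc' hc, ?_, ?_⟩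
    · rw [mul_smul, ← h1, ← h1']; rfl
    · rw [mul_smul, ← h2, ← h2']; rfl

/-- A permutation brings two equal letters to the positions 0 and 1. Exchanging them fixes the word
and multiplies the value by -1, so the value is 0; the way back costs only a nonzero scalar. -/
theorem AntiSym.eq_zero {k : κ → κ → ℂ} (hk : ∀ i j, k i j ≠ 0) (hk1 : ∀ i, k i i = -1) {n : ℕ}
    {f : (Fin n → κ) → M} (hf : AntiSym k f) {J : Fin n → κ} (hJ : ¬ Function.Injective J) :
    f J = 0 := by
  simp only [Function.Injective, not_forall] at hJ
  obtain ⟨p, q, hpq, hne⟩ := hJ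
  obtain _ | _ | n := n
  · exact p.elim0
  · exact absurd (Fin.ext (by omega)) hne
  -- `r` is the position which `Equiv.swap 0 p` sends to q. This makes the permutation τ below
  -- satisfy τ 0 = p and τ 1 = q.
  set r := Equiv.swap 0 p q with hr
  have hr0 : r ≠ 0 := by
    intro h
    apply hne
    have h1 : Equiv.swap 0 p r = q := by rw [hr, Equiv.swap_apply_self]
    rw [h, Equiv.swap_apply_left] at h1
    exact h1
  obtain ⟨c, hc, h1, -⟩ := hf.perm hk hf (Equiv.swap 0 p * Equiv.swap 1 r) J
  set τ := Equiv.swap 0 p * Equiv.swap 1 r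
  have h2 : τ 0 = p := by
    simp only [τ, Equiv.Perm.mul_apply]
    rw [Equiv.swap_apply_of_ne_of_ne (by simp) hr0.symm, Equiv.swap_apply_left]
  have h3 : τ 1 = q := by
    simp only [τ, Equiv.Perm.mul_apply, Equiv.swap_apply_left]
    rw [hr, Equiv.swap_apply_self]
  have h4 : (J ∘ τ) 0 = (J ∘ τ) 1 := by simp [h2, h3, hpq]
  have h5 : (J ∘ τ) ∘ Equiv.swap 0 1 = J ∘ τ := by
    funext a
    simp only [Function.comp_apply]
    rcases eq_or_ne a 0 with rfl | h0
    · rw [Equiv.swap_apply_left]; exact h4.symm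
    rcases eq_or_ne a 1 with rfl | h1
    · rw [Equiv.swap_apply_right]; exact h4
    rw [Equiv.swap_apply_of_ne_of_ne h0 h1]
  have h6 := hf 0 1 rfl (J ∘ τ)
  rw [h5, h4, hk1, neg_one_smul] at h6
  have h7 : (2 : ℂ) • f (J ∘ τ) = 0 := by rw [two_smul]; exact add_eq_zero_iff_eq_neg.2 h6
  have h8 := (smul_eq_zero.1 h7).resolve_left two_ne_zero
  rw [h1] at h8
  exact (smul_eq_zero.1 h8).resolve_left hc

/-- All antisymmetric functions on words of maximal length are proportional. -/
theorem AntiSym.proportional {k : κ → κ → ℂ} (hk : ∀ i j, k i j ≠ 0) (hk1 : ∀ i, k i i = -1)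
    {n : ℕ} {f : (Fin n → κ) → M} {l : (Fin n → κ) → ℂ} (hf : AntiSym k f) (hl : AntiSym k l) (J₀ : Fin n ≃ κ)
    (J : Fin n → κ) : l J₀ • f J = l J • f J₀ := by
  by_cases hJ : Function.Injective J
  · have hb : Function.Bijective (J₀.symm ∘ J) :=
      Finite.injective_iff_bijective.1 (J₀.symm.injective.comp hJ)
    -- An injective word of maximal length is a rearrangement of J₀, and f and l pick up the same
    -- scalar on the way from J₀ to J.
    obtain ⟨c, -, h1, h2⟩ := hf.perm hk hl (Equiv.ofBijective _ hb) J₀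
    have h3 : J₀ ∘ Equiv.ofBijective _ hb = J := by funext a; simp
    rw [h3] at h1 h2
    rw [h1, h2, smul_comm, smul_assoc]
  · rw [hf.eq_zero hk hk1 hJ, hl.eq_zero hk hk1 hJ, smul_zero, zero_smul]

/-- The product of the numbers `g (J b) (J a)` for `a < b`. -/
def pairProd (g : κ → κ → ℂ) : {n : ℕ} → (Fin n → κ) → ℂ
  | 0, _ => 1
  | _ + 1, J => (∏ b, g (Fin.tail J b) (J 0)) * pairProd g (Fin.tail J)

theorem pairProd_succ (g : κ → κ → ℂ) {n : ℕ} (J : Fin (n + 1) → κ) :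
    pairProd g J = (∏ b, g (Fin.tail J b) (J 0)) * pairProd g (Fin.tail J) := rfl

theorem pairProd_eq (g : κ → κ → ℂ) {n : ℕ} (J : Fin n → κ) :
    pairProd g J = ∏ a, ∏ b, if a < b then g (J b) (J a) else 1 := by
  induction n with
  | zero => simp [pairProd]
  | succ n ih =>
    rw [pairProd, ih, Fin.prod_univ_succ]
    simp only [Fin.prod_univ_succ, Fin.succ_lt_succ_iff, Fin.succ_pos, Fin.not_lt_zero, lt_irrefl,
      if_true, if_false, one_mul, Fin.tail]

theorem tail_comp_swap {α : Type*} {n : ℕ} (i j : Fin n) (J : Fin (n + 1) → α) :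
    Fin.tail (J ∘ Equiv.swap i.succ j.succ) = Fin.tail J ∘ Equiv.swap i j := by
  funext a
  simp only [Fin.tail, Function.comp_apply]
  congr 1
  rcases eq_or_ne a i with rfl | h0
  · simp
  rcases eq_or_ne a j with rfl | h1
  · simp
  rw [Equiv.swap_apply_of_ne_of_ne h0 h1, Equiv.swap_apply_of_ne_of_ne]
  · simpa using h0
  · simpa using h1

theorem comp_swap_zero {α : Type*} {n : ℕ} (i j : Fin n) (J : Fin (n + 1) → α) :
    (J ∘ Equiv.swap i.succ j.succ) 0 = J 0 := by
  simp only [Function.comp_apply]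
  rw [Equiv.swap_apply_of_ne_of_ne (Fin.succ_ne_zero i).symm (Fin.succ_ne_zero j).symm]

theorem tail_tail_comp_swap {α : Type*} {n : ℕ} (J : Fin (n + 2) → α) :
    Fin.tail (Fin.tail (J ∘ Equiv.swap 0 1)) = Fin.tail (Fin.tail J) := by
  funext a
  simp only [Fin.tail, Function.comp_apply]
  rw [Equiv.swap_apply_of_ne_of_ne (Fin.succ_ne_zero _)]
  rw [← Fin.succ_zero_eq_one, Ne, Fin.succ_inj]
  exact Fin.succ_ne_zero _

/-- A swap of neighbouring positions reverses the order of that one pair of letters and merely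
permutes the remaining factors. -/
theorem pairProd_antiSym {k g : κ → κ → ℂ} (hg : ∀ i j, g i j = k i j * g j i) {n : ℕ} :
    AntiSym k (pairProd g (n := n)) := by
  induction n with
  | zero => exact antiSym_zero _
  | succ n ih =>
    refine antiSym_succ fun i J => ?_
    obtain _ | n := n
    · exact i.elim0
    induction i using Fin.cases with
    | zero =>
      simp only [Fin.castSucc_zero, Fin.succ_zero_eq_one, pairProd, tail_tail_comp_swap,
        Fin.prod_univ_succ]
      have e1 : ∀ b : Fin n, Fin.tail (J ∘ Equiv.swap 0 1) b.succ = Fin.tail (Fin.tail J) b :=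
        fun b => congrFun (tail_tail_comp_swap J) b
      have e2 : ∀ b : Fin n, Fin.tail J b.succ = Fin.tail (Fin.tail J) b := fun b => rfl
      have e3 : Fin.tail (J ∘ Equiv.swap 0 1) 0 = J 0 := by simp [Fin.tail]
      have e4 : Fin.tail J 0 = J 1 := rfl
      simp only [e1, e2, e3, e4, Function.comp_apply, Equiv.swap_apply_left, smul_eq_mul]
      rw [hg (J 0) (J 1)]
      ring
    | succ i =>
      rw [Fin.castSucc_succ, pairProd_succ g (J ∘ _), pairProd_succ g J, tail_comp_swap, comp_swap_zero,
        ih i.castSucc i.succ (by simp)]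
      simp only [Function.comp_apply, smul_eq_mul]
      rw [Equiv.prod_comp (Equiv.swap i.castSucc i.succ) (fun b => g (Fin.tail J b) (J 0))]
      simp only [Fin.tail]
      ring

variable {n : ℕ} (k : κ → κ → ℂ) (J₀ : Fin n ≃ κ)

/-- The antisymmetric function on words with the value `1` at the word `J₀`. -/
def stdAnti (J : Fin n → κ) : ℂ :=
  -- The first argument is the later letter, so `k` is the contribution of an inversion with respect
  -- to the order given by J₀. The value 0 for equal letters makes the required relation between the
  -- two orders of a pair hold trivially there.
  pairProd (fun i j => if J₀.symm i < J₀.symm j then k i j else if J₀.symm i = J₀.symm j then 0 else 1) J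

theorem stdAnti_antiSym (hk : ∀ i j, k i j * k j i = 1) : AntiSym k (stdAnti k J₀) := by
  refine pairProd_antiSym fun i j => ?_
  rcases lt_trichotomy (J₀.symm i) (J₀.symm j) with h | h | h
  · rw [if_pos h, if_neg h.not_gt, if_neg h.ne', mul_one]
  · rw [if_neg h.not_lt, if_pos h, if_neg h.not_gt, if_pos h.symm, mul_zero]
  · rw [if_neg h.not_gt, if_neg h.ne', if_pos h, hk]

theorem stdAnti_self : stdAnti k J₀ J₀ = 1 := by
  rw [stdAnti, pairProd_eq]
  refine Finset.prod_eq_one fun a _ => Finset.prod_eq_one fun b _ => ?_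
  by_cases h : a < b
  · simp [h, h.not_gt, h.ne']
  · simp [h]

end AntiSym

end

end Colour

namespace Colour

noncomputable section


/-! ### Tensor powers of a homogeneous matrix. -/

section Det

variable {Γ : Type*} [AddCommGroup Γ] [DecidableEq Γ] (ω : CommFactor Γ)
variable {A : Type*} [Ring A] [Algebra ℂ A]

/-- The coefficient of `e_{J_1} ⊗ ⋯ ⊗ e_{J_n}` in the product of the elements `e_{J_a} ⊗ y_a`, where
`p` and `q - p` are the degrees of the `e_{J_a}` and of the `y_a`. -/
def cmon : {n : ℕ} → (Fin n → A) → (Fin n → Γ) → (Fin n → Γ) → A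
  | 0, _, _, _ => 1
  | _ + 1, y, p, q => ω (q 0 - p 0) (∑ a, Fin.tail p a) •
      (y 0 * cmon (Fin.tail y) (Fin.tail p) (Fin.tail q))

theorem cmon_succ {n : ℕ} (y : Fin (n + 1) → A) (p q : Fin (n + 1) → Γ) :
    cmon ω y p q = ω (q 0 - p 0) (∑ a, Fin.tail p a) •
      (y 0 * cmon ω (Fin.tail y) (Fin.tail p) (Fin.tail q)) := rfl

theorem cmon_succ_succ {n : ℕ} (y : Fin (n + 2) → A) (p q : Fin (n + 2) → Γ) :
    cmon ω y p q = (ω (q 0 - p 0) (p 1 + ∑ a, Fin.tail (Fin.tail p) a) *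
        ω (q 1 - p 1) (∑ a, Fin.tail (Fin.tail p) a)) •
      (y 0 * y 1 * cmon ω (Fin.tail (Fin.tail y)) (Fin.tail (Fin.tail p))
        (Fin.tail (Fin.tail q))) := by
  rw [cmon_succ, cmon_succ, mul_smul_comm, smul_smul, Fin.sum_univ_succ, mul_assoc (y 0)]
  rfl

theorem map_cmon {B : Type*} [Ring B] [Algebra ℂ B] (φ : A →ₐ[ℂ] B) {n : ℕ} (y : Fin n → A)
    (p q : Fin n → Γ) : φ (cmon ω y p q) = cmon ω (φ ∘ y) p q := by
  induction n with
  | zero => exact map_one φ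
  | succ n ih => rw [cmon_succ, cmon_succ, map_smul, map_mul, ih]; rfl

variable {ω} {𝒜 : Γ → Submodule ℂ A} [GradedAlgebra 𝒜]

theorem cmon_mem {n : ℕ} {y : Fin n → A} {p q : Fin n → Γ} (h : ∀ a, y a ∈ 𝒜 (q a - p a)) :
    cmon ω y p q ∈ 𝒜 (∑ a, q a - ∑ a, p a) := by
  induction n with
  | zero => simp only [Finset.univ_eq_empty, Finset.sum_empty, sub_zero]
            exact SetLike.GradedOne.one_mem
  | succ n ih =>
    rw [cmon_succ, Fin.sum_univ_succ, Fin.sum_univ_succ, add_sub_add_comm]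
    exact Submodule.smul_mem _ _ (SetLike.mul_mem_graded (h 0) (ih fun a => h a.succ))

/-- The co-action commutes with the braiding: exchanging neighbouring factors costs ω of the degrees
q on the source word and ω of the degrees p on the target word. It is enough that the y_a, of
degrees q - p, commute up to `ω`. -/
theorem OmegaComm.cmon_swap (hA : OmegaComm ω 𝒜) {n : ℕ} {y : Fin (n + 1) → A}
    {p q : Fin (n + 1) → Γ} (h : ∀ a, y a ∈ 𝒜 (q a - p a)) (i : Fin n) :
    ω (q i.castSucc) (q i.succ) • cmon ω (y ∘ Equiv.swap i.castSucc i.succ)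
        (p ∘ Equiv.swap i.castSucc i.succ) (q ∘ Equiv.swap i.castSucc i.succ) =
      ω (p i.castSucc) (p i.succ) • cmon ω y p q := by
  induction n with
  | zero => exact i.elim0
  | succ n ih =>
    induction i using Fin.cases with
    | zero =>
      simp only [Fin.castSucc_zero, Fin.succ_zero_eq_one]
      rw [cmon_succ_succ, cmon_succ_succ, tail_tail_comp_swap, tail_tail_comp_swap,
        tail_tail_comp_swap]
      simp only [Function.comp_apply, Equiv.swap_apply_left, Equiv.swap_apply_right]
      rw [hA (h 0) (h 1), smul_mul_assoc, smul_smul, smul_smul, smul_smul]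
      congr 1
      simp only [ω.add_right, ω.sub_left, ω.sub_right]
      have h1 := ω.skew (p 0) (p 1)
      have h3 := ω.skew (q 0) (p 1)
      grind
    | succ i =>
      have h1 := ih (y := Fin.tail y) (p := Fin.tail p) (q := Fin.tail q) (fun a => h a.succ) i
      have h2 : ∑ a, (Fin.tail p ∘ Equiv.swap i.castSucc i.succ) a = ∑ a, Fin.tail p a :=
        Equiv.sum_comp _ _
      rw [Fin.castSucc_succ, cmon_succ ω (y ∘ _), cmon_succ ω y, tail_comp_swap, comp_swap_zero,
        tail_comp_swap, comp_swap_zero, tail_comp_swap, comp_swap_zero, h2,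
        smul_comm (ω (q _) _), ← mul_smul_comm (ω (q i.castSucc.succ) _), smul_comm (ω (p _) _),
        ← mul_smul_comm (ω (p i.castSucc.succ) _)]
      exact congrArg (fun z : A => ω (q 0 - p 0) (∑ a, Fin.tail p a) • (y 0 * z)) h1


variable {κ : Type*} (d : κ → Γ)

variable (ω) in
/-- The coefficient of `e_J` in the image of `e_I` under the co-action `e_i ↦ ∑_j e_j ⊗ x_{ji}`. -/
def cword (x : Matrix κ κ A) {n : ℕ} (J I : Fin n → κ) : A :=
  cmon ω (fun a => x (J a) (I a)) (d ∘ J) (d ∘ I)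

variable {d}

theorem cword_cons (x : Matrix κ κ A) {n : ℕ} (j i : κ) (J I : Fin n → κ) :
    cword ω d x (Fin.cons j J : Fin (n + 1) → κ) (Fin.cons i I : Fin (n + 1) → κ) =
      ω (d i - d j) (∑ a, d (J a)) • (x j i * cword ω d x J I) := rfl

theorem map_cword {B : Type*} [Ring B] [Algebra ℂ B] (φ : A →ₐ[ℂ] B) (x : Matrix κ κ A) {n : ℕ}
    (J I : Fin n → κ) : φ (cword ω d x J I) = cword ω d (x.map φ) J I := map_cmon ω φ _ _ _

theorem cword_mem {x : Matrix κ κ A} (hx : ∀ j i, x j i ∈ 𝒜 (d i - d j)) {n : ℕ}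
    (J I : Fin n → κ) : cword ω d x J I ∈ 𝒜 (∑ a, d (I a) - ∑ a, d (J a)) :=
  cmon_mem fun _ => hx _ _

theorem OmegaComm.cword_swap (hA : OmegaComm ω 𝒜) {x : Matrix κ κ A}
    (hx : ∀ j i, x j i ∈ 𝒜 (d i - d j)) {n : ℕ} (J I : Fin n → κ) {a b : Fin n}
    (hab : (b : ℕ) = a + 1) :
    ω (d (I a)) (d (I b)) • cword ω d x (J ∘ Equiv.swap a b) (I ∘ Equiv.swap a b) =
      ω (d (J a)) (d (J b)) • cword ω d x J I := by
  obtain ⟨m, e, i, rfl, rfl⟩ := exists_castSucc_of_succ hab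
  obtain ⟨rfl⟩ := e
  exact hA.cmon_swap (y := fun a => x (J a) (I a)) (p := d ∘ J) (q := d ∘ I) (fun a => hx _ _) i

theorem sum_cons {M : Type*} [AddCommMonoid M] [Fintype κ] {n : ℕ} (f : (Fin (n + 1) → κ) → M) :
    ∑ J, f J = ∑ j, ∑ J : Fin n → κ, f (Fin.cons j J) := by
  rw [← (Fin.consEquiv fun _ : Fin (n + 1) => κ).sum_comp, Fintype.sum_prod_type]
  rfl

/-- Tensor powers are functorial for homogeneous matrices. In the expansion letter by letter, the
entry of y has to pass the word of x in the remaining letters, and the resulting factor accounts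
exactly for the difference of the prefactors of the three words. -/
theorem OmegaComm.cword_mul (hA : OmegaComm ω 𝒜) [Fintype κ] {x y : Matrix κ κ A}
    (hx : ∀ j i, x j i ∈ 𝒜 (d i - d j)) (hy : ∀ j i, y j i ∈ 𝒜 (d i - d j)) {n : ℕ}
    (J I : Fin n → κ) :
    cword ω d (x * y) J I = ∑ K, cword ω d x J K * cword ω d y K I := by
  induction n with
  | zero =>
    rw [Fintype.sum_unique]
    exact (one_mul 1).symm
  | succ n ih =>
    rw [← Fin.cons_self_tail J, ← Fin.cons_self_tail I]
    generalize J 0 = j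
    generalize I 0 = i
    generalize Fin.tail J = J
    generalize Fin.tail I = I
    rw [cword_cons, ih, sum_cons, Matrix.mul_apply, Finset.sum_mul_sum, Finset.smul_sum]
    refine Finset.sum_congr rfl fun k _ => ?_
    rw [Finset.smul_sum]
    refine Finset.sum_congr rfl fun K _ => ?_
    rw [cword_cons, cword_cons, smul_mul_smul_comm, mul_assoc, ← mul_assoc (y k i), mul_assoc (x j k),
      ← mul_assoc _ (y k i), hA (cword_mem hx J K) (hy k i), smul_mul_assoc, mul_smul_comm, smul_smul]
    congr 1
    simp only [ω.sub_left, ω.sub_right]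
    have h1 := ω.skew (d k) (∑ a, d (J a))
    have h2 := ω.skew (d i) (∑ a, d (K a))
    have h3 := ω.skew (d k) (∑ a, d (K a))
    grind

theorem cword_one [DecidableEq κ] {n : ℕ} (J I : Fin n → κ) :
    cword ω d (1 : Matrix κ κ A) J I = if J = I then 1 else 0 := by
  induction n with
  | zero => rw [if_pos (Subsingleton.elim _ _)]; rfl
  | succ n ih =>
    rw [← Fin.cons_self_tail J, ← Fin.cons_self_tail I]
    generalize J 0 = j
    generalize I 0 = i
    generalize Fin.tail J = J
    generalize Fin.tail I = I
    rw [cword_cons, ih, Matrix.one_apply]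
    by_cases h : j = i
    · subst h
      by_cases h' : J = I
      · simp [h']
      · simp [h', Fin.cons_inj]
    · simp [h, Fin.cons_inj]

end Det

/-! ### The determinant on a space of one parity, and Cramer's rule. -/

section Det2

variable {Γ : Type*} [AddCommGroup Γ] [DecidableEq Γ] {ω : CommFactor Γ}
variable {A : Type*} [Ring A] [Algebra ℂ A] {𝒜 : Γ → Submodule ℂ A} [GradedAlgebra 𝒜]
variable {κ : Type*} [Fintype κ] [DecidableEq κ] {d : κ → Γ} {c : ℂ} {n : ℕ}

variable (ω d c) in
/-- The factors of antisymmetry. -/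
def antiFactor (i j : κ) : ℂ := -c * ω (d i) (d j)

theorem antiFactor_ne_zero (hc : c * c = 1) (i j : κ) : antiFactor ω d c i j ≠ 0 :=
  mul_ne_zero (neg_ne_zero.2 (left_ne_zero_of_mul_eq_one hc)) (ω.ne_zero _ _)

/-- This is what treats both parities at once: tensors antisymmetric under the braiding for c = 1
and symmetric ones for c = -1 have coefficients which vanish on words with a repeated letter. -/
theorem antiFactor_self (hc : c * c = 1) (hd : ∀ i, ω (d i) (d i) = c) (i : κ) :
    antiFactor ω d c i i = -1 := by rw [antiFactor, hd, neg_mul, hc]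

theorem antiFactor_mul (hc : c * c = 1) (i j : κ) :
    antiFactor ω d c i j * antiFactor ω d c j i = 1 := by
  have h := ω.skew (d i) (d j)
  unfold antiFactor
  linear_combination c * c * h + hc

variable (ω d c) in
/-- The function `λ` for which `∑ λ(I) e_I` spans the line of the antisymmetric tensors of maximal
degree. -/
def topAnti (J₀ : Fin n ≃ κ) : (Fin n → κ) → ℂ := stdAnti (antiFactor ω d c) J₀

theorem topAnti_antiSym (hc : c * c = 1) (J₀ : Fin n ≃ κ) :
    AntiSym (antiFactor ω d c) (topAnti ω d c J₀) := stdAnti_antiSym _ _ (antiFactor_mul hc)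

theorem topAnti_self (J₀ : Fin n ≃ κ) : topAnti ω d c J₀ J₀ = 1 := stdAnti_self _ _

variable (ω d c) in
/-- The determinant of a matrix with homogeneous entries. -/
def cdet (J₀ : Fin n ≃ κ) (x : Matrix κ κ A) : A :=
  ∑ I, topAnti ω d c J₀ I • cword ω d x J₀ I

theorem map_cdet {B : Type*} [Ring B] [Algebra ℂ B] (φ : A →ₐ[ℂ] B) (J₀ : Fin n ≃ κ)
    (x : Matrix κ κ A) : φ (cdet ω d c J₀ x) = cdet ω d c J₀ (x.map φ) := by
  simp only [cdet, map_sum, map_smul, map_cword]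

/-- After reindexing the sum by the swap, `cword_swap` trades the factor of the source word for that
of the target word, while -c is common to both. Thus a homogeneous matrix preserves the
antisymmetric tensors. -/
theorem antiSym_sum_cword (hA : OmegaComm ω 𝒜) {x : Matrix κ κ A}
    (hx : ∀ j i, x j i ∈ 𝒜 (d i - d j)) {f : (Fin n → κ) → ℂ}
    (hf : AntiSym (antiFactor ω d c) f) :
    AntiSym (antiFactor ω d c) (fun J => ∑ I, f I • cword ω d x J I) := by
  intro a b hab J
  have e : Function.Bijective (fun I : Fin n → κ => I ∘ Equiv.swap a b) :=
    Function.Involutive.bijective fun I => by funext i; simp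
  beta_reduce
  rw [← e.sum_comp, Finset.smul_sum]
  refine Finset.sum_congr rfl fun I _ => ?_
  have h := hA.cword_swap hx J I hab
  rw [hf a b hab I, antiFactor, antiFactor, smul_eq_mul, mul_comm (-c * _), ← smul_smul, ← smul_smul, h]
  simp only [smul_smul]
  congr 1
  ring

/-- The defining property of the determinant. -/
theorem sum_smul_cword (hA : OmegaComm ω 𝒜) (hc : c * c = 1) (hd : ∀ i, ω (d i) (d i) = c)
    {x : Matrix κ κ A} (hx : ∀ j i, x j i ∈ 𝒜 (d i - d j)) (J₀ : Fin n ≃ κ)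
    {f : (Fin n → κ) → ℂ} (hf : AntiSym (antiFactor ω d c) f) (J : Fin n → κ) :
    ∑ I, f I • cword ω d x J I = f J • cdet ω d c J₀ x := by
  -- The image of the top tensor is antisymmetric in J, hence proportional to `topAnti`, with its
  -- value at J₀ as the factor; that value is the determinant. By `h2` the function f is itself a
  -- multiple of `topAnti`.
  have h1 := (antiSym_sum_cword hA hx (topAnti_antiSym hc J₀)).proportional
    (antiFactor_ne_zero hc) (antiFactor_self hc hd) (topAnti_antiSym hc J₀) J₀ J
  rw [topAnti_self, one_smul] at h1
  have h2 : ∀ J, f J = topAnti ω d c J₀ J * f J₀ := fun J => by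
    have := hf.proportional (antiFactor_ne_zero hc) (antiFactor_self hc hd)
      (topAnti_antiSym hc J₀) J₀ J
    rwa [topAnti_self, one_smul] at this
  rw [h2 J, mul_comm, mul_smul, Finset.sum_congr rfl (fun I _ => by
    rw [h2 I, mul_comm, mul_smul] : ∀ I ∈ Finset.univ, f I • cword ω d x J I =
      f J₀ • (topAnti ω d c J₀ I • cword ω d x J I)), ← Finset.smul_sum]
  exact congrArg (fun z : A => f J₀ • z) h1

theorem sum_deg (J : Fin n ≃ κ) : ∑ a, d (J a) = ∑ i, d i := J.sum_comp d

/-- A word in the support has no repeated letter, and its length is the number of letters, so it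
uses each letter exactly once. -/
theorem sum_deg_of_ne_zero (hc : c * c = 1) (hd : ∀ i, ω (d i) (d i) = c) (J₀ : Fin n ≃ κ)
    {J : Fin n → κ} (hJ : topAnti ω d c J₀ J ≠ 0) : ∑ a, d (J a) = ∑ i, d i := by
  have h1 : Function.Injective J := by
    by_contra h
    exact hJ ((topAnti_antiSym hc J₀).eq_zero (antiFactor_ne_zero hc) (antiFactor_self hc hd) h)
  have h2 : Function.Bijective J :=
    (Fintype.bijective_iff_injective_and_card J).2 ⟨h1, Fintype.card_congr J₀⟩
  exact h2.sum_comp d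

theorem cdet_mem (hc : c * c = 1) (hd : ∀ i, ω (d i) (d i) = c)
    {x : Matrix κ κ A} (hx : ∀ j i, x j i ∈ 𝒜 (d i - d j)) (J₀ : Fin n ≃ κ) :
    cdet ω d c J₀ x ∈ 𝒜 0 := by
  refine Submodule.sum_mem _ fun I _ => ?_
  by_cases h : topAnti ω d c J₀ I = 0
  · rw [h, zero_smul]; exact zero_mem _
  · have h1 := cword_mem (ω := ω) hx J₀ I
    rw [sum_deg_of_ne_zero hc hd J₀ h, sum_deg, sub_self] at h1
    exact Submodule.smul_mem _ _ h1

theorem cdet_one (J₀ : Fin n ≃ κ) : cdet ω d c J₀ (1 : Matrix κ κ A) = 1 := by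
  simp [cdet, cword_one, topAnti_self]

/-- The product matrix acts on the line of top tensors by applying the two matrices in succession:
after `cword_mul` the inner sum is a multiple of `topAnti` with the factor det y. -/
theorem cdet_mul (hA : OmegaComm ω 𝒜) (hc : c * c = 1) (hd : ∀ i, ω (d i) (d i) = c)
    {x y : Matrix κ κ A} (hx : ∀ j i, x j i ∈ 𝒜 (d i - d j)) (hy : ∀ j i, y j i ∈ 𝒜 (d i - d j))
    (J₀ : Fin n ≃ κ) : cdet ω d c J₀ (x * y) = cdet ω d c J₀ x * cdet ω d c J₀ y := by
  have h := topAnti_antiSym (ω := ω) (d := d) hc J₀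
  have h1 : ∀ I, topAnti ω d c J₀ I • cword ω d (x * y) J₀ I =
      ∑ K, cword ω d x J₀ K * (topAnti ω d c J₀ I • cword ω d y K I) := fun I => by
    rw [hA.cword_mul hx hy, Finset.smul_sum]; simp only [mul_smul_comm]
  rw [cdet, Finset.sum_congr rfl (fun I _ => h1 I), Finset.sum_comm]
  simp only [← Finset.mul_sum, sum_smul_cword hA hc hd hy J₀ h]
  simp only [cdet, Finset.sum_mul, mul_smul_comm, smul_mul_assoc]

/-- Cramer's rule. Expand the action on the top tensor by the first letter, for the target word j
followed by all letters except k. For j = k this gives the determinant up to a nonzero scalar; for j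
≠ k the letter j is repeated and the sum vanishes. The inverse of the determinant may be taken of
degree 0, which keeps the solution homogeneous. -/
theorem exists_right_inverse (hA : OmegaComm ω 𝒜) (hc : c * c = 1)
    (hd : ∀ i, ω (d i) (d i) = c) {x : Matrix κ κ A} (hx : ∀ j i, x j i ∈ 𝒜 (d i - d j))
    (J₀ : Fin n ≃ κ) (hD : IsUnit (cdet ω d c J₀ x)) :
    ∃ y : Matrix κ κ A, (∀ j i, y j i ∈ 𝒜 (d i - d j)) ∧ x * y = 1 := by
  obtain ⟨E, hE, hDE, -⟩ := exists_inv_of_isUnit (cdet_mem hc hd hx J₀) hD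
  obtain _ | n := n
  · have : IsEmpty κ := J₀.symm.isEmpty
    exact ⟨1, fun j => isEmptyElim j, Subsingleton.elim _ _⟩
  have h := topAnti_antiSym (ω := ω) (d := d) hc J₀
  -- The permutation `τ k` brings the letter k to the front of J₀, so `K k` is a word in all letters
  -- except k.
  let τ : κ → Equiv.Perm (Fin (n + 1)) := fun k => Equiv.swap 0 (J₀.symm k)
  let K : κ → Fin n → κ := fun k => Fin.tail (J₀ ∘ τ k)
  have hK : ∀ k, (Fin.cons k (K k) : Fin (n + 1) → κ) = J₀ ∘ τ k := fun k => by
    have h1 : (J₀ ∘ τ k) 0 = k := by simp [τ]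
    rw [← Fin.cons_self_tail (J₀ ∘ τ k), h1]
  have h1 : ∀ k, topAnti ω d c J₀ (Fin.cons k (K k) : Fin (n + 1) → κ) ≠ 0 := fun k => by
    obtain ⟨c', hc', h1, -⟩ := h.perm (antiFactor_ne_zero hc) h (τ k) J₀
    rw [hK, h1, topAnti_self, smul_eq_mul, mul_one]
    exact hc'
  have h2 : ∀ j k, j ≠ k → topAnti ω d c J₀ (Fin.cons j (K k) : Fin (n + 1) → κ) = 0 := by
    intro j k hjk
    refine h.eq_zero (antiFactor_ne_zero hc) (antiFactor_self hc hd) fun hinj => ?_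
    obtain ⟨a, ha⟩ : ∃ a, (Fin.cons k (K k) : Fin (n + 1) → κ) a = j := by
      rw [hK]; exact (J₀.surjective.comp (τ k).surjective) j
    induction a using Fin.cases with
    | zero => exact hjk (by simpa using ha.symm)
    | succ a =>
      have h3 := @hinj 0 a.succ (by simpa using ha.symm)
      exact absurd h3 (Fin.succ_ne_zero a).symm
  have hsum : ∀ k, ∑ a, d (K k a) = ∑ i, d i - d k := fun k => by
    have := sum_deg_of_ne_zero hc hd J₀ (h1 k)
    rw [Fin.sum_univ_succ] at this
    simp only [Fin.cons_zero, Fin.cons_succ] at this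
    rw [← this, add_sub_cancel_left]
  -- The minors. The factor ω(d_i - d_k, ·) turns the prefactor ω(d_i - d_j, ·) of `cword_cons` into
  -- one independent of i, so that the sum over i can be carried out.
  let B : Matrix κ κ A := fun i k => ∑ I : Fin n → κ,
    (topAnti ω d c J₀ (Fin.cons i I : Fin (n + 1) → κ) * ω (d i - d k) (∑ a, d (K k a))) •
      cword ω d x (K k) I
  have hB : ∀ i k, B i k ∈ 𝒜 (d k - d i) := by
    intro i k
    refine Submodule.sum_mem _ fun I _ => ?_
    by_cases h3 : topAnti ω d c J₀ (Fin.cons i I : Fin (n + 1) → κ) = 0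
    · rw [h3, zero_mul, zero_smul]; exact zero_mem _
    · have h4 := cword_mem (ω := ω) hx (K k) I
      have h5 := sum_deg_of_ne_zero hc hd J₀ h3
      rw [Fin.sum_univ_succ] at h5
      simp only [Fin.cons_zero, Fin.cons_succ] at h5
      have h6 : ∑ a, d (I a) - ∑ a, d (K k a) = d k - d i := by
        rw [hsum, ← h5]; abel
      rw [h6] at h4
      exact Submodule.smul_mem _ _ h4
  have hxB : ∀ j k, ∑ i, x j i * B i k = if j = k then
      topAnti ω d c J₀ (Fin.cons k (K k) : Fin (n + 1) → κ) • cdet ω d c J₀ x else 0 := by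
    intro j k
    have h3 := sum_smul_cword hA hc hd hx J₀ h (Fin.cons j (K k) : Fin (n + 1) → κ)
    rw [sum_cons] at h3
    have h4 : ∀ i, x j i * B i k = ω (d j - d k) (∑ a, d (K k a)) •
        ∑ I, topAnti ω d c J₀ (Fin.cons i I : Fin (n + 1) → κ) •
          cword ω d x (Fin.cons j (K k) : Fin (n + 1) → κ) (Fin.cons i I : Fin (n + 1) → κ) := by
      intro i
      simp only [B, Finset.mul_sum, Finset.smul_sum]
      refine Finset.sum_congr rfl fun I _ => ?_
      rw [cword_cons, mul_smul_comm, smul_smul, smul_smul]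
      congr 1
      have h5 : ω (d i - d k) (∑ a, d (K k a)) =
          ω (d j - d k) (∑ a, d (K k a)) * ω (d i - d j) (∑ a, d (K k a)) := by
        rw [← ω.add_left]; congr 1; abel
      rw [h5]; ring
    rw [Finset.sum_congr rfl (fun i _ => h4 i), ← Finset.smul_sum, h3]
    split_ifs with hjk
    · subst hjk
      rw [sub_self, ω.zero_left, one_smul]
    · rw [h2 j k hjk, zero_smul, smul_zero]
  let Y : Matrix κ κ A := fun i k =>
    (topAnti ω d c J₀ (Fin.cons k (K k) : Fin (n + 1) → κ))⁻¹ • (B i k * E)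
  refine ⟨Y, fun i k => Submodule.smul_mem _ _ ?_, ?_⟩
  · have h3 := SetLike.mul_mem_graded (hB i k) hE
    rwa [add_zero] at h3
  · ext j k
    rw [Matrix.mul_apply, Matrix.one_apply]
    simp only [Y, mul_smul_comm, ← mul_assoc, ← Finset.smul_sum, ← Finset.sum_mul, hxB]
    split_ifs with hjk
    · rw [smul_mul_assoc, smul_smul, inv_mul_cancel₀ (h1 k), one_smul, hDE]
    · rw [zero_mul, smul_zero]

variable (𝒜 d) in
/-- The matrices `x` whose entries `x_{ji}` have the degrees `d_i - d_j`. -/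
def homMat : Subalgebra ℂ (Matrix κ κ A) where
  carrier := {x | ∀ j i, x j i ∈ 𝒜 (d i - d j)}
  mul_mem' {x y} hx hy j i := by
    rw [Matrix.mul_apply]
    refine Submodule.sum_mem _ fun k _ => ?_
    have h := SetLike.mul_mem_graded (hx j k) (hy k i)
    rwa [sub_add_sub_cancel'] at h
  add_mem' {x y} hx hy j i := add_mem (hx j i) (hy j i)
  algebraMap_mem' r j i := by
    rw [Matrix.algebraMap_matrix_apply]
    split_ifs with h
    · subst h
      rw [sub_self, Algebra.algebraMap_eq_smul_one]
      exact Submodule.smul_mem _ _ SetLike.GradedOne.one_mem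
    · exact zero_mem _

/-- A homogeneous matrix is invertible if and only if its determinant is. -/
theorem isUnit_cdet_iff (hA : OmegaComm ω 𝒜) (hc : c * c = 1) (hd : ∀ i, ω (d i) (d i) = c)
    (x : homMat 𝒜 d) (J₀ : Fin n ≃ κ) :
    IsUnit (cdet ω d c J₀ (x : Matrix κ κ A)) ↔ IsUnit x := by
  constructor
  · intro hD
    -- A right inverse y has an invertible determinant, so it has a right inverse z in turn. Then z
    -- = x, and y is an inverse on both sides.
    obtain ⟨y, hy, hxy⟩ := exists_right_inverse hA hc hd x.2 J₀ hD
    have h1 := cdet_mul hA hc hd x.2 hy J₀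
    rw [hxy, cdet_one] at h1
    have h2 : IsUnit (cdet ω d c J₀ y) := by
      obtain ⟨E, hE⟩ := hD.exists_left_inv
      have h3 : cdet ω d c J₀ y = E := by
        rw [← one_mul (cdet ω d c J₀ y), ← hE, mul_assoc, ← h1, mul_one]
      exact ⟨⟨E, cdet ω d c J₀ x, hE, by rw [← h3, ← h1]⟩, h3.symm⟩
    obtain ⟨z, hz, hyz⟩ := exists_right_inverse hA hc hd hy J₀ h2
    have h3 : (x : Matrix κ κ A) = z := by
      rw [← mul_one (x : Matrix κ κ A), ← hyz, ← mul_assoc, hxy, one_mul]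
    exact ⟨⟨x, ⟨y, hy⟩, Subtype.ext hxy, Subtype.ext (by rw [← h3] at hyz; exact hyz)⟩, rfl⟩
  · rintro ⟨u, rfl⟩
    have h1 := cdet_mul hA hc hd (u : homMat 𝒜 d).2 (u⁻¹.1 : homMat 𝒜 d).2 J₀
    have h2 := cdet_mul hA hc hd (u⁻¹.1 : homMat 𝒜 d).2 (u : homMat 𝒜 d).2 J₀
    have e1 : ((u : homMat 𝒜 d) : Matrix κ κ A) * (u⁻¹.1 : homMat 𝒜 d) = 1 :=
      congrArg Subtype.val u.mul_inv
    have e2 : ((u⁻¹.1 : homMat 𝒜 d) : Matrix κ κ A) * (u : homMat 𝒜 d) = 1 :=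
      congrArg Subtype.val u.inv_mul
    rw [e1, cdet_one] at h1
    rw [e2, cdet_one] at h2
    exact ⟨⟨_, _, h1.symm, h2.symm⟩, rfl⟩

end Det2

end

end Colour

namespace Colour

noncomputable section


/-! ### Matrices with both parities: odd entries are negligible. -/

section Super

variable {Γ : Type*} [AddCommGroup Γ] [DecidableEq Γ] {ω : CommFactor Γ}
variable {A : Type*} [Ring A] [Algebra ℂ A] {𝒜 : Γ → Submodule ℂ A} [GradedAlgebra 𝒜]

/-- Homogeneous elements commute with a up to nonzero scalars, so Aa = aA as subspaces. In the
semiring of subspaces the ideals Aa with a homogeneous therefore commute with each other. -/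
theorem OmegaComm.commute_span_top (hA : OmegaComm ω 𝒜) {α : Γ} {a : A} (ha : a ∈ 𝒜 α) :
    Commute (⊤ : Submodule ℂ A) (Submodule.span ℂ {a}) := by
  apply le_antisymm
  · rw [Submodule.mul_le]
    intro b _ a' ha'
    obtain ⟨r, rfl⟩ := Submodule.mem_span_singleton.1 ha'
    induction b using hom_induction 𝒜 with
    | h0 => rw [zero_mul]; exact zero_mem _
    | hadd b b' hb hb' => rw [add_mul]; exact add_mem (hb trivial) (hb' trivial)
    | h β b hb =>
      rw [mul_smul_comm, hA hb ha]
      exact Submodule.smul_mem _ _ (Submodule.smul_mem _ _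
        (Submodule.mul_mem_mul (Submodule.mem_span_singleton_self a) trivial))
  · rw [Submodule.mul_le]
    intro a' ha' b _
    obtain ⟨r, rfl⟩ := Submodule.mem_span_singleton.1 ha'
    induction b using hom_induction 𝒜 with
    | h0 => rw [mul_zero]; exact zero_mem _
    | hadd b b' hb hb' => rw [mul_add]; exact add_mem (hb trivial) (hb' trivial)
    | h β b hb =>
      rw [smul_mul_assoc, hA ha hb]
      exact Submodule.smul_mem _ _ (Submodule.smul_mem _ _
        (Submodule.mul_mem_mul trivial (Submodule.mem_span_singleton_self a)))

theorem OmegaComm.commute_span_span (hA : OmegaComm ω 𝒜) {α β : Γ} {a b : A} (ha : a ∈ 𝒜 α)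
    (hb : b ∈ 𝒜 β) : Commute (Submodule.span ℂ {a}) (Submodule.span ℂ {b}) := by
  have h : Submodule.span ℂ {a * b} = Submodule.span ℂ {b * a} := by
    rw [hA ha hb]
    exact Submodule.span_singleton_smul_eq (ω.ne_zero α β).isUnit _
  rw [Commute, SemiconjBy, Submodule.span_mul_span, Submodule.span_mul_span, Set.singleton_mul_singleton,
    Set.singleton_mul_singleton, h]

/-- The ideal generated by finitely many odd elements is nilpotent. -/
theorem OmegaComm.isNilpotent_sum_ideal (hA : OmegaComm ω 𝒜) {κ : Type*} (s : Finset κ) (x : κ → A)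
    (d : κ → Γ) (hx : ∀ p ∈ s, x p ∈ 𝒜 (d p)) (hd : ∀ p ∈ s, ω (d p) (d p) = -1) :
    IsNilpotent (∑ p ∈ s, (⊤ : Submodule ℂ A) * Submodule.span ℂ {x p}) := by
  classical
  have h1 : ∀ p ∈ s, ∀ q ∈ s, Commute ((⊤ : Submodule ℂ A) * Submodule.span ℂ {x p})
      ((⊤ : Submodule ℂ A) * Submodule.span ℂ {x q}) := fun p hp q hq =>
    Commute.mul_left ((Commute.refl _).mul_right (hA.commute_span_top (hx q hq)))
      ((hA.commute_span_top (hx p hp)).symm.mul_right (hA.commute_span_span (hx p hp) (hx q hq)))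
  -- An element of odd degree has square zero, so each ideal A x_p has square zero; a sum of
  -- commuting nilpotent elements of a semiring is nilpotent.
  have h2 : ∀ p ∈ s, IsNilpotent ((⊤ : Submodule ℂ A) * Submodule.span ℂ {x p}) := fun p hp => by
    refine ⟨2, ?_⟩
    rw [(hA.commute_span_top (hx p hp)).mul_pow, pow_two (Submodule.span ℂ {x p}),
      Submodule.span_mul_span, Set.singleton_mul_singleton, hA.sq_eq_zero (hd p hp) (hx p hp),
      Submodule.span_zero_singleton]
    exact Submodule.mul_bot _
  induction s using Finset.induction_on with
  | empty => rw [Finset.sum_empty]; exact IsNilpotent.zero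
  | insert p s hp ih =>
    rw [Finset.sum_insert hp]
    have e : ∀ q ∈ s, q ∈ insert p s := fun q hq => Finset.mem_insert_of_mem hq
    refine Commute.isNilpotent_add (Commute.sum_right _ _ _ fun q hq =>
      h1 p (Finset.mem_insert_self p s) q (e q hq)) (h2 p (Finset.mem_insert_self p s)) ?_
    exact ih (fun q hq => hx q (e q hq)) (fun q hq => hd q (e q hq))
      (fun q hq r hr => h1 q (e q hq) r (e r hr)) (fun q hq => h2 q (e q hq))

theorem le_sum_submodule {κ : Type*} [DecidableEq κ] {s : Finset κ} (f : κ → Submodule ℂ A) {p : κ}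
    (hp : p ∈ s) : f p ≤ ∑ q ∈ s, f q := by
  rw [← Finset.add_sum_erase s f hp, Submodule.add_eq_sup]
  exact le_sup_left

theorem isUnit_add_of_isNilpotent_mul {R : Type*} [Ring R] {x y : R} (hx : IsUnit x)
    (hy : ∀ r, IsNilpotent (r * y)) : IsUnit (x + y) := by
  obtain ⟨u, rfl⟩ := hx
  have h : (u : R) + y = u * (1 + ↑u⁻¹ * y) := by
    rw [mul_add, mul_one, ← mul_assoc, Units.mul_inv, one_mul]
  rw [h]
  exact u.isUnit.mul (hy _).isUnit_one_add

theorem isUnit_add_iff_of_isNilpotent_mul {R : Type*} [Ring R] {x y : R}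
    (hy : ∀ r, IsNilpotent (r * y)) : IsUnit (x + y) ↔ IsUnit x := by
  refine ⟨fun h => ?_, fun h => isUnit_add_of_isNilpotent_mul h hy⟩
  have h1 := isUnit_add_of_isNilpotent_mul (y := -y) h (fun r => by
    rw [mul_neg, isNilpotent_neg_iff]; exact hy r)
  rwa [add_neg_cancel_right] at h1

theorem matrix_pow_mem {κ : Type*} [Fintype κ] [DecidableEq κ] {I : Submodule ℂ A}
    {x : Matrix κ κ A} (hx : ∀ j i, x j i ∈ I) (n : ℕ) (j i : κ) : (x ^ n) j i ∈ I ^ n := by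
  induction n generalizing j i with
  | zero =>
    rw [pow_zero, pow_zero, Matrix.one_apply]
    split_ifs
    · exact Submodule.one_le.1 le_rfl
    · exact zero_mem _
  | succ n ih =>
    rw [pow_succ, pow_succ, Matrix.mul_apply]
    exact Submodule.sum_mem _ fun k _ => Submodule.mul_mem_mul (ih j k) (hx k i)

variable {ι : Type*} [Fintype ι] [DecidableEq ι] {d : ι → Γ}

variable (ω d) in
/-- The indices of the basis elements of `V_+` or `V_-`. -/
abbrev ParIdx (c : ℂ) : Type _ := {i : ι // ω (d i) (d i) = c}

open Classical in
instance (c : ℂ) : Fintype (ParIdx ω d c) := inferInstanceAs (Fintype {i : ι // ω (d i) (d i) = c})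

variable (ω) in
open Classical in
/-- The entries of a matrix with indices of equal parity. -/
def evenPart (d : ι → Γ) (x : Matrix ι ι A) : Matrix ι ι A := fun j i =>
  if ω (d j) (d j) = ω (d i) (d i) then x j i else 0

theorem evenPart_mem (x : homMat 𝒜 d) : evenPart ω d (x : Matrix ι ι A) ∈ homMat 𝒜 d := by
  intro j i
  unfold evenPart
  split_ifs
  · exact x.2 j i
  · exact zero_mem _

/-- The mixed factors ω(α, β) and ω(β, α) cancel and leave the product of the two parities. Hence
the entries outside the diagonal blocks have odd degrees. -/
theorem odd_of_ne {α β : Γ} (h : ω α α ≠ ω β β) : ω (β - α) (β - α) = -1 := by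
  have h1 := ω.skew α β
  have h2 : ω α α * ω β β = -1 := by
    rcases ω.self_eq α with h | h <;> rcases ω.self_eq β with h' | h' <;> simp_all
  rw [ω.sub_left, ω.sub_right, ω.sub_left]
  linear_combination (ω β α * ω α β) * h2 - h1

/-- The entries of x outside the diagonal blocks generate a nilpotent ideal. Every multiple of the
difference of x and its even part has its entries in that ideal and is nilpotent, and such a
difference does not affect invertibility. -/
theorem isUnit_evenPart_iff (hA : OmegaComm ω 𝒜) (x : homMat 𝒜 d) :
    IsUnit x ↔ IsUnit (⟨evenPart ω d (x : Matrix ι ι A), evenPart_mem x⟩ : homMat 𝒜 d) := by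
  classical
  set x₀ : homMat 𝒜 d := ⟨evenPart ω d (x : Matrix ι ι A), evenPart_mem x⟩
  let s : Finset (ι × ι) := Finset.univ.filter fun p => ω (d p.1) (d p.1) ≠ ω (d p.2) (d p.2)
  have hs : ∀ p ∈ s, ω (d p.1) (d p.1) ≠ ω (d p.2) (d p.2) := fun p hp =>
    (Finset.mem_filter.1 hp).2
  obtain ⟨n, hn⟩ := hA.isNilpotent_sum_ideal s (fun p => (x : Matrix ι ι A) p.1 p.2)
    (fun p => d p.2 - d p.1) (fun p _ => x.2 p.1 p.2) (fun p hp => odd_of_ne (hs p hp))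
  set I := ∑ p ∈ s, (⊤ : Submodule ℂ A) * Submodule.span ℂ {(x : Matrix ι ι A) p.1 p.2}
  have h1 : ∀ r : homMat 𝒜 d, IsNilpotent (r * (x - x₀)) := by
    intro r
    refine ⟨n, Subtype.ext ?_⟩
    have h2 : ∀ j i, ((r : Matrix ι ι A) * ((x - x₀ : homMat 𝒜 d) : Matrix ι ι A)) j i ∈ I := by
      intro j i
      rw [Matrix.mul_apply]
      refine Submodule.sum_mem _ fun k _ => ?_
      have h3 : ((x - x₀ : homMat 𝒜 d) : Matrix ι ι A) k i =
          (x : Matrix ι ι A) k i - evenPart ω d (x : Matrix ι ι A) k i := rfl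
      rw [h3, evenPart]
      split_ifs with h
      · rw [sub_self, mul_zero]; exact zero_mem _
      · rw [sub_zero]
        have h4 : (k, i) ∈ s := Finset.mem_filter.2 ⟨Finset.mem_univ _, h⟩
        exact le_sum_submodule (fun p : ι × ι => (⊤ : Submodule ℂ A) *
          Submodule.span ℂ {(x : Matrix ι ι A) p.1 p.2}) h4 (Submodule.mul_mem_mul trivial (Submodule.mem_span_singleton_self _))
    refine Matrix.ext fun j i => ?_
    have h3 := matrix_pow_mem h2 n j i
    rw [hn] at h3
    have h4 : ((r * (x - x₀)) ^ n : homMat 𝒜 d).1 =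
        ((r : Matrix ι ι A) * ((x - x₀ : homMat 𝒜 d) : Matrix ι ι A)) ^ n := rfl
    rw [h4, (Submodule.mem_bot ℂ).1 h3]
    rfl
  have h2 := isUnit_add_iff_of_isNilpotent_mul (x := x₀) h1
  rwa [add_sub_cancel] at h2

/-- The block of a matrix with indices of parity `c`. -/
def parBlock (x : homMat 𝒜 d) (c : ℂ) : homMat 𝒜 (fun i : ParIdx ω d c => d i) :=
  ⟨fun j i => (x : Matrix ι ι A) j i, fun j i => x.2 j i⟩

theorem sum_parIdx {M : Type*} [AddCommMonoid M] (c : ℂ) (f : ι → M)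
    (hf : ∀ i, ω (d i) (d i) ≠ c → f i = 0) : ∑ i : ParIdx ω d c, f i = ∑ i, f i :=
  Fintype.sum_of_injective _ Subtype.val_injective _ _
    (fun i hi => hf i fun h => hi ⟨⟨i, h⟩, rfl⟩) (fun _ => rfl)

open Classical in
/-- The matrix with one block of parity `c`. -/
def extendBlock {c : ℂ} (y : homMat 𝒜 (fun i : ParIdx ω d c => d i)) : homMat 𝒜 d :=
  ⟨fun j i => if h : ω (d j) (d j) = c ∧ ω (d i) (d i) = c then
      y.1 ⟨j, h.1⟩ ⟨i, h.2⟩ else 0, fun j i => by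
    beta_reduce
    split_ifs with h
    · exact y.2 ⟨j, h.1⟩ ⟨i, h.2⟩
    · exact zero_mem _⟩

theorem extendBlock_apply {c : ℂ} (y : homMat 𝒜 (fun i : ParIdx ω d c => d i)) {j i : ι}
    (hj : ω (d j) (d j) = c) (hi : ω (d i) (d i) = c) :
    (extendBlock y : Matrix ι ι A) j i = y.1 ⟨j, hj⟩ ⟨i, hi⟩ := dif_pos ⟨hj, hi⟩

theorem extendBlock_left {c : ℂ} (y : homMat 𝒜 (fun i : ParIdx ω d c => d i)) {j i : ι}
    (hj : ω (d j) (d j) ≠ c) : (extendBlock y : Matrix ι ι A) j i = 0 := dif_neg fun h => hj h.1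

theorem extendBlock_right {c : ℂ} (y : homMat 𝒜 (fun i : ParIdx ω d c => d i)) {j i : ι}
    (hi : ω (d i) (d i) ≠ c) : (extendBlock y : Matrix ι ι A) j i = 0 := dif_neg fun h => hi h.2

theorem evenPart_apply (x : Matrix ι ι A) {j i : ι} (h : ω (d j) (d j) = ω (d i) (d i)) :
    evenPart ω d x j i = x j i := if_pos h

theorem evenPart_apply_ne (x : Matrix ι ι A) {j i : ι} (h : ω (d j) (d j) ≠ ω (d i) (d i)) :
    evenPart ω d x j i = 0 := if_neg h

open Classical in
-- As the even part is block diagonal, its product with the inverse of one block, extended by zero,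
-- is the idempotent of the parity c.
theorem evenPart_mul_extendBlock (x : homMat 𝒜 d) {c : ℂ}
    {y : homMat 𝒜 (fun i : ParIdx ω d c => d i)} (h : parBlock x c * y = 1) (j i : ι) :
    (evenPart ω d (x : Matrix ι ι A) * (extendBlock y : homMat 𝒜 d)) j i =
      if ω (d j) (d j) = c ∧ j = i then 1 else 0 := by
  rw [Matrix.mul_apply]
  by_cases hj : ω (d j) (d j) = c
  · by_cases hi : ω (d i) (d i) = c
    · have h1 := congrFun (congrFun (congrArg Subtype.val h) ⟨j, hj⟩) ⟨i, hi⟩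
      have h2 : ∑ k : ParIdx ω d c, (x : Matrix ι ι A) j k * y.1 k ⟨i, hi⟩ =
          if j = i then 1 else 0 := by
        refine Eq.trans h1 ((Matrix.one_apply).trans ?_)
        simp only [Subtype.mk.injEq]
      rw [← sum_parIdx (ω := ω) (d := d) c _ (fun k hk => by
        rw [extendBlock_left y hk, mul_zero])]
      simp only [hj, true_and]
      rw [← h2]
      refine Finset.sum_congr rfl fun k _ => ?_
      rw [extendBlock_apply y k.2 hi, evenPart_apply _ (hj.trans k.2.symm)]
    · rw [if_neg (by rintro ⟨-, rfl⟩; exact hi hj)]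
      exact Finset.sum_eq_zero fun k _ => by rw [extendBlock_right y hi, mul_zero]
  · rw [if_neg (fun h => hj h.1)]
    refine Finset.sum_eq_zero fun k _ => ?_
    by_cases hk : ω (d k) (d k) = c
    · rw [evenPart_apply_ne _ (fun h => hj (h.trans hk)), zero_mul]
    · rw [extendBlock_left y hk, mul_zero]

open Classical in
theorem extendBlock_mul_evenPart (x : homMat 𝒜 d) {c : ℂ}
    {y : homMat 𝒜 (fun i : ParIdx ω d c => d i)} (h : y * parBlock x c = 1) (j i : ι) :
    ((extendBlock y : homMat 𝒜 d) * evenPart ω d (x : Matrix ι ι A)) j i =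
      if ω (d j) (d j) = c ∧ j = i then 1 else 0 := by
  rw [Matrix.mul_apply]
  by_cases hj : ω (d j) (d j) = c
  · by_cases hi : ω (d i) (d i) = c
    · have h1 := congrFun (congrFun (congrArg Subtype.val h) ⟨j, hj⟩) ⟨i, hi⟩
      have h2 : ∑ k : ParIdx ω d c, y.1 ⟨j, hj⟩ k * (x : Matrix ι ι A) k i =
          if j = i then 1 else 0 := by
        refine Eq.trans h1 ((Matrix.one_apply).trans ?_)
        simp only [Subtype.mk.injEq]
      rw [← sum_parIdx (ω := ω) (d := d) c _ (fun k hk => by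
        rw [extendBlock_right y hk, zero_mul])]
      simp only [hj, true_and]
      rw [← h2]
      refine Finset.sum_congr rfl fun k _ => ?_
      rw [extendBlock_apply y hj k.2, evenPart_apply _ (k.2.trans hi.symm)]
    · rw [if_neg (by rintro ⟨-, rfl⟩; exact hi hj)]
      refine Finset.sum_eq_zero fun k _ => ?_
      by_cases hk : ω (d k) (d k) = c
      · rw [evenPart_apply_ne _ (fun h => hi (h.symm.trans hk)), mul_zero]
      · rw [extendBlock_right y hk, zero_mul]
  · rw [if_neg (fun h => hj h.1)]
    exact Finset.sum_eq_zero fun k _ => by rw [extendBlock_left y hj, zero_mul]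

/-- In the c-block of a product with a block diagonal matrix only middle indices of parity c
contribute, so the c-block of the inverse is the inverse of the c-block. -/
theorem isUnit_parBlock {x : homMat 𝒜 d}
    (h : IsUnit (⟨evenPart ω d (x : Matrix ι ι A), evenPart_mem x⟩ : homMat 𝒜 d)) (c : ℂ) :
    IsUnit (parBlock (ω := ω) x c) := by
  obtain ⟨u, hu⟩ := h
  have e1 : evenPart ω d (x : Matrix ι ι A) * (u⁻¹.1 : homMat 𝒜 d) = 1 := by
    have := congrArg Subtype.val u.mul_inv
    rw [hu] at this
    exact this
  have e2 : ((u⁻¹.1 : homMat 𝒜 d) : Matrix ι ι A) * evenPart ω d (x : Matrix ι ι A) = 1 := by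
    have := congrArg Subtype.val u.inv_mul
    rw [hu] at this
    exact this
  refine ⟨⟨parBlock x c, parBlock u⁻¹.1 c, ?_, ?_⟩, rfl⟩
  · refine Subtype.ext (Matrix.ext fun j i => ?_)
    have h1 := congrFun (congrFun e1 j) i
    rw [Matrix.mul_apply, ← sum_parIdx (ω := ω) (d := d) c _ (fun k hk => by
        rw [evenPart_apply_ne _ (fun h => hk (h.symm.trans j.2)), zero_mul])] at h1
    refine Eq.trans ?_ (h1.trans ?_)
    · refine Eq.trans (Matrix.mul_apply) (Finset.sum_congr rfl fun k _ => ?_)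
      rw [evenPart_apply _ (j.2.trans k.2.symm)]
      rfl
    · refine Eq.trans Matrix.one_apply (Eq.trans ?_ Matrix.one_apply.symm)
      simp only [Subtype.ext_iff]
  · refine Subtype.ext (Matrix.ext fun j i => ?_)
    have h1 := congrFun (congrFun e2 j) i
    rw [Matrix.mul_apply, ← sum_parIdx (ω := ω) (d := d) c _ (fun k hk => by
        rw [evenPart_apply_ne _ (fun h => hk (h.trans i.2)), mul_zero])] at h1
    refine Eq.trans ?_ (h1.trans ?_)
    · refine Eq.trans (Matrix.mul_apply) (Finset.sum_congr rfl fun k _ => ?_)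
      rw [evenPart_apply _ (k.2.trans i.2.symm)]
      rfl
    · refine Eq.trans Matrix.one_apply (Eq.trans ?_ Matrix.one_apply.symm)
      simp only [Subtype.ext_iff]

theorem isUnit_of_parBlock {x : homMat 𝒜 d} (h : IsUnit (parBlock (ω := ω) x 1))
    (h' : IsUnit (parBlock (ω := ω) x (-1))) :
    IsUnit (⟨evenPart ω d (x : Matrix ι ι A), evenPart_mem x⟩ : homMat 𝒜 d) := by
  classical
  obtain ⟨u, hu⟩ := h
  obtain ⟨v, hv⟩ := h'
  -- Each parity is 1 or -1, so the two idempotents add up to 1 and the sum of the extended inverses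
  -- of the blocks is an inverse.
  have key : ∀ j i : ι, ((if ω (d j) (d j) = 1 ∧ j = i then 1 else 0 : A) +
      if ω (d j) (d j) = -1 ∧ j = i then 1 else 0) = (1 : Matrix ι ι A) j i := by
    intro j i
    rw [Matrix.one_apply]
    rcases ω.self_eq (d j) with h | h <;> simp [h, eq_comm] <;> norm_num
  refine ⟨⟨_, extendBlock u⁻¹.1 + extendBlock v⁻¹.1, ?_, ?_⟩, rfl⟩
  · refine Subtype.ext (Matrix.ext fun j i => ?_)
    refine Eq.trans ?_ (key j i)
    rw [← evenPart_mul_extendBlock x (y := u⁻¹.1) (by rw [← hu, Units.mul_inv]),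
      ← evenPart_mul_extendBlock x (y := v⁻¹.1) (by rw [← hv, Units.mul_inv]), ← Matrix.add_apply,
      ← mul_add]
    rfl
  · refine Subtype.ext (Matrix.ext fun j i => ?_)
    refine Eq.trans ?_ (key j i)
    rw [← extendBlock_mul_evenPart x (y := u⁻¹.1) (by rw [← hu, Units.inv_mul]),
      ← extendBlock_mul_evenPart x (y := v⁻¹.1) (by rw [← hv, Units.inv_mul]), ← Matrix.add_apply,
      ← add_mul]
    rfl

variable (ω d) in
/-- The determinant of the block of parity `c` of a matrix. -/
def parDet (c : ℂ) {n : ℕ} (J₀ : Fin n ≃ ParIdx ω d c) (x : Matrix ι ι A) : A :=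
  cdet ω (fun i : ParIdx ω d c => d i) c J₀ (x.submatrix Subtype.val Subtype.val)

theorem map_parDet {B : Type*} [Ring B] [Algebra ℂ B] (φ : A →ₐ[ℂ] B) {c : ℂ} {n : ℕ}
    (J₀ : Fin n ≃ ParIdx ω d c) (x : Matrix ι ι A) :
    φ (parDet ω d c J₀ x) = parDet ω d c J₀ (x.map φ) := map_cdet φ _ _

theorem parDet_mem {c : ℂ} (hc : c * c = 1) {n : ℕ} (J₀ : Fin n ≃ ParIdx ω d c) (x : homMat 𝒜 d) :
    parDet ω d c J₀ (x : Matrix ι ι A) ∈ 𝒜 0 :=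
  cdet_mem hc (fun i => i.2) (parBlock x c).2 J₀

/-- A homogeneous matrix is invertible if and only if the determinants of its two diagonal blocks
are. -/
theorem isUnit_iff_parDet (hA : OmegaComm ω 𝒜) (x : homMat 𝒜 d) {m n : ℕ}
    (J₁ : Fin m ≃ ParIdx ω d 1) (J₂ : Fin n ≃ ParIdx ω d (-1)) :
    IsUnit x ↔ IsUnit (parDet ω d 1 J₁ (x : Matrix ι ι A)) ∧
      IsUnit (parDet ω d (-1) J₂ (x : Matrix ι ι A)) := by
  have h1 : IsUnit (parDet ω d 1 J₁ (x : Matrix ι ι A)) ↔ IsUnit (parBlock (ω := ω) x 1) :=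
    isUnit_cdet_iff hA (by norm_num) (fun i => i.2) (parBlock x 1) J₁
  have h2 : IsUnit (parDet ω d (-1) J₂ (x : Matrix ι ι A)) ↔ IsUnit (parBlock (ω := ω) x (-1)) :=
    isUnit_cdet_iff hA (by norm_num) (fun i => i.2) (parBlock x (-1)) J₂
  rw [h1, h2, isUnit_evenPart_iff hA]
  exact ⟨fun h => ⟨isUnit_parBlock h _, isUnit_parBlock h _⟩, fun h => isUnit_of_parBlock h.1 h.2⟩

end Super

end

end Colour

namespace Colour

noncomputable section


/-! ### The antipode of U and the representation on V^*. -/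

section Antipode

variable {Γ : Type*} [AddCommGroup Γ] [DecidableEq Γ] (ω : CommFactor Γ)
variable {V : Type*} [AddCommGroup V] [Module ℂ V] [FiniteDimensional ℂ V]
variable {𝒱 : Γ → Submodule ℂ V} [DirectSum.Decomposition 𝒱]

theorem uS_one : uS ω 𝒱 1 = 1 := map_one (uAntipode ω 𝒱)

theorem uS_ι (X : Module.End ℂ V) : uS ω 𝒱 (UEnv.ι ω 𝒱 X) = -UEnv.ι ω 𝒱 X := by
  have h : uAntipode ω 𝒱 (UEnv.ι ω 𝒱 X) = -COp.of ω (uGr ω 𝒱) (UEnv.ι ω 𝒱 X) :=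
    UEnv.lift_ι ω 𝒱 _ _ X
  exact congrArg (COp.of ω (uGr ω 𝒱)).symm h

theorem uS_mul {α β : Γ} {x y : UEnv ω 𝒱} (hx : x ∈ uGr ω 𝒱 α) (hy : y ∈ uGr ω 𝒱 β) :
    uS ω 𝒱 (x * y) = ω α β • (uS ω 𝒱 y * uS ω 𝒱 x) :=
  congrArg (COp.of ω (uGr ω 𝒱)).symm ((map_mul (uAntipode ω 𝒱) x y).trans
    (COp.of_mul_of ω (uGr ω 𝒱) (uS_mem ω 𝒱 hx) (uS_mem ω 𝒱 hy)))

theorem uS_ι_mul {α β : Γ} {X : Module.End ℂ V} {x : UEnv ω 𝒱} (hX : X ∈ endGr 𝒱 α)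
    (hx : x ∈ uGr ω 𝒱 β) :
    uS ω 𝒱 (UEnv.ι ω 𝒱 X * x) = -(ω α β • (uS ω 𝒱 x * UEnv.ι ω 𝒱 X)) := by
  rw [uS_mul ω (UEnv.ι_mem ω 𝒱 hX) hx, uS_ι]
  exact (congrArg _ (mul_neg (uS ω 𝒱 x) (UEnv.ι ω 𝒱 X))).trans (smul_neg _ _)

/-- The factors ω(α, β) and ω(β, α) from the two reversals of a product cancel, and so do the two
signs on a generator. -/
theorem uS_uS {γ : Γ} {x : UEnv ω 𝒱} (hx : x ∈ uGr ω 𝒱 γ) : uS ω 𝒱 (uS ω 𝒱 x) = x := by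
  refine UEnv.induction (P := fun _ x => uS ω 𝒱 (uS ω 𝒱 x) = x) (by simp) ?_ ?_ ?_ ?_ hx
  · intro γ x y hx hy; rw [map_add, map_add, hx, hy]
  · intro γ c x hx; rw [map_smul, map_smul, hx]
  · rw [uS_one, uS_one]
  · intro α β X x hX hx ih
    rw [uS_ι_mul ω hX hx, map_neg, map_smul, uS_mul ω (uS_mem ω 𝒱 hx) (UEnv.ι_mem ω 𝒱 hX), ih,
      uS_ι, smul_smul, ω.skew, one_smul]
    exact (congrArg _ (neg_mul (UEnv.ι ω 𝒱 X) x)).trans (neg_neg _)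

theorem dualRep_mem {α β : Γ} {x : UEnv ω 𝒱} {w : Module.Dual ℂ V} (hx : x ∈ uGr ω 𝒱 α)
    (hw : w ∈ dualGr 𝒱 β) : dualRep ω 𝒱 x w ∈ dualGr 𝒱 (α + β) := by
  rw [mem_dualGr]
  intro γ v hv h
  rw [dualRep_apply ω 𝒱 hx hw]
  have h1 := natRep_mem ω 𝒱 (uS_mem ω 𝒱 hx) γ v hv
  rw [(mem_dualGr 𝒱).1 hw _ _ h1 (fun h' => h (by rw [← h']; abel)), mul_zero]

theorem dualRep_mul {α β : Γ} {x y : UEnv ω 𝒱} (hx : x ∈ uGr ω 𝒱 α) (hy : y ∈ uGr ω 𝒱 β) :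
    dualRep ω 𝒱 (x * y) = dualRep ω 𝒱 x * dualRep ω 𝒱 y := by
  ext w v
  induction w using hom_induction (dualGr 𝒱) with
  | h0 => simp
  | hadd w w' h h' => simp only [map_add, LinearMap.add_apply, h, h']
  | h γ w hw =>
    rw [Module.End.mul_apply, dualRep_apply ω 𝒱 (SetLike.mul_mem_graded hx hy) hw,
      dualRep_apply ω 𝒱 hx (dualRep_mem ω hy hw), dualRep_apply ω 𝒱 hy hw, uS_mul ω hx hy,
      map_smul, LinearMap.smul_apply, map_smul, map_mul, Module.End.mul_apply, ω.add_left,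
      ω.add_right, smul_eq_mul]
    ring

end Antipode

/-! ### The dual of U: commutativity, right translations and the transposed antipode. -/

section UDual

variable {Γ : Type*} [AddCommGroup Γ] [DecidableEq Γ] (ω : CommFactor Γ)
variable {V : Type*} [AddCommGroup V] [Module ℂ V] [FiniteDimensional ℂ V]
variable {𝒱 : Γ → Submodule ℂ V} [DirectSum.Decomposition 𝒱]

namespace UDual

theorem one_mem_uGr : (1 : UEnv ω 𝒱) ∈ uGr ω 𝒱 0 := SetLike.GradedOne.one_mem

@[simp] theorem smul_eval (c : ℂ) (f : UDual ω 𝒱) (x : UEnv ω 𝒱) :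
    eval (c • f) x = c * eval f x := rfl

variable (𝒱) in
/-- Evaluation, as a linear map in the functional. -/
def evalₗ (x : UEnv ω 𝒱) : UDual ω 𝒱 →ₗ[ℂ] ℂ where
  toFun f := eval f x
  map_add' _ _ := rfl
  map_smul' _ _ := rfl

theorem sum_eval {κ : Type*} (s : Finset κ) (f : κ → UDual ω 𝒱) (x : UEnv ω 𝒱) :
    eval (∑ i ∈ s, f i) x = ∑ i ∈ s, eval (f i) x := map_sum (evalₗ ω 𝒱 x) f s

theorem eval_neg (f : UDual ω 𝒱) (x : UEnv ω 𝒱) : eval f (-x) = -eval f x := map_neg _ _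

/-- A functional of degree β is nonzero only on elements of degree -β, where the scaling is the
constant ω(α, -β) = ω(β, α). -/
theorem scale_of_mem (α : Γ) {β : Γ} {f : UDual ω 𝒱} (hf : f ∈ gr ω 𝒱 β) :
    scale ω 𝒱 α f = ω β α • f := by
  refine ext_hom fun γ x hx => ?_
  rw [scale_eval ω 𝒱 α f hx, smul_eval]
  by_cases h : β + γ = 0
  · rw [← neg_eq_of_add_eq_zero_right h, ω.neg_right]
  · rw [mem_gr.1 hf γ x hx h, mul_zero, mul_zero]

/-- The dual of `U` is `ω`-commutative. -/
theorem omegaComm : OmegaComm ω (gr ω 𝒱) := by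
  intro α β f g hf hg
  refine ext_hom fun γ x hx => ?_
  revert α β f g
  refine UEnv.induction (P := fun _ x => ∀ (α β : Γ) (f g : UDual ω 𝒱), f ∈ gr ω 𝒱 α →
    g ∈ gr ω 𝒱 β → eval (f * g) x = eval (ω α β • (g * f)) x) (by simp) ?_ ?_ ?_ ?_ hx
  · intro γ x y hx hy α β f g hf hg; rw [eval_add, eval_add, hx _ _ f g hf hg, hy _ _ f g hf hg]
  · intro γ c x hx α β f g hf hg; rw [eval_smul, eval_smul, hx _ _ f g hf hg]
  · intro α β f g hf hg
    rw [smul_eval, mul_eval_one, mul_eval_one]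
    by_cases h : α = 0
    · rw [h, ω.zero_left]; ring
    · rw [mem_gr.1 hf 0 1 (one_mem_uGr ω) (by rwa [add_zero])]; ring
  -- Translation by X is a twisted derivation because X is primitive. So the value at Xx is a
  -- combination of values at x of products with one translated factor, and the induction hypothesis
  -- applies to both orders.
  · intro δ γ X x hX hx ih α β f g hf hg
    rw [smul_eval, ← transL_eval, ← transL_eval, transL_mul ω 𝒱 hX, transL_mul ω 𝒱 hX,
      scale_of_mem ω δ hf, scale_of_mem ω δ hg, add_eval, add_eval, mul_smul_comm, smul_eval,
      mul_smul_comm, smul_eval, ih _ _ _ _ (transL_mem ω 𝒱 hX hf) hg,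
      ih _ _ _ _ hf (transL_mem ω 𝒱 hX hg), smul_eval, smul_eval, ω.add_left, ω.add_right]
    linear_combination (ω α β * eval (g * transL ω 𝒱 X f) x) * ω.skew δ β

/-- The functional `x ↦ ⟨f, x X⟩`. -/
def transR (X : Module.End ℂ V) (f : UDual ω 𝒱) : UDual ω 𝒱 :=
  of ω 𝒱 ((of ω 𝒱).symm f ∘ₗ LinearMap.mulRight ℂ (UEnv.ι ω 𝒱 X))

theorem transR_eval (X : Module.End ℂ V) (f : UDual ω 𝒱) (x : UEnv ω 𝒱) :
    eval (transR ω X f) x = eval f (x * UEnv.ι ω 𝒱 X) := rfl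

theorem transR_mem {α γ : Γ} {X : Module.End ℂ V} (hX : X ∈ endGr 𝒱 α) {f : UDual ω 𝒱}
    (hf : f ∈ gr ω 𝒱 γ) : transR ω X f ∈ gr ω 𝒱 (γ + α) := by
  rw [mem_gr] at hf ⊢
  intro β x hx h
  rw [transR_eval]
  refine hf (β + α) _ (SetLike.mul_mem_graded hx (UEnv.ι_mem ω 𝒱 hX)) ?_
  rwa [add_comm β α, ← add_assoc]

/-- The counterpart of `transL_mul`, from the multiplication of Δ(x) by X ⊗ 1 + 1 ⊗ X on the right.
Here the factor depends on the first functional, which is therefore taken to be homogeneous. -/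
theorem transR_mul {α β : Γ} {X : Module.End ℂ V} (hX : X ∈ endGr 𝒱 α) {f : UDual ω 𝒱}
    (hf : f ∈ gr ω 𝒱 β) (g : UDual ω 𝒱) :
    transR ω X (f * g) = transR ω X f * g + ω α β • (f * transR ω X g) := by
  have hX' := UEnv.ι_mem ω 𝒱 hX
  have h1 : (1 : UEnv ω 𝒱) ∈ uGr ω 𝒱 0 := SetLike.GradedOne.one_mem
  have key : ∀ z : CTensor ω (uGr ω 𝒱) (uGr ω 𝒱),
      colourPair ω (uGr ω 𝒱) ((of ω 𝒱).symm f ⊗ₜ (of ω 𝒱).symm g)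
        ((CTensor.of ω (uGr ω 𝒱) (uGr ω 𝒱)).symm (z * uComulAux ω 𝒱 X)) =
      colourPair ω (uGr ω 𝒱) ((of ω 𝒱).symm (transR ω X f) ⊗ₜ (of ω 𝒱).symm g)
        ((CTensor.of ω (uGr ω 𝒱) (uGr ω 𝒱)).symm z) +
      ω α β * colourPair ω (uGr ω 𝒱) ((of ω 𝒱).symm f ⊗ₜ (of ω 𝒱).symm (transR ω X g))
        ((CTensor.of ω (uGr ω 𝒱) (uGr ω 𝒱)).symm z) := by
    intro z
    induction z using CTensor.induction with
    | h0 => simp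
    | hadd x y hx hy => rw [add_mul, map_add, map_add, hx, hy]; simp only [map_add]; ring
    | h γ δ a b ha hb =>
      rw [uComulAux_apply, mul_add, CTensor.tmul_mul_tmul ω _ _ _ hb hX',
        CTensor.tmul_mul_tmul ω _ _ _ hb h1]
      simp only [CTensor.tmul, map_add, map_smul, LinearEquiv.symm_apply_apply, mul_one]
      rw [colourPair_tmul ω _ _ _ (SetLike.mul_mem_graded ha hX') hb,
        colourPair_tmul ω _ _ _ ha (SetLike.mul_mem_graded hb hX'),
        colourPair_tmul ω _ _ _ ha hb, colourPair_tmul ω _ _ _ ha hb]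
      change _ = ω γ δ * (eval f (a * UEnv.ι ω 𝒱 X) * eval g b) +
        ω α β * (ω γ δ * (eval f a * eval g (b * UEnv.ι ω 𝒱 X)))
      rw [ω.add_left, ω.add_right, ω.zero_right]
      simp only [smul_eq_mul]
      change ω δ α * (ω γ δ * ω α δ * (eval f (a * UEnv.ι ω 𝒱 X) * eval g b)) +
        1 * (ω γ δ * ω γ α * (eval f a * eval g (b * UEnv.ι ω 𝒱 X))) = _
      -- If f does not vanish on a, then γ = -β.
      have h2 : ω γ α * eval f a = ω α β * eval f a := by
        by_cases h : β + γ = 0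
        · rw [← neg_eq_of_add_eq_zero_right h, ω.neg_left]
        · rw [mem_gr.1 hf γ a ha h, mul_zero, mul_zero]
      linear_combination ω γ δ * (eval f (a * UEnv.ι ω 𝒱 X) * eval g b) * ω.skew δ α +
        ω γ δ * eval g (b * UEnv.ι ω 𝒱 X) * h2
  refine ext' fun x => ?_
  rw [transR_eval, mul_eval, map_mul, add_eval, smul_eval, mul_eval, mul_eval]
  have h : uComul ω 𝒱 (UEnv.ι ω 𝒱 X) = uComulAux ω 𝒱 X := UEnv.lift_ι ω 𝒱 _ _ X
  rw [h]
  exact key _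

/-- The functional `x ↦ ⟨f, S(x)⟩`. -/
def antipode : UDual ω 𝒱 →ₗ[ℂ] UDual ω 𝒱 where
  toFun f := of ω 𝒱 ((of ω 𝒱).symm f ∘ₗ uS ω 𝒱)
  map_add' _ _ := rfl
  map_smul' _ _ := rfl

theorem antipode_eval (f : UDual ω 𝒱) (x : UEnv ω 𝒱) :
    eval (antipode ω f) x = eval f (uS ω 𝒱 x) := rfl

theorem antipode_mem {γ : Γ} {f : UDual ω 𝒱} (hf : f ∈ gr ω 𝒱 γ) : antipode ω f ∈ gr ω 𝒱 γ := by
  rw [mem_gr] at hf ⊢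
  exact fun β x hx h => hf β _ (uS_mem ω 𝒱 hx) h

theorem antipode_antipode (f : UDual ω 𝒱) : antipode ω (antipode ω f) = f :=
  ext_hom fun γ x hx => by rw [antipode_eval, antipode_eval, uS_uS ω hx]

theorem antipode_one : antipode ω (1 : UDual ω 𝒱) = 1 := by
  refine ext_hom fun γ x hx => ?_
  refine UEnv.induction (P := fun _ x => eval (antipode ω (1 : UDual ω 𝒱)) x = eval 1 x)
    (by simp) ?_ ?_ ?_ ?_ hx
  · intro γ x y hx hy; rw [eval_add, eval_add, hx, hy]
  · intro γ c x hx; rw [eval_smul, eval_smul, hx]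
  · rw [antipode_eval, uS_one]
  · intro β γ X x hX hx ih
    rw [antipode_eval, uS_ι_mul ω hX hx, eval_neg, eval_smul, one_eval, one_eval, map_mul, map_mul]
    have h : uCounit ω 𝒱 (UEnv.ι ω 𝒱 X) = 0 := UEnv.lift_ι ω 𝒱 _ _ X
    rw [h]; ring

/-- S reverses products, so a left translation after S is a right translation before S. The sign
comes from S(X) = -X, and the factor is ω(α, γ) for the only degree γ = -(β + α) on which both sides
can be nonzero. -/
theorem transL_antipode {α β : Γ} {X : Module.End ℂ V} (hX : X ∈ endGr 𝒱 α) {f : UDual ω 𝒱}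
    (hf : f ∈ gr ω 𝒱 β) :
    transL ω 𝒱 X (antipode ω f) = -(ω (β + α) α • antipode ω (transR ω X f)) := by
  refine ext_hom fun γ x hx => ?_
  rw [transL_eval, antipode_eval, uS_ι_mul ω hX hx, eval_neg, eval_smul, ← transR_eval,
    ← antipode_eval]
  change _ = -(ω (β + α) α * eval (antipode ω (transR ω X f)) x)
  by_cases h : β + α + γ = 0
  · rw [← neg_eq_of_add_eq_zero_right h, ω.neg_right]
  · rw [mem_gr.1 (antipode_mem ω (transR_mem ω hX hf)) γ x hx h, mul_zero, mul_zero]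

/-- There is no reversal and no factor: on an `ω`-commutative algebra an anti-homomorphism is a
homomorphism. Left translation by X reduces the claim to shorter words in U. -/
theorem antipode_mul {α β : Γ} {f g : UDual ω 𝒱} (hf : f ∈ gr ω 𝒱 α) (hg : g ∈ gr ω 𝒱 β) :
    antipode ω (f * g) = antipode ω f * antipode ω g := by
  refine ext_hom fun γ x hx => ?_
  refine UEnv.induction (P := fun _ x => ∀ (α β : Γ) (f g : UDual ω 𝒱), f ∈ gr ω 𝒱 α →
    g ∈ gr ω 𝒱 β → eval (antipode ω (f * g)) x = eval (antipode ω f * antipode ω g) x)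
    (by simp) ?_ ?_ ?_ ?_ hx α β f g hf hg
  · intro γ x y hx hy α β f g hf hg; rw [eval_add, eval_add, hx _ _ f g hf hg, hy _ _ f g hf hg]
  · intro γ c x hx α β f g hf hg; rw [eval_smul, eval_smul, hx _ _ f g hf hg]
  · intro α β f g hf hg
    rw [antipode_eval, uS_one, mul_eval_one, mul_eval_one, antipode_eval, antipode_eval, uS_one]
  · intro δ γ X x hX hx ih α β f g hf hg
    rw [← transL_eval, ← transL_eval, transL_mul ω 𝒱 hX, scale_of_mem ω δ (antipode_mem ω hg),
      transL_antipode ω hX (SetLike.mul_mem_graded hf hg), transL_antipode ω hX hf,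
      transL_antipode ω hX hg, transR_mul ω hX hf, map_add, map_smul, smul_add, neg_mul,
      mul_neg, smul_mul_smul_comm, mul_smul_comm, smul_smul]
    change -(_ * eval (antipode ω (transR ω X f * g)) x + _ * eval (antipode ω (f * transR ω X g)) x) =
      -(_ * eval (antipode ω (transR ω X f) * antipode ω g) x) +
      -(_ * eval (antipode ω f * antipode ω (transR ω X g)) x)
    rw [ih _ _ _ _ (transR_mem ω hX hf) hg, ih _ _ _ _ hf (transR_mem ω hX hg)]
    simp only [ω.add_left]
    linear_combination (-(ω β δ * ω δ δ) *
      eval (antipode ω f * antipode ω (transR ω X g)) x) * ω.skew α δ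

end UDual

theorem OmegaComm.subGr (A : Subalgebra ℂ (UDual ω 𝒱)) : OmegaComm ω (subGr ω A) :=
  fun _ _ _ _ ha hb => Subtype.ext (UDual.omegaComm ω ha hb)

end UDual

/-! ### Matrix coefficients, and the inverse of the matrix t. -/

section MatCoeff

variable {Γ : Type*} [AddCommGroup Γ] [DecidableEq Γ] (ω : CommFactor Γ)
variable {V : Type*} [AddCommGroup V] [Module ℂ V] [FiniteDimensional ℂ V]
variable {𝒱 : Γ → Submodule ℂ V} [DirectSum.Decomposition 𝒱]
variable {ι : Type*} [Fintype ι] [DecidableEq ι]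

open UDual

/-- A graded representation with a homogeneous basis. -/
structure IsGradedRep {W : Type*} [AddCommGroup W] [Module ℂ W]
    (π : UEnv ω 𝒱 →ₗ[ℂ] Module.End ℂ W) (b : Module.Basis ι ℂ W) (d : ι → Γ) : Prop where
  map_mul : ∀ {α β : Γ} {x y : UEnv ω 𝒱}, x ∈ uGr ω 𝒱 α → y ∈ uGr ω 𝒱 β → π (x * y) = π x * π y
  map_one : π 1 = 1
  coord : ∀ {α : Γ} {x : UEnv ω 𝒱}, x ∈ uGr ω 𝒱 α → ∀ j i, α + d i ≠ d j →
    b.coord j (π x (b i)) = 0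

variable {ω} {W : Type*} [AddCommGroup W] [Module ℂ W]
  {π : UEnv ω 𝒱 →ₗ[ℂ] Module.End ℂ W} {b : Module.Basis ι ℂ W} {d : ι → Γ}

theorem IsGradedRep.mem (h : IsGradedRep ω π b d) (j i : ι) :
    matCoeff ω 𝒱 π b d j i ∈ gr ω 𝒱 (d i - d j) := by
  rw [mem_gr]
  intro β x hx h'
  rw [matCoeff_eval ω 𝒱 π b d j i hx, h.coord hx j i (fun h'' => h' (by rw [← h'']; abel)), mul_zero]

theorem IsGradedRep.eval_one (h : IsGradedRep ω π b d) (j i : ι) :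
    eval (matCoeff ω 𝒱 π b d j i) 1 = if j = i then 1 else 0 := by
  rw [matCoeff_eval ω 𝒱 π b d j i (one_mem_uGr ω), h.map_one, ω.zero_right, Module.End.one_apply,
    Module.Basis.coord_apply, Module.Basis.repr_self, Finsupp.single_apply, one_mul]
  simp only [eq_comm]

/-- Insert the basis between x and y: the coefficient of b_k in y b_i vanishes unless d(y) + d_i =
d_k, and in that case the scalars agree. This is the formula Δ(t_{ji}) = ∑ t_{jk} ⊗ t_{ki} in terms
of the pairing. -/
theorem IsGradedRep.eval_mul (h : IsGradedRep ω π b d) (j i : ι) {α β : Γ} {x y : UEnv ω 𝒱}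
    (hx : x ∈ uGr ω 𝒱 α) (hy : y ∈ uGr ω 𝒱 β) :
    eval (matCoeff ω 𝒱 π b d j i) (x * y) =
      ∑ k, ω α β * (eval (matCoeff ω 𝒱 π b d j k) x * eval (matCoeff ω 𝒱 π b d k i) y) := by
  rw [matCoeff_eval ω 𝒱 π b d j i (SetLike.mul_mem_graded hx hy), h.map_mul hx hy,
    Module.End.mul_apply]
  conv_lhs => rw [← b.sum_repr (π y (b i))]
  rw [map_sum, map_sum, Finset.mul_sum]
  refine Finset.sum_congr rfl fun k _ => ?_
  rw [map_smul, map_smul, smul_eq_mul, matCoeff_eval ω 𝒱 π b d j k hx,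
    matCoeff_eval ω 𝒱 π b d k i hy, ← Module.Basis.coord_apply]
  by_cases h1 : β + d i = d k
  · rw [← h1, ω.add_left, ω.add_right]
    linear_combination (-ω (d i) α * ω (d i) β * b.coord j (π x (b k)) *
      b.coord k (π y (b i))) * ω.skew α β
  · rw [h.coord hy k i h1]; ring

theorem isGradedRep_natRep (e : HomBasis 𝒱 ι) :
    IsGradedRep ω (natRep ω 𝒱).toLinearMap e.basis e.deg where
  map_mul _ _ := map_mul (natRep ω 𝒱) _ _
  map_one := map_one (natRep ω 𝒱)
  coord hx _ i hne := e.coord_eq_zero (natRep_mem ω 𝒱 hx _ _ (e.mem i)) hne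

theorem dualBasis_coord (e : HomBasis 𝒱 ι) (j : ι) (φ : Module.Dual ℂ V) :
    e.basis.dualBasis.coord j φ = φ (e.basis j) := by
  rw [Module.Basis.coord_apply, Module.Basis.dualBasis_repr]

theorem isGradedRep_dualRep (e : HomBasis 𝒱 ι) :
    IsGradedRep ω (dualRep ω 𝒱) e.basis.dualBasis (fun i => -e.deg i) where
  map_mul hx hy := dualRep_mul ω hx hy
  map_one := by
    ext w v
    induction w using hom_induction (dualGr 𝒱) with
    | h0 => simp
    | hadd w w' h h' => simp only [map_add, LinearMap.add_apply, h, h']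
    | h γ w hw =>
      rw [dualRep_apply ω 𝒱 (one_mem_uGr ω) hw, uS_one, _root_.map_one, ω.zero_left, one_mul]
      rfl
  coord hx j i hne := by
    rw [dualBasis_coord]
    refine (mem_dualGr 𝒱).1 (dualRep_mem ω hx (dualBasis_mem e i)) _ _ (e.mem j) ?_
    exact fun h => hne (eq_neg_of_add_eq_zero_left h)

/-- The factor in the action on V^* cancels the one in the definition of a matrix coefficient, so
the coefficients of V^* are those of S(x) on V, transposed and without a scalar. -/
theorem tbarGen_eval (e : HomBasis 𝒱 ι) (j i : ι) {γ : Γ} {x : UEnv ω 𝒱} (hx : x ∈ uGr ω 𝒱 γ) :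
    eval (tbarGen ω e j i) x = e.basis.coord i (natRep ω 𝒱 (uS ω 𝒱 x) (e.basis j)) := by
  rw [tbarGen, matCoeff_eval ω 𝒱 _ _ _ _ _ hx, dualBasis_coord,
    dualRep_apply ω 𝒱 hx (dualBasis_mem e i), Module.Basis.coe_dualBasis, ← mul_assoc,
    ω.skew, one_mul]

/-- V^* is defined through S. The coefficient of e_j in S(x) e_i vanishes unless d(x) = d_j - d_i,
and this fixes the scalar. -/
theorem antipode_tGen (e : HomBasis 𝒱 ι) (j i : ι) :
    antipode ω (tGen ω e j i) = ω (e.deg i) (e.deg j - e.deg i) • tbarGen ω e i j := by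
  refine ext_hom fun γ x hx => ?_
  rw [antipode_eval, tGen, matCoeff_eval ω 𝒱 _ _ _ _ _ (uS_mem ω 𝒱 hx), smul_eval,
    tbarGen_eval e i j hx, AlgHom.toLinearMap_apply]
  by_cases h : γ + e.deg i = e.deg j
  · rw [← h, add_sub_cancel_right]
  · rw [e.coord_eq_zero (natRep_mem ω 𝒱 (uS_mem ω 𝒱 hx) _ _ (e.mem i)) h, mul_zero, mul_zero]

theorem transL_sum_smul (X : Module.End ℂ V) {κ : Type*} (s : Finset κ) (f : κ → UDual ω 𝒱) :
    transL ω 𝒱 X (∑ i ∈ s, f i) = ∑ i ∈ s, transL ω 𝒱 X (f i) :=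
  ext' fun x => by rw [transL_eval, sum_eval, sum_eval]; rfl

theorem tGen_ι (e : HomBasis 𝒱 ι) (j i : ι) {α : Γ} {X : Module.End ℂ V} (hX : X ∈ endGr 𝒱 α) :
    eval (tGen ω e j i) (UEnv.ι ω 𝒱 X) = ω (e.deg i) α * e.basis.coord j (X (e.basis i)) := by
  rw [tGen, matCoeff_eval ω 𝒱 _ _ _ _ _ (UEnv.ι_mem ω 𝒱 hX), AlgHom.toLinearMap_apply, natRep,
    UEnv.lift_ι]
  rfl

theorem transL_tGen (e : HomBasis 𝒱 ι) {α : Γ} {X : Module.End ℂ V} (hX : X ∈ endGr 𝒱 α)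
    (i k : ι) : transL ω 𝒱 X (tGen ω e i k) =
      ∑ l, (ω (e.deg k) α * e.basis.coord i (X (e.basis l))) • tGen ω e l k := by
  refine ext_hom fun γ x hx => ?_
  rw [transL_eval, sum_eval]
  refine ((isGradedRep_natRep (ω := ω) e).eval_mul i k (UEnv.ι_mem ω 𝒱 hX) hx).trans
    (Finset.sum_congr rfl fun l _ => ?_)
  change ω α γ * (eval (tGen ω e i l) (UEnv.ι ω 𝒱 X) * eval (tGen ω e l k) x) = _
  rw [tGen_ι e i l hX, smul_eval]
  by_cases h : e.deg k - e.deg l + γ = 0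
  · rw [show e.deg l = γ + e.deg k by rw [← sub_eq_zero, ← neg_eq_zero, ← h]; abel, ω.add_left]
    linear_combination (ω (e.deg k) α * e.basis.coord i (X (e.basis l)) *
      eval (tGen ω e l k) x) * ω.skew α γ
  · rw [mem_gr.1 (tGen_mem ω e l k) γ x hx h]; ring

theorem transR_tGen (e : HomBasis 𝒱 ι) {α : Γ} {X : Module.End ℂ V} (hX : X ∈ endGr 𝒱 α)
    (j i : ι) : transR ω X (tGen ω e j i) =
      ∑ l, (ω (e.deg j) α * ω α α * e.basis.coord l (X (e.basis i))) • tGen ω e j l := by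
  refine ext_hom fun γ x hx => ?_
  rw [transR_eval, sum_eval]
  refine ((isGradedRep_natRep (ω := ω) e).eval_mul j i hx (UEnv.ι_mem ω 𝒱 hX)).trans
    (Finset.sum_congr rfl fun l _ => ?_)
  change ω γ α * (eval (tGen ω e j l) x * eval (tGen ω e l i) (UEnv.ι ω 𝒱 X)) = _
  rw [tGen_ι e l i hX, smul_eval]
  by_cases h : α + e.deg i = e.deg l
  · by_cases h' : e.deg l - e.deg j + γ = 0
    · rw [show e.deg j = γ + α + e.deg i by rw [← sub_eq_zero, ← neg_eq_zero, ← h', ← h]; abel,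
        ω.add_left, ω.add_left]
      linear_combination (-ω γ α * ω (e.deg i) α * e.basis.coord l (X (e.basis i)) *
        eval (tGen ω e j l) x) * ω.skew α α
    · rw [mem_gr.1 (tGen_mem ω e j l) γ x hx h']; ring
  · rw [e.coord_eq_zero (hX _ _ (e.mem i)) h]; ring

/-- The antipode axiom of U in matrix form. At the unit of U both sides are δ_{jk}. Left translation
by X kills the right side, and it kills the left side because translating the first factor gives
minus the result of translating the second one. -/
theorem antipode_mul_tGen (e : HomBasis 𝒱 ι) (j k : ι) :
    ∑ i, antipode ω (tGen ω e j i) * tGen ω e i k = if j = k then 1 else 0 := by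
  have hrep := isGradedRep_natRep (ω := ω) e
  refine ext_hom fun γ x hx => ?_
  refine UEnv.induction (P := fun _ x =>
    eval (∑ i, antipode ω (tGen ω e j i) * tGen ω e i k) x =
      eval (if j = k then 1 else 0 : UDual ω 𝒱) x) (by simp) ?_ ?_ ?_ ?_ hx
  · intro γ x y hx hy; rw [eval_add, eval_add, hx, hy]
  · intro γ c x hx; rw [eval_smul, eval_smul, hx]
  · rw [sum_eval]
    have h1 : ∀ i, eval (antipode ω (tGen ω e j i) * tGen ω e i k) 1 =
        (if j = i then 1 else 0) * (if i = k then 1 else 0) := fun i => by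
      rw [mul_eval_one, antipode_eval, uS_one]
      exact congrArg₂ _ (hrep.eval_one j i) (hrep.eval_one i k)
    simp only [h1]
    split_ifs with h
    · simp [h, one_eval]
    · simp [h]; rfl
  · intro α β X x hX hx _
    -- The terms in which X acts on the first factor. After exchanging i and l they are the
    -- negatives of those in which it acts on the second factor.
    have hs : ∀ i, transL ω 𝒱 X (antipode ω (tGen ω e j i)) * scale ω 𝒱 α (tGen ω e i k) =
        -∑ l, (ω (e.deg k) α * e.basis.coord l (X (e.basis i))) •
          (antipode ω (tGen ω e j l) * tGen ω e i k) := by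
      intro i
      rw [transL_antipode ω hX (tGen_mem ω e j i), transR_tGen e hX, map_sum,
        scale_of_mem ω α (tGen_mem ω e i k), mul_smul_comm, Finset.smul_sum, neg_mul, smul_neg,
        Finset.sum_mul, Finset.smul_sum]
      congr 1
      refine Finset.sum_congr rfl fun l _ => ?_
      rw [map_smul, smul_smul, smul_mul_assoc, smul_smul]
      congr 1
      simp only [ω.add_left, ω.sub_left]
      have h1 := ω.skew (e.deg i) α
      have h2 := ω.skew (e.deg j) α
      have h3 := ω.skew α α
      generalize e.basis.coord l (X (e.basis i)) = c
      grind
    rw [← transL_eval, transL_sum_smul, Finset.sum_congr rfl fun i _ => transL_mul ω 𝒱 hX _ _,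
      Finset.sum_add_distrib, Finset.sum_congr rfl fun i _ => hs i, Finset.sum_neg_distrib]
    simp only [transL_tGen e hX, Finset.mul_sum, mul_smul_comm]
    rw [Finset.sum_comm, neg_add_cancel]
    split_ifs
    · rw [← transL_eval, transL_one]
    · rfl

/-- Apply the transposed antipode, an involution which preserves products of homogeneous
functionals, to the other identity. -/
theorem tGen_mul_antipode (e : HomBasis 𝒱 ι) (j k : ι) :
    ∑ i, tGen ω e j i * antipode ω (tGen ω e i k) = if j = k then 1 else 0 := by
  have h := congrArg (antipode ω) (antipode_mul_tGen (ω := ω) e j k)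
  rw [map_sum, apply_ite (antipode ω), antipode_one, map_zero] at h
  rw [← h]
  refine Finset.sum_congr rfl fun i _ => ?_
  rw [antipode_mul ω (antipode_mem ω (tGen_mem ω e j i)) (tGen_mem ω e i k), antipode_antipode]

end MatCoeff

end

end Colour

namespace Colour

noncomputable section


/-! ### The co-action on tensors: D_+ and D_- are block determinants of t. -/

section Coaction

variable {Γ : Type*} [AddCommGroup Γ] [DecidableEq Γ] (ω : CommFactor Γ)
variable {V : Type*} [AddCommGroup V] [Module ℂ V] [FiniteDimensional ℂ V]
variable {𝒱 : Γ → Submodule ℂ V} [DirectSum.Decomposition 𝒱]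
variable {ι : Type*} [Fintype ι] [DecidableEq ι] (e : HomBasis 𝒱 ι)

/-- The matrix of the generators of `T`. -/
def tMat : homMat (subGr ω (algT ω e)) e.deg :=
  ⟨fun j i => tT ω e j i, fun j i => tGen_mem ω e j i⟩

/-- The tensor `e_{I_1} ⊗ ⋯ ⊗ e_{I_n}`. -/
def eWord {n : ℕ} (I : Fin n → ι) : TensorAlgebra ℂ V := TensorAlgebra.tprod ℂ V n (e.basis ∘ I)

theorem eWord_zero (I : Fin 0 → ι) : eWord e I = 1 := by
  rw [eWord, TensorAlgebra.tprod_apply]; simp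

theorem eWord_cons {n : ℕ} (i : ι) (I : Fin n → ι) :
    eWord e (Fin.cons i I : Fin (n + 1) → ι) = TensorAlgebra.ι ℂ (e.basis i) * eWord e I := by
  rw [eWord, eWord, TensorAlgebra.tprod_apply, TensorAlgebra.tprod_apply, List.ofFn_succ,
    List.prod_cons]
  rfl

theorem eWord_mem {n : ℕ} (I : Fin n → ι) : eWord e I ∈ taGr 𝒱 (∑ a, e.deg (I a)) := by
  induction n with
  | zero => rw [eWord_zero, Fin.sum_univ_zero]; exact SetLike.GradedOne.one_mem
  | succ n ih =>
    rw [← Fin.cons_self_tail I, eWord_cons, Fin.sum_univ_succ]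
    exact SetLike.mul_mem_graded (ι_mem_taGr 𝒱 (e.mem _)) (ih _)

/-- The recursion which defines `cmon` is the rule for multiplying e_j ⊗ t_{ji} by a tensor in the
remaining letters. -/
theorem coact_eWord {n : ℕ} (I : Fin n → ι) :
    coact ω e (eWord e I) = ∑ J : Fin n → ι,
      CTensor.tmul ω (taGr 𝒱) (subGr ω (algT ω e)) (eWord e J)
        (cword ω e.deg (tMat ω e : Matrix ι ι (algT ω e)) J I) := by
  induction n with
  | zero =>
    rw [Fintype.sum_unique, eWord_zero, eWord_zero, map_one]
    rfl
  | succ n ih =>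
    rw [← Fin.cons_self_tail I, eWord_cons, map_mul, ih, sum_cons]
    have h1 : coact ω e (TensorAlgebra.ι ℂ (e.basis (I 0))) =
        ∑ j, CTensor.tmul ω (taGr 𝒱) (subGr ω (algT ω e)) (TensorAlgebra.ι ℂ (e.basis j))
          (tT ω e j (I 0)) := by
      rw [coact, TensorAlgebra.lift_ι_apply, Module.Basis.constr_basis]
    rw [h1, Finset.sum_mul_sum]
    refine Finset.sum_congr rfl fun j _ => Finset.sum_congr rfl fun J _ => ?_
    rw [CTensor.tmul_mul_tmul ω _ _ _ (show tT ω e j (I 0) ∈ subGr ω (algT ω e) (e.deg (I 0) - e.deg j)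
      from tGen_mem ω e j (I 0)) (eWord_mem e J), eWord_cons, cword_cons]
    simp only [CTensor.tmul, TensorProduct.tmul_smul, map_smul]
    rfl

open Classical in
theorem parityProj_eWord (c : ℂ) {n : ℕ} (J : Fin n → ι) :
    parityProj ω 𝒱 c (eWord e J) =
      if ∀ a, ω (e.deg (J a)) (e.deg (J a)) = c then eWord e J else 0 := by
  induction n with
  | zero => rw [eWord_zero, map_one, if_pos fun a => a.elim0]
  | succ n ih =>
    rw [← Fin.cons_self_tail J, eWord_cons, map_mul, ih]
    have h1 : parityProj ω 𝒱 c (TensorAlgebra.ι ℂ (e.basis (J 0))) =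
        if ω (e.deg (J 0)) (e.deg (J 0)) = c then TensorAlgebra.ι ℂ (e.basis (J 0)) else 0 := by
      rw [parityProj, TensorAlgebra.lift_ι_apply, LinearMap.comp_apply,
        gradScale_of_mem _ _ (e.mem (J 0))]
      split_ifs <;> simp
    rw [h1]
    simp only [Fin.forall_fin_succ, Fin.cons_zero, Fin.cons_succ]
    split_ifs <;> simp_all

theorem projCoact_eWord (c : ℂ) {n : ℕ} (I : Fin n → ι) :
    projCoact ω e c (eWord e I) = ∑ J : Fin n → ParIdx ω e.deg c,
      eWord e (Subtype.val ∘ J) ⊗ₜ[ℂ]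
        cword ω e.deg (tMat ω e : Matrix ι ι (algT ω e)) (Subtype.val ∘ J) I := by
  classical
  have h1 : projCoact ω e c (eWord e I) = ∑ J : Fin n → ι, parityProj ω 𝒱 c (eWord e J) ⊗ₜ[ℂ]
        cword ω e.deg (tMat ω e : Matrix ι ι (algT ω e)) J I := by
    rw [projCoact, LinearMap.comp_apply, LinearMap.comp_apply, AlgHom.toLinearMap_apply,
      coact_eWord, map_sum, map_sum]
    rfl
  rw [h1]
  symm
  refine Fintype.sum_of_injective (fun J : Fin n → ParIdx ω e.deg c => Subtype.val ∘ J)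
    (fun J J' h => funext fun a => Subtype.ext (congrFun h a)) _ _ (fun J hJ => ?_) (fun J => ?_)
  · rw [parityProj_eWord, if_neg, TensorProduct.zero_tmul]
    exact fun h => hJ ⟨fun a => ⟨J a, h a⟩, rfl⟩
  · rw [parityProj_eWord, if_pos]
    exact fun a => (J a).2

/-- The matrix coefficients of the words in the basis elements of one parity. -/
theorem projCoact_antiSym {c : ℂ} (hc : c * c = 1) {n : ℕ} (J₀ : Fin n ≃ ParIdx ω e.deg c)
    {f : (Fin n → ParIdx ω e.deg c) → ℂ}
    (hf : AntiSym (antiFactor ω (fun i : ParIdx ω e.deg c => e.deg i) c) f) :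
    projCoact ω e c (∑ K, f K • eWord e (Subtype.val ∘ K)) =
      (∑ K, f K • eWord e (Subtype.val ∘ K)) ⊗ₜ[ℂ]
        parDet ω e.deg c J₀ (tMat ω e : Matrix ι ι (algT ω e)) := by
  have hA : OmegaComm ω (subGr ω (algT ω e)) := OmegaComm.subGr ω _
  simp only [map_sum, map_smul, projCoact_eWord, Finset.smul_sum, TensorProduct.sum_tmul]
  rw [Finset.sum_comm]
  refine Finset.sum_congr rfl fun J _ => ?_
  rw [← TensorProduct.smul_tmul', ← TensorProduct.tmul_smul]
  have h1 := sum_smul_cword hA hc (fun i => i.2) (parBlock (tMat ω e) c).2 J₀ hf J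
  refine Eq.trans ?_ (congrArg (fun z => eWord e (Subtype.val ∘ J) ⊗ₜ[ℂ] z) h1)
  rw [TensorProduct.tmul_sum]
  refine Finset.sum_congr rfl fun K _ => ?_
  rw [TensorProduct.tmul_smul]
  rfl

/-- The antisymmetriser for vectors of degrees `d` and parity `c`. -/
def altTensor (c : ℂ) {n : ℕ} (d : Fin n → Γ) :
    MultilinearMap ℂ (fun _ : Fin n => V) (TensorAlgebra ℂ V) :=
  ∑ τ : Equiv.Perm (Fin n), topAnti ω d c (Equiv.refl _) τ •
    (TensorAlgebra.tprod ℂ V n).domDomCongr τ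

theorem altTensor_apply (c : ℂ) {n : ℕ} (d : Fin n → Γ) (v : Fin n → V) :
    altTensor ω c d v = ∑ τ : Equiv.Perm (Fin n), topAnti ω d c (Equiv.refl _) τ •
      TensorAlgebra.tprod ℂ V n (v ∘ τ) := by
  simp only [altTensor, sum_apply, smul_apply]
  rfl

/-- Reindexing the positions by σ turns a product over pairs of positions into one over the
inversions of σ. -/
theorem topAnti_refl_symm (c : ℂ) {n : ℕ} (d : Fin n → Γ) (σ : Equiv.Perm (Fin n)) :
    topAnti ω d c (Equiv.refl _) σ.symm =
      ∏ p : Fin n × Fin n with p.1 < p.2 ∧ σ p.2 < σ p.1, (-c * ω (d p.1) (d p.2)) := by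
  rw [topAnti, stdAnti, pairProd_eq, Finset.prod_filter, Fintype.prod_prod_type_right,
    ← Equiv.prod_comp σ]
  refine Finset.prod_congr rfl fun a _ => ?_
  rw [← Equiv.prod_comp σ]
  refine Finset.prod_congr rfl fun b _ => ?_
  simp only [Equiv.symm_apply_apply, Equiv.refl_symm, Equiv.refl_apply, antiFactor]
  by_cases h1 : σ a < σ b
  · have h2 : b ≠ a := by rintro rfl; exact lt_irrefl _ h1
    simp [h1, h2]
  · simp [h1]

theorem sign_eq_prod_inv {n : ℕ} (σ : Equiv.Perm (Fin n)) : ((Equiv.Perm.sign σ : ℤ) : ℂ) =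
    ∏ p : Fin n × Fin n with p.1 < p.2 ∧ σ p.2 < σ p.1, (-1 : ℂ) := by
  rw [Equiv.Perm.sign_eq_prod_prod_Iio, Finset.prod_filter, Fintype.prod_prod_type_right]
  push_cast
  refine Finset.prod_congr rfl fun a _ => ?_
  rw [← Finset.prod_subset (Finset.subset_univ (Finset.Iio a)) (fun b _ hb => by
    rw [if_neg fun h => hb (Finset.mem_Iio.2 h.1)])]
  refine Finset.prod_congr rfl fun b hb => ?_
  have h1 := Finset.mem_Iio.1 hb
  by_cases h : σ b < σ a
  · simp [h, h.not_gt]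
  · have h2 : σ a < σ b := lt_of_le_of_ne (not_lt.1 h) fun h => h1.ne' (σ.injective h)
    simp [h, h2, h1]

/-- For c = 1 the factors -c of the inversions multiply up to the sign of σ; for c = -1, in
`sum_permTensor`, they are 1. So one tensor covers the antisymmetriser and the symmetriser. -/
theorem sum_sign_permTensor {n : ℕ} (d : Fin n → Γ) (v : Fin n → V) :
    ∑ σ : Equiv.Perm (Fin n), ((Equiv.Perm.sign σ : ℤ) : ℂ) • permTensor ω σ d v =
      altTensor ω 1 d v := by
  rw [altTensor_apply, ← Equiv.sum_comp (Equiv.inv (Equiv.Perm (Fin n)))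
    (fun τ : Equiv.Perm (Fin n) => topAnti ω d 1 (Equiv.refl _) τ • TensorAlgebra.tprod ℂ V n (v ∘ τ))]
  refine Finset.sum_congr rfl fun σ _ => ?_
  have h := topAnti_refl_symm ω 1 d σ
  rw [Equiv.inv_apply, Equiv.Perm.inv_def, h, permTensor, smul_smul, sign_eq_prod_inv,
    ← Finset.prod_mul_distrib]

theorem sum_permTensor {n : ℕ} (d : Fin n → Γ) (v : Fin n → V) :
    ∑ σ : Equiv.Perm (Fin n), permTensor ω σ d v = altTensor ω (-1) d v := by
  rw [altTensor_apply, ← Equiv.sum_comp (Equiv.inv (Equiv.Perm (Fin n)))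
    (fun τ : Equiv.Perm (Fin n) => topAnti ω d (-1) (Equiv.refl _) τ • TensorAlgebra.tprod ℂ V n (v ∘ τ))]
  refine Finset.sum_congr rfl fun σ _ => ?_
  have h := topAnti_refl_symm ω (-1) d σ
  rw [Equiv.inv_apply, Equiv.Perm.inv_def, h, permTensor]
  simp

variable {ω} in
/-- The coefficients of the antisymmetriser of a word. -/
def altCoeff (c : ℂ) {n : ℕ} (I K : Fin n → ParIdx ω e.deg c) : ℂ :=
  ∑ τ : Fin n → Fin n, if I ∘ τ = K then topAnti ω (fun a => e.deg (I a)) c (Equiv.refl _) τ else 0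

theorem altCoeff_antiSym {c : ℂ} (hc : c * c = 1) {n : ℕ} (I : Fin n → ParIdx ω e.deg c) :
    AntiSym (antiFactor ω (fun i : ParIdx ω e.deg c => e.deg i) c) (altCoeff e c I) := by
  intro a b hab K
  have h : Function.Involutive (fun τ : Fin n → Fin n => τ ∘ Equiv.swap a b) :=
    fun τ => by funext i; simp
  rw [altCoeff, altCoeff, ← h.bijective.sum_comp, Finset.smul_sum]
  refine Finset.sum_congr rfl fun τ _ => ?_
  have h1 : I ∘ τ ∘ Equiv.swap a b = K ∘ Equiv.swap a b ↔ I ∘ τ = K := by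
    constructor
    · intro h
      funext i
      have := congrFun h (Equiv.swap a b i)
      simpa using this
    · intro h
      rw [← h]; rfl
  simp only [h1]
  split_ifs with h2
  · rw [topAnti_antiSym hc _ a b hab τ, ← h2]
    rfl
  · rw [smul_zero]

theorem altTensor_basis {c : ℂ} (hc : c * c = 1) {n : ℕ} (I : Fin n → ParIdx ω e.deg c) :
    altTensor ω c (fun a => e.deg (I a)) (fun a => e.basis (I a)) =
      ∑ K, altCoeff e c I K • eWord e (Subtype.val ∘ K) := by
  simp only [altCoeff, Finset.sum_smul, ite_smul, zero_smul]
  rw [Finset.sum_comm, altTensor_apply]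
  simp only [Finset.sum_ite_eq, Finset.mem_univ, if_true]
  -- The coefficients sum over all maps τ; `topAnti` vanishes on the maps which are not injective,
  -- which leaves the permutations.
  refine Fintype.sum_of_injective (fun τ : Equiv.Perm (Fin n) => (τ : Fin n → Fin n))
    DFunLike.coe_injective _ _ (fun τ hτ => ?_) (fun τ => rfl)
  rw [(topAnti_antiSym hc _).eq_zero (antiFactor_ne_zero hc)
    (antiFactor_self hc fun a => (I a).2), zero_smul]
  intro hinj
  exact hτ ⟨Equiv.ofBijective τ (Finite.injective_iff_bijective.1 hinj), rfl⟩

/-- Both sides are multilinear in v, so basis vectors suffice. For them the tensor has antisymmetric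
coefficients on words of parity c, and t acts on such tensors by its block determinant. -/
theorem projCoact_altTensor {c : ℂ} (hc : c * c = 1) {n : ℕ} (J₀ : Fin n ≃ ParIdx ω e.deg c)
    {d : Fin n → Γ} {v : Fin n → V} (hv : ∀ a, v a ∈ 𝒱 (d a) ∧ ω (d a) (d a) = c) :
    projCoact ω e c (altTensor ω c d v) = altTensor ω c d v ⊗ₜ[ℂ]
      parDet ω e.deg c J₀ (tMat ω e : Matrix ι ι (algT ω e)) := by
  set D := parDet ω e.deg c J₀ (tMat ω e : Matrix ι ι (algT ω e))
  -- Composing with the projections to the degrees d_a leaves the values on the given v unchanged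
  -- and kills basis vectors of other degrees, so that both sides can be compared on all basis
  -- vectors.
  let m := (altTensor (V := V) ω c d).compLinearMap (fun a => projGr 𝒱 (d a))
  have key : (projCoact ω e c).compMultilinearMap m =
      ((TensorProduct.mk ℂ (TensorAlgebra ℂ V) (algT ω e)).flip D).compMultilinearMap m := by
    refine Module.Basis.ext_multilinear (fun _ => e.basis) fun I => ?_
    simp only [LinearMap.compMultilinearMap_apply, MultilinearMap.compLinearMap_apply, m]
    by_cases h : ∀ a, e.deg (I a) = d a
    · have h1 : (fun a => projGr 𝒱 (d a) (e.basis (I a))) = fun a => e.basis (I a) := by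
        funext a
        exact projGr_same 𝒱 (h a ▸ e.mem (I a))
      obtain rfl : (fun a => e.deg (I a)) = d := funext h
      have h2 := altTensor_basis ω e hc (fun a => ⟨I a, (hv a).2⟩ : Fin n → ParIdx ω e.deg c)
      simp only at h2
      rw [h1, h2, projCoact_antiSym ω e hc J₀ (altCoeff_antiSym ω e hc _)]
      rfl
    · push Not at h
      obtain ⟨a, ha⟩ := h
      have h1 : (altTensor (V := V) ω c d) (fun a => projGr 𝒱 (d a) (e.basis (I a))) = 0 :=
        MultilinearMap.map_coord_zero _ a (projGr_ne 𝒱 (e.mem (I a)) ha)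
      rw [h1, map_zero, map_zero]
  have h := congrArg (fun f => f v) key
  simp only [LinearMap.compMultilinearMap_apply, MultilinearMap.compLinearMap_apply, m,
    projGr_same 𝒱 (hv _).1] at h
  exact h

theorem finrank_parityPart (c : ℂ) :
    Module.finrank ℂ (parityPart ω 𝒱 c) = Fintype.card (ParIdx ω e.deg c) := by
  have h1 : parityPart ω 𝒱 c =
      Submodule.span ℂ (Set.range fun i : ParIdx ω e.deg c => e.basis i) := by
    apply le_antisymm
    · refine iSup_le fun α => iSup_le fun hα v hv => ?_
      rw [← e.basis.sum_repr v]
      refine Submodule.sum_mem _ fun i _ => ?_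
      by_cases h : α = e.deg i
      · exact Submodule.smul_mem _ _ (Submodule.subset_span ⟨⟨i, h ▸ hα⟩, rfl⟩)
      · have h2 := e.coord_eq_zero hv h
        rw [Module.Basis.coord_apply] at h2
        rw [h2, zero_smul]; exact zero_mem _
    · rw [Submodule.span_le]
      rintro _ ⟨i, rfl⟩
      exact Submodule.mem_iSup_of_mem (e.deg i) (Submodule.mem_iSup_of_mem i.2 (e.mem i))
  rw [h1]
  exact finrank_span_eq_card (e.basis.linearIndependent.comp _ Subtype.val_injective)

open Classical in
-- The words in the e_i are the monomial basis of the tensor algebra; this is used to read off a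
-- single coefficient.
theorem repr_eWord {n : ℕ} (J I : Fin n → ι) :
    e.basis.tensorAlgebra.repr (eWord e I) (FreeMonoid.ofList (List.ofFn J)) =
      if I = J then 1 else 0 := by
  have h1 : eWord e I = e.basis.tensorAlgebra (FreeMonoid.ofList (List.ofFn I)) := by
    have h2 : ∀ l : List ι, e.basis.tensorAlgebra (FreeMonoid.ofList l) =
        (l.map fun i => TensorAlgebra.ι ℂ (e.basis i)).prod := by
      intro l
      have h3 : e.basis.tensorAlgebra (FreeMonoid.ofList l) =
          (TensorAlgebra.equivFreeAlgebra e.basis).symm (FreeAlgebra.equivMonoidAlgebraFreeMonoid.symm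
            (MonoidAlgebra.single (FreeMonoid.ofList l) 1)) := rfl
      have h4 : FreeAlgebra.equivMonoidAlgebraFreeMonoid.symm
            (MonoidAlgebra.single (FreeMonoid.ofList l) (1 : ℂ)) = (l.map (FreeAlgebra.ι ℂ)).prod := by
        refine (MonoidAlgebra.lift_single _ _ _).trans ?_
        rw [one_smul, FreeMonoid.lift_apply]
        rfl
      rw [h3, h4, map_list_prod, List.map_map]
      congr 1
      refine List.map_congr_left fun i _ => ?_
      exact TensorAlgebra.equivFreeAlgebra_symm_ι e.basis i
    rw [eWord, TensorAlgebra.tprod_apply, h2, List.map_ofFn]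
    rfl
  rw [h1, Module.Basis.repr_self, Finsupp.single_apply]
  congr 1
  rw [FreeMonoid.ofList.injective.eq_iff, List.ofFn_injective.eq_iff]

theorem altCoeff_self {c : ℂ} {n : ℕ} (J₀ : Fin n ≃ ParIdx ω e.deg c) :
    altCoeff e c J₀ J₀ = 1 := by
  rw [altCoeff, Finset.sum_eq_single id]
  · rw [if_pos (Function.comp_id _)]
    exact topAnti_self (Equiv.refl _)
  · intro τ _ hτ
    rw [if_neg]
    intro h
    exact hτ (funext fun a => J₀.injective (congrFun h a))
  · intro h; exact absurd (Finset.mem_univ _) h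

/-- The coefficient of the word J₀ in this tensor is 1, so applying the corresponding coordinate to
the first tensor factor recovers D. -/
theorem eq_of_altTensor_tmul {c : ℂ} (hc : c * c = 1) {n : ℕ} (J₀ : Fin n ≃ ParIdx ω e.deg c)
    {D D' : algT ω e}
    (h : altTensor ω c (fun a => e.deg (J₀ a)) (fun a => e.basis (J₀ a)) ⊗ₜ[ℂ] D =
      altTensor ω c (fun a => e.deg (J₀ a)) (fun a => e.basis (J₀ a)) ⊗ₜ[ℂ] D') : D = D' := by
  classical
  let φ := e.basis.tensorAlgebra.coord (FreeMonoid.ofList (List.ofFn (Subtype.val ∘ J₀)))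
  have h1 : φ (altTensor ω c (fun a => e.deg (J₀ a)) (fun a => e.basis (J₀ a))) = 1 := by
    rw [altTensor_basis ω e hc J₀, map_sum, Finset.sum_eq_single (J₀ : Fin n → _)]
    · rw [map_smul, Module.Basis.coord_apply, repr_eWord, if_pos rfl, altCoeff_self, smul_eq_mul,
        one_mul]
    · intro K _ hK
      rw [map_smul, Module.Basis.coord_apply, repr_eWord, if_neg, smul_zero]
      exact fun h => hK (funext fun a => Subtype.ext (congrFun h a))
    · intro h; exact absurd (Finset.mem_univ _) h
  have h2 := congrArg (TensorProduct.lid ℂ (algT ω e) ∘ TensorProduct.map φ LinearMap.id) h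
  simpa [h1] using h2

/-- Existence is `projCoact_altTensor`, extended linearly. Uniqueness is tested on the
antisymmetriser of the word J₀, which is not 0. The proof for D_- is the same with c = -1. -/
theorem isDPlus_iff (J₀ : Fin (Module.finrank ℂ (parityPart ω 𝒱 1)) ≃ ParIdx ω e.deg 1)
    (D : algT ω e) :
    IsDPlus ω e D ↔ D = parDet ω e.deg 1 J₀ (tMat ω e : Matrix ι ι (algT ω e)) := by
  have hc : (1 : ℂ) * 1 = 1 := one_mul 1
  have key : IsDPlus ω e (parDet ω e.deg 1 J₀ (tMat ω e : Matrix ι ι (algT ω e))) := by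
    intro Λ hΛ
    induction hΛ using Submodule.span_induction with
    | mem Λ hΛ =>
      obtain ⟨d, v, hv, rfl⟩ := hΛ
      rw [sum_sign_permTensor, projCoact_altTensor ω e hc J₀ hv]
    | zero => rw [map_zero, TensorProduct.zero_tmul]
    | add x y _ _ hx hy => rw [map_add, TensorProduct.add_tmul, hx, hy]
    | smul r x _ hx => rw [map_smul, hx, TensorProduct.smul_tmul']
  refine ⟨fun h => ?_, fun h => h ▸ key⟩
  have hmem : altTensor ω 1 (fun a => e.deg (J₀ a)) (fun a => e.basis (J₀ a)) ∈
      extPlus ω 𝒱 (Module.finrank ℂ (parityPart ω 𝒱 1)) :=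
    Submodule.subset_span ⟨_, _, fun a => ⟨e.mem _, (J₀ a).2⟩, (sum_sign_permTensor ω _ _).symm⟩
  exact eq_of_altTensor_tmul ω e hc J₀ ((h _ hmem).symm.trans (key _ hmem))

theorem isDMinus_iff (J₀ : Fin (Module.finrank ℂ (parityPart ω 𝒱 (-1))) ≃ ParIdx ω e.deg (-1))
    (D : algT ω e) :
    IsDMinus ω e D ↔ D = parDet ω e.deg (-1) J₀ (tMat ω e : Matrix ι ι (algT ω e)) := by
  have hc : (-1 : ℂ) * -1 = 1 := by norm_num
  have key : IsDMinus ω e (parDet ω e.deg (-1) J₀ (tMat ω e : Matrix ι ι (algT ω e))) := by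
    intro Λ hΛ
    induction hΛ using Submodule.span_induction with
    | mem Λ hΛ =>
      obtain ⟨d, v, hv, rfl⟩ := hΛ
      rw [sum_permTensor, projCoact_altTensor ω e hc J₀ hv]
    | zero => rw [map_zero, TensorProduct.zero_tmul]
    | add x y _ _ hx hy => rw [map_add, TensorProduct.add_tmul, hx, hy]
    | smul r x _ hx => rw [map_smul, hx, TensorProduct.smul_tmul']
  refine ⟨fun h => ?_, fun h => h ▸ key⟩
  have hmem : altTensor ω (-1) (fun a => e.deg (J₀ a)) (fun a => e.basis (J₀ a)) ∈
      symMinus ω 𝒱 (Module.finrank ℂ (parityPart ω 𝒱 (-1))) :=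
    Submodule.subset_span ⟨_, _, fun a => ⟨e.mem _, (J₀ a).2⟩, (sum_permTensor ω _ _).symm⟩
  exact eq_of_altTensor_tmul ω e hc J₀ ((h _ hmem).symm.trans (key _ hmem))

end Coaction

end

end Colour

namespace Colour

noncomputable section


/-! ### Matrix coefficients lie in the finite dual. -/

section FiniteDual

variable {Γ : Type*} [AddCommGroup Γ] [DecidableEq Γ] (ω : CommFactor Γ)
variable {V : Type*} [AddCommGroup V] [Module ℂ V] [FiniteDimensional ℂ V]
variable {𝒱 : Γ → Submodule ℂ V} [DirectSum.Decomposition 𝒱]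

namespace UDual

/-- A space of functionals which is stable under the translations and the scalings. -/
structure IsStable (W : Submodule ℂ (UDual ω 𝒱)) : Prop where
  transL : ∀ {α : Γ} {X : Module.End ℂ V}, X ∈ endGr 𝒱 α → ∀ {f}, f ∈ W → transL ω 𝒱 X f ∈ W
  scale : ∀ (α : Γ) {f}, f ∈ W → scale ω 𝒱 α f ∈ W

variable (𝒱) in
/-- The translations, as a linear map. -/
def transLₗ (X : Module.End ℂ V) : UDual ω 𝒱 →ₗ[ℂ] UDual ω 𝒱 where
  toFun := UDual.transL ω 𝒱 X
  map_add' _ _ := rfl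
  map_smul' _ _ := rfl

variable (𝒱) in
/-- The scalings, as a linear map. -/
def scaleₗ (α : Γ) : UDual ω 𝒱 →ₗ[ℂ] UDual ω 𝒱 where
  toFun := UDual.scale ω 𝒱 α
  map_add' _ _ := rfl
  map_smul' _ _ := rfl

variable {ω} in
theorem IsStable.sup {W W' : Submodule ℂ (UDual ω 𝒱)} (h : IsStable ω W) (h' : IsStable ω W') :
    IsStable ω (W ⊔ W') where
  transL {α X} hX f hf := by
    have h1 : W ⊔ W' ≤ (W ⊔ W').comap (transLₗ ω 𝒱 X) :=
      sup_le (fun f hf => (le_sup_left : W ≤ W ⊔ W') (h.transL hX hf))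
        (fun f hf => (le_sup_right : W' ≤ W ⊔ W') (h'.transL hX hf))
    exact h1 hf
  scale α f hf := by
    have h1 : W ⊔ W' ≤ (W ⊔ W').comap (scaleₗ ω 𝒱 α) :=
      sup_le (fun f hf => (le_sup_left : W ≤ W ⊔ W') (h.scale α hf))
        (fun f hf => (le_sup_right : W' ≤ W ⊔ W') (h'.scale α hf))
    exact h1 hf

variable {ω} in
-- Translations are derivations twisted by scalings, which is why stability under scalings is part
-- of the notion.
theorem IsStable.mul {W W' : Submodule ℂ (UDual ω 𝒱)} (h : IsStable ω W) (h' : IsStable ω W') :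
    IsStable ω (W * W') where
  transL {α X} hX f hf := by
    have h1 : W * W' ≤ (W * W').comap (transLₗ ω 𝒱 X) := Submodule.mul_le.2 fun f hf g hg => by
      change UDual.transL ω 𝒱 X (f * g) ∈ W * W'
      rw [transL_mul ω 𝒱 hX]
      exact add_mem (Submodule.mul_mem_mul (h.transL hX hf) (h'.scale α hg))
        (Submodule.mul_mem_mul hf (h'.transL hX hg))
    exact h1 hf
  scale α f hf := by
    have h1 : W * W' ≤ (W * W').comap (scaleₗ ω 𝒱 α) := Submodule.mul_le.2 fun f hf g hg => by
      change UDual.scale ω 𝒱 α (f * g) ∈ W * W'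
      rw [scale_mul]
      exact Submodule.mul_mem_mul (h.scale α hf) (h'.scale α hg)
    exact h1 hf

variable (𝒱) in
/-- The functional `y ↦ ⟨f, x y⟩`. -/
def translate : UEnv ω 𝒱 →ₗ[ℂ] UDual ω 𝒱 →ₗ[ℂ] UDual ω 𝒱 :=
  LinearMap.mk₂ ℂ (fun x f => of ω 𝒱 ((of ω 𝒱).symm f ∘ₗ LinearMap.mulLeft ℂ x))
    (fun x y f => ext' fun z => by
      change eval f ((x + y) * z) = eval f (x * z) + eval f (y * z)
      rw [add_mul, eval_add])
    (fun c x f => ext' fun z => by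
      change eval f ((c • x) * z) = c * eval f (x * z)
      rw [smul_mul_assoc, eval_smul])
    (fun _ _ _ => rfl) (fun _ _ _ => rfl)

theorem translate_eval (x y : UEnv ω 𝒱) (f : UDual ω 𝒱) :
    eval (translate ω 𝒱 x f) y = eval f (x * y) := rfl

variable {ω} in
theorem IsStable.translate_mem {W : Submodule ℂ (UDual ω 𝒱)} (h : IsStable ω W) (x : UEnv ω 𝒱)
    {f : UDual ω 𝒱} (hf : f ∈ W) : translate ω 𝒱 x f ∈ W := by
  induction x using hom_induction (uGr ω 𝒱) with
  | h0 => rw [map_zero]; exact zero_mem _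
  | hadd x y hx hy => rw [map_add]; exact add_mem hx hy
  | h γ x hx =>
    revert f
    refine UEnv.induction (P := fun _ x => ∀ {f}, f ∈ W → translate ω 𝒱 x f ∈ W) ?_ ?_ ?_ ?_ ?_ hx
    · intro _ f _; rw [map_zero]; exact zero_mem _
    · intro γ x y hx hy f hf; rw [map_add]; exact add_mem (hx hf) (hy hf)
    · intro γ c x hx f hf; rw [map_smul]; exact Submodule.smul_mem _ _ (hx hf)
    · intro f hf
      have h1 : translate ω 𝒱 1 f = f := ext' fun z => by rw [translate_eval, one_mul]
      rwa [h1]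
    · intro α β X x hX hx ih f hf
      have h1 : translate ω 𝒱 (UEnv.ι ω 𝒱 X * x) f = translate ω 𝒱 x (UDual.transL ω 𝒱 X f) :=
        ext' fun z => by rw [translate_eval, translate_eval, transL_eval, mul_assoc]
      rw [h1]
      exact ih (h.transL hX hf)

variable {ω} in
-- U acts on W by translations, and the kernel of this action is a two-sided ideal. Its codimension
-- is finite because U modulo the kernel embeds in End(W). An element x of the kernel satisfies ⟨f,
-- x⟩ = 0, as one sees by evaluating the translate of f by x at 1.
theorem IsStable.mem_finiteDual {W : Submodule ℂ (UDual ω 𝒱)} (h : IsStable ω W)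
    (hW : W.FG) {f : UDual ω 𝒱} (hf : f ∈ W) : f ∈ finiteDual ω 𝒱 := by
  have : FiniteDimensional ℂ W := Module.Finite.iff_fg.2 hW
  let r : UEnv ω 𝒱 →ₗ[ℂ] (W →ₗ[ℂ] W) :=
    { toFun := fun x => (translate ω 𝒱 x).restrict fun f hf => h.translate_mem x hf
      map_add' := fun x y => by ext1 g; apply Subtype.ext; simp [LinearMap.restrict_apply]
      map_smul' := fun c x => by ext1 g; apply Subtype.ext; simp [LinearMap.restrict_apply] }
  have hr : ∀ x, x ∈ LinearMap.ker r ↔ ∀ g ∈ W, translate ω 𝒱 x g = 0 := fun x =>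
    ⟨fun hx g hg => congrArg Subtype.val (LinearMap.congr_fun (LinearMap.mem_ker.1 hx) ⟨g, hg⟩),
      fun hx => LinearMap.mem_ker.2 (LinearMap.ext fun g => Subtype.ext (hx g g.2))⟩
  refine ⟨LinearMap.ker r, fun a x hx => ⟨(hr _).2 fun g hg => ?_, (hr _).2 fun g hg => ?_⟩,
    Module.Finite.equiv r.quotKerEquivRange.symm, fun x hx => ?_⟩
  · rw [← (hr x).1 hx _ (h.translate_mem a hg)]
    exact ext' fun z => by rw [translate_eval, translate_eval, translate_eval, mul_assoc]
  · refine ext' fun z => ?_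
    rw [translate_eval, mul_assoc, ← translate_eval, (hr x).1 hx g hg]
    rfl
  · have h1 := congrArg (fun g => eval g 1) ((hr x).1 hx f hf)
    rw [translate_eval, mul_one] at h1
    exact h1

variable {ι : Type*} [Fintype ι] [DecidableEq ι]

variable {ω} in
theorem isStable_matCoeff {W : Type*} [AddCommGroup W] [Module ℂ W]
    {π : UEnv ω 𝒱 →ₗ[ℂ] Module.End ℂ W} {b : Module.Basis ι ℂ W} {d : ι → Γ}
    (h : IsGradedRep ω π b d) :
    IsStable ω (Submodule.span ℂ (Set.range fun p : ι × ι => matCoeff ω 𝒱 π b d p.1 p.2)) where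
  transL {α X} hX f hf := by
    refine (Submodule.span_le (p := Submodule.comap (transLₗ ω 𝒱 X) (Submodule.span ℂ
      (Set.range fun p : ι × ι => matCoeff ω 𝒱 π b d p.1 p.2)))).2 ?_ hf
    rintro _ ⟨⟨j, i⟩, rfl⟩
    -- In `eval_mul` the factor ω(α, γ) depends on the degree γ of x, but the second coefficient is
    -- nonzero only for γ = d_k - d_i; this makes the factor constant.
    have h1 : UDual.transL ω 𝒱 X (matCoeff ω 𝒱 π b d j i) =
        ∑ k, (ω α (d k - d i) * eval (matCoeff ω 𝒱 π b d j k) (UEnv.ι ω 𝒱 X)) •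
          matCoeff ω 𝒱 π b d k i := by
      refine ext_hom fun γ x hx => ?_
      rw [transL_eval, h.eval_mul j i (UEnv.ι_mem ω 𝒱 hX) hx, sum_eval]
      refine Finset.sum_congr rfl fun k _ => ?_
      rw [smul_eval]
      by_cases h' : d i - d k + γ = 0
      · rw [show γ = -(d i - d k) from (neg_eq_of_add_eq_zero_right h').symm, neg_sub,
          mul_assoc]
      · rw [mem_gr.1 (h.mem k i) γ x hx h', mul_zero, mul_zero, mul_zero]
    rw [SetLike.mem_coe, Submodule.mem_comap]
    change UDual.transL ω 𝒱 X (matCoeff ω 𝒱 π b d j i) ∈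
      Submodule.span ℂ (Set.range fun p : ι × ι => matCoeff ω 𝒱 π b d p.1 p.2)
    rw [h1]
    exact Submodule.sum_mem _ fun k _ => Submodule.smul_mem _ _
      (Submodule.subset_span ⟨(k, i), rfl⟩)
  scale α f hf := by
    refine (Submodule.span_le (p := Submodule.comap (scaleₗ ω 𝒱 α) (Submodule.span ℂ
      (Set.range fun p : ι × ι => matCoeff ω 𝒱 π b d p.1 p.2)))).2 ?_ hf
    rintro _ ⟨⟨j, i⟩, rfl⟩
    rw [SetLike.mem_coe, Submodule.mem_comap]
    change UDual.scale ω 𝒱 α (matCoeff ω 𝒱 π b d j i) ∈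
      Submodule.span ℂ (Set.range fun p : ι × ι => matCoeff ω 𝒱 π b d p.1 p.2)
    rw [scale_of_mem ω α (h.mem j i)]
    exact Submodule.smul_mem _ _ (Submodule.subset_span ⟨(j, i), rfl⟩)

end UDual

/-- The coordinate algebra is contained in the finite dual. -/
theorem mem_finiteDual {ι : Type*} [Fintype ι] [DecidableEq ι] (e : HomBasis 𝒱 ι)
    {f : UDual ω 𝒱} (hf : f ∈ coordAlg ω e) : f ∈ UDual.finiteDual ω 𝒱 := by
  -- The finite dimensional stable space W can be carried through an induction over sums and
  -- products, unlike a single ideal.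
  suffices h : ∃ W : Submodule ℂ (UDual ω 𝒱), UDual.IsStable ω W ∧ W.FG ∧ f ∈ W by
    obtain ⟨W, h, hW, hf⟩ := h
    exact h.mem_finiteDual hW hf
  have hgen : ∀ {W : Type _} [AddCommGroup W] [Module ℂ W]
      {π : UEnv ω 𝒱 →ₗ[ℂ] Module.End ℂ W} {b : Module.Basis ι ℂ W} {d : ι → Γ}
      (_ : IsGradedRep ω π b d) (j i : ι), ∃ W : Submodule ℂ (UDual ω 𝒱),
        UDual.IsStable ω W ∧ W.FG ∧ matCoeff ω 𝒱 π b d j i ∈ W := fun h j i =>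
    ⟨_, UDual.isStable_matCoeff h, Submodule.fg_span (Set.finite_range _),
      Submodule.subset_span ⟨(j, i), rfl⟩⟩
  induction hf using Algebra.adjoin_induction with
  | mem f hf =>
    rcases hf with ⟨j, i, rfl⟩ | ⟨j, i, rfl⟩
    · exact hgen (isGradedRep_natRep e) j i
    · exact hgen (isGradedRep_dualRep e) j i
  | algebraMap c =>
    refine ⟨1, ⟨?_, ?_⟩, ?_, ?_⟩
    · intro α X hX f hf
      obtain ⟨c, rfl⟩ := Submodule.mem_one.1 hf
      rw [Algebra.algebraMap_eq_smul_one]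
      have h1 : UDual.transL ω 𝒱 X (c • 1) = c • UDual.transL ω 𝒱 X 1 := rfl
      rw [h1, UDual.transL_one, smul_zero]
      exact zero_mem _
    · intro α f hf
      obtain ⟨c, rfl⟩ := Submodule.mem_one.1 hf
      rw [Algebra.algebraMap_eq_smul_one]
      have h1 : UDual.scale ω 𝒱 α (c • 1) = c • UDual.scale ω 𝒱 α 1 := rfl
      rw [h1, UDual.scale_one]
      exact Submodule.smul_mem _ _ (Submodule.mem_one.2 ⟨1, map_one _⟩)
    · rw [Submodule.one_eq_span]; exact Submodule.fg_span_singleton _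
    · exact Submodule.mem_one.2 ⟨c, rfl⟩
  | add f g _ _ hf hg =>
    obtain ⟨W, h1, h2, h3⟩ := hf
    obtain ⟨W', h1', h2', h3'⟩ := hg
    exact ⟨W ⊔ W', h1.sup h1', h2.sup h2', Submodule.add_mem_sup h3 h3'⟩
  | mul f g _ _ hf hg =>
    obtain ⟨W, h1, h2, h3⟩ := hf
    obtain ⟨W', h1', h2', h3'⟩ := hg
    exact ⟨W * W', h1.mul h1', h2.mul h2', Submodule.mul_mem_mul h3 h3'⟩

end FiniteDual

end

end Colour

namespace Colour

noncomputable section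


/-! ### Homomorphisms of coloured tensor products. -/

namespace CTensor

variable {Γ : Type*} [AddCommGroup Γ] [DecidableEq Γ] {ω : CommFactor Γ}
variable {A B C D : Type*} [Ring A] [Algebra ℂ A] [Ring B] [Algebra ℂ B] [Ring C] [Algebra ℂ C]
  [Ring D] [Algebra ℂ D]
variable {𝒜 : Γ → Submodule ℂ A} {ℬ : Γ → Submodule ℂ B} {𝒞 : Γ → Submodule ℂ C}
  {𝒟 : Γ → Submodule ℂ D}
variable [GradedAlgebra 𝒜] [GradedAlgebra ℬ] [GradedAlgebra 𝒞] [GradedAlgebra 𝒟]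

theorem add_tmul (a a' : A) (b : B) :
    tmul ω 𝒜 ℬ (a + a') b = tmul ω 𝒜 ℬ a b + tmul ω 𝒜 ℬ a' b := TensorProduct.add_tmul _ _ _

theorem tmul_add (a : A) (b b' : B) :
    tmul ω 𝒜 ℬ a (b + b') = tmul ω 𝒜 ℬ a b + tmul ω 𝒜 ℬ a b' := TensorProduct.tmul_add _ _ _

theorem smul_tmul' (c : ℂ) (a : A) (b : B) : tmul ω 𝒜 ℬ (c • a) b = c • tmul ω 𝒜 ℬ a b := rfl

theorem tmul_smul (c : ℂ) (a : A) (b : B) : tmul ω 𝒜 ℬ a (c • b) = c • tmul ω 𝒜 ℬ a b :=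
  TensorProduct.tmul_smul _ _ _

theorem tmul_one_mul (a a' : A) (b : B) :
    tmul ω 𝒜 ℬ a 1 * tmul ω 𝒜 ℬ a' b = tmul ω 𝒜 ℬ (a * a') b := by
  induction a' using hom_induction 𝒜 with
  | h0 =>
    have h1 : tmul ω 𝒜 ℬ 0 b = 0 := TensorProduct.zero_tmul _ _
    rw [mul_zero, h1, mul_zero]
  | hadd x y hx hy => rw [add_tmul, mul_add, mul_add, hx, hy, add_tmul]
  | h α a' ha' =>
    rw [tmul_mul_tmul ω 𝒜 ℬ a SetLike.GradedOne.one_mem ha', ω.zero_left, one_smul, one_mul]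

theorem mul_one_tmul (a : A) (b b' : B) :
    tmul ω 𝒜 ℬ a b * tmul ω 𝒜 ℬ 1 b' = tmul ω 𝒜 ℬ a (b * b') := by
  induction b using hom_induction ℬ with
  | h0 =>
    have h1 : tmul ω 𝒜 ℬ a 0 = 0 := TensorProduct.tmul_zero _ _
    rw [zero_mul, h1, zero_mul]
  | hadd x y hx hy => rw [tmul_add, add_mul, add_mul, hx, hy, tmul_add]
  | h β b hb =>
    rw [tmul_mul_tmul ω 𝒜 ℬ a hb SetLike.GradedOne.one_mem, ω.zero_right, one_smul, mul_one]

variable (ω 𝒜 ℬ) in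
/-- The map `a ↦ a ⊗ 1`. -/
def inl : A →ₐ[ℂ] CTensor ω 𝒜 ℬ :=
  AlgHom.ofLinearMap ((of ω 𝒜 ℬ).toLinearMap ∘ₗ (TensorProduct.mk ℂ A B).flip 1) rfl
    (fun a a' => (tmul_one_mul a a' 1).symm)

variable (ω 𝒜 ℬ) in
/-- The map `b ↦ 1 ⊗ b`. -/
def inr : B →ₐ[ℂ] CTensor ω 𝒜 ℬ :=
  AlgHom.ofLinearMap ((of ω 𝒜 ℬ).toLinearMap ∘ₗ TensorProduct.mk ℂ A B 1) rfl
    (fun b b' => (mul_one_tmul 1 b b').symm)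

theorem inl_mem {α : Γ} {a : A} (ha : a ∈ 𝒜 α) : inl ω 𝒜 ℬ a ∈ gr ω 𝒜 ℬ α := by
  have h := tmul_mem_gr ω 𝒜 ℬ ha (b := 1) SetLike.GradedOne.one_mem
  rwa [add_zero] at h

theorem inr_mem {β : Γ} {b : B} (hb : b ∈ ℬ β) : inr ω 𝒜 ℬ b ∈ gr ω 𝒜 ℬ β := by
  have h := tmul_mem_gr ω 𝒜 ℬ (a := 1) SetLike.GradedOne.one_mem hb
  rwa [zero_add] at h

theorem inl_mul_inr (a : A) (b : B) : inl ω 𝒜 ℬ a * inr ω 𝒜 ℬ b = tmul ω 𝒜 ℬ a b := by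
  refine (mul_one_tmul a 1 b).trans ?_
  rw [one_mul]

/-- The tensor product of `ω`-commutative algebras is `ω`-commutative. -/
theorem omegaComm (hA : OmegaComm ω 𝒜) (hB : OmegaComm ω ℬ) : OmegaComm ω (gr ω 𝒜 ℬ) := by
  intro γ δ x y hx hy
  induction hx using Submodule.span_induction with
  | zero => simp
  | add x x' _ _ h h' => rw [add_mul, mul_add, h, h', smul_add]
  | smul c x _ h => rw [smul_mul_assoc, mul_smul_comm, h, smul_comm]
  | mem x hx =>
    obtain ⟨α, β, a, b, ha, hb, rfl, rfl⟩ := hx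
    induction hy using Submodule.span_induction with
    | zero => simp
    | add x x' _ _ h h' => rw [add_mul, mul_add, h, h', smul_add]
    | smul c x _ h => rw [smul_mul_assoc, mul_smul_comm, h, smul_comm]
    | mem y hy =>
      obtain ⟨α', β', a', b', ha', hb', rfl, rfl⟩ := hy
      rw [tmul_mul_tmul ω 𝒜 ℬ a hb ha', tmul_mul_tmul ω 𝒜 ℬ a' hb' ha, hA ha ha', hB hb hb',
        smul_tmul', tmul_smul, smul_smul, smul_smul, smul_smul]
      congr 1
      simp only [ω.add_left, ω.add_right]
      linear_combination (-(ω α α' * ω β α' * ω β β')) * ω.skew α β'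

section Lift

variable (f : A →ₐ[ℂ] C) (g : B →ₐ[ℂ] C)

/-- The homomorphism `a ⊗ b ↦ f(a) g(b)`, where `g(b) f(a') = ω(d(b), d(a')) f(a') g(b)`. -/
def lift (h : ∀ β, ∀ b ∈ ℬ β, ∀ α, ∀ a ∈ 𝒜 α, g b * f a = ω β α • (f a * g b)) :
    CTensor ω 𝒜 ℬ →ₐ[ℂ] C :=
  AlgHom.ofLinearMap
    ((TensorProduct.lift ((LinearMap.mul ℂ C).compl₁₂ f.toLinearMap g.toLinearMap)) ∘ₗ
      (of ω 𝒜 ℬ).symm.toLinearMap)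
    (by
      change f 1 * g 1 = 1
      rw [map_one, map_one, one_mul])
    (fun x y => by
      induction x using induction with
      | h0 => rw [zero_mul, map_zero, zero_mul]
      | hadd x x' hx hx' => rw [add_mul, map_add, map_add, add_mul, hx, hx']
      | h α β a b ha hb =>
        induction y using induction with
        | h0 => rw [mul_zero, map_zero, mul_zero]
        | hadd x x' hx hx' => rw [mul_add, map_add, map_add, mul_add, hx, hx']
        | h α' β' a' b' ha' hb' =>
          rw [tmul_mul_tmul ω 𝒜 ℬ a hb ha', map_smul]
          change ω β α' • (f (a * a') * g (b * b')) = f a * g b * (f a' * g b')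
          rw [map_mul, map_mul, mul_assoc (f a) (g b), ← mul_assoc (g b), h β b hb α' a' ha']
          simp only [smul_mul_assoc, mul_smul_comm, mul_assoc])

theorem lift_tmul (h : ∀ β, ∀ b ∈ ℬ β, ∀ α, ∀ a ∈ 𝒜 α, g b * f a = ω β α • (f a * g b))
    (a : A) (b : B) : lift f g h (tmul ω 𝒜 ℬ a b) = f a * g b := rfl

end Lift

/-- The tensor product of two homomorphisms of graded algebras. -/
def map (f : A →ₐ[ℂ] C) (g : B →ₐ[ℂ] D) (hf : ∀ γ, ∀ a ∈ 𝒜 γ, f a ∈ 𝒞 γ)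
    (hg : ∀ γ, ∀ b ∈ ℬ γ, g b ∈ 𝒟 γ) : CTensor ω 𝒜 ℬ →ₐ[ℂ] CTensor ω 𝒞 𝒟 :=
  AlgHom.ofLinearMap ((of ω 𝒞 𝒟).toLinearMap ∘ₗ TensorProduct.map f.toLinearMap g.toLinearMap ∘ₗ
      (of ω 𝒜 ℬ).symm.toLinearMap)
    (by
      change tmul ω 𝒞 𝒟 (f 1) (g 1) = tmul ω 𝒞 𝒟 1 1
      rw [map_one, map_one])
    (fun x y => by
      induction x using induction with
      | h0 => rw [zero_mul, map_zero, zero_mul]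
      | hadd x x' hx hx' => rw [add_mul, map_add, map_add, add_mul, hx, hx']
      | h α β a b ha hb =>
        induction y using induction with
        | h0 => rw [mul_zero, map_zero, mul_zero]
        | hadd x x' hx hx' => rw [mul_add, map_add, map_add, mul_add, hx, hx']
        | h α' β' a' b' ha' hb' =>
          rw [tmul_mul_tmul ω 𝒜 ℬ a hb ha', map_smul]
          change ω β α' • tmul ω 𝒞 𝒟 (f (a * a')) (g (b * b')) =
            tmul ω 𝒞 𝒟 (f a) (g b) * tmul ω 𝒞 𝒟 (f a') (g b')
          rw [map_mul, map_mul, tmul_mul_tmul ω 𝒞 𝒟 (f a) (hg β b hb) (hf α' a' ha')])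

theorem map_tmul (f : A →ₐ[ℂ] C) (g : B →ₐ[ℂ] D) (hf : ∀ γ, ∀ a ∈ 𝒜 γ, f a ∈ 𝒞 γ)
    (hg : ∀ γ, ∀ b ∈ ℬ γ, g b ∈ 𝒟 γ) (a : A) (b : B) :
    map (ω := ω) f g hf hg (tmul ω 𝒜 ℬ a b) = tmul ω 𝒞 𝒟 (f a) (g b) := rfl

theorem inr_mul_tmul {α β : Γ} {a : A} {b : B} (ha : a ∈ 𝒜 α) (hb : b ∈ ℬ β) (b' : B) :
    inr ω 𝒜 ℬ b * tmul ω 𝒜 ℬ a b' = ω β α • tmul ω 𝒜 ℬ a (b * b') := by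
  refine (tmul_mul_tmul ω 𝒜 ℬ 1 hb ha b').trans ?_
  rw [one_mul]

variable (𝒜) in
theorem id_mem : ∀ γ, ∀ a ∈ 𝒜 γ, AlgHom.id ℂ A a ∈ 𝒜 γ := fun _ _ h => h

variable (ω 𝒜 ℬ 𝒞) in
/-- The associativity of the tensor product, as a homomorphism of algebras. -/
def assocHom : CTensor ω (gr ω 𝒜 ℬ) 𝒞 →ₐ[ℂ] CTensor ω 𝒜 (gr ω ℬ 𝒞) :=
  -- The map is a ⊗ b ↦ a ⊗ (b ⊗ 1) on the first factor and c ↦ 1 ⊗ (1 ⊗ c) on the second; the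
  -- remaining argument is their commutation rule.
  lift (map (AlgHom.id ℂ A) (inl ω ℬ 𝒞) (id_mem 𝒜) (fun _ _ h => inl_mem h))
    ((inr ω 𝒜 (gr ω ℬ 𝒞)).comp (inr ω ℬ 𝒞))
    (fun γ c hc δ p hp => by
      induction hp using Submodule.span_induction with
      | zero => simp
      | add x x' _ _ h h' => rw [map_add, mul_add, add_mul, h, h', smul_add]
      | smul r x _ h => rw [map_smul, smul_mul_assoc, mul_smul_comm, h, smul_comm]
      | mem x hx =>
        obtain ⟨α, β, a, b, ha, hb, rfl, rfl⟩ := hx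
        rw [map_tmul, AlgHom.comp_apply, AlgHom.id_apply, inr_mul_tmul ha (inr_mem hc)]
        have h1 : inr ω ℬ 𝒞 c * inl ω ℬ 𝒞 b = ω γ β • tmul ω ℬ 𝒞 b c :=
          (inr_mul_tmul hb hc 1).trans (by rw [mul_one])
        have h2 : tmul ω 𝒜 (gr ω ℬ 𝒞) a (inl ω ℬ 𝒞 b) * inr ω 𝒜 (gr ω ℬ 𝒞) (inr ω ℬ 𝒞 c) =
            tmul ω 𝒜 (gr ω ℬ 𝒞) a (tmul ω ℬ 𝒞 b c) :=
          (mul_one_tmul a _ _).trans (by rw [inl_mul_inr])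
        rw [h1, h2, tmul_smul, smul_smul, ω.add_right])

theorem assocHom_tmul (a : A) (b : B) (c : C) :
    assocHom ω 𝒜 ℬ 𝒞 (tmul ω (gr ω 𝒜 ℬ) 𝒞 (tmul ω 𝒜 ℬ a b) c) =
      tmul ω 𝒜 (gr ω ℬ 𝒞) a (tmul ω ℬ 𝒞 b c) := by
  rw [assocHom, lift_tmul, map_tmul]
  exact (mul_one_tmul a _ _).trans (congrArg (tmul ω 𝒜 (gr ω ℬ 𝒞) a) (inl_mul_inr b c))

end CTensor

end

end Colour

namespace Colour

noncomputable section


/-! ### The universal property of the symmetric algebra. -/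

section Sym

variable {Γ : Type*} [AddCommGroup Γ] [DecidableEq Γ] {ω : CommFactor Γ}
variable {M : Type*} [AddCommGroup M] [Module ℂ M] {𝓜 : Γ → Submodule ℂ M}
  [DirectSum.Decomposition 𝓜] {κ : Type*} [Fintype κ]
variable {B : Type*} [Ring B] [Algebra ℂ B]

variable (ω) in
/-- The homomorphism on `S_ω(M)` with given values on a homogeneous basis of `M`. -/
def SymAlg.lift (b : HomBasis 𝓜 κ) (x : κ → B)
    (hx : ∀ p q, x p * x q = ω (b.deg p) (b.deg q) • (x q * x p)) : SymAlg ω 𝓜 →ₐ[ℂ] B :=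
  RingQuot.liftAlgHom ℂ ⟨TensorAlgebra.lift ℂ (b.basis.constr ℂ x), by
    rintro _ _ ⟨α, β, m, m', hm, hm'⟩
    rw [map_smul, map_mul, map_mul]
    simp only [TensorAlgebra.lift_ι_apply, Module.Basis.constr_apply_fintype,
      Module.Basis.equivFun_apply, ← Module.Basis.coord_apply]
    simp only [Finset.sum_mul_sum, Finset.smul_sum]
    rw [Finset.sum_comm]
    refine Finset.sum_congr rfl fun q _ => Finset.sum_congr rfl fun p _ => ?_
    rw [smul_mul_smul_comm, smul_mul_smul_comm, hx, smul_smul, smul_smul]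
    -- The relation concerns arbitrary homogeneous elements and the hypothesis only basis elements;
    -- a homogeneous element has no coordinates at basis elements of other degrees, so the factors
    -- agree.
    by_cases hp : α = b.deg p
    · by_cases hq : β = b.deg q
      · rw [hp, hq]; congr 1; ring
      · rw [b.coord_eq_zero hm' hq]; simp
    · rw [b.coord_eq_zero hm hp]; simp⟩

theorem SymAlg.lift_ι (b : HomBasis 𝓜 κ) (x : κ → B)
    (hx : ∀ p q, x p * x q = ω (b.deg p) (b.deg q) • (x q * x p)) (p : κ) :
    SymAlg.lift ω b x hx (SymAlg.ι ω 𝓜 (b.basis p)) = x p := by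
  unfold SymAlg.lift SymAlg.ι
  rw [LinearMap.comp_apply, AlgHom.toLinearMap_apply, RingQuot.liftAlgHom_mkAlgHom_apply,
    TensorAlgebra.lift_ι_apply, Module.Basis.constr_basis]

theorem SymAlg.adjoin_eq_top (b : HomBasis 𝓜 κ) :
    Algebra.adjoin ℂ (Set.range fun p => SymAlg.ι ω 𝓜 (b.basis p)) = ⊤ := by
  set S := Algebra.adjoin ℂ (Set.range fun p => SymAlg.ι ω 𝓜 (b.basis p)) with hS
  have h1 : ∀ m, SymAlg.ι ω 𝓜 m ∈ S := by
    intro m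
    rw [← b.basis.sum_repr m, map_sum]
    refine Subalgebra.sum_mem _ fun p _ => ?_
    rw [map_smul]
    exact Subalgebra.smul_mem _ (hS ▸ Algebra.subset_adjoin (Set.mem_range_self p)) _
  have h2 : S.comap (RingQuot.mkAlgHom ℂ (symRel ω 𝓜)) = ⊤ := by
    rw [eq_top_iff, ← TensorAlgebra.adjoin_range_ι, Algebra.adjoin_le_iff]
    rintro _ ⟨m, rfl⟩
    exact h1 m
  rw [eq_top_iff]
  intro x _
  obtain ⟨y, rfl⟩ := RingQuot.mkAlgHom_surjective ℂ (symRel ω 𝓜) x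
  exact (h2 ▸ Algebra.mem_top : y ∈ S.comap (RingQuot.mkAlgHom ℂ (symRel ω 𝓜)))

theorem SymAlg.ι_mul_ι (b : HomBasis 𝓜 κ) (p q : κ) :
    SymAlg.ι ω 𝓜 (b.basis p) * SymAlg.ι ω 𝓜 (b.basis q) =
      ω (b.deg p) (b.deg q) • (SymAlg.ι ω 𝓜 (b.basis q) * SymAlg.ι ω 𝓜 (b.basis p)) := by
  have h := RingQuot.mkAlgHom_rel ℂ (symRel.comm (ω := ω) (𝓜 := 𝓜) _ _ _ _ (b.mem p) (b.mem q))
  rw [map_smul, map_mul, map_mul] at h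
  exact h

theorem SymAlg.omegaComm (b : HomBasis 𝓜 κ) : OmegaComm ω (symGr ω 𝓜) :=
  OmegaComm.of_adjoin _ b.deg (fun p => SymAlg.ι_mem ω 𝓜 (b.mem p)) (SymAlg.adjoin_eq_top b)
    (SymAlg.ι_mul_ι b)

end Sym

/-! ### Algebras generated by a matrix and its inverse. -/

section MatrixGenerated

variable {A B : Type*} [Ring A] [Algebra ℂ A] [Ring B] [Algebra ℂ B]
variable {ι : Type*} [Fintype ι] [DecidableEq ι]

/-- The entries of two matrices. -/
def matGen (X y : Matrix ι ι A) : (ι × ι) ⊕ (ι × ι) → A :=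
  Sum.elim (fun p => X p.1 p.2) (fun p => y p.1 p.2)

/-- A homomorphism on an algebra generated by the entries of a matrix and of its inverse is determined
by its values on the entries of the matrix. -/
theorem hom_ext_of_matrix {X y : Matrix ι ι A} (hXy : X * y = 1) (hyX : y * X = 1)
    (hgen : Algebra.adjoin ℂ (Set.range (matGen X y)) = ⊤) {f g : A →ₐ[ℂ] B}
    (h : ∀ j i, f (X j i) = g (X j i)) : f = g := by
  have h1 : X.map f = X.map g := Matrix.ext fun j i => h j i
  have h2 : y.map f * X.map f = 1 := by
    rw [← Matrix.map_mul, hyX]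
    exact Matrix.map_one f (map_zero f) (map_one f)
  have h3 : X.map g * y.map g = 1 := by
    rw [← Matrix.map_mul, hXy]
    exact Matrix.map_one g (map_zero g) (map_one g)
  -- The two images of y are a left inverse and a right inverse of the same matrix.
  have h4 : y.map f = y.map g := left_inv_eq_right_inv h2 (h1 ▸ h3)
  refine AlgHom.ext_of_adjoin_eq_top hgen ?_
  rintro _ ⟨⟨j, i⟩ | ⟨j, i⟩, rfl⟩
  · exact h j i
  · exact congrFun (congrFun h4 j) i

variable {Γ : Type*} [AddCommGroup Γ] [DecidableEq Γ]
variable {𝒜 : Γ → Submodule ℂ A} {ℬ : Γ → Submodule ℂ B} [GradedAlgebra 𝒜] [GradedAlgebra ℬ]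
  {d : ι → Γ}

end MatrixGenerated

/-! ### The algebra 𝓕(V) and its universal property. -/

section Pres

variable {Γ : Type*} [AddCommGroup Γ] [DecidableEq Γ] {ω : CommFactor Γ}
variable {V : Type*} [AddCommGroup V] [Module ℂ V] [FiniteDimensional ℂ V]
variable {𝒱 : Γ → Submodule ℂ V} [DirectSum.Decomposition 𝒱]
variable {ι : Type*} [Fintype ι] [DecidableEq ι] (e : HomBasis 𝒱 ι)

/-- The basis `e_j^* ⊗ e_i` of `V^* ⊗ V`. -/
def dualTensorBasis : HomBasis (tensorGr (dualGr 𝒱) 𝒱) (ι × ι) where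
  basis := e.basis.dualBasis.tensorProduct e.basis
  deg p := e.deg p.2 - e.deg p.1
  mem p := by
    rw [Module.Basis.tensorProduct_apply, ← neg_add_eq_sub]
    exact tmul_mem_tensorGr (dualBasis_mem e p.1) (e.mem p.2)

/-- The basis `e_j ⊗ e_i^*` of `V ⊗ V^*`. -/
def tensorDualBasis : HomBasis (tensorGr 𝒱 (dualGr 𝒱)) (ι × ι) where
  basis := e.basis.tensorProduct e.basis.dualBasis
  deg p := e.deg p.1 - e.deg p.2
  mem p := by
    rw [Module.Basis.tensorProduct_apply, sub_eq_add_neg]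
    exact tmul_mem_tensorGr (e.mem p.1) (dualBasis_mem e p.2)

theorem dualTensorBasis_apply (j i : ι) :
    (dualTensorBasis e).basis (j, i) = e.basis.dualBasis j ⊗ₜ e.basis i :=
  Module.Basis.tensorProduct_apply _ _ _ _

theorem tensorDualBasis_apply (j i : ι) :
    (tensorDualBasis e).basis (j, i) = e.basis j ⊗ₜ e.basis.dualBasis i :=
  Module.Basis.tensorProduct_apply _ _ _ _

theorem ffAlg_omegaComm (e : HomBasis 𝒱 ι) : OmegaComm ω (ffGr ω 𝒱) :=
  CTensor.omegaComm (SymAlg.omegaComm (dualTensorBasis e)) (SymAlg.omegaComm (tensorDualBasis e))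

theorem presAlg_omegaComm : OmegaComm ω (presGr ω e) :=
  (ffAlg_omegaComm e).of_surjective_of_eq (RingQuot.mkAlgHom ℂ (JRel ω e)) (fun _ _ h => h)

theorem presX_mem (j i : ι) : presX ω e j i ∈ presGr ω e (e.deg i - e.deg j) :=
  mk_mem_quotGr _ (XGen_mem ω e j i)

theorem presXbar_mem (j i : ι) : presXbar ω e j i ∈ presGr ω e (e.deg j - e.deg i) :=
  mk_mem_quotGr _ (XbarGen_mem ω e j i)

/-- The generators of `𝓕(V)`. -/
def presGen : (ι × ι) ⊕ (ι × ι) → presAlg ω e :=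
  Sum.elim (fun p => presX ω e p.1 p.2) (fun p => presXbar ω e p.1 p.2)

theorem presGen_mem (p : (ι × ι) ⊕ (ι × ι)) : presGen (ω := ω) e p ∈
    presGr ω e (Sum.elim (fun p : ι × ι => e.deg p.2 - e.deg p.1)
      (fun p : ι × ι => e.deg p.1 - e.deg p.2) p) := by
  rcases p with p | p
  exacts [presX_mem e p.1 p.2, presXbar_mem e p.1 p.2]

theorem adjoin_presGen : Algebra.adjoin ℂ (Set.range (presGen (ω := ω) e)) = ⊤ := by
  set S := Algebra.adjoin ℂ (Set.range (presGen (ω := ω) e)) with hS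
  let π := RingQuot.mkAlgHom ℂ (JRel ω e)
  have h1 : S.comap (π.comp (CTensor.inl ω (fGr ω 𝒱) (fbarGr ω 𝒱))) = ⊤ := by
    rw [eq_top_iff, ← SymAlg.adjoin_eq_top (dualTensorBasis e), Algebra.adjoin_le_iff]
    rintro _ ⟨⟨j, i⟩, rfl⟩
    have h : presGen (ω := ω) e (Sum.inl (j, i)) ∈ S := Algebra.subset_adjoin ⟨_, rfl⟩
    simp only [dualTensorBasis_apply]
    exact h
  have h2 : S.comap (π.comp (CTensor.inr ω (fGr ω 𝒱) (fbarGr ω 𝒱))) = ⊤ := by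
    rw [eq_top_iff, ← SymAlg.adjoin_eq_top (tensorDualBasis e), Algebra.adjoin_le_iff]
    rintro _ ⟨⟨j, i⟩, rfl⟩
    have h : presGen (ω := ω) e (Sum.inr (j, i)) ∈ S := Algebra.subset_adjoin ⟨_, rfl⟩
    have h' := Subalgebra.smul_mem _ h (ω (e.deg j) (e.deg j))
    simp only [tensorDualBasis_apply]
    have h3 : ω (e.deg j) (e.deg j) • presGen (ω := ω) e (Sum.inr (j, i)) =
        π (CTensor.inr ω (fGr ω 𝒱) (fbarGr ω 𝒱)
          (SymAlg.ι ω (tensorGr 𝒱 (dualGr 𝒱)) (e.basis j ⊗ₜ e.basis.dualBasis i))) := by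
      change _ • π (CTensor.inr ω (fGr ω 𝒱) (fbarGr ω 𝒱) (ω (e.deg j) (e.deg j) • _)) = _
      rw [map_smul, map_smul, smul_smul, ω.skew, one_smul]
    rw [h3] at h'
    exact h'
  rw [eq_top_iff]
  intro x _
  obtain ⟨y, rfl⟩ := RingQuot.mkAlgHom_surjective ℂ (JRel ω e) x
  induction y using CTensor.induction with
  | h0 => rw [map_zero]; exact zero_mem _
  | hadd x y hx hy => rw [map_add]; exact add_mem (hx Algebra.mem_top) (hy Algebra.mem_top)
  | h α β a b _ _ =>
    rw [← CTensor.inl_mul_inr, map_mul]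
    have ha : a ∈ S.comap (π.comp (CTensor.inl ω (fGr ω 𝒱) (fbarGr ω 𝒱))) := h1 ▸ Algebra.mem_top
    have hb : b ∈ S.comap (π.comp (CTensor.inr ω (fGr ω 𝒱) (fbarGr ω 𝒱))) := h2 ▸ Algebra.mem_top
    exact mul_mem (S := Subalgebra ℂ (presAlg ω e)) (s := S) ha hb

/-- The matrix `X`. -/
def presMat : homMat (presGr ω e) e.deg :=
  ⟨fun j i => presX ω e j i, fun j i => presX_mem e j i⟩

/-- The inverse of the matrix `X`. -/
def presInv : homMat (presGr ω e) e.deg :=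
  ⟨fun j i => ω (e.deg i) (e.deg j - e.deg i) • presXbar ω e i j,
    fun j i => Submodule.smul_mem _ _ (presXbar_mem e i j)⟩

theorem presXbar_eq (j i : ι) : presXbar ω e j i =
    ω (e.deg j) (e.deg j - e.deg i) • (presInv (ω := ω) e : Matrix ι ι (presAlg ω e)) i j := by
  change _ = _ • ω (e.deg j) (e.deg i - e.deg j) • presXbar ω e j i
  rw [smul_smul, ← ω.add_right, sub_add_sub_cancel, sub_self, ω.zero_right, one_smul]

/-- The relation with the indices j, k is this matrix entry up to the factor ω(d_k, d_j - d_k). The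
factor is 1 on the diagonal, and off the diagonal the right side is 0. -/
theorem presMat_mul_presInv : presMat (ω := ω) e * presInv e = 1 := by
  refine Subtype.ext (Matrix.ext fun j k => ?_)
  have h := RingQuot.mkAlgHom_rel ℂ (JRel.right (ω := ω) (e := e) j k)
  rw [map_sum, apply_ite (RingQuot.mkAlgHom ℂ (JRel ω e)), map_one, map_zero] at h
  change ∑ i, presX ω e j i * (ω (e.deg k) (e.deg i - e.deg k) • presXbar ω e k i) =
    (1 : Matrix ι ι (presAlg ω e)) j k
  rw [Matrix.one_apply, ← h, ← one_smul ℂ (∑ i, presX ω e j i * _)]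
  by_cases hjk : j = k
  · subst hjk
    rw [one_smul]
    refine Finset.sum_congr rfl fun i _ => ?_
    rw [map_smul, map_mul, mul_smul_comm]
    rfl
  · rw [if_neg hjk] at h
    rw [h, one_smul]
    have h2 := congrArg (fun z => ω (e.deg k) (e.deg j - e.deg k) • z) h
    rw [smul_zero] at h2
    rw [← h2, Finset.smul_sum]
    refine Finset.sum_congr rfl fun i _ => ?_
    rw [map_smul, map_mul, mul_smul_comm, smul_smul, ← ω.add_right, add_comm,
      sub_add_sub_cancel]
    rfl

theorem presInv_mul_presMat : presInv (ω := ω) e * presMat e = 1 := by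
  refine Subtype.ext (Matrix.ext fun j k => ?_)
  have h := RingQuot.mkAlgHom_rel ℂ (JRel.left (ω := ω) (e := e) j k)
  rw [map_sum, apply_ite (RingQuot.mkAlgHom ℂ (JRel ω e)), map_one, map_zero] at h
  change ∑ i, (ω (e.deg i) (e.deg j - e.deg i) • presXbar ω e i j) * presX ω e i k =
    (1 : Matrix ι ι (presAlg ω e)) j k
  rw [Matrix.one_apply, ← h]
  refine Finset.sum_congr rfl fun i _ => ?_
  rw [map_smul, map_mul, smul_mul_assoc, ← ω.neg_right (e.deg i), neg_sub]
  rfl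

theorem adjoin_presMat : Algebra.adjoin ℂ (Set.range (matGen
    (presMat (ω := ω) e : Matrix ι ι (presAlg ω e)) (presInv (ω := ω) e : Matrix ι ι (presAlg ω e)))) = ⊤ := by
  rw [eq_top_iff, ← adjoin_presGen, Algebra.adjoin_le_iff]
  rintro _ ⟨⟨j, i⟩ | ⟨j, i⟩, rfl⟩
  · exact Algebra.subset_adjoin ⟨Sum.inl (j, i), rfl⟩
  · have h : presGen (ω := ω) e (Sum.inr (j, i)) = _ := presXbar_eq e j i
    rw [h]
    exact Subalgebra.smul_mem _ (Algebra.subset_adjoin (Set.mem_range_self (Sum.inr (i, j)))) _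

section Lift

variable {B : Type*} [Ring B] [Algebra ℂ B] {ℬ : Γ → Submodule ℂ B} [GradedAlgebra ℬ]

/-- The homomorphism on `F(V)` with given values on the generators. -/
def fLift (hB : OmegaComm ω ℬ) (x : homMat ℬ e.deg) : FAlg ω 𝒱 →ₐ[ℂ] B :=
  SymAlg.lift ω (dualTensorBasis e) (fun p => (x : Matrix ι ι B) p.1 p.2)
    (fun p q => hB (x.2 p.1 p.2) (x.2 q.1 q.2))

theorem fLift_ι (hB : OmegaComm ω ℬ) (x : homMat ℬ e.deg) (j i : ι) :
    fLift e hB x (SymAlg.ι ω (tensorGr (dualGr 𝒱) 𝒱) (e.basis.dualBasis j ⊗ₜ e.basis i)) =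
      (x : Matrix ι ι B) j i := by
  rw [← dualTensorBasis_apply]
  exact SymAlg.lift_ι _ _ _ _

theorem fLift_mem (hB : OmegaComm ω ℬ) (x : homMat ℬ e.deg) {γ : Γ} {a : FAlg ω 𝒱}
    (ha : a ∈ fGr ω 𝒱 γ) : fLift e hB x a ∈ ℬ γ := by
  refine map_mem_of_adjoin _ _ (fun p => SymAlg.ι_mem ω _ ((dualTensorBasis e).mem p))
    (SymAlg.adjoin_eq_top (dualTensorBasis e)) _ (fun p => ?_) ha
  have h : fLift e hB x (SymAlg.ι ω _ ((dualTensorBasis e).basis p)) =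
    (x : Matrix ι ι B) p.1 p.2 := SymAlg.lift_ι _ _ _ _
  rw [h]
  exact x.2 p.1 p.2

/-- The homomorphism on `S_ω(V ⊗ V^*)` with given values on the generators. -/
def fbarLift (hB : OmegaComm ω ℬ) (y : homMat ℬ e.deg) : FbarAlg ω 𝒱 →ₐ[ℂ] B :=
  SymAlg.lift ω (tensorDualBasis e)
    -- The generator carries the factor ω(d_j, d_j), so this choice sends it to ω(d_j, d_j - d_i)
    -- y_{ij}, in accordance with `presXbar_eq`.
    (fun p => ω (e.deg p.1) (-e.deg p.2) • (y : Matrix ι ι B) p.2 p.1)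
    (fun p q => by
      rw [smul_mul_smul_comm, smul_mul_smul_comm, hB (y.2 p.2 p.1) (y.2 q.2 q.1), smul_comm,
        mul_comm (ω (e.deg p.1) _)]
      rfl)

theorem fbarLift_ι (hB : OmegaComm ω ℬ) (y : homMat ℬ e.deg) (j i : ι) :
    fbarLift e hB y (ω (e.deg j) (e.deg j) •
      SymAlg.ι ω (tensorGr 𝒱 (dualGr 𝒱)) (e.basis j ⊗ₜ e.basis.dualBasis i)) =
      ω (e.deg j) (e.deg j - e.deg i) • (y : Matrix ι ι B) i j := by
  rw [← tensorDualBasis_apply, map_smul, sub_eq_add_neg, ω.add_right, mul_smul]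
  exact congrArg _ (SymAlg.lift_ι (tensorDualBasis e) _ _ _)

theorem fbarLift_mem (hB : OmegaComm ω ℬ) (y : homMat ℬ e.deg) {γ : Γ} {a : FbarAlg ω 𝒱}
    (ha : a ∈ fbarGr ω 𝒱 γ) : fbarLift e hB y a ∈ ℬ γ := by
  refine map_mem_of_adjoin _ _ (fun p => SymAlg.ι_mem ω _ ((tensorDualBasis e).mem p))
    (SymAlg.adjoin_eq_top (tensorDualBasis e)) _ (fun p => ?_) ha
  have h : fbarLift e hB y (SymAlg.ι ω _ ((tensorDualBasis e).basis p)) =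
    ω (e.deg p.1) (-e.deg p.2) • (y : Matrix ι ι B) p.2 p.1 := SymAlg.lift_ι _ _ _ _
  rw [h]
  exact Submodule.smul_mem _ _ (y.2 p.2 p.1)

/-- The homomorphism on `𝓕(V)` which sends `X` to a given invertible matrix. -/
def presLift (hB : OmegaComm ω ℬ) (x y : homMat ℬ e.deg) (hxy : x * y = 1) (hyx : y * x = 1) :
    presAlg ω e →ₐ[ℂ] B :=
  RingQuot.liftAlgHom ℂ ⟨CTensor.lift (fLift e hB x) (fbarLift e hB y)
      (fun _ _ hb _ _ ha => hB (fbarLift_mem e hB y hb) (fLift_mem e hB x ha)), by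
    have h1 : ∀ j k, ∑ i, (x : Matrix ι ι B) j i * (y : Matrix ι ι B) i k = if j = k then 1 else 0 :=
      fun j k => (congrFun (congrFun (congrArg Subtype.val hxy) j) k).trans Matrix.one_apply
    have h2 : ∀ j k, ∑ i, (y : Matrix ι ι B) j i * (x : Matrix ι ι B) i k = if j = k then 1 else 0 :=
      fun j k => (congrFun (congrFun (congrArg Subtype.val hyx) j) k).trans Matrix.one_apply
    have hX : ∀ j i, CTensor.lift (fLift e hB x) (fbarLift e hB y)
      (fun _ _ hb _ _ ha => hB (fbarLift_mem e hB y hb) (fLift_mem e hB x ha)) (XGen ω e j i) =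
        (x : Matrix ι ι B) j i := fun j i => by
      rw [XGen, CTensor.lift_tmul, map_one, mul_one, fLift_ι]
    have hXbar : ∀ j i, CTensor.lift (fLift e hB x) (fbarLift e hB y)
      (fun _ _ hb _ _ ha => hB (fbarLift_mem e hB y hb) (fLift_mem e hB x ha)) (XbarGen ω e j i) =
        ω (e.deg j) (e.deg j - e.deg i) • (y : Matrix ι ι B) i j := fun j i => by
      rw [XbarGen, CTensor.lift_tmul, map_one, one_mul, fbarLift_ι]
    rintro _ _ (⟨j, k⟩ | ⟨j, k⟩)
    · rw [map_sum, apply_ite (CTensor.lift (fLift e hB x) (fbarLift e hB y) _), map_one, map_zero]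
      -- The discrepancy between the relation and the matrix identity is a scalar which is 1 for j =
      -- k, so it may be put in front of δ_{jk}.
      have h3 : (if j = k then 1 else 0 : B) =
          ω (e.deg k) (e.deg k - e.deg j) • (if j = k then 1 else 0 : B) := by
        split_ifs with h
        · rw [h, sub_self, ω.zero_right, one_smul]
        · rw [smul_zero]
      rw [h3, ← h1 j k, Finset.smul_sum]
      refine Finset.sum_congr rfl fun i _ => ?_
      rw [map_smul, map_mul, hX, hXbar, mul_smul_comm, smul_smul, ← ω.add_right, add_comm,
        sub_add_sub_cancel]
    · rw [map_sum, apply_ite (CTensor.lift (fLift e hB x) (fbarLift e hB y) _), map_one, map_zero]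
      rw [← h2 j k]
      refine Finset.sum_congr rfl fun i _ => ?_
      rw [map_smul, map_mul, hX, hXbar, smul_mul_assoc, smul_smul, ω.skew, one_smul]⟩

variable (hB : OmegaComm ω ℬ) (x y : homMat ℬ e.deg) (hxy : x * y = 1) (hyx : y * x = 1)

theorem presLift_X (j i : ι) : presLift e hB x y hxy hyx (presX ω e j i) =
    (x : Matrix ι ι B) j i := by
  rw [presLift, presX, RingQuot.liftAlgHom_mkAlgHom_apply, XGen, CTensor.lift_tmul, map_one,
    mul_one, fLift_ι]

theorem presLift_Xbar (j i : ι) : presLift e hB x y hxy hyx (presXbar ω e j i) =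
    ω (e.deg j) (e.deg j - e.deg i) • (y : Matrix ι ι B) i j := by
  rw [presLift, presXbar, RingQuot.liftAlgHom_mkAlgHom_apply, XbarGen, CTensor.lift_tmul, map_one,
    one_mul, fbarLift_ι]

theorem presLift_inv (j i : ι) : presLift e hB x y hxy hyx
    ((presInv (ω := ω) e : Matrix ι ι (presAlg ω e)) j i) = (y : Matrix ι ι B) j i := by
  change presLift e hB x y hxy hyx (ω (e.deg i) (e.deg j - e.deg i) • presXbar ω e i j) = _
  rw [map_smul, presLift_Xbar, smul_smul, ← ω.add_right, sub_add_sub_cancel, sub_self,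
    ω.zero_right, one_smul]

theorem presLift_mem {γ : Γ} {a : presAlg ω e} (ha : a ∈ presGr ω e γ) :
    presLift e hB x y hxy hyx a ∈ ℬ γ := by
  refine map_mem_of_adjoin _ _ (presGen_mem e) (adjoin_presGen e) _ (fun p => ?_) ha
  rcases p with ⟨j, i⟩ | ⟨j, i⟩
  · exact (presLift_X e hB x y hxy hyx j i).symm ▸ x.2 j i
  · exact (presLift_Xbar e hB x y hxy hyx j i).symm ▸ Submodule.smul_mem _ _ (y.2 i j)

end Lift

end Pres

end

end Colour

namespace Colour

noncomputable section


/-! ### The field as an `ω`-commutative algebra, the target of the co-unit. -/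

section Triv

variable {Γ : Type*} [AddCommGroup Γ] [DecidableEq Γ] {ω : CommFactor Γ}

theorem mem_trivGr {γ : Γ} {c : ℂ} : c ∈ trivGr γ ↔ (γ ≠ 0 → c = 0) := by
  by_cases h : γ = 0 <;> simp [trivGr, h]

instance : GradedAlgebra (trivGr (Γ := Γ)) :=
  { (inferInstance : DirectSum.Decomposition (trivGr (Γ := Γ))) with
    one_mem := mem_trivGr.2 fun h => absurd rfl h
    mul_mem := fun α β a b ha hb => mem_trivGr.2 fun h => by
      by_cases hα : α = 0
      · rw [mem_trivGr.1 hb fun hβ => h (by rw [hα, hβ, add_zero]), mul_zero]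
      · rw [mem_trivGr.1 ha hα, zero_mul] }

theorem trivGr_omegaComm : OmegaComm ω (trivGr (Γ := Γ)) := by
  intro α β a b ha hb
  by_cases hα : α = 0
  · rw [hα, ω.zero_left, one_smul, mul_comm]
  · rw [mem_trivGr.1 ha hα]; simp

end Triv

/-! ### Hopf structures on algebras generated by a matrix and its inverse. -/

section HopfOfMatrix

variable {Γ : Type*} [AddCommGroup Γ] [DecidableEq Γ] {ω : CommFactor Γ}
variable {A : Type*} [Ring A] [Algebra ℂ A] {𝒜 : Γ → Submodule ℂ A} [GradedAlgebra 𝒜]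
variable {ι : Type*} [Fintype ι] [DecidableEq ι] {d : ι → Γ}

/-- The Hopf structure of an `ω`-commutative algebra which is generated by the entries of a matrix
and of its inverse, for given structure maps with the usual values on the matrix. -/
def hopfOfMatrix (hA : OmegaComm ω 𝒜) (X y : homMat 𝒜 d) (hXy : X * y = 1) (hyX : y * X = 1)
    (hgen : Algebra.adjoin ℂ (Set.range (matGen (X : Matrix ι ι A) y)) = ⊤)
    (Δ : A →ₐ[ℂ] CTensor ω 𝒜 𝒜) (ε : A →ₐ[ℂ] ℂ) (S : A →ₐ[ℂ] A)
    (hΔ : ∀ j i, Δ ((X : Matrix ι ι A) j i) =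
      ∑ k, CTensor.tmul ω 𝒜 𝒜 ((X : Matrix ι ι A) j k) ((X : Matrix ι ι A) k i))
    (hε : ∀ j i, ε ((X : Matrix ι ι A) j i) = if j = i then 1 else 0)
    (hS : ∀ j i, S ((X : Matrix ι ι A) j i) = (y : Matrix ι ι A) j i)
    (hΔ' : ∀ γ, ∀ a ∈ 𝒜 γ, Δ a ∈ CTensor.gr ω 𝒜 𝒜 γ)
    (hε' : ∀ γ, ∀ a ∈ 𝒜 γ, γ ≠ 0 → ε a = 0) (hS' : ∀ γ, ∀ a ∈ 𝒜 γ, S a ∈ 𝒜 γ) :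
    ColourHopf ω 𝒜 :=
  -- The axioms on co-associativity, co-unit and antipode below are equalities of algebra
  -- homomorphisms, so they are verified on the entries of X only.
  have hext : ∀ {B : Type _} [Ring B] [Algebra ℂ B] {f g : A →ₐ[ℂ] B},
      (∀ j i, f ((X : Matrix ι ι A) j i) = g ((X : Matrix ι ι A) j i)) → f = g := fun h =>
    hom_ext_of_matrix (congrArg Subtype.val hXy) (congrArg Subtype.val hyX) hgen h
  have hyX' : ∀ j k, ∑ i, (y : Matrix ι ι A) j i * (X : Matrix ι ι A) i k = if j = k then 1 else 0 :=
    fun j k => (congrFun (congrFun (congrArg Subtype.val hyX) j) k).trans Matrix.one_apply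
  have hXy' : ∀ j k, ∑ i, (X : Matrix ι ι A) j i * (y : Matrix ι ι A) i k = if j = k then 1 else 0 :=
    fun j k => (congrFun (congrFun (congrArg Subtype.val hXy) j) k).trans Matrix.one_apply
  -- The co-unit vanishes outside degree 0, and scalars are central; this is the commutation rule
  -- needed to combine it with the identity on the tensor product.
  have hεc : ∀ β, ∀ b ∈ 𝒜 β, ∀ α, ∀ a ∈ 𝒜 α, b * (Algebra.ofId ℂ A).comp ε a =
      ω β α • ((Algebra.ofId ℂ A).comp ε a * b) := fun β b hb α a ha => by
    rw [AlgHom.comp_apply, Algebra.ofId_apply, ← Algebra.commutes]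
    by_cases h : α = 0
    · rw [h, ω.zero_right, one_smul]
    · rw [hε' α a ha h, map_zero, zero_mul, smul_zero]
  have hεc' : ∀ β, ∀ b ∈ 𝒜 β, ∀ α, ∀ a ∈ 𝒜 α, (Algebra.ofId ℂ A).comp ε b * a =
      ω β α • (a * (Algebra.ofId ℂ A).comp ε b) := fun β b hb α a ha => by
    rw [AlgHom.comp_apply, Algebra.ofId_apply, Algebra.commutes]
    by_cases h : β = 0
    · rw [h, ω.zero_left, one_smul]
    · rw [hε' β b hb h, map_zero, mul_zero, smul_zero]
  { comul := Δ
    counit := ε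
    antipode := S.toLinearMap
    comul_mem := hΔ'
    counit_eq_zero := hε'
    antipode_mem := hS'
    coassoc := fun a => by
      -- Co-associativity as an equality of homomorphisms of coloured tensor products. The
      -- statements `h3`, `h5` and `h4` identify these homomorphisms with the linear maps of the
      -- axiom.
      have h1 : (CTensor.assocHom ω 𝒜 𝒜 𝒜).comp ((CTensor.map Δ (AlgHom.id ℂ A) hΔ'
          (CTensor.id_mem 𝒜)).comp Δ) =
          (CTensor.map (AlgHom.id ℂ A) Δ (CTensor.id_mem 𝒜) hΔ').comp Δ := hext fun j i => by
        simp only [AlgHom.comp_apply, hΔ, map_sum, CTensor.map_tmul, AlgHom.id_apply]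
        have e1 : ∀ (f : ι → CTensor ω 𝒜 𝒜) (b : A),
            CTensor.tmul ω (CTensor.gr ω 𝒜 𝒜) 𝒜 (∑ k, f k) b =
              ∑ k, CTensor.tmul ω (CTensor.gr ω 𝒜 𝒜) 𝒜 (f k) b := fun f b =>
          TensorProduct.sum_tmul _ _ _
        have e2 : ∀ (f : ι → CTensor ω 𝒜 𝒜) (b : A),
            CTensor.tmul ω 𝒜 (CTensor.gr ω 𝒜 𝒜) b (∑ k, f k) =
              ∑ k, CTensor.tmul ω 𝒜 (CTensor.gr ω 𝒜 𝒜) b (f k) := fun f b =>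
          TensorProduct.tmul_sum _ _ _
        simp only [e1, e2, map_sum, CTensor.assocHom_tmul]
        exact Finset.sum_comm
      have h2 := congrArg (fun z => TensorProduct.map LinearMap.id
        (CTensor.of ω 𝒜 𝒜).symm.toLinearMap ((CTensor.of ω 𝒜 (CTensor.gr ω 𝒜 𝒜)).symm z))
        (AlgHom.congr_fun h1 a)
      have h3 : ∀ z : A ⊗[ℂ] A, TensorProduct.map LinearMap.id
          (CTensor.of ω 𝒜 𝒜).symm.toLinearMap ((CTensor.of ω 𝒜 (CTensor.gr ω 𝒜 𝒜)).symm
          (CTensor.map (AlgHom.id ℂ A) Δ (CTensor.id_mem 𝒜) hΔ' (CTensor.of ω 𝒜 𝒜 z))) =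
          TensorProduct.map LinearMap.id ((CTensor.of ω 𝒜 𝒜).symm.toLinearMap ∘ₗ Δ.toLinearMap) z := by
        intro z
        induction z using TensorProduct.induction_on with
        | zero => simp
        | add x y hx hy => simp only [map_add, hx, hy]
        | tmul x y => rfl
      have h5 : ∀ (p : A ⊗[ℂ] A) (b : A), TensorProduct.map LinearMap.id
          (CTensor.of ω 𝒜 𝒜).symm.toLinearMap ((CTensor.of ω 𝒜 (CTensor.gr ω 𝒜 𝒜)).symm
          (CTensor.assocHom ω 𝒜 𝒜 𝒜 (CTensor.tmul ω _ _ (CTensor.of ω 𝒜 𝒜 p) b))) =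
          TensorProduct.assoc ℂ A A A (p ⊗ₜ b) := by
        intro p b
        induction p using TensorProduct.induction_on with
        | zero =>
          have e0 : CTensor.tmul ω (CTensor.gr ω 𝒜 𝒜) 𝒜 0 b = 0 := TensorProduct.zero_tmul _ _
          rw [map_zero, e0]; simp
        | add x y hx hy =>
          rw [map_add, CTensor.add_tmul, TensorProduct.add_tmul, map_add, map_add, map_add, hx, hy,
            map_add]
        | tmul x y =>
          have e0 := CTensor.assocHom_tmul (ω := ω) (𝒜 := 𝒜) (ℬ := 𝒜) (𝒞 := 𝒜) x y b
          refine (congrArg (fun z => TensorProduct.map LinearMap.id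
            (CTensor.of ω 𝒜 𝒜).symm.toLinearMap
            ((CTensor.of ω 𝒜 (CTensor.gr ω 𝒜 𝒜)).symm z)) e0).trans ?_
          rfl
      have h4 : ∀ z : A ⊗[ℂ] A, TensorProduct.map LinearMap.id
          (CTensor.of ω 𝒜 𝒜).symm.toLinearMap ((CTensor.of ω 𝒜 (CTensor.gr ω 𝒜 𝒜)).symm
          (CTensor.assocHom ω 𝒜 𝒜 𝒜 (CTensor.map Δ (AlgHom.id ℂ A) hΔ' (CTensor.id_mem 𝒜)
            (CTensor.of ω 𝒜 𝒜 z)))) =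
          TensorProduct.assoc ℂ A A A (TensorProduct.map
            ((CTensor.of ω 𝒜 𝒜).symm.toLinearMap ∘ₗ Δ.toLinearMap) LinearMap.id z) := by
        intro z
        induction z using TensorProduct.induction_on with
        | zero => simp
        | add x y hx hy => simp only [map_add, hx, hy]
        | tmul x y => exact h5 ((CTensor.of ω 𝒜 𝒜).symm (Δ x)) y
      exact (h4 ((CTensor.of ω 𝒜 𝒜).symm (Δ a))).symm.trans
        (h2.trans (h3 ((CTensor.of ω 𝒜 𝒜).symm (Δ a))))
    counit_left := fun a => by
      have h1 : (CTensor.lift ((Algebra.ofId ℂ A).comp ε) (AlgHom.id ℂ A) hεc).comp Δ =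
          AlgHom.id ℂ A := hext fun j i => by
        have h0 : ∀ a b, CTensor.lift ((Algebra.ofId ℂ A).comp ε) (AlgHom.id ℂ A) hεc
            (CTensor.tmul ω 𝒜 𝒜 a b) = ε a • b := fun a b => (Algebra.smul_def _ _).symm
        simp [hΔ, hε, h0]
      have h2 : ∀ z : A ⊗[ℂ] A, CTensor.lift ((Algebra.ofId ℂ A).comp ε) (AlgHom.id ℂ A) hεc
          (CTensor.of ω 𝒜 𝒜 z) = TensorProduct.lid ℂ A
            (TensorProduct.map ε.toLinearMap LinearMap.id z) := by
        intro z
        induction z using TensorProduct.induction_on with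
        | zero => simp
        | add x y hx hy => simp only [map_add, hx, hy]
        | tmul x y =>
          rw [TensorProduct.map_tmul, TensorProduct.lid_tmul]
          exact (Algebra.smul_def (ε x) y).symm
      exact (h2 ((CTensor.of ω 𝒜 𝒜).symm (Δ a))).symm.trans (AlgHom.congr_fun h1 a)
    counit_right := fun a => by
      have h1 : (CTensor.lift (AlgHom.id ℂ A) ((Algebra.ofId ℂ A).comp ε) hεc').comp Δ =
          AlgHom.id ℂ A := hext fun j i => by
        have h0 : ∀ a b, CTensor.lift (AlgHom.id ℂ A) ((Algebra.ofId ℂ A).comp ε) hεc'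
            (CTensor.tmul ω 𝒜 𝒜 a b) = ε b • a := fun a b =>
          ((Algebra.smul_def _ _).trans (Algebra.commutes _ _)).symm
        simp [hΔ, hε, h0]
      have h2 : ∀ z : A ⊗[ℂ] A, CTensor.lift (AlgHom.id ℂ A) ((Algebra.ofId ℂ A).comp ε) hεc'
          (CTensor.of ω 𝒜 𝒜 z) = TensorProduct.rid ℂ A
            (TensorProduct.map LinearMap.id ε.toLinearMap z) := by
        intro z
        induction z using TensorProduct.induction_on with
        | zero => simp
        | add x y hx hy => simp only [map_add, hx, hy]
        | tmul x y =>
          rw [TensorProduct.map_tmul, TensorProduct.rid_tmul]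
          exact ((Algebra.smul_def (ε y) x).trans (Algebra.commutes _ _)).symm
      exact (h2 ((CTensor.of ω 𝒜 𝒜).symm (Δ a))).symm.trans (AlgHom.congr_fun h1 a)
    antipode_one := map_one S
    antipode_mul := fun α β a ha b hb => by
      -- S is given as a homomorphism, and `ω`-commutativity makes it an anti-homomorphism.
      change S (a * b) = ω α β • (S b * S a)
      rw [map_mul, hA (hS' α a ha) (hS' β b hb)]
    antipode_left := fun a => by
      have h1 : (CTensor.lift S (AlgHom.id ℂ A) fun β b hb α a ha => hA hb (hS' α a ha)).comp Δ =
          (Algebra.ofId ℂ A).comp ε := hext fun j i => by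
        simp only [AlgHom.comp_apply, hΔ, map_sum, CTensor.lift_tmul, hε, hS, AlgHom.id_apply, hyX']
        split_ifs <;> simp
      have h2 : ∀ z : A ⊗[ℂ] A, CTensor.lift S (AlgHom.id ℂ A)
          (fun β b hb α a ha => hA hb (hS' α a ha)) (CTensor.of ω 𝒜 𝒜 z) =
            LinearMap.mul' ℂ A (TensorProduct.map S.toLinearMap LinearMap.id z) := by
        intro z
        induction z using TensorProduct.induction_on with
        | zero => simp
        | add x y hx hy => simp only [map_add, hx, hy]
        | tmul x y => rfl
      exact (h2 ((CTensor.of ω 𝒜 𝒜).symm (Δ a))).symm.trans (AlgHom.congr_fun h1 a)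
    antipode_right := fun a => by
      have h1 : (CTensor.lift (AlgHom.id ℂ A) S fun β b hb α a ha => hA (hS' β b hb) ha).comp Δ =
          (Algebra.ofId ℂ A).comp ε := hext fun j i => by
        simp only [AlgHom.comp_apply, hΔ, map_sum, CTensor.lift_tmul, hε, hS, AlgHom.id_apply, hXy']
        split_ifs <;> simp
      have h2 : ∀ z : A ⊗[ℂ] A, CTensor.lift (AlgHom.id ℂ A) S
          (fun β b hb α a ha => hA (hS' β b hb) ha) (CTensor.of ω 𝒜 𝒜 z) =
            LinearMap.mul' ℂ A (TensorProduct.map LinearMap.id S.toLinearMap z) := by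
        intro z
        induction z using TensorProduct.induction_on with
        | zero => simp
        | add x y hx hy => simp only [map_add, hx, hy]
        | tmul x y => rfl
      exact (h2 ((CTensor.of ω 𝒜 𝒜).symm (Δ a))).symm.trans (AlgHom.congr_fun h1 a) }

end HopfOfMatrix

/-- Used for the matrix (X ⊗ 1)(1 ⊗ X), the image of X under Δ. With Y = X⁻¹ its inverse is (1 ⊗
Y)(Y ⊗ 1). -/
theorem map_mul_map_eq_one {M N : Type*} [Monoid M] [Monoid N] (f g : M →* N) {x y : M}
    (h : x * y = 1) : (f x * g x) * (g y * f y) = 1 := by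
  rw [mul_assoc, ← mul_assoc (g x), ← map_mul, h, map_one, one_mul, ← map_mul, h, map_one]

/-! ### The Hopf structure of 𝓕(V). -/

section PresHopf

variable {Γ : Type*} [AddCommGroup Γ] [DecidableEq Γ] {ω : CommFactor Γ}
variable {V : Type*} [AddCommGroup V] [Module ℂ V] [FiniteDimensional ℂ V]
variable {𝒱 : Γ → Submodule ℂ V} [DirectSum.Decomposition 𝒱]
variable {ι : Type*} [Fintype ι] [DecidableEq ι] (e : HomBasis 𝒱 ι)

/-- The image of a homogeneous matrix under a homomorphism of graded algebras. -/
def mapHomMat {A B : Type*} [Ring A] [Algebra ℂ A] [Ring B] [Algebra ℂ B]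
    {𝒜 : Γ → Submodule ℂ A} {ℬ : Γ → Submodule ℂ B} [GradedAlgebra 𝒜] [GradedAlgebra ℬ]
    (φ : A →ₐ[ℂ] B) (hφ : ∀ γ, ∀ a ∈ 𝒜 γ, φ a ∈ ℬ γ) (d : ι → Γ) :
    homMat 𝒜 d →* homMat ℬ d where
  toFun x := ⟨(x : Matrix ι ι A).map φ, fun j i => hφ _ _ (x.2 j i)⟩
  map_one' := Subtype.ext (Matrix.map_one φ (map_zero φ) (map_one φ))
  map_mul' _ _ := Subtype.ext Matrix.map_mul

variable (ω) in
/-- The matrix `a ↦ a ⊗ 1`, applied to the entries of a matrix. -/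
def inlMat : homMat (presGr ω e) e.deg →* homMat (CTensor.gr ω (presGr ω e) (presGr ω e)) e.deg :=
  mapHomMat (CTensor.inl ω (presGr ω e) (presGr ω e)) (fun _ _ h => CTensor.inl_mem h) e.deg

variable (ω) in
/-- The matrix `a ↦ 1 ⊗ a`, applied to the entries of a matrix. -/
def inrMat : homMat (presGr ω e) e.deg →* homMat (CTensor.gr ω (presGr ω e) (presGr ω e)) e.deg :=
  mapHomMat (CTensor.inr ω (presGr ω e) (presGr ω e)) (fun _ _ h => CTensor.inr_mem h) e.deg

variable (ω) in
/-- The co-multiplication of `𝓕(V)`. -/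
def presComul : presAlg ω e →ₐ[ℂ] CTensor ω (presGr ω e) (presGr ω e) :=
  presLift e (CTensor.omegaComm (presAlg_omegaComm e) (presAlg_omegaComm e))
    (inlMat ω e (presMat e) * inrMat ω e (presMat e))
    (inrMat ω e (presInv e) * inlMat ω e (presInv e))
    (map_mul_map_eq_one (inlMat ω e) (inrMat ω e) (presMat_mul_presInv e))
    (map_mul_map_eq_one (inrMat ω e) (inlMat ω e) (presInv_mul_presMat e))

theorem presComul_X (j i : ι) : presComul ω e (presX ω e j i) =
    ∑ k, CTensor.tmul ω (presGr ω e) (presGr ω e) (presX ω e j k) (presX ω e k i) := by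
  rw [presComul, presLift_X]
  exact Finset.sum_congr rfl fun k _ => CTensor.inl_mul_inr _ _

/-- The entries of (1 ⊗ Y)(Y ⊗ 1) contain the tensor factors in the wrong order. The factor which
arises in exchanging them cancels against the scalars between Y and the generators. -/
theorem presComul_Xbar (j i : ι) : presComul ω e (presXbar ω e j i) =
    ∑ k, CTensor.tmul ω (presGr ω e) (presGr ω e) (presXbar ω e j k) (presXbar ω e k i) := by
  rw [presComul, presLift_Xbar]
  change _ • ∑ k, CTensor.inr ω _ _ (_ • presXbar ω e k i) * CTensor.inl ω _ _ (_ • presXbar ω e j k) = _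
  rw [Finset.smul_sum]
  refine Finset.sum_congr rfl fun k _ => ?_
  have h : CTensor.inr ω (presGr ω e) (presGr ω e) (presXbar ω e k i) *
      CTensor.inl ω (presGr ω e) (presGr ω e) (presXbar ω e j k) =
      ω (e.deg k - e.deg i) (e.deg j - e.deg k) • CTensor.tmul ω _ _ (presXbar ω e j k)
        (presXbar ω e k i) :=
    (CTensor.inr_mul_tmul (presXbar_mem e j k) (presXbar_mem e k i) 1).trans (by rw [mul_one])
  rw [map_smul, map_smul, smul_mul_smul_comm, h, smul_smul, smul_smul]
  convert one_smul ℂ _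
  simp only [ω.sub_left, ω.sub_right]
  have h1 := ω.skew (e.deg j) (e.deg i)
  have h2 := ω.skew (e.deg j) (e.deg k)
  have h3 := ω.skew (e.deg k) (e.deg i)
  have h4 := ω.skew (e.deg j) (e.deg j)
  have h5 := ω.skew (e.deg k) (e.deg k)
  grind

variable (ω) in
/-- The co-unit of `𝓕(V)`. -/
def presCounit : presAlg ω e →ₐ[ℂ] ℂ :=
  presLift e (ℬ := trivGr (Γ := Γ)) trivGr_omegaComm 1 1 (one_mul 1) (one_mul 1)

theorem presCounit_X (j i : ι) : presCounit ω e (presX ω e j i) = if j = i then 1 else 0 := by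
  rw [presCounit, presLift_X]
  exact Matrix.one_apply

theorem presCounit_Xbar (j i : ι) : presCounit ω e (presXbar ω e j i) = if j = i then 1 else 0 := by
  rw [presCounit, presLift_Xbar]
  change ω (e.deg j) (e.deg j - e.deg i) • (1 : Matrix ι ι ℂ) i j = _
  rw [Matrix.one_apply]
  by_cases h : j = i
  · rw [if_pos h, if_pos h.symm, h, sub_self, ω.zero_right, one_smul]
  · rw [if_neg h, if_neg (Ne.symm h), smul_zero]

variable (ω) in
/-- The antipode of `𝓕(V)`. -/
def presAntipode : presAlg ω e →ₐ[ℂ] presAlg ω e :=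
  presLift e (presAlg_omegaComm e) (presInv e) (presMat e) (presInv_mul_presMat e)
    (presMat_mul_presInv e)

variable (ω) in
/-- The Hopf structure of `𝓕(V)`. -/
def presHopf : ColourHopf ω (presGr ω e) :=
  hopfOfMatrix (presAlg_omegaComm e) (presMat e) (presInv e) (presMat_mul_presInv e)
    (presInv_mul_presMat e) (adjoin_presMat e) (presComul ω e) (presCounit ω e) (presAntipode ω e)
    (presComul_X e) (presCounit_X e) (presLift_X e _ _ _ _ _)
    (fun _ _ ha => presLift_mem e _ _ _ _ _ ha)
    (fun _ _ ha h => mem_trivGr.1 (presLift_mem e trivGr_omegaComm 1 1 (one_mul 1) (one_mul 1) ha) h)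
    (fun _ _ ha => presLift_mem e _ _ _ _ _ ha)

theorem isPresHopf_presHopf : IsPresHopf ω e (presHopf ω e) where
  comul_X := presComul_X e
  comul_Xbar := presComul_Xbar e
  counit_X := presCounit_X e
  counit_Xbar := presCounit_Xbar e
  antipode_X j i := by
    refine (presLift_X e _ _ _ _ _ j i).trans ?_
    change ω (e.deg i) (e.deg j - e.deg i) • presXbar ω e i j = _
    rw [← ω.neg_right (e.deg i), neg_sub]
  antipode_Xbar i j := presLift_Xbar e _ _ _ _ _ i j

end PresHopf

end

end Colour

namespace Colour

noncomputable section


/-! ### Twisted derivations of symmetric algebras. -/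

section TwistedDer

variable {Γ : Type*} [AddCommGroup Γ] [DecidableEq Γ] {ω : CommFactor Γ}
variable {M : Type*} [AddCommGroup M] [Module ℂ M] {𝓜 : Γ → Submodule ℂ M}
  [DirectSum.Decomposition 𝓜] {κ : Type*} [Fintype κ]

/-- There is a twisted derivation on `S_ω(M)` with given values on a homogeneous basis of `M`. -/
theorem SymAlg.exists_twistedDer (b : HomBasis 𝓜 κ) (δ : Γ) (n : κ → SymAlg ω 𝓜)
    (hn : ∀ p, n p ∈ symGr ω 𝓜 (b.deg p + δ)) : ∃ D : SymAlg ω 𝓜 →ₗ[ℂ] SymAlg ω 𝓜,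
      (∀ p, D (SymAlg.ι ω 𝓜 (b.basis p)) = n p) ∧
      ∀ x y, D (x * y) = x * D y + D x * charScale (symGr ω 𝓜) (fun α => ω α δ) (ω.zero_left δ)
        (fun _ _ => ω.add_left _ _ _) y := by
  set s := charScale (symGr ω 𝓜) (fun α => ω α δ) (ω.zero_left δ) (fun _ _ => ω.add_left _ _ _)
    with hs
  have hA := SymAlg.omegaComm (ω := ω) b
  have hX : ∀ p, SymAlg.ι ω 𝓜 (b.basis p) ∈ symGr ω 𝓜 (b.deg p) := fun p => SymAlg.ι_mem ω 𝓜 (b.mem p)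
  set X : κ → SymAlg ω 𝓜 := fun p => SymAlg.ι ω 𝓜 (b.basis p) with hXdef
  -- A map D is a derivation twisted by s exactly if sending x to the upper triangular matrix with
  -- the rows (x, D x) and (0, s x) is multiplicative. The universal property of S_ω(M) provides
  -- this homomorphism once the matrices of the generators commute up to `ω`.
  set m : κ → Matrix (Fin 2) (Fin 2) (SymAlg ω 𝓜) := fun p =>
    Matrix.of ![![X p, n p], ![0, ω (b.deg p) δ • X p]] with hm
  have hmm : ∀ p q, m p * m q = ω (b.deg p) (b.deg q) • (m q * m p) := by
    intro p q
    have h1 := hA (hX p) (hX q)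
    have h2 := hA (hX p) (hn q)
    have h3 := hA (hn p) (hX q)
    refine Matrix.ext fun i j => ?_
    fin_cases i <;> fin_cases j
    · simp [hm, Matrix.mul_apply, Fin.sum_univ_two]; exact h1
    · simp only [hm, Matrix.mul_apply, Fin.sum_univ_two, Matrix.smul_apply]
      simp only [Fin.zero_eta, Fin.mk_one, Matrix.of_apply, Matrix.cons_val_zero,
        Matrix.cons_val_one, Matrix.cons_val_fin_one]
      rw [mul_smul_comm, mul_smul_comm, smul_add, smul_smul, add_comm]
      refine congrArg₂ (· + ·) ?_ ?_
      · refine (congrArg (fun z => ω (b.deg q) δ • z) h3).trans ?_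
        rw [smul_smul, ω.add_left]
        congr 1
        linear_combination ω (b.deg p) (b.deg q) * ω.skew (b.deg q) δ
      · rw [← ω.add_right]; exact h2
    · simp [hm, Matrix.mul_apply, Fin.sum_univ_two]
    · simp only [hm, Matrix.mul_apply, Fin.sum_univ_two, Matrix.smul_apply]
      simp only [Fin.mk_one, Matrix.of_apply, Matrix.cons_val_zero,
        Matrix.cons_val_one, Matrix.cons_val_fin_one]
      rw [smul_mul_smul_comm, smul_mul_smul_comm, zero_mul, zero_mul, zero_add, zero_add, smul_smul]
      refine (congrArg (fun z => (ω (b.deg p) δ * ω (b.deg q) δ) • z) h1).trans ?_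
      rw [smul_smul]
      congr 1
      ring
  set T := SymAlg.lift ω b m hmm with hT
  have hTX : ∀ p, T (X p) = m p := SymAlg.lift_ι b m hmm
  -- The remaining three entries are as expected, so the upper right entry satisfies the product
  -- rule.
  have key : ∀ x, T x 0 0 = x ∧ T x 1 0 = 0 ∧ T x 1 1 = s x := by
    intro x
    have hx : x ∈ Algebra.adjoin ℂ (Set.range X) := by
      rw [hXdef, SymAlg.adjoin_eq_top b]; exact Algebra.mem_top
    induction hx using Algebra.adjoin_induction with
    | mem x hx =>
      obtain ⟨p, rfl⟩ := hx
      rw [hTX, hs, charScale_of_mem (hX p)]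
      exact ⟨rfl, rfl, rfl⟩
    | algebraMap c =>
      rw [AlgHom.commutes, AlgHom.commutes]
      simp [Matrix.algebraMap_matrix_apply]
    | add x y _ _ hx hy =>
      rw [map_add, map_add]
      simp only [Matrix.add_apply, hx, hy, add_zero, and_self]
    | mul x y _ _ hx hy =>
      rw [map_mul, map_mul]
      simp only [Matrix.mul_apply, Fin.sum_univ_two, hx, hy, mul_zero, zero_mul, add_zero, zero_add,
        and_self]
  refine ⟨(Matrix.entryLinearMap ℂ (SymAlg ω 𝓜) (0 : Fin 2) (1 : Fin 2)) ∘ₗ T.toLinearMap,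
    fun p => congrFun (congrFun (hTX p) 0) 1, fun x y => ?_⟩
  change T (x * y) 0 1 = x * T y 0 1 + T x 0 1 * s y
  rw [map_mul, Matrix.mul_apply, Fin.sum_univ_two, (key x).1, (key y).2.2]

end TwistedDer

/-! ### Powers of the augmentation ideal and the Euler derivation. -/

section Filtration

variable {Γ : Type*} [AddCommGroup Γ] [DecidableEq Γ] {ω : CommFactor Γ}
variable {A : Type*} [Ring A] [Algebra ℂ A] {𝒜 : Γ → Submodule ℂ A} [GradedAlgebra 𝒜]
variable {ι : Type*} [Fintype ι] [DecidableEq ι] {d : ι → Γ} (X : ι → ι → A)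

/-- The span of the elements `X_{ji} - δ_{ji}`. -/
def shiftSpan : Submodule ℂ A :=
  Submodule.span ℂ (Set.range fun p : ι × ι => X p.1 p.2 - if p.1 = p.2 then 1 else 0)

theorem mem_shiftSpan (j i : ι) : X j i - (if j = i then 1 else 0) ∈ shiftSpan X :=
  Submodule.subset_span ⟨(j, i), rfl⟩

/-- The `k`-th power of the ideal which is generated by the elements `X_{ji} - δ_{ji}`. -/
def shiftPow (k : ℕ) : Submodule ℂ A := ⊤ * shiftSpan X ^ k

theorem shiftPow_succ (k : ℕ) : shiftPow X (k + 1) = shiftPow X k * shiftSpan X := by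
  rw [shiftPow, shiftPow, pow_succ, mul_assoc]

theorem mem_shiftPow_zero (x : A) : x ∈ shiftPow X 0 := by
  have h := Submodule.mul_mem_mul (M := (⊤ : Submodule ℂ A)) (N := 1) (Submodule.mem_top (x := x))
    (Submodule.one_le.1 le_rfl)
  rw [mul_one] at h
  rwa [shiftPow, pow_zero, mul_one]

variable {X}

theorem mul_mem_shiftPow {k : ℕ} {x y : A} (hx : x ∈ shiftPow X k) (hy : y ∈ shiftSpan X) :
    x * y ∈ shiftPow X (k + 1) := by
  rw [shiftPow_succ]; exact Submodule.mul_mem_mul hx hy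

theorem mul_left_mem_shiftPow {k : ℕ} (a : A) {x : A} (hx : x ∈ shiftPow X k) :
    a * x ∈ shiftPow X k := by
  have h := Submodule.mul_mem_mul (M := (⊤ : Submodule ℂ A)) (Submodule.mem_top (x := a)) hx
  have h2 : (⊤ : Submodule ℂ A) * shiftPow X k ≤ shiftPow X k := by
    rw [shiftPow, ← mul_assoc]
    exact mul_le_mul' le_top le_rfl
  exact h2 h

theorem shift_mem (hX : ∀ j i, X j i ∈ 𝒜 (d i - d j)) (j i : ι) :
    X j i - (if j = i then 1 else 0) ∈ 𝒜 (d i - d j) := by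
  refine sub_mem (hX j i) ?_
  split_ifs with h
  · rw [h, sub_self]; exact SetLike.GradedOne.one_mem
  · exact zero_mem _

/-- The entries of X - 1 generate the augmentation ideal: xy - ε(xy) = x(y - ε(y)) + ε(y)(x - ε(x)).
-/
theorem sub_counit_mem_shiftPow
    (hgen : Algebra.adjoin ℂ (Set.range fun p : ι × ι => X p.1 p.2) = ⊤) (ε : A →ₐ[ℂ] ℂ)
    (hε : ∀ j i, ε (X j i) = if j = i then 1 else 0) (x : A) :
    x - algebraMap ℂ A (ε x) ∈ shiftPow X 1 := by
  have hx : x ∈ Algebra.adjoin ℂ (Set.range fun p : ι × ι => X p.1 p.2) := by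
    rw [hgen]; exact Algebra.mem_top
  induction hx using Algebra.adjoin_induction with
  | mem x hx =>
    obtain ⟨p, rfl⟩ := hx
    have h := mul_mem_shiftPow (mem_shiftPow_zero X 1) (mem_shiftSpan X p.1 p.2)
    rw [one_mul] at h
    change X p.1 p.2 - algebraMap ℂ A (ε (X p.1 p.2)) ∈ _
    rw [hε]
    split_ifs at h ⊢ with h' <;> simpa using h
  | algebraMap c =>
    have h : ε (algebraMap ℂ A c) = c := ε.commutes c
    rw [h, sub_self]; exact zero_mem _
  | add x y _ _ hx hy =>
    rw [map_add, map_add, add_sub_add_comm]; exact add_mem hx hy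
  | mul x y _ _ hx hy =>
    have h : x * y - algebraMap ℂ A (ε (x * y)) =
        x * (y - algebraMap ℂ A (ε y)) + ε y • (x - algebraMap ℂ A (ε x)) := by
      rw [map_mul ε, mul_comm (ε x), map_mul, Algebra.smul_def, mul_sub, mul_sub,
        ← Algebra.commutes (ε y) x]
      abel
    rw [h]
    exact add_mem (mul_left_mem_shiftPow x hy) (Submodule.smul_mem _ _ hx)

/-- The homomorphism Φ multiplies X - 1 by an indeterminate s, so Φ(x) has no coefficients below s^k
when x lies in the k-th power of the ideal. If this holds for all k, then Φ(x) = 0; putting s = 1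
gives back x. -/
theorem eq_zero_of_forall_mem_shiftPow (Φ : A →ₐ[ℂ] Polynomial A)
    (hΦ : ∀ j i, Φ (X j i - if j = i then 1 else 0) =
      Polynomial.C (X j i - if j = i then 1 else 0) * Polynomial.X)
    (hgen : Algebra.adjoin ℂ (Set.range fun p : ι × ι => X p.1 p.2) = ⊤) {x : A}
    (hx : ∀ k, x ∈ shiftPow X k) : x = 0 := by
  have h1 : ∀ k, ∀ x ∈ shiftPow X k, ∀ n < k, (Φ x).coeff n = 0 := by
    intro k
    induction k with
    | zero => intro x _ n hn; omega
    | succ k ih =>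
      intro x hx
      rw [shiftPow_succ] at hx
      induction hx using Submodule.mul_induction_on' with
      | add x _ y _ hx hy =>
        intro n hn
        rw [map_add, Polynomial.coeff_add, hx n hn, hy n hn, add_zero]
      | mem_mul_mem a ha y hy =>
        induction hy using Submodule.span_induction with
        | zero => intro n _; rw [mul_zero, map_zero, Polynomial.coeff_zero]
        | add x y _ _ hx hy =>
          intro n hn
          rw [mul_add, map_add, Polynomial.coeff_add, hx n hn, hy n hn, add_zero]
        | smul c x _ hx =>
          intro n hn
          rw [mul_smul_comm, map_smul, Polynomial.coeff_smul, hx n hn, smul_zero]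
        | mem y hy =>
          obtain ⟨p, rfl⟩ := hy
          intro n hn
          rw [map_mul, hΦ, ← mul_assoc]
          cases n with
          | zero => rw [Polynomial.coeff_mul_X_zero]
          | succ n => rw [Polynomial.coeff_mul_X, Polynomial.coeff_mul_C, ih a ha n (by omega), zero_mul]
  have h2 : Φ x = 0 := Polynomial.ext fun n => by
    rw [h1 (n + 1) x (hx _) n (by omega), Polynomial.coeff_zero]
  -- Evaluation at 1 is multiplicative although A is not commutative, because 1 is central.
  set ev : Polynomial A →ₐ[ℂ] A :=
    { Polynomial.eval₂RingHom' (RingHom.id A) 1 (fun a => Commute.one_right a) with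
      commutes' := fun c => Polynomial.eval₂_C _ _ } with hev
  have h3 : ev.comp Φ = AlgHom.id ℂ A := by
    refine AlgHom.ext_of_adjoin_eq_top hgen ?_
    rintro _ ⟨p, rfl⟩
    have h4 : ev (Φ (X p.1 p.2 - if p.1 = p.2 then 1 else 0)) =
        X p.1 p.2 - if p.1 = p.2 then 1 else 0 := by
      rw [hΦ]
      refine (Polynomial.eval₂_mul_X _ _).trans ?_
      rw [Polynomial.eval₂_C, mul_one]
      rfl
    change ev (Φ (X p.1 p.2)) = X p.1 p.2
    rw [map_sub, map_sub] at h4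
    split_ifs at h4 with h
    · rw [map_one, map_one] at h4
      exact sub_left_injective h4
    · rwa [map_zero, map_zero, sub_zero, sub_zero] at h4
  have h5 := AlgHom.congr_fun h3 x
  rw [AlgHom.comp_apply, h2, map_zero] at h5
  exact h5.symm

variable (hA : OmegaComm ω 𝒜) (hX : ∀ j i, X j i ∈ 𝒜 (d i - d j))
  (D : ι → ι → A →ₗ[ℂ] A)
  (hDX : ∀ a b j i, D a b (X j i) = if a = j then ω (d i) (d a - d b) • X b i else 0)
  (hD : ∀ a b x y, D a b (x * y) = x * D a b y + D a b x *
    charScale 𝒜 (fun α => ω α (d a - d b)) (ω.zero_left _) (fun _ _ => ω.add_left _ _ _) y)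

variable (X ω d) in
/-- The operator which measures the order of vanishing at the identity matrix. -/
def eulerOp : A →ₗ[ℂ] A :=
  ∑ a, ∑ b, ω (d b) (d b - d a) •
    (LinearMap.mulRight ℂ (X a b - if a = b then 1 else 0) ∘ₗ D a b)

theorem eulerOp_apply (x : A) : eulerOp ω d X D x =
    ∑ a, ∑ b, ω (d b) (d b - d a) • (D a b x * (X a b - if a = b then 1 else 0)) := by
  simp [eulerOp]

theorem eulerOp_mem {k : ℕ} {x : A} (h : ∀ a b, D a b x ∈ shiftPow X k) :
    eulerOp ω d X D x ∈ shiftPow X (k + 1) := by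
  rw [eulerOp_apply]
  exact sum_mem fun a _ => sum_mem fun b _ => Submodule.smul_mem _ _
    (mul_mem_shiftPow (h a b) (mem_shiftSpan X a b))

include hA hX hD in
-- This is an ordinary derivation: the scaling of the right factor in the rule for D_{ab} is
-- absorbed when X_{ab} - δ_{ab} is moved past that factor.
theorem eulerOp_mul (x y : A) : eulerOp ω d X D (x * y) =
    x * eulerOp ω d X D y + eulerOp ω d X D x * y := by
  have h1 : ∀ a b, charScale 𝒜 (fun α => ω α (d a - d b)) (ω.zero_left _)
      (fun _ _ => ω.add_left _ _ _) y * (X a b - if a = b then 1 else 0) =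
      (X a b - if a = b then 1 else 0) * y := by
    intro a b
    induction y using hom_induction 𝒜 with
    | h0 => simp
    | hadd y y' hy hy' => rw [map_add, add_mul, hy, hy', mul_add]
    | h γ y hy =>
      rw [charScale_of_mem hy, hA (shift_mem hX a b) hy, ← neg_sub (d a), ω.neg_left, smul_mul_assoc]
  simp only [eulerOp_apply, hD, add_mul, mul_assoc, h1, smul_add, Finset.sum_add_distrib,
    Finset.mul_sum, Finset.sum_mul, mul_smul_comm, smul_mul_assoc]

include hA hX hD hDX in
-- On I^k/I^{k+1} the Euler derivation is multiplication by k: it fixes the entries of X - 1 modulo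
-- products of two such entries, and the product rule adds up the factors.
theorem eulerOp_sub_mem (k : ℕ) {x : A} (hx : x ∈ shiftPow X k) :
    eulerOp ω d X D x - (k : ℂ) • x ∈ shiftPow X (k + 1) := by
  have h0 : eulerOp ω d X D 1 = 0 := by
    have h := eulerOp_mul hA hX D hD 1 1
    rw [one_mul, one_mul, mul_one] at h
    exact left_eq_add.1 h
  have hY : ∀ y ∈ shiftSpan X, eulerOp ω d X D y - y ∈ shiftSpan X * shiftSpan X := by
    intro y hy
    induction hy using Submodule.span_induction with
    | zero => simp
    | add x y _ _ hx hy => rw [map_add, add_sub_add_comm]; exact add_mem hx hy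
    | smul c x _ hx => rw [map_smul, ← smul_sub]; exact Submodule.smul_mem _ _ hx
    | mem y hy =>
      obtain ⟨⟨j, i⟩, rfl⟩ := hy
      have h1 : eulerOp ω d X D (X j i - if j = i then 1 else 0) = eulerOp ω d X D (X j i) := by
        rw [map_sub]
        split_ifs
        · rw [h0, sub_zero]
        · rw [map_zero, sub_zero]
      change eulerOp ω d X D (X j i - if j = i then 1 else 0) - _ ∈ _
      rw [h1, eulerOp_apply]
      simp only [hDX, ite_mul, zero_mul, smul_ite, smul_zero]
      rw [Finset.sum_comm]
      simp only [Finset.sum_ite_eq', Finset.mem_univ, if_true]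
      -- Replacing X_{bi} by δ_{bi} in the formula for the Euler derivation of X_{ji} leaves only b
      -- = i, where the two scalars cancel, and gives X_{ji} - δ_{ji}. By `h3` the error is a sum of
      -- products of two entries of X - 1.
      have h2 : X j i - (if j = i then 1 else 0) = ∑ b, ω (d b) (d b - d j) •
          ((ω (d i) (d j - d b) • if b = i then (1 : A) else 0) * (X j b - if j = b then 1 else 0)) := by
        rw [Finset.sum_eq_single i]
        · rw [if_pos rfl, smul_mul_assoc, smul_smul, one_mul, ← ω.add_right, sub_add_sub_cancel,
            sub_self, ω.zero_right, one_smul]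
        · intro b _ hb
          rw [if_neg hb, smul_zero, zero_mul, smul_zero]
        · simp
      have h3 : ∀ b, ω (d b) (d b - d j) • (ω (d i) (d j - d b) • X b i *
          (X j b - if j = b then 1 else 0)) - ω (d b) (d b - d j) •
          ((ω (d i) (d j - d b) • if b = i then (1 : A) else 0) * (X j b - if j = b then 1 else 0)) ∈
          shiftSpan X * shiftSpan X := by
        intro b
        rw [← smul_sub, ← sub_mul, ← smul_sub]
        exact Submodule.smul_mem _ _ (Submodule.mul_mem_mul
          (Submodule.smul_mem _ _ (mem_shiftSpan X b i)) (mem_shiftSpan X j b))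
      change _ - (X j i - if j = i then 1 else 0) ∈ _
      rw [h2, ← Finset.sum_sub_distrib]
      exact sum_mem fun b _ => h3 b
  induction k generalizing x with
  | zero =>
    rw [Nat.cast_zero, zero_smul, sub_zero]
    exact eulerOp_mem D fun a b => mem_shiftPow_zero X _
  | succ k ih =>
    rw [shiftPow_succ] at hx
    induction hx using Submodule.mul_induction_on' with
    | add x _ y _ hx hy => rw [map_add, smul_add, add_sub_add_comm]; exact add_mem hx hy
    | mem_mul_mem x hx y hy =>
      have h1 : eulerOp ω d X D (x * y) - ((k + 1 : ℕ) : ℂ) • (x * y) =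
          x * (eulerOp ω d X D y - y) + (eulerOp ω d X D x - (k : ℂ) • x) * y := by
        rw [eulerOp_mul hA hX D hD, Nat.cast_succ, add_smul, one_smul, mul_sub, sub_mul,
          smul_mul_assoc]
        abel
      rw [h1]
      refine add_mem ?_ (mul_mem_shiftPow (ih hx) hy)
      rw [shiftPow_succ, shiftPow_succ, mul_assoc]
      exact Submodule.mul_mem_mul hx (hY y hy)

include hA hX hD hDX in
/-- A homomorphism from an algebra with the given twisted derivations is injective, if its kernel is
stable under the derivations and contained in the kernel of the co-unit. -/
theorem injective_of_twistedDer
    (hgen : Algebra.adjoin ℂ (Set.range fun p : ι × ι => X p.1 p.2) = ⊤) (ε : A →ₐ[ℂ] ℂ)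
    (hε : ∀ j i, ε (X j i) = if j = i then 1 else 0) (Φ : A →ₐ[ℂ] Polynomial A)
    (hΦ : ∀ j i, Φ (X j i - if j = i then 1 else 0) =
      Polynomial.C (X j i - if j = i then 1 else 0) * Polynomial.X)
    {B : Type*} [Ring B] [Algebra ℂ B] (π : A →ₐ[ℂ] B) (hπD : ∀ a b x, π x = 0 → π (D a b x) = 0)
    (hπε : ∀ x, π x = 0 → ε x = 0) : Function.Injective π := by
  refine (injective_iff_map_eq_zero π).2 fun x hx => eq_zero_of_forall_mem_shiftPow Φ hΦ hgen ?_
  -- If the kernel lies in I^{k+1}, then so do all D_{ab} x, hence E x lies in I^{k+2}. As E x is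
  -- congruent to (k+1) x modulo I^{k+2}, division by k+1 gives the next step.
  have h : ∀ k, ∀ x, π x = 0 → x ∈ shiftPow X (k + 1) := by
    intro k
    induction k with
    | zero =>
      intro x hx
      have h := sub_counit_mem_shiftPow hgen ε hε x
      rwa [hπε x hx, map_zero, sub_zero] at h
    | succ k ih =>
      intro x hx
      have h1 := eulerOp_sub_mem hA hX D hDX hD (k + 1) (ih x hx)
      have h2 : eulerOp ω d X D x ∈ shiftPow X (k + 1 + 1) :=
        eulerOp_mem D fun a b => ih _ (hπD a b x hx)
      have h3 := sub_mem h2 h1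
      rw [sub_sub_cancel] at h3
      exact ((shiftPow X (k + 1 + 1)).smul_mem_iff (Nat.cast_ne_zero.2 k.succ_ne_zero)).1 h3
  intro k
  cases k with
  | zero => exact mem_shiftPow_zero X x
  | succ k => exact h k x hx

end Filtration

/-! ### T is the free algebra F(V). -/

section FAlg

variable {Γ : Type*} [AddCommGroup Γ] [DecidableEq Γ] {ω : CommFactor Γ}
variable {V : Type*} [AddCommGroup V] [Module ℂ V] [FiniteDimensional ℂ V]
variable {𝒱 : Γ → Submodule ℂ V} [DirectSum.Decomposition 𝒱]
variable {ι : Type*} [Fintype ι] [DecidableEq ι] (e : HomBasis 𝒱 ι)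

variable (ω) in
/-- The generator `X_{ji}` of `F(V)`. -/
def fGen (j i : ι) : FAlg ω 𝒱 :=
  SymAlg.ι ω (tensorGr (dualGr 𝒱) 𝒱) (e.basis.dualBasis j ⊗ₜ e.basis i)

theorem fGen_mem (j i : ι) : fGen ω e j i ∈ fGr ω 𝒱 (e.deg i - e.deg j) := by
  rw [fGen, ← dualTensorBasis_apply]
  exact SymAlg.ι_mem ω _ ((dualTensorBasis e).mem (j, i))

theorem adjoin_fGen :
    Algebra.adjoin ℂ (Set.range fun p : ι × ι => fGen ω e p.1 p.2) = ⊤ := by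
  rw [← SymAlg.adjoin_eq_top (ω := ω) (dualTensorBasis e)]
  congr 2
  funext p
  rw [fGen, ← dualTensorBasis_apply]

variable (ω) in
/-- The homomorphism from `F(V)` to the algebra `T`. -/
def fToT : FAlg ω 𝒱 →ₐ[ℂ] algT ω e := fLift e (OmegaComm.subGr ω (algT ω e)) (tMat ω e)

theorem fToT_fGen (j i : ι) : fToT ω e (fGen ω e j i) = tT ω e j i := fLift_ι _ _ _ _ _

theorem fToT_surjective : Function.Surjective (fToT ω e) := by
  rintro ⟨f, hf⟩
  have h : algT ω e ≤ ((algT ω e).val.comp (fToT ω e)).range := by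
    refine Algebra.adjoin_le ?_
    rintro _ ⟨j, i, rfl⟩
    exact ⟨fGen ω e j i, congrArg Subtype.val (fToT_fGen e j i)⟩
  obtain ⟨x, hx⟩ := h hf
  exact ⟨x, Subtype.ext hx⟩

theorem matUnit_mem (a b : ι) : matUnit e a b ∈ endGr 𝒱 (e.deg a - e.deg b) := by
  intro γ v hv
  change e.basis.coord b v • e.basis a ∈ _
  by_cases h : γ = e.deg b
  · rw [h, sub_add_cancel]; exact Submodule.smul_mem _ _ (e.mem a)
  · rw [e.coord_eq_zero hv h, zero_smul]; exact zero_mem _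

theorem fToT_charScale (α : Γ) (x : FAlg ω 𝒱) :
    ((fToT ω e (charScale (fGr ω 𝒱) (fun β => ω β α) (ω.zero_left _)
      (fun _ _ => ω.add_left _ _ _) x) : algT ω e) : UDual ω 𝒱) =
      UDual.scale ω 𝒱 α (fToT ω e x : algT ω e) := by
  induction x using hom_induction (fGr ω 𝒱) with
  | h0 => rw [map_zero, map_zero]; exact UDual.ext' fun x => rfl
  | hadd x y hx hy =>
    rw [map_add, map_add, map_add]
    exact (congrArg₂ (· + ·) hx hy).trans (UDual.ext' fun x => rfl)
  | h γ x hx =>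
    have h : fToT ω e x ∈ subGr ω (algT ω e) γ := fLift_mem e _ _ hx
    rw [charScale_of_mem hx, map_smul]
    exact (UDual.scale_of_mem ω α h).symm

/-- Left translation by the matrix unit and D satisfy the same product rule with the same scaling,
and they agree on the generators by `transL_tGen`. -/
theorem fToT_twistedDer (a b : ι) (D : FAlg ω 𝒱 →ₗ[ℂ] FAlg ω 𝒱)
    (hDX : ∀ j i, D (fGen ω e j i) =
        if a = j then ω (e.deg i) (e.deg a - e.deg b) • fGen ω e b i else 0)
    (hD : ∀ x y, D (x * y) = x * D y + D x * charScale (fGr ω 𝒱)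
      (fun α => ω α (e.deg a - e.deg b)) (ω.zero_left _) (fun _ _ => ω.add_left _ _ _) y)
    (x : FAlg ω 𝒱) : ((fToT ω e (D x) : algT ω e) : UDual ω 𝒱) =
      UDual.transL ω 𝒱 (matUnit e a b) (fToT ω e x : algT ω e) := by
  have h0 : D 1 = 0 := by
    have h := hD 1 1
    simp only [map_one, mul_one, one_mul] at h
    exact left_eq_add.1 h
  have hx : x ∈ Algebra.adjoin ℂ (Set.range fun p : ι × ι => fGen ω e p.1 p.2) := by
    rw [adjoin_fGen]; exact Algebra.mem_top
  induction hx using Algebra.adjoin_induction with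
  | mem x hx =>
    obtain ⟨⟨j, i⟩, rfl⟩ := hx
    rw [hDX, fToT_fGen]
    refine Eq.trans ?_ (transL_tGen e (matUnit_mem e a b) j i).symm
    rw [Finset.sum_eq_single b]
    · have h : e.basis.coord j (matUnit e a b (e.basis b)) = if a = j then 1 else 0 := by
        simp [matUnit, Finsupp.single_apply]
      rw [h]
      split_ifs with h
      · rw [map_smul, fToT_fGen, mul_one]; rfl
      · rw [map_zero, mul_zero, zero_smul]; rfl
    · intro l _ hl
      have h : matUnit e a b (e.basis l) = 0 := by
        simp [matUnit, hl]
      rw [h, map_zero, mul_zero, zero_smul]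
    · simp
  | algebraMap c =>
    rw [Algebra.algebraMap_eq_smul_one, map_smul, map_smul, map_smul, h0, map_one]
    refine Eq.trans ?_ (Eq.trans (congrArg (fun f => c • f)
      (UDual.transL_one ω 𝒱 (matUnit e a b)).symm) (UDual.ext' fun x => rfl))
    rw [map_zero, smul_zero, smul_zero]; rfl
  | add x y _ _ hx hy =>
    rw [map_add, map_add, map_add]
    exact (congrArg₂ (· + ·) hx hy).trans (UDual.ext' fun x => rfl)
  | mul x y _ _ hx hy =>
    rw [hD, map_add, map_mul, map_mul, map_mul]
    refine Eq.trans ?_ (UDual.transL_mul ω 𝒱 (matUnit_mem e a b) _ _).symm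
    rw [← hx, ← hy, ← fToT_charScale, add_comm]
    rfl

/-- The twisted derivations D_{ab} of F(V) lift the left translations of U^* by matrix units, so the
kernel is stable under them. The co-unit of F(V) is evaluation at the unit of U after the map to T,
so it vanishes on the kernel. Thus `injective_of_twistedDer` applies. -/
theorem fToT_injective : Function.Injective (fToT ω e) := by
  have hA : OmegaComm ω (fGr ω 𝒱) := SymAlg.omegaComm (dualTensorBasis e)
  have hY := shift_mem (X := fGen ω e) (fGen_mem e)
  have hD : ∀ a b : ι, ∃ D : FAlg ω 𝒱 →ₗ[ℂ] FAlg ω 𝒱,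
      (∀ j i, D (fGen ω e j i) =
        if a = j then ω (e.deg i) (e.deg a - e.deg b) • fGen ω e b i else 0) ∧
      ∀ x y, D (x * y) = x * D y + D x * charScale (fGr ω 𝒱) (fun α => ω α (e.deg a - e.deg b))
        (ω.zero_left _) (fun _ _ => ω.add_left _ _ _) y := by
    intro a b
    obtain ⟨D, h1, h2⟩ := SymAlg.exists_twistedDer (ω := ω) (dualTensorBasis e) (e.deg a - e.deg b)
      (fun p => if a = p.1 then ω (e.deg p.2) (e.deg a - e.deg b) • fGen ω e b p.2 else 0)
      (by
        rintro ⟨j, i⟩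
        change (if a = j then _ else _) ∈ fGr ω 𝒱 (e.deg i - e.deg j + (e.deg a - e.deg b))
        split_ifs with h
        · subst h
          rw [sub_add_sub_cancel]
          exact Submodule.smul_mem _ _ (fGen_mem e b i)
        · exact zero_mem _)
    refine ⟨D, fun j i => ?_, h2⟩
    rw [fGen, ← dualTensorBasis_apply]
    exact h1 (j, i)
  choose D hDX hD using hD
  -- evaluation at the unit of `U`
  set ev : algT ω e →ₐ[ℂ] ℂ := AlgHom.ofLinearMap
    (UDual.evalₗ ω 𝒱 1 ∘ₗ (algT ω e).val.toLinearMap)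
    ((UDual.one_eval ω 𝒱 1).trans (map_one _)) (fun f g => UDual.mul_eval_one ω 𝒱 f g) with hev
  have hε : ∀ j i, ev.comp (fToT ω e) (fGen ω e j i) = if j = i then 1 else 0 := by
    intro j i
    rw [AlgHom.comp_apply, fToT_fGen]
    exact (isGradedRep_natRep (ω := ω) e).eval_one j i
  have hδ : ∀ j i, (if j = i then 1 else 0 : FAlg ω 𝒱) ∈ fGr ω 𝒱 (e.deg i - e.deg j) := by
    intro j i
    split_ifs with h
    · rw [h, sub_self]; exact SetLike.GradedOne.one_mem
    · exact zero_mem _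
  -- The matrix 1 + (X - 1)s with an indeterminate s. Both δ_{ji} and X_{ji} - δ_{ji} have the
  -- degree d_i - d_j, so its entries commute up to `ω` as the generators do.
  set m : ι × ι → Polynomial (FAlg ω 𝒱) := fun p =>
    Polynomial.C (if p.1 = p.2 then 1 else 0) +
      Polynomial.C (fGen ω e p.1 p.2 - if p.1 = p.2 then 1 else 0) * Polynomial.X with hm
  have hmm : ∀ p q, m p * m q =
      ω ((dualTensorBasis e).deg p) ((dualTensorBasis e).deg q) • (m q * m p) := by
    intro p q
    have hC : ∀ a ∈ fGr ω 𝒱 (e.deg p.2 - e.deg p.1), ∀ b ∈ fGr ω 𝒱 (e.deg q.2 - e.deg q.1),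
        Polynomial.C a * Polynomial.C b = ω ((dualTensorBasis e).deg p)
          ((dualTensorBasis e).deg q) • (Polynomial.C b * Polynomial.C a) := by
      intro a ha b hb
      rw [← Polynomial.C_mul, ← Polynomial.C_mul, hA ha hb, ← Polynomial.smul_C]
      rfl
    have r1 := hC _ (hδ p.1 p.2) _ (hδ q.1 q.2)
    have r2 := hC _ (hδ p.1 p.2) _ (hY q.1 q.2)
    have r3 := hC _ (hY p.1 p.2) _ (hδ q.1 q.2)
    have r4 := hC _ (hY p.1 p.2) _ (hY q.1 q.2)
    have hx : ∀ a b : Polynomial (FAlg ω 𝒱), a * Polynomial.X * b = a * b * Polynomial.X := by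
      intro a b
      rw [mul_assoc, Polynomial.X_mul, mul_assoc]
    simp only [hm, add_mul, mul_add, hx, ← mul_assoc, r1, r2, r3, r4, smul_add, smul_mul_assoc]
    abel
  set Φ := SymAlg.lift ω (dualTensorBasis e) m hmm with hΦ
  have hΦX : ∀ j i, Φ (fGen ω e j i) = m (j, i) := fun j i => by
    rw [fGen, ← dualTensorBasis_apply]
    exact SymAlg.lift_ι _ _ _ _
  refine injective_of_twistedDer hA (fGen_mem e) D hDX hD (adjoin_fGen e) (ev.comp (fToT ω e)) hε Φ
    (fun j i => ?_) (fToT ω e) (fun a b x hx => ?_) (fun x hx => by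
      rw [AlgHom.comp_apply, hx, map_zero])
  · rw [map_sub, hΦX, hm]
    split_ifs
    · simp_all
    · simp_all
  · have h1 := fToT_twistedDer e a b (D a b) (hDX a b) (hD a b) x
    rw [hx] at h1
    exact Subtype.ext (h1.trans (UDual.ext' fun x => rfl))

end FAlg

end

end Colour

namespace Colour

noncomputable section


/-! ### Rings of fractions and graded homomorphisms. -/

section GradedHom

variable {Γ : Type*} [AddCommGroup Γ] [DecidableEq Γ]
variable {A B : Type*} [Ring A] [Algebra ℂ A] [Ring B] [Algebra ℂ B]
variable {𝒜 : Γ → Submodule ℂ A} [GradedAlgebra 𝒜] {ℬ : Γ → Submodule ℂ B} [GradedAlgebra ℬ]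

/-- φ commutes with the projections, so an element with a homogeneous image and its component of
that degree have the same image. -/
theorem mem_iff_map_mem_of_injective (φ : A →ₐ[ℂ] B) (hφ : Function.Injective φ)
    (h : ∀ γ, ∀ a ∈ 𝒜 γ, φ a ∈ ℬ γ) (γ : Γ) (a : A) : a ∈ 𝒜 γ ↔ φ a ∈ ℬ γ := by
  refine ⟨h γ a, fun hφa => ?_⟩
  have h1 : ∀ a : A, φ (projGr 𝒜 γ a) = projGr ℬ γ (φ a) := by
    intro a
    induction a using hom_induction 𝒜 with
    | h0 => simp
    | hadd a b ha hb => simp only [map_add, ha, hb]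
    | h δ a ha =>
      by_cases hδ : δ = γ
      · subst hδ; rw [projGr_same 𝒜 ha, projGr_same ℬ (h _ _ ha)]
      · rw [projGr_ne 𝒜 ha hδ, projGr_ne ℬ (h _ _ ha) hδ, map_zero]
  have h2 := h1 a
  rw [projGr_same ℬ hφa] at h2
  rw [← hφ h2]
  exact projGr_mem 𝒜 γ a

end GradedHom

namespace Frac

variable {Γ : Type*} [AddCommGroup Γ] [DecidableEq Γ] {ω : CommFactor Γ}
variable {A B : Type*} [Ring A] [Algebra ℂ A] [Ring B] [Algebra ℂ B]
variable {𝒜 : Γ → Submodule ℂ A} [GradedAlgebra 𝒜] {ℬ : Γ → Submodule ℂ B} [GradedAlgebra ℬ]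
variable (S : Submonoid A) [CentralSet S]

/-- The canonical homomorphism `a ↦ a/1`. -/
def of : A →ₐ[ℂ] Frac S where
  toFun a := mk a 1
  map_one' := one_eq.symm
  map_mul' a b := by rw [mk_mul_mk, one_mul]
  map_zero' := mk_zero 1
  map_add' a b := (mk_add_mk a b 1).symm
  commutes' c := rfl

variable {S}

theorem isUnit_of (s : S) : IsUnit (of S (s : A)) := by
  refine ⟨⟨of S (s : A), mk 1 s, ?_, ?_⟩, rfl⟩
  · refine (mk_mul_mk (s : A) 1 1 s).trans ?_
    rw [mul_one, one_mul]; exact mk_self S s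
  · refine (mk_mul_mk 1 (s : A) s 1).trans ?_
    rw [mul_one, one_mul]; exact mk_self S s

variable (f : A →ₐ[ℂ] B) (hf : ∀ s : S, IsUnit (f s))

/-- The universal property of the ring of fractions. -/
def lift : Frac S →ₐ[ℂ] B where
  __ := OreLocalization.universalHom (S := S) f.toRingHom
    (IsUnit.liftRight (f.toRingHom.toMonoidHom.comp S.subtype) hf) (fun _ => rfl)
  commutes' c := (OreLocalization.universalHom_commutes (S := S) f.toRingHom
    (IsUnit.liftRight (f.toRingHom.toMonoidHom.comp S.subtype) hf) (fun _ => rfl)).trans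
    (f.commutes c)

theorem lift_of (a : A) : lift f hf (of S a) = f a :=
  OreLocalization.universalHom_commutes (S := S) f.toRingHom
    (IsUnit.liftRight (f.toRingHom.toMonoidHom.comp S.subtype) hf) (fun _ => rfl)

/-- Multiplying s⁻¹a by s gives a/1. If s⁻¹a maps to 0, then so does a, which is therefore 0. -/
theorem lift_injective (h : Function.Injective f) : Function.Injective (lift f hf) := by
  refine (injective_iff_map_eq_zero _).2 fun x hx => ?_
  induction x using ind with
  | hP a s =>
    have h1 : of S (s : A) * mk a s = of S a := by
      refine (mk_mul_mk (s : A) a 1 s).trans ?_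
      rw [one_mul, mk_mul_cancel]; rfl
    have h2 := congrArg (lift f hf) h1
    rw [map_mul, hx, mul_zero, lift_of] at h2
    rw [h (h2.symm.trans (map_zero f).symm), mk_zero]

variable [DegZeroSet 𝒜 S]

/-- The denominators have degree 0, and so do the inverses of their images. -/
theorem lift_mem (h : ∀ γ, ∀ a ∈ 𝒜 γ, f a ∈ ℬ γ) {γ : Γ} {x : Frac S} (hx : x ∈ gr 𝒜 S γ) :
    lift f hf x ∈ ℬ γ := by
  induction hx using Submodule.span_induction with
  | zero => rw [map_zero]; exact zero_mem _
  | add x y _ _ hx hy => rw [map_add]; exact add_mem hx hy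
  | smul c x _ hx => rw [map_smul]; exact Submodule.smul_mem _ c hx
  | mem x hx =>
    obtain ⟨a, ha, s, rfl⟩ := hx
    obtain ⟨b, hb, h1, h2⟩ := exists_inv_of_isUnit (h 0 s (DegZeroSet.deg s.1 s.2)) (hf s)
    have h3 : lift f hf (mk a s) = b * f a := by
      have h4 : of S (s : A) * mk a s = of S a := by
        refine (mk_mul_mk (s : A) a 1 s).trans ?_
        rw [one_mul, mk_mul_cancel]; rfl
      have h5 := congrArg (lift f hf) h4
      rw [map_mul, lift_of, lift_of] at h5
      rw [← h5, ← mul_assoc, h2, one_mul]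
    rw [h3]
    have h6 := SetLike.mul_mem_graded hb (h γ a ha)
    rwa [zero_add] at h6

theorem omegaComm (hA : OmegaComm ω 𝒜) : OmegaComm ω (gr 𝒜 S) := by
  intro α β x y hx hy
  induction hx using Submodule.span_induction with
  | zero => simp
  | add x x' _ _ h h' => rw [add_mul, h, h', mul_add, smul_add]
  | smul c x _ h => rw [smul_mul_assoc, h, mul_smul_comm, smul_comm]
  | mem x hx =>
    obtain ⟨a, ha, s, rfl⟩ := hx
    induction hy using Submodule.span_induction with
    | zero => simp
    | add x x' _ _ h h' => rw [mul_add, h, h', add_mul, smul_add]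
    | smul c x _ h => rw [mul_smul_comm, h, smul_mul_assoc, smul_comm]
    | mem y hy =>
      obtain ⟨b, hb, u, rfl⟩ := hy
      rw [mk_mul_mk, mk_mul_mk, smul_mk, hA ha hb]
      have h : s * u = u * s := Subtype.ext (CentralSet.central s.1 s.2 _)
      rw [h]

end Frac

/-! ### Homogeneous matrices as elements of A ⊗ End(V). -/

section GenMatrix

variable {Γ : Type*} [AddCommGroup Γ] [DecidableEq Γ] {ω : CommFactor Γ}
variable {V : Type*} [AddCommGroup V] [Module ℂ V] [FiniteDimensional ℂ V]
variable {𝒱 : Γ → Submodule ℂ V} [DirectSum.Decomposition 𝒱]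
variable {ι : Type*} [Fintype ι] [DecidableEq ι] (e : HomBasis 𝒱 ι)
variable {A : Type*} [Ring A] [Algebra ℂ A] {𝒜 : Γ → Submodule ℂ A} [GradedAlgebra 𝒜]

theorem matUnit_mul (j i k l : ι) : matUnit e j i * matUnit e k l =
    if i = k then matUnit e j l else 0 := by
  refine e.basis.ext fun m => ?_
  by_cases h : i = k
  · by_cases hm : m = l <;> simp [matUnit, h, hm]
  · by_cases hm : m = l <;> simp [matUnit, h, hm]

theorem sum_matUnit : ∑ j, matUnit e j j = 1 := by
  refine LinearMap.ext fun v => ?_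
  simp [matUnit, e.basis.sum_repr v]

theorem genMatrix_one : genMatrix ω e 𝒜 (1 : homMat 𝒜 e.deg).1 = 1 := by
  have h : ∀ j, ∑ i, ω (e.deg j) (e.deg i - e.deg j) •
      CTensor.tmul ω 𝒜 (endGr 𝒱) ((1 : Matrix ι ι A) j i) (matUnit e j i) =
      CTensor.tmul ω 𝒜 (endGr 𝒱) 1 (matUnit e j j) := by
    intro j
    rw [Finset.sum_eq_single j]
    · rw [sub_self, ω.zero_right, one_smul, Matrix.one_apply_eq]
    · intro i _ hi
      have h0 : CTensor.tmul ω 𝒜 (endGr 𝒱) 0 (matUnit e j i) = 0 := TensorProduct.zero_tmul _ _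
      rw [Matrix.one_apply_ne (Ne.symm hi), h0, smul_zero]
    · simp
  refine (Finset.sum_congr rfl fun j _ => h j).trans ?_
  rw [CTensor.one_def, ← sum_matUnit e]
  exact (TensorProduct.tmul_sum _ _ _).symm

/-- The scalars ω(d_j, d_i - d_j) compensate for the factor which arises when a matrix unit passes
an entry. Hence an invertible homogeneous matrix gives an invertible element of A ⊗ End(V). -/
theorem genMatrix_mul (x y : homMat 𝒜 e.deg) :
    genMatrix ω e 𝒜 x.1 * genMatrix ω e 𝒜 y.1 = genMatrix ω e 𝒜 (x * y).1 := by
  have h : ∀ j i k l, (ω (e.deg j) (e.deg i - e.deg j) •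
      CTensor.tmul ω 𝒜 (endGr 𝒱) (x.1 j i) (matUnit e j i)) *
      (ω (e.deg k) (e.deg l - e.deg k) • CTensor.tmul ω 𝒜 (endGr 𝒱) (y.1 k l) (matUnit e k l)) =
      if i = k then ω (e.deg j) (e.deg l - e.deg j) •
        CTensor.tmul ω 𝒜 (endGr 𝒱) (x.1 j k * y.1 k l) (matUnit e j l) else 0 := by
    intro j i k l
    rw [smul_mul_smul_comm, CTensor.tmul_mul_tmul ω 𝒜 (endGr 𝒱) _ (matUnit_mem e j i) (y.2 k l),
      matUnit_mul, smul_smul]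
    split_ifs with h
    · subst h
      congr 1
      simp only [ω.sub_left, ω.sub_right]
      have h1 := ω.skew (e.deg i) (e.deg j)
      have h2 := ω.skew (e.deg i) (e.deg l)
      have h3 := ω.skew (e.deg i) (e.deg i)
      grind
    · have h0 : CTensor.tmul ω 𝒜 (endGr 𝒱) (x.1 j i * y.1 k l) 0 = 0 := TensorProduct.tmul_zero _ _
      rw [h0, smul_zero]
  have h2 : ∀ j l, CTensor.tmul ω 𝒜 (endGr 𝒱) ((x * y).1 j l) (matUnit e j l) =
      ∑ i, CTensor.tmul ω 𝒜 (endGr 𝒱) (x.1 j i * y.1 i l) (matUnit e j l) := fun j l =>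
    TensorProduct.sum_tmul _ _ _
  have h3 : ∀ f : ι → ι → ι → CTensor ω 𝒜 (endGr 𝒱),
      ∑ k, ∑ l, ∑ j, ∑ i, (if i = k then f j k l else 0) = ∑ j, ∑ l, ∑ i, f j i l := by
    intro f
    simp only [Finset.sum_ite_eq', Finset.mem_univ, if_true]
    rw [Finset.sum_comm]
    exact (Finset.sum_congr rfl fun l _ => Finset.sum_comm).trans Finset.sum_comm
  simp only [genMatrix, Finset.sum_mul, Finset.mul_sum, h, h2, Finset.smul_sum]
  exact h3 _

theorem isUnit_genMatrix {x : homMat 𝒜 e.deg} (hx : IsUnit x) : IsUnit (genMatrix ω e 𝒜 x.1) := by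
  obtain ⟨⟨x, y, hxy, hyx⟩, rfl⟩ := hx
  exact ⟨⟨genMatrix ω e 𝒜 x.1, genMatrix ω e 𝒜 y.1, by rw [genMatrix_mul, hxy, genMatrix_one],
    by rw [genMatrix_mul, hyx, genMatrix_one]⟩, rfl⟩

end GenMatrix

end

end Colour

namespace Colour

noncomputable section


/-! ### The isomorphisms of 𝒯(V) with the ring of fractions and with 𝓕(V). -/

section CoordMatrix

variable {Γ : Type*} [AddCommGroup Γ] [DecidableEq Γ] {ω : CommFactor Γ}
variable {V : Type*} [AddCommGroup V] [Module ℂ V] [FiniteDimensional ℂ V]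
variable {𝒱 : Γ → Submodule ℂ V} [DirectSum.Decomposition 𝒱]
variable {ι : Type*} [Fintype ι] [DecidableEq ι] (e : HomBasis 𝒱 ι)

variable (ω) in
/-- The inclusion of `T` in the coordinate algebra. -/
def tIncl : algT ω e →ₐ[ℂ] coordAlg ω e := Subalgebra.inclusion (algT_le ω e)

theorem mem_subGr {A : Subalgebra ℂ (UDual ω 𝒱)} {γ : Γ} {f : A} :
    f ∈ subGr ω A γ ↔ (f : UDual ω 𝒱) ∈ UDual.gr ω 𝒱 γ := Iff.rfl

theorem tIncl_mem (γ : Γ) (f : algT ω e) (hf : f ∈ subGr ω (algT ω e) γ) :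
    tIncl ω e f ∈ subGr ω (coordAlg ω e) γ := by
  rw [mem_subGr] at hf ⊢
  rwa [tIncl, Subalgebra.coe_inclusion]

theorem tIncl_injective : Function.Injective (tIncl ω e) :=
  Subalgebra.inclusion_injective (algT_le ω e)

variable (ω) in
/-- The matrix `t_{ji}` over the coordinate algebra. -/
def tcMat : homMat (subGr ω (coordAlg ω e)) e.deg :=
  ⟨fun j i => tC ω e j i, fun j i => tGen_mem ω e j i⟩

variable (ω) in
/-- The inverse of the matrix `t_{ji}`. -/
def tcInv : homMat (subGr ω (coordAlg ω e)) e.deg :=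
  ⟨fun j i => ω (e.deg i) (e.deg j - e.deg i) • tbarC ω e i j,
    fun j i => Submodule.smul_mem _ _ (tbarGen_mem ω e i j)⟩

theorem tcInv_val (j i : ι) : (((tcInv ω e : Matrix ι ι (coordAlg ω e)) j i : coordAlg ω e) :
    UDual ω 𝒱) = UDual.antipode ω (tGen ω e j i) := (antipode_tGen e j i).symm

theorem tcMat_mul_tcInv : tcMat ω e * tcInv ω e = 1 := by
  refine Subtype.ext (Matrix.ext fun j k => Subtype.ext ?_)
  have h : (((tcMat ω e * tcInv ω e : homMat (subGr ω (coordAlg ω e)) e.deg) :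
      Matrix ι ι (coordAlg ω e)) j k : UDual ω 𝒱) =
      ∑ i, tGen ω e j i * UDual.antipode ω (tGen ω e i k) := by
    simp only [← tcInv_val]
    exact map_sum (coordAlg ω e).val _ _
  rw [h, tGen_mul_antipode]
  change _ = (((1 : Matrix ι ι (coordAlg ω e)) j k : coordAlg ω e) : UDual ω 𝒱)
  rw [Matrix.one_apply]
  split_ifs <;> rfl

theorem tcInv_mul_tcMat : tcInv ω e * tcMat ω e = 1 := by
  refine Subtype.ext (Matrix.ext fun j k => Subtype.ext ?_)
  have h : (((tcInv ω e * tcMat ω e : homMat (subGr ω (coordAlg ω e)) e.deg) :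
      Matrix ι ι (coordAlg ω e)) j k : UDual ω 𝒱) =
      ∑ i, UDual.antipode ω (tGen ω e j i) * tGen ω e i k := by
    simp only [← tcInv_val]
    exact map_sum (coordAlg ω e).val _ _
  rw [h, antipode_mul_tGen]
  change _ = (((1 : Matrix ι ι (coordAlg ω e)) j k : coordAlg ω e) : UDual ω 𝒱)
  rw [Matrix.one_apply]
  split_ifs <;> rfl

theorem tbarC_eq (j i : ι) : tbarC ω e j i =
    ω (e.deg j) (e.deg j - e.deg i) • (tcInv ω e : Matrix ι ι (coordAlg ω e)) i j := by
  change _ = _ • (_ • tbarC ω e j i)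
  rw [smul_smul, ← ω.add_right, sub_add_sub_cancel, sub_self, ω.zero_right, one_smul]

theorem coordAlg_le {B : Subalgebra ℂ (coordAlg ω e)} (h : ∀ j i, tC ω e j i ∈ B)
    (h' : ∀ j i, tbarC ω e j i ∈ B) : B = ⊤ := by
  refine eq_top_iff.2 fun f _ => ?_
  have h1 : coordAlg ω e ≤ B.map (coordAlg ω e).val := by
    refine Algebra.adjoin_le ?_
    rintro _ (⟨j, i, rfl⟩ | ⟨j, i, rfl⟩)
    exacts [⟨_, h j i, rfl⟩, ⟨_, h' j i, rfl⟩]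
  obtain ⟨g, hg, hgf⟩ := h1 f.2
  rwa [← Subtype.ext (a1 := g) (a2 := f) hgf]

theorem adjoin_tcMat : Algebra.adjoin ℂ (Set.range (matGen
    (tcMat ω e : Matrix ι ι (coordAlg ω e)) (tcInv ω e : Matrix ι ι (coordAlg ω e)))) = ⊤ := by
  refine coordAlg_le e (fun j i => Algebra.subset_adjoin ⟨Sum.inl (j, i), rfl⟩) fun j i => ?_
  rw [tbarC_eq]
  exact Subalgebra.smul_mem _ (Algebra.subset_adjoin (Set.mem_range_self (Sum.inr (i, j)))) _

variable (ω) in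
/-- A numbering of the basis elements of parity `c`. -/
def parEquiv (c : ℂ) : Fin (Module.finrank ℂ (parityPart ω 𝒱 c)) ≃ ParIdx ω e.deg c :=
  (Fintype.equivFinOfCardEq (finrank_parityPart ω e c).symm).symm

variable (ω) in
/-- The determinant `D_+` for `c = 1` and `D_-` for `c = -1`. -/
def tDet (c : ℂ) : algT ω e :=
  parDet ω e.deg c (parEquiv ω e c) (tMat ω e : Matrix ι ι (algT ω e))

variable (ω) in
/-- The multiplicative set generated by `D_+` and `D_-`. -/
abbrev tSet : Submonoid (algT ω e) := Submonoid.closure {tDet ω e 1, tDet ω e (-1)}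

theorem tDet_mem (c : ℂ) (hc : c * c = 1) : tDet ω e c ∈ subGr ω (algT ω e) 0 :=
  parDet_mem hc (parEquiv ω e c) (tMat ω e)

theorem tSet_mem {s : algT ω e} (hs : s ∈ tSet ω e) : s ∈ subGr ω (algT ω e) 0 := by
  induction hs using Submonoid.closure_induction with
  | mem s hs =>
    rcases hs with rfl | rfl
    exacts [tDet_mem e 1 (one_mul 1), tDet_mem e (-1) (by norm_num)]
  | one => exact SetLike.GradedOne.one_mem
  | mul s u _ _ hs hu =>
    have h := SetLike.mul_mem_graded hs hu
    rwa [add_zero] at h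

instance : CentralSet (tSet ω e) :=
  ⟨fun _ hs a => (OmegaComm.subGr ω (algT ω e)).central (tSet_mem e hs) a⟩

instance : DegZeroSet (subGr ω (algT ω e)) (tSet ω e) := ⟨fun _ hs => tSet_mem e hs⟩

variable {B : Type*} [Ring B] [Algebra ℂ B] {ℬ : Γ → Submodule ℂ B} [GradedAlgebra ℬ]

/-- The homomorphisms which make the matrix `t` invertible are those which make `D_+` and `D_-`
invertible. -/
theorem isUnit_mapHomMat_tMat_iff (hB : OmegaComm ω ℬ) (f : algT ω e →ₐ[ℂ] B)
    (hf : ∀ γ, ∀ a ∈ subGr ω (algT ω e) γ, f a ∈ ℬ γ) :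
    IsUnit (mapHomMat f hf e.deg (tMat ω e)) ↔
      IsUnit (f (tDet ω e 1)) ∧ IsUnit (f (tDet ω e (-1))) := by
  rw [isUnit_iff_parDet hB _ (parEquiv ω e 1) (parEquiv ω e (-1)), tDet, tDet, map_parDet, map_parDet]
  rfl

theorem isUnit_map_tSet (hB : OmegaComm ω ℬ) (f : algT ω e →ₐ[ℂ] B)
    (hf : ∀ γ, ∀ a ∈ subGr ω (algT ω e) γ, f a ∈ ℬ γ)
    (h : IsUnit (mapHomMat f hf e.deg (tMat ω e))) (s : tSet ω e) : IsUnit (f s) := by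
  obtain ⟨h1, h2⟩ := (isUnit_mapHomMat_tMat_iff e hB f hf).1 h
  obtain ⟨s, hs⟩ := s
  change IsUnit (f s)
  induction hs using Submonoid.closure_induction with
  | mem s hs => rcases hs with rfl | rfl; exacts [h1, h2]
  | one => rw [map_one]; exact isUnit_one
  | mul s u _ _ hs hu => rw [map_mul]; exact hs.mul hu

theorem fracOf_mem (γ : Γ) (f : algT ω e) (hf : f ∈ subGr ω (algT ω e) γ) :
    Frac.of (tSet ω e) f ∈ Frac.gr (subGr ω (algT ω e)) (tSet ω e) γ := Frac.mk_mem hf 1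

theorem isUnit_fracMat :
    IsUnit (mapHomMat (Frac.of (tSet ω e)) (fracOf_mem e) e.deg (tMat ω e)) := by
  refine (isUnit_mapHomMat_tMat_iff e (Frac.omegaComm (OmegaComm.subGr ω _)) _ _).2 ⟨?_, ?_⟩
  · exact Frac.isUnit_of (S := tSet ω e) ⟨_, Submonoid.subset_closure (Or.inl rfl)⟩
  · exact Frac.isUnit_of (S := tSet ω e) ⟨_, Submonoid.subset_closure (Or.inr rfl)⟩

/-- Over 𝒯(V) the matrix t has an inverse, made of the coefficients of V^*, so D_+ and D_- are units
there. -/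
theorem isUnit_tIncl (s : tSet ω e) : IsUnit (tIncl ω e s) :=
  isUnit_map_tSet e (OmegaComm.subGr ω (coordAlg ω e)) (tIncl ω e) (tIncl_mem e)
    ⟨⟨tcMat ω e, tcInv ω e, tcMat_mul_tcInv e, tcInv_mul_tcMat e⟩, rfl⟩ s

variable (ω) in
/-- The homomorphism from the ring of fractions to the coordinate algebra. -/
def fracToCoord : Frac (tSet ω e) →ₐ[ℂ] coordAlg ω e :=
  Frac.lift (tIncl ω e) (isUnit_tIncl e)

theorem fracToCoord_of (f : algT ω e) :
    fracToCoord ω e (Frac.of (tSet ω e) f) = tIncl ω e f := Frac.lift_of _ _ f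

theorem fracToCoord_mem (γ : Γ) (x : Frac (tSet ω e))
    (hx : x ∈ Frac.gr (subGr ω (algT ω e)) (tSet ω e) γ) :
    fracToCoord ω e x ∈ subGr ω (coordAlg ω e) γ := by
  rw [fracToCoord]
  exact Frac.lift_mem (tIncl ω e) (isUnit_tIncl e) (tIncl_mem e) hx

/-- Injective because T is embedded in 𝒯(V). Surjective because t is invertible over the ring of
fractions: by uniqueness of inverses the entries of t⁻¹ lie in the image, and with them the
coefficients of V^*. -/
theorem fracToCoord_bijective : Function.Bijective (fracToCoord ω e) := by
  refine ⟨Frac.lift_injective _ _ (tIncl_injective e), ?_⟩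
  obtain ⟨⟨x, y, hxy, hyx⟩, hx⟩ := isUnit_fracMat (ω := ω) e
  change x = _ at hx
  have h1 := congrArg (mapHomMat (fracToCoord ω e) (fracToCoord_mem e) e.deg) hxy
  rw [map_mul, map_one] at h1
  have h2 : mapHomMat (fracToCoord ω e) (fracToCoord_mem e) e.deg x = tcMat ω e := by
    rw [hx]
    exact Subtype.ext (Matrix.ext fun j i => fracToCoord_of e (tT ω e j i))
  rw [h2] at h1
  have h3 := left_inv_eq_right_inv (tcInv_mul_tcMat e) h1
  have h4 : ∀ j i, (tcInv ω e : Matrix ι ι (coordAlg ω e)) j i ∈ (fracToCoord ω e).range :=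
    fun j i => ⟨_, (congrFun (congrFun (congrArg Subtype.val h3) j) i).symm⟩
  refine (AlgHom.range_eq_top _).1 (coordAlg_le e (fun j i => ⟨_, fracToCoord_of e (tT ω e j i)⟩)
    fun j i => ?_)
  rw [tbarC_eq]
  exact Subalgebra.smul_mem _ (h4 i j) _

variable (ω) in
/-- The isomorphism of the coordinate algebra with the ring of fractions. -/
def coordEquivFrac : coordAlg ω e ≃ₐ[ℂ] Frac (tSet ω e) :=
  (AlgEquiv.ofBijective (fracToCoord ω e) (fracToCoord_bijective e)).symm

theorem coordEquivFrac_tIncl (f : algT ω e) :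
    coordEquivFrac ω e (tIncl ω e f) = Frac.of (tSet ω e) f :=
  (AlgEquiv.symm_apply_eq _).2 (fracToCoord_of e f).symm

theorem coordEquivFrac_mem_iff (γ : Γ) (f : coordAlg ω e) : f ∈ subGr ω (coordAlg ω e) γ ↔
    coordEquivFrac ω e f ∈ Frac.gr (subGr ω (algT ω e)) (tSet ω e) γ := by
  rw [mem_iff_map_mem_of_injective (fracToCoord ω e) (fracToCoord_bijective e).1
    (fracToCoord_mem e) γ]
  have h : fracToCoord ω e (coordEquivFrac ω e f) = f :=
    (AlgEquiv.ofBijective (fracToCoord ω e) (fracToCoord_bijective e)).apply_symm_apply f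
  rw [h]

variable (ω) in
/-- The homomorphism from `T` to `𝓕(V)` which sends `t_{ji}` to `X_{ji}`. -/
def tToPres : algT ω e →ₐ[ℂ] presAlg ω e :=
  (fLift e (presAlg_omegaComm e) (presMat e)).comp
    (AlgEquiv.ofBijective (fToT ω e) ⟨fToT_injective e, fToT_surjective e⟩).symm.toAlgHom

theorem tToPres_fToT (x : FAlg ω 𝒱) :
    tToPres ω e (fToT ω e x) = fLift e (presAlg_omegaComm e) (presMat e) x :=
  congrArg (fLift e (presAlg_omegaComm e) (presMat e))
    ((AlgEquiv.ofBijective (fToT ω e) ⟨fToT_injective e, fToT_surjective e⟩).symm_apply_apply x)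

theorem tToPres_tT (j i : ι) : tToPres ω e (tT ω e j i) = presX ω e j i := by
  rw [← fToT_fGen, tToPres_fToT]
  exact fLift_ι _ _ _ _ _

theorem tToPres_mem (γ : Γ) (f : algT ω e) (hf : f ∈ subGr ω (algT ω e) γ) :
    tToPres ω e f ∈ presGr ω e γ := by
  obtain ⟨x, rfl⟩ := fToT_surjective e f
  rw [tToPres_fToT]
  refine fLift_mem e _ _ ?_
  exact (mem_iff_map_mem_of_injective (fToT ω e) (fToT_injective e)
    (ℬ := subGr ω (algT ω e)) (fun _ _ ha => fLift_mem e _ _ ha) γ x).2 hf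

/-- The matrix t maps to X, which is invertible over 𝓕(V), so its block determinants map to units.
This extends the map from T to the ring of fractions. -/
theorem isUnit_tToPres (s : tSet ω e) : IsUnit (tToPres ω e s) := by
  refine isUnit_map_tSet e (presAlg_omegaComm e) (tToPres ω e) (tToPres_mem e)
    ⟨⟨presMat e, presInv e, presMat_mul_presInv e, presInv_mul_presMat e⟩, ?_⟩ s
  exact Subtype.ext (Matrix.ext fun j i => (tToPres_tT e j i).symm)

variable (ω) in
/-- The homomorphism from the coordinate algebra to `𝓕(V)`. -/
def coordToPres : coordAlg ω e →ₐ[ℂ] presAlg ω e :=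
  (Frac.lift (tToPres ω e) (isUnit_tToPres e)).comp (coordEquivFrac ω e).toAlgHom

theorem coordToPres_tC (j i : ι) : coordToPres ω e (tC ω e j i) = presX ω e j i := by
  have h : coordToPres ω e (tIncl ω e (tT ω e j i)) =
      Frac.lift (tToPres ω e) (isUnit_tToPres e) (Frac.of (tSet ω e) (tT ω e j i)) :=
    congrArg _ (coordEquivFrac_tIncl e (tT ω e j i))
  rw [Frac.lift_of, tToPres_tT] at h
  exact h

variable (ω) in
/-- The homomorphism from `𝓕(V)` to the coordinate algebra. -/
def presToCoord : presAlg ω e →ₐ[ℂ] coordAlg ω e :=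
  presLift e (OmegaComm.subGr ω (coordAlg ω e)) (tcMat ω e) (tcInv ω e) (tcMat_mul_tcInv e)
    (tcInv_mul_tcMat e)

theorem presToCoord_X (j i : ι) : presToCoord ω e (presX ω e j i) = tC ω e j i :=
  presLift_X _ _ _ _ _ _ _ _

theorem presToCoord_Xbar (j i : ι) : presToCoord ω e (presXbar ω e j i) = tbarC ω e j i :=
  (presLift_Xbar _ _ _ _ _ _ _ _).trans (tbarC_eq e j i).symm

theorem presToCoord_comp :
    (presToCoord ω e).comp (coordToPres ω e) = AlgHom.id ℂ (coordAlg ω e) := by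
  have h1 : (tcMat ω e : Matrix ι ι (coordAlg ω e)) * (tcInv ω e : Matrix ι ι (coordAlg ω e)) = 1 :=
    congrArg Subtype.val (tcMat_mul_tcInv e)
  have h2 : (tcInv ω e : Matrix ι ι (coordAlg ω e)) * (tcMat ω e : Matrix ι ι (coordAlg ω e)) = 1 :=
    congrArg Subtype.val (tcInv_mul_tcMat e)
  refine hom_ext_of_matrix h1 h2 (adjoin_tcMat e) fun j i => ?_
  change presToCoord ω e (coordToPres ω e (tC ω e j i)) = tC ω e j i
  rw [coordToPres_tC, presToCoord_X]

theorem coordToPres_comp : (coordToPres ω e).comp (presToCoord ω e) = AlgHom.id ℂ _ :=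
  hom_ext_of_matrix (congrArg Subtype.val (presMat_mul_presInv e))
    (congrArg Subtype.val (presInv_mul_presMat e)) (adjoin_presMat e) fun j i => by
      change coordToPres ω e (presToCoord ω e (presX ω e j i)) = presX ω e j i
      rw [presToCoord_X, coordToPres_tC]

variable (ω) in
/-- The isomorphism of `𝓕(V)` with the coordinate algebra. -/
def presEquivCoord : presAlg ω e ≃ₐ[ℂ] coordAlg ω e :=
  AlgEquiv.ofAlgHom (presToCoord ω e) (coordToPres ω e) (presToCoord_comp e) (coordToPres_comp e)

theorem presEquivCoord_mem_iff (γ : Γ) (a : presAlg ω e) :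
    a ∈ presGr ω e γ ↔ presEquivCoord ω e a ∈ subGr ω (coordAlg ω e) γ :=
  mem_iff_map_mem_of_injective (𝒜 := presGr ω e) (ℬ := subGr ω (coordAlg ω e))
    (presToCoord ω e) (presEquivCoord ω e).injective (fun _ _ ha => presLift_mem e _ _ _ _ _ ha) γ a

theorem coordToPres_mem {γ : Γ} {f : coordAlg ω e} (hf : f ∈ subGr ω (coordAlg ω e) γ) :
    coordToPres ω e f ∈ presGr ω e γ := by
  rw [presEquivCoord_mem_iff]
  have h : presEquivCoord ω e (coordToPres ω e f) = f := (presEquivCoord ω e).apply_symm_apply f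
  rwa [h]

end CoordMatrix

end

end Colour

namespace Colour

noncomputable section


/-! ### Tensors as finite sums of homogeneous ones. -/

section Sums

variable {Γ : Type*} [AddCommGroup Γ] [DecidableEq Γ] {ω : CommFactor Γ}
variable {A B : Type*} [Ring A] [Algebra ℂ A] [Ring B] [Algebra ℂ B]
variable {𝒜 : Γ → Submodule ℂ A} [GradedAlgebra 𝒜] {ℬ : Γ → Submodule ℂ B} [GradedAlgebra ℬ]

theorem CTensor.exists_eq_sum (x : CTensor ω 𝒜 ℬ) : ∃ (κ : Type) (_ : Fintype κ) (α β : κ → Γ)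
    (a : κ → A) (b : κ → B), (∀ k, a k ∈ 𝒜 (α k)) ∧ (∀ k, b k ∈ ℬ (β k)) ∧
      x = ∑ k, CTensor.tmul ω 𝒜 ℬ (a k) (b k) := by
  induction x using CTensor.induction with
  | h0 =>
    exact ⟨Empty, inferInstance, nofun, nofun, nofun, nofun, nofun, nofun,
      (Finset.sum_of_isEmpty _).symm⟩
  | h α β a b ha hb =>
    exact ⟨Unit, inferInstance, fun _ => α, fun _ => β, fun _ => a, fun _ => b, fun _ => ha,
      fun _ => hb, by rw [Fintype.sum_unique]⟩
  | hadd x y hx hy =>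
    obtain ⟨κ, _, α, β, a, b, ha, hb, rfl⟩ := hx
    obtain ⟨κ', _, α', β', a', b', ha', hb', rfl⟩ := hy
    refine ⟨κ ⊕ κ', inferInstance, Sum.elim α α', Sum.elim β β', Sum.elim a a', Sum.elim b b',
      ?_, ?_, ?_⟩
    · rintro (k | k)
      exacts [ha k, ha' k]
    · rintro (k | k)
      exacts [hb k, hb' k]
    · rw [Fintype.sum_sum_type]; rfl

end Sums

/-! ### The Hopf structure of 𝒯(V) and its duality with U. -/

section CoordHopf

variable {Γ : Type*} [AddCommGroup Γ] [DecidableEq Γ] {ω : CommFactor Γ}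
variable {V : Type*} [AddCommGroup V] [Module ℂ V] [FiniteDimensional ℂ V]
variable {𝒱 : Γ → Submodule ℂ V} [DirectSum.Decomposition 𝒱]
variable {ι : Type*} [Fintype ι] [DecidableEq ι] (e : HomBasis 𝒱 ι)

theorem presToCoord_mem (γ : Γ) (a : presAlg ω e) (ha : a ∈ presGr ω e γ) :
    presToCoord ω e a ∈ subGr ω (coordAlg ω e) γ := presLift_mem e _ _ _ _ _ ha

variable (ω) in
/-- The co-multiplication of the coordinate algebra. -/
def coordComul : coordAlg ω e →ₐ[ℂ] CTensor ω (subGr ω (coordAlg ω e)) (subGr ω (coordAlg ω e)) :=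
  ((CTensor.map (presToCoord ω e) (presToCoord ω e) (presToCoord_mem e) (presToCoord_mem e)).comp
    (presComul ω e)).comp (coordToPres ω e)

variable (ω) in
/-- The co-unit of the coordinate algebra. -/
def coordCounit : coordAlg ω e →ₐ[ℂ] ℂ := (presCounit ω e).comp (coordToPres ω e)

variable (ω) in
/-- The antipode of the coordinate algebra. -/
def coordAntipode : coordAlg ω e →ₐ[ℂ] coordAlg ω e :=
  ((presToCoord ω e).comp (presAntipode ω e)).comp (coordToPres ω e)

theorem isUnit_genMatrix_frac :
    IsUnit (genMatrix ω e (Frac.gr (subGr ω (algT ω e)) (tSet ω e))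
      (fun j i => Frac.mk (tT ω e j i) 1)) := by
  have h := isUnit_genMatrix (ω := ω) e (isUnit_fracMat (ω := ω) e)
  exact h

theorem coordToPres_tbarC (j i : ι) : coordToPres ω e (tbarC ω e j i) = presXbar ω e j i := by
  rw [← presToCoord_Xbar]
  exact AlgHom.congr_fun (coordToPres_comp e) (presXbar ω e j i)

theorem coordComul_tC (j i : ι) : coordComul ω e (tC ω e j i) =
    ∑ k, CTensor.tmul ω (subGr ω (coordAlg ω e)) (subGr ω (coordAlg ω e))
      (tC ω e j k) (tC ω e k i) := by
  rw [coordComul, AlgHom.comp_apply, AlgHom.comp_apply, coordToPres_tC, presComul_X, map_sum]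
  exact Finset.sum_congr rfl fun k _ => by rw [CTensor.map_tmul, presToCoord_X, presToCoord_X]

theorem coordComul_tbarC (j i : ι) : coordComul ω e (tbarC ω e j i) =
    ∑ k, CTensor.tmul ω (subGr ω (coordAlg ω e)) (subGr ω (coordAlg ω e))
      (tbarC ω e j k) (tbarC ω e k i) := by
  rw [coordComul, AlgHom.comp_apply, AlgHom.comp_apply, coordToPres_tbarC, presComul_Xbar, map_sum]
  exact Finset.sum_congr rfl fun k _ => by rw [CTensor.map_tmul, presToCoord_Xbar, presToCoord_Xbar]

theorem coordCounit_tC (j i : ι) : coordCounit ω e (tC ω e j i) = if j = i then 1 else 0 := by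
  rw [coordCounit, AlgHom.comp_apply, coordToPres_tC, presCounit_X]

theorem coordAntipode_tC (j i : ι) : coordAntipode ω e (tC ω e j i) =
    (tcInv ω e : Matrix ι ι (coordAlg ω e)) j i := by
  rw [coordAntipode, AlgHom.comp_apply, AlgHom.comp_apply, coordToPres_tC, presAntipode, presLift_X]
  exact presLift_inv e _ _ _ _ _ j i

theorem map_mem_gr {A B : Type*} [Ring A] [Algebra ℂ A] [Ring B] [Algebra ℂ B]
    {𝒜 : Γ → Submodule ℂ A} [GradedAlgebra 𝒜] {ℬ : Γ → Submodule ℂ B} [GradedAlgebra ℬ]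
    (f : A →ₐ[ℂ] B) (hf : ∀ γ, ∀ a ∈ 𝒜 γ, f a ∈ ℬ γ) {γ : Γ} {x : CTensor ω 𝒜 𝒜}
    (hx : x ∈ CTensor.gr ω 𝒜 𝒜 γ) : CTensor.map f f hf hf x ∈ CTensor.gr ω ℬ ℬ γ := by
  induction hx using Submodule.span_induction with
  | zero => rw [map_zero]; exact zero_mem _
  | add x y _ _ hx hy => rw [map_add]; exact add_mem hx hy
  | smul c x _ hx => rw [map_smul]; exact Submodule.smul_mem _ c hx
  | mem x hx =>
    obtain ⟨α, β, a, b, ha, hb, rfl, rfl⟩ := hx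
    rw [CTensor.map_tmul]
    exact CTensor.tmul_mem_gr ω ℬ ℬ (hf α a ha) (hf β b hb)

variable (ω) in
/-- The Hopf structure of the coordinate algebra. -/
def coordHopf : ColourHopf ω (subGr ω (coordAlg ω e)) :=
  hopfOfMatrix (OmegaComm.subGr ω (coordAlg ω e)) (tcMat ω e) (tcInv ω e) (tcMat_mul_tcInv e)
    (tcInv_mul_tcMat e) (adjoin_tcMat e) (coordComul ω e) (coordCounit ω e) (coordAntipode ω e)
    (coordComul_tC e) (coordCounit_tC e) (coordAntipode_tC e)
    (fun _ _ ha => map_mem_gr (presToCoord ω e) (presToCoord_mem e)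
      ((presHopf ω e).comul_mem _ _ (coordToPres_mem e ha)))
    (fun _ _ ha h => (presHopf ω e).counit_eq_zero _ _ (coordToPres_mem e ha) h)
    (fun _ _ ha => presToCoord_mem e _ _
      ((presHopf ω e).antipode_mem _ _ (coordToPres_mem e ha)))

theorem coordHopf_antipode (f : coordAlg ω e) :
    (coordHopf ω e).antipode f = coordAntipode ω e f := rfl

variable (ω) in
/-- The pairing of the tensor square of the coordinate algebra with the one of `U`. -/
def coPair : CTensor ω (subGr ω (coordAlg ω e)) (subGr ω (coordAlg ω e)) →ₗ[ℂ]
    Module.Dual ℂ (UEnv ω 𝒱 ⊗[ℂ] UEnv ω 𝒱) :=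
  colourPair ω (uGr ω 𝒱) ∘ₗ
    TensorProduct.map ((UDual.of ω 𝒱).symm.toLinearMap ∘ₗ (coordAlg ω e).val.toLinearMap)
      ((UDual.of ω 𝒱).symm.toLinearMap ∘ₗ (coordAlg ω e).val.toLinearMap) ∘ₗ
    (CTensor.of ω (subGr ω (coordAlg ω e)) (subGr ω (coordAlg ω e))).symm.toLinearMap

theorem coPair_tmul (f g : coordAlg ω e) {α β : Γ} {x y : UEnv ω 𝒱} (hx : x ∈ uGr ω 𝒱 α)
    (hy : y ∈ uGr ω 𝒱 β) : coPair ω e (CTensor.tmul ω _ _ f g) (x ⊗ₜ y) =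
      ω α β * (UDual.eval (f : UDual ω 𝒱) x * UDual.eval (g : UDual ω 𝒱) y) :=
  colourPair_tmul ω (uGr ω 𝒱) _ _ hx hy

theorem coPair_induction {z : CTensor ω (subGr ω (coordAlg ω e)) (subGr ω (coordAlg ω e))}
    {b : UEnv ω 𝒱 →ₗ[ℂ] UEnv ω 𝒱 →ₗ[ℂ] ℂ} (h : ∀ α β x y, x ∈ uGr ω 𝒱 α → y ∈ uGr ω 𝒱 β →
      coPair ω e z (x ⊗ₜ y) = b x y) (x y : UEnv ω 𝒱) : coPair ω e z (x ⊗ₜ y) = b x y := by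
  induction x using hom_induction (uGr ω 𝒱) with
  | h0 => simp
  | hadd x x' hx hx' => rw [TensorProduct.add_tmul, map_add, map_add, hx, hx']; rfl
  | h α x hx =>
    induction y using hom_induction (uGr ω 𝒱) with
    | h0 => simp
    | hadd y y' hy hy' => rw [TensorProduct.tmul_add, map_add, map_add, hy, hy']
    | h β y hy => exact h α β x y hx hy

theorem eval_eq_zero {A : Subalgebra ℂ (UDual ω 𝒱)} {φ α : Γ} {f : A} (hf : f ∈ subGr ω A φ)
    {x : UEnv ω 𝒱} (hx : x ∈ uGr ω 𝒱 α) (h : φ + α ≠ 0) : UDual.eval (f : UDual ω 𝒱) x = 0 :=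
  UDual.mem_gr.1 (mem_subGr.1 hf) α x hx h

/-- The pairing vanishes unless x and y have the degrees opposite to those of f and g, so the factor
ω(d(x), d(y)) can be written in terms of f and g and the formula holds for all x and y. -/
theorem coPair_tmul_of_mem {φ ψ : Γ} {f g : coordAlg ω e} (hf : f ∈ subGr ω (coordAlg ω e) φ)
    (hg : g ∈ subGr ω (coordAlg ω e) ψ) (x y : UEnv ω 𝒱) :
    coPair ω e (CTensor.tmul ω _ _ f g) (x ⊗ₜ y) =
      ω φ ψ * (UDual.eval (f : UDual ω 𝒱) x * UDual.eval (g : UDual ω 𝒱) y) := by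
  refine coPair_induction e (b := ω φ ψ • ((LinearMap.mul ℂ ℂ).compl₁₂
    ((UDual.of ω 𝒱).symm (f : UDual ω 𝒱)) ((UDual.of ω 𝒱).symm (g : UDual ω 𝒱)))) ?_ x y
  intro α β x y hx hy
  change _ = ω φ ψ * (UDual.eval (f : UDual ω 𝒱) x * UDual.eval (g : UDual ω 𝒱) y)
  rw [coPair_tmul e f g hx hy]
  by_cases h1 : φ + α = 0
  · by_cases h2 : ψ + β = 0
    · rw [eq_neg_of_add_eq_zero_left h1, eq_neg_of_add_eq_zero_left h2, ω.neg_right, ω.neg_right]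
    · rw [eval_eq_zero hg hy h2]; ring
  · rw [eval_eq_zero hf hx h1]; ring

/-- `⟨z, x ⊗ y⟩ = ⟨f, x y⟩` for all `x, y`. -/
def IsDualComul (f : coordAlg ω e)
    (z : CTensor ω (subGr ω (coordAlg ω e)) (subGr ω (coordAlg ω e))) : Prop :=
  ∀ x y, coPair ω e z (x ⊗ₜ y) = UDual.eval (f : UDual ω 𝒱) (x * y)

/-- Compatibility of Δ with products is dual to Δ(xy) = Δ(x)Δ(y) in U: both sides are expanded as
sums over the tensors of z and w paired with Δ(x) and Δ(y). -/
theorem IsDualComul.mul {f g : coordAlg ω e}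
    {z w : CTensor ω (subGr ω (coordAlg ω e)) (subGr ω (coordAlg ω e))}
    (hf : IsDualComul e f z) (hg : IsDualComul e g w) : IsDualComul e (f * g) (z * w) := by
  obtain ⟨κ, _, ζ₁, ζ₂, z₁, z₂, hz₁, hz₂, rfl⟩ := CTensor.exists_eq_sum z
  obtain ⟨κ', _, ξ₁, ξ₂, w₁, w₂, hw₁, hw₂, rfl⟩ := CTensor.exists_eq_sum w
  have hf' : ∀ {α β : Γ} {x y : UEnv ω 𝒱}, x ∈ uGr ω 𝒱 α → y ∈ uGr ω 𝒱 β →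
      UDual.eval (f : UDual ω 𝒱) (x * y) =
      ∑ s, ω α β * (UDual.eval (z₁ s : UDual ω 𝒱) x * UDual.eval (z₂ s : UDual ω 𝒱) y) := by
    intro α β x y hx hy
    rw [← hf, map_sum, LinearMap.sum_apply]
    exact Finset.sum_congr rfl fun s _ => coPair_tmul e _ _ hx hy
  have hg' : ∀ {α β : Γ} {x y : UEnv ω 𝒱}, x ∈ uGr ω 𝒱 α → y ∈ uGr ω 𝒱 β →
      UDual.eval (g : UDual ω 𝒱) (x * y) =
      ∑ t, ω α β * (UDual.eval (w₁ t : UDual ω 𝒱) x * UDual.eval (w₂ t : UDual ω 𝒱) y) := by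
    intro α β x y hx hy
    rw [← hg, map_sum, LinearMap.sum_apply]
    exact Finset.sum_congr rfl fun t _ => coPair_tmul e _ _ hx hy
  let P : UDual ω 𝒱 → UDual ω 𝒱 → CTensor ω (uGr ω 𝒱) (uGr ω 𝒱) →ₗ[ℂ] ℂ := fun f g =>
    colourPair ω (uGr ω 𝒱) ((UDual.of ω 𝒱).symm f ⊗ₜ (UDual.of ω 𝒱).symm g) ∘ₗ
      (CTensor.of ω (uGr ω 𝒱) (uGr ω 𝒱)).symm.toLinearMap
  have hP : ∀ f g : UDual ω 𝒱, ∀ {α β : Γ} {x y : UEnv ω 𝒱}, x ∈ uGr ω 𝒱 α → y ∈ uGr ω 𝒱 β →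
      P f g (CTensor.tmul ω _ _ x y) = ω α β * (UDual.eval f x * UDual.eval g y) :=
    fun f g α β x y hx hy => colourPair_tmul ω (uGr ω 𝒱) _ _ hx hy
  -- With p = Δ(x) and q = Δ(y) this is the claim. It is bilinear in p and q, so it needs proof only
  -- for tensors of homogeneous elements, where it is a comparison of scalars.
  have key : ∀ p q : CTensor ω (uGr ω 𝒱) (uGr ω 𝒱),
      ∑ s, ∑ t, ω (ζ₂ s) (ξ₁ t) * (ω (ζ₁ s + ξ₁ t) (ζ₂ s + ξ₂ t) *
        (P (z₁ s) (w₁ t) p * P (z₂ s) (w₂ t) q)) = P f g (p * q) := by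
    intro p q
    induction p using CTensor.induction with
    | h0 => simp
    | hadd p p' hp hp' =>
      rw [add_mul, map_add, ← hp, ← hp']
      simp only [map_add, add_mul, mul_add, Finset.sum_add_distrib]
    | h α₁ α₂ p₁ p₂ hp₁ hp₂ =>
      induction q using CTensor.induction with
      | h0 => simp
      | hadd q q' hq hq' =>
        rw [mul_add, map_add, ← hq, ← hq']
        simp only [map_add, mul_add, Finset.sum_add_distrib]
      | h β₁ β₂ q₁ q₂ hq₁ hq₂ =>
        rw [CTensor.tmul_mul_tmul ω _ _ p₁ hp₂ hq₁ q₂, map_smul,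
          hP _ _ (SetLike.mul_mem_graded hp₁ hq₁) (SetLike.mul_mem_graded hp₂ hq₂),
          hf' hp₁ hq₁, hg' hp₂ hq₂, Finset.sum_mul_sum, smul_eq_mul, Finset.mul_sum, Finset.mul_sum]
        refine Finset.sum_congr rfl fun s _ => ?_
        rw [Finset.mul_sum, Finset.mul_sum]
        refine Finset.sum_congr rfl fun t _ => ?_
        rw [hP _ _ hp₁ hp₂, hP _ _ hq₁ hq₂]
        -- Unless all four degrees are opposite to those of the functionals, both sides are 0;
        -- otherwise every scalar is expressed in the degrees of the functionals.
        by_cases h1 : ζ₁ s + α₁ = 0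
        swap
        · rw [eval_eq_zero (hz₁ s) hp₁ h1]; ring
        by_cases h2 : ζ₂ s + β₁ = 0
        swap
        · rw [eval_eq_zero (hz₂ s) hq₁ h2]; ring
        by_cases h3 : ξ₁ t + α₂ = 0
        swap
        · rw [eval_eq_zero (hw₁ t) hp₂ h3]; ring
        by_cases h4 : ξ₂ t + β₂ = 0
        swap
        · rw [eval_eq_zero (hw₂ t) hq₂ h4]; ring
        rw [← neg_eq_of_add_eq_zero_right h1, ← neg_eq_of_add_eq_zero_right h2,
          ← neg_eq_of_add_eq_zero_right h3, ← neg_eq_of_add_eq_zero_right h4]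
        simp only [ω.add_left, ω.add_right, ω.neg_left]
        ring
  intro x y
  have h1 := key (uComul ω 𝒱 x) (uComul ω 𝒱 y)
  rw [← map_mul] at h1
  refine Eq.trans ?_ h1
  rw [Finset.sum_mul_sum, map_sum, LinearMap.sum_apply]
  refine Finset.sum_congr rfl fun s _ => ?_
  rw [map_sum, LinearMap.sum_apply]
  refine Finset.sum_congr rfl fun t _ => ?_
  rw [CTensor.tmul_mul_tmul ω _ _ (z₁ s) (hz₂ s) (hw₁ t), map_smul, LinearMap.smul_apply, smul_eq_mul,
    coPair_tmul_of_mem e (SetLike.mul_mem_graded (hz₁ s) (hw₁ t))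
      (SetLike.mul_mem_graded (hz₂ s) (hw₂ t))]
  rfl

/-- This is `IsGradedRep.eval_mul` read through the pairing; it serves both V and V^*. -/
theorem isDualComul_sum {W : Type*} [AddCommGroup W] [Module ℂ W]
    {π : UEnv ω 𝒱 →ₗ[ℂ] Module.End ℂ W} {b : Module.Basis ι ℂ W} {d : ι → Γ}
    (h : IsGradedRep ω π b d) (u : ι → ι → coordAlg ω e)
    (hu : ∀ j i, (u j i : UDual ω 𝒱) = matCoeff ω 𝒱 π b d j i) (j i : ι) :
    IsDualComul e (u j i) (∑ k, CTensor.tmul ω _ _ (u j k) (u k i)) := by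
  refine coPair_induction e (b := (LinearMap.mul ℂ (UEnv ω 𝒱)).compr₂
    ((UDual.of ω 𝒱).symm (u j i : UDual ω 𝒱))) fun α β x y hx hy => ?_
  change _ = UDual.eval (u j i : UDual ω 𝒱) (x * y)
  rw [hu, h.eval_mul j i hx hy, map_sum, LinearMap.sum_apply]
  exact Finset.sum_congr rfl fun k _ => (coPair_tmul e _ _ hx hy).trans (by rw [hu, hu])

theorem isDualComul_coordComul (f : coordAlg ω e) : IsDualComul e f (coordComul ω e f) := by
  have hf : f ∈ Algebra.adjoin ℂ (Set.range (matGen (tC ω e) (tbarC ω e))) := by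
    rw [coordAlg_le e (B := Algebra.adjoin ℂ (Set.range (matGen (tC ω e) (tbarC ω e))))
      (fun j i => Algebra.subset_adjoin ⟨Sum.inl (j, i), rfl⟩)
      (fun j i => Algebra.subset_adjoin ⟨Sum.inr (j, i), rfl⟩)]
    exact Algebra.mem_top
  induction hf using Algebra.adjoin_induction with
  | mem f hf =>
    obtain ⟨⟨j, i⟩ | ⟨j, i⟩, rfl⟩ := hf
    · change IsDualComul e (tC ω e j i) (coordComul ω e (tC ω e j i))
      rw [coordComul_tC]
      exact isDualComul_sum e (isGradedRep_natRep e) (tC ω e) (fun _ _ => rfl) j i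
    · change IsDualComul e (tbarC ω e j i) (coordComul ω e (tbarC ω e j i))
      rw [coordComul_tbarC]
      exact isDualComul_sum e (isGradedRep_dualRep e) (tbarC ω e) (fun _ _ => rfl) j i
  | algebraMap c =>
    intro x y
    have h1 : (1 : coordAlg ω e) ∈ subGr ω (coordAlg ω e) 0 := SetLike.GradedOne.one_mem
    rw [AlgHom.commutes, Algebra.algebraMap_eq_smul_one, Algebra.algebraMap_eq_smul_one, map_smul,
      LinearMap.smul_apply, CTensor.one_def, coPair_tmul_of_mem e h1 h1, ω.zero_right, one_mul]
    change c * (uCounit ω 𝒱 x * uCounit ω 𝒱 y) = c * uCounit ω 𝒱 (x * y)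
    rw [map_mul]
  | add f g _ _ hf hg =>
    intro x y
    rw [map_add, map_add, LinearMap.add_apply, hf, hg]
    rfl
  | mul f g _ _ hf hg => rw [map_mul]; exact hf.mul e hg

theorem coordCounit_eq (f : coordAlg ω e) : coordCounit ω e f = UDual.eval (f : UDual ω 𝒱) 1 := by
  let ev : coordAlg ω e →ₐ[ℂ] ℂ := AlgHom.ofLinearMap
    (UDual.evalₗ ω 𝒱 1 ∘ₗ (coordAlg ω e).val.toLinearMap)
    ((UDual.one_eval ω 𝒱 1).trans (map_one _)) (fun f g => UDual.mul_eval_one ω 𝒱 f g)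
  have h1 : (tcMat ω e : Matrix ι ι (coordAlg ω e)) * (tcInv ω e : Matrix ι ι (coordAlg ω e)) = 1 :=
    congrArg Subtype.val (tcMat_mul_tcInv e)
  have h2 : (tcInv ω e : Matrix ι ι (coordAlg ω e)) * (tcMat ω e : Matrix ι ι (coordAlg ω e)) = 1 :=
    congrArg Subtype.val (tcInv_mul_tcMat e)
  have h : coordCounit ω e = ev := hom_ext_of_matrix h1 h2 (adjoin_tcMat e) fun j i =>
    (coordCounit_tC e j i).trans ((isGradedRep_natRep (ω := ω) e).eval_one j i).symm
  exact AlgHom.congr_fun h f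

theorem antipode_mul_coe (f g : coordAlg ω e) : UDual.antipode ω ((f * g : coordAlg ω e) : UDual ω 𝒱) =
    UDual.antipode ω (f : UDual ω 𝒱) * UDual.antipode ω (g : UDual ω 𝒱) := by
  change UDual.antipode ω ((f : UDual ω 𝒱) * (g : UDual ω 𝒱)) = _
  induction f using hom_induction (subGr ω (coordAlg ω e)) with
  | h0 =>
    change UDual.antipode ω ((0 : UDual ω 𝒱) * _) = UDual.antipode ω (0 : UDual ω 𝒱) * _
    rw [zero_mul, map_zero, zero_mul]
  | hadd f f' hf hf' =>
    change UDual.antipode ω (((f : UDual ω 𝒱) + (f' : UDual ω 𝒱)) * _) = UDual.antipode ω ((f : UDual ω 𝒱) + (f' : UDual ω 𝒱)) * _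
    rw [add_mul, map_add, map_add, hf, hf', add_mul]
  | h α f hf =>
    induction g using hom_induction (subGr ω (coordAlg ω e)) with
    | h0 =>
      change UDual.antipode ω (_ * (0 : UDual ω 𝒱)) = _ * UDual.antipode ω (0 : UDual ω 𝒱)
      rw [mul_zero, map_zero, mul_zero]
    | hadd f f' hf hf' =>
      change UDual.antipode ω (_ * ((f : UDual ω 𝒱) + (f' : UDual ω 𝒱))) = _ * UDual.antipode ω ((f : UDual ω 𝒱) + (f' : UDual ω 𝒱))
      rw [mul_add, map_add, map_add, hf, hf', mul_add]
    | h β g hg => exact UDual.antipode_mul ω hf hg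

/-- Both sides are algebra homomorphisms in f to U^*, and both send t to its inverse. -/
theorem coordAntipode_eq (f : coordAlg ω e) :
    (coordAntipode ω e f : UDual ω 𝒱) = UDual.antipode ω (f : UDual ω 𝒱) := by
  let N : coordAlg ω e →ₐ[ℂ] UDual ω 𝒱 := AlgHom.ofLinearMap
    (UDual.antipode ω ∘ₗ (coordAlg ω e).val.toLinearMap) (UDual.antipode_one ω) (antipode_mul_coe e)
  have h1 : (tcMat ω e : Matrix ι ι (coordAlg ω e)) * (tcInv ω e : Matrix ι ι (coordAlg ω e)) = 1 :=
    congrArg Subtype.val (tcMat_mul_tcInv e)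
  have h2 : (tcInv ω e : Matrix ι ι (coordAlg ω e)) * (tcMat ω e : Matrix ι ι (coordAlg ω e)) = 1 :=
    congrArg Subtype.val (tcInv_mul_tcMat e)
  have h : (coordAlg ω e).val.comp (coordAntipode ω e) = N :=
    hom_ext_of_matrix h1 h2 (adjoin_tcMat e) fun j i =>
      (congrArg Subtype.val (coordAntipode_tC e j i)).trans (tcInv_val e j i)
  exact AlgHom.congr_fun h f

theorem isCoordHopf_coordHopf : IsCoordHopf ω e (coordHopf ω e) where
  comul f x y := isDualComul_coordComul e f x y
  counit f := coordCounit_eq e f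
  antipode f x := by
    rw [coordHopf_antipode, coordAntipode_eq]
    exact UDual.antipode_eval ω _ x

/-- The structure maps of 𝒯(V) were defined by transport from 𝓕(V), so only the two mutually inverse
isomorphisms have to be cancelled. -/
theorem isHopfIso_presEquivCoord : IsHopfIso (presHopf ω e) (coordHopf ω e) (presEquivCoord ω e) where
  map_mem := presEquivCoord_mem_iff e
  comul a := by
    have h : coordToPres ω e (presToCoord ω e a) = a := AlgHom.congr_fun (coordToPres_comp e) a
    change (CTensor.of ω _ _).symm (CTensor.map (presToCoord ω e) (presToCoord ω e)
      (presToCoord_mem e) (presToCoord_mem e)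
      (presComul ω e (coordToPres ω e (presToCoord ω e a)))) = _
    rw [h]
    rfl
  counit a := by
    have h : coordToPres ω e (presToCoord ω e a) = a := AlgHom.congr_fun (coordToPres_comp e) a
    change presCounit ω e (coordToPres ω e (presToCoord ω e a)) = _
    rw [h]
    rfl
  antipode a := by
    have h : coordToPres ω e (presToCoord ω e a) = a := AlgHom.congr_fun (coordToPres_comp e) a
    change presToCoord ω e (presAntipode ω e (coordToPres ω e (presToCoord ω e a))) = _
    rw [h]
    rfl

theorem presEquivCoord_unique (φ : presAlg ω e ≃ₐ[ℂ] coordAlg ω e)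
    (hX : ∀ j i, φ (presX ω e j i) = presToCoord ω e (presX ω e j i)) : φ = presEquivCoord ω e := by
  have h : (φ : presAlg ω e →ₐ[ℂ] coordAlg ω e) = presToCoord ω e :=
    hom_ext_of_matrix (congrArg Subtype.val (presMat_mul_presInv e))
      (congrArg Subtype.val (presInv_mul_presMat e)) (adjoin_presMat e) hX
  exact AlgEquiv.ext fun a => AlgHom.congr_fun h a

end CoordHopf

end

end Colour

/-! ### The theorem, assembled. -/

theorem mainTheorem11 {Γ : Type*} [AddCommGroup Γ] [DecidableEq Γ] (ω : CommFactor Γ)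
    {V : Type*} [AddCommGroup V] [Module ℂ V] [FiniteDimensional ℂ V]
    (𝒱 : Γ → Submodule ℂ V) [DirectSum.Decomposition 𝒱]
    {ι : Type*} [Fintype ι] [DecidableEq ι] (e : HomBasis 𝒱 ι) :
    -- the coordinate algebra is contained in the finite dual of `U`
    (∀ f ∈ coordAlg ω e, f ∈ UDual.finiteDual ω 𝒱) ∧
    -- the ring of fractions
    (∃ Dp Dm : algT ω e,
      (∀ D, IsDPlus ω e D ↔ D = Dp) ∧ (∀ D, IsDMinus ω e D ↔ D = Dm) ∧
      ∃ (_ : CentralSet (Submonoid.closure {Dp, Dm}))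
        (_ : DegZeroSet (subGr ω (algT ω e)) (Submonoid.closure {Dp, Dm})),
        IsUnit (genMatrix ω e (Frac.gr (subGr ω (algT ω e)) (Submonoid.closure {Dp, Dm}))
          (fun j i => Frac.mk (tT ω e j i) 1)) ∧
        ∃ φ : coordAlg ω e ≃ₐ[ℂ] Frac (Submonoid.closure {Dp, Dm}),
          (∀ γ f, f ∈ subGr ω (coordAlg ω e) γ ↔
            φ f ∈ Frac.gr (subGr ω (algT ω e)) (Submonoid.closure {Dp, Dm}) γ) ∧
          ∀ f : algT ω e, φ (Subalgebra.inclusion (algT_le ω e) f) = Frac.mk f 1) ∧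
    -- the presentation
    ∃ (HT : ColourHopf ω (subGr ω (coordAlg ω e))) (HF : ColourHopf ω (presGr ω e)),
      IsCoordHopf ω e HT ∧ IsPresHopf ω e HF ∧
      ∃! φ : presAlg ω e ≃ₐ[ℂ] coordAlg ω e,
        IsHopfIso HF HT φ ∧
        (∀ j i, φ (presX ω e j i) = tC ω e j i) ∧
        ∀ j i, φ (presXbar ω e j i) = tbarC ω e j i := by
  refine ⟨fun f hf => mem_finiteDual ω e hf, ⟨tDet ω e 1, tDet ω e (-1),
    isDPlus_iff ω e (parEquiv ω e 1), isDMinus_iff ω e (parEquiv ω e (-1)),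
    inferInstance, inferInstance, isUnit_genMatrix_frac e, coordEquivFrac ω e,
    coordEquivFrac_mem_iff e, coordEquivFrac_tIncl e⟩,
    coordHopf ω e, presHopf ω e, isCoordHopf_coordHopf e, isPresHopf_presHopf e,
    presEquivCoord ω e, ⟨isHopfIso_presEquivCoord e, presToCoord_X e, presToCoord_Xbar e⟩, ?_⟩
  rintro φ ⟨-, hX, -⟩
  exact presEquivCoord_unique e φ fun j i => (hX j i).trans (presToCoord_X e j i).symm
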